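/- All function spaces are over the interval $(0,1)$ and consist of complex-valued functions. Let $W_2^0=L_2(0,1)$ with norm $|f|_0=\|f\|_{L_2}$, let $W_2^2$ be the space of $f\in L_2$ whose distributional derivatives $f',f''$ lie in $L_2$, with norm $|f|_2=(|f|_0^2+|f'|_0^2+|f''|_0^2)^{1/2}$, and for $0<s<2$ let $W_2^{s}=[W_2^2,W_2^0]_{1-s/2}$ be the complex interpolation space, with its norm $|\cdot|_s$. For $\tau\in L_2$ put $\tau_1=\tau$ and, for $n\ge 1$ and almost every $s\in(0,1)$, $$\tau_{n+1}(s)=\int_{\Pi_n^*(s)}\tau\bigl(s+\xi_n(y)\bigr)\,\tau(y_1)\cdots\tau(y_n)\,dy_1\cdots dy_n ,$$ where $\xi_n(y)=\sum_{l=1}^n(-1)^{l+1}y_l$ and $\Pi_n^*(s)=\{y\in\mathbb R^n : 0\le y_n\le\dots\le y_1\le s+\xi_n(y)\le 1\}$. Let $\alpha\in(0,1]$ and $\gamma=\min\{3\alpha,1+\alpha\}$. There is a constant $C>0$, depending only on $\alpha$, such that for every $\tau\in W_2^\alpha$ the integrals defining the functions $\tau_n$, $n\ge2$, converge absolutely for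 almost every $s$, and for every $n\ge 3$ the function $\tau_n$ belongs to $W_2^\gamma$ and $$|\tau_n|_\gamma\le\frac{C}{\sqrt{r!}}\,|\tau|_\alpha^n,\qquad r=\max\{0,n-7\}.$$ Moreover, for every $\tau\in W_2^\alpha$ all $\tau_n$ belong to $L_2$, the series $\sum_{n\ge1}\tau_n$ and $\sum_{n\ge1}(-1)^n\tau_n$ converge in $L_2$, and their sums $\tau^+$ and $\tau^-$ have the form $$\tau^\pm=\pm\tau+\tau_2+\phi^\pm$$ with some functions $\phi^\pm\in W_2^\gamma$. -/

import Mathlib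

open MeasureTheory Filter Topology Set

open scoped ENNReal ContDiff

noncomputable section

namespace SobolevInterval

/-! ### The Sobolev spaces `W_2^s(0,1)`, `0 ≤ s ≤ 2` -/

/-- Lebesgue measure on the interval `(0,1)`. -/
abbrev unitMeasure : Measure ℝ := volume.restrict (Ioo (0 : ℝ) 1)

/-- The complex Hilbert space `L_2(0,1)`. -/
abbrev L2 : Type := Lp ℂ 2 unitMeasure

/-- `g` is the distributional derivative of `f` on `(0,1)`: `∫ φ' f = - ∫ φ g` for every smooth
function `φ` with compact support in `(0,1)`. -/
def IsWeakDeriv (f g : L2) : Prop :=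
  ∀ φ : ℝ → ℝ, ContDiff ℝ ∞ φ → HasCompactSupport φ → tsupport φ ⊆ Ioo 0 1 →
    ∫ x, ((deriv φ x : ℝ) : ℂ) * f x ∂unitMeasure = - ∫ x, (φ x : ℂ) * g x ∂unitMeasure

lemma integrable_ofReal_mul {ψ : ℝ → ℝ} (hψ : Continuous ψ) (hc : HasCompactSupport ψ) (f : L2) :
    Integrable (fun x => (ψ x : ℂ) * f x) unitMeasure := by
  obtain ⟨B, hB⟩ := hψ.bounded_above_of_compact_support hc
  have hf : Integrable (fun x => f x) unitMeasure :=
    (Lp.memLp f).integrable (by norm_num)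
  refine hf.bdd_mul (c := B) ?_ (Eventually.of_forall fun x => ?_)
  · exact (Complex.continuous_ofReal.comp hψ).aestronglyMeasurable
  · simpa using hB x

lemma integral_ofReal_mul_add {ψ : ℝ → ℝ} (hψ : Continuous ψ) (hc : HasCompactSupport ψ)
    (f g : L2) :
    ∫ x, (ψ x : ℂ) * (f + g : L2) x ∂unitMeasure
      = ∫ x, (ψ x : ℂ) * f x ∂unitMeasure + ∫ x, (ψ x : ℂ) * g x ∂unitMeasure := by
  rw [← integral_add (integrable_ofReal_mul hψ hc f) (integrable_ofReal_mul hψ hc g)]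
  refine integral_congr_ae ?_
  filter_upwards [Lp.coeFn_add f g] with x hx
  rw [hx, Pi.add_apply, mul_add]

lemma integral_ofReal_mul_smul (ψ : ℝ → ℝ) (c : ℂ) (f : L2) :
    ∫ x, (ψ x : ℂ) * (c • f : L2) x ∂unitMeasure = c * ∫ x, (ψ x : ℂ) * f x ∂unitMeasure := by
  rw [← integral_const_mul]
  refine integral_congr_ae ?_
  filter_upwards [Lp.coeFn_smul c f] with x hx
  rw [hx, Pi.smul_apply, smul_eq_mul, mul_left_comm]

lemma isWeakDeriv_zero : IsWeakDeriv 0 0 := by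
  intro φ _ _ _
  have h (ψ : ℝ → ℝ) : ∫ x, (ψ x : ℂ) * (0 : L2) x ∂unitMeasure = 0 := by
    simpa using integral_ofReal_mul_smul ψ 0 0
  rw [h, h, neg_zero]

lemma IsWeakDeriv.add {f f' g g' : L2} (hf : IsWeakDeriv f f') (hg : IsWeakDeriv g g') :
    IsWeakDeriv (f + g) (f' + g') := by
  intro φ h1 h2 h3
  rw [integral_ofReal_mul_add (h1.continuous_deriv (by simp)) h2.deriv,
    integral_ofReal_mul_add h1.continuous h2, hf φ h1 h2 h3, hg φ h1 h2 h3, neg_add]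

lemma IsWeakDeriv.smul {f f' : L2} (c : ℂ) (hf : IsWeakDeriv f f') :
    IsWeakDeriv (c • f) (c • f') := by
  intro φ h1 h2 h3
  rw [integral_ofReal_mul_smul, integral_ofReal_mul_smul, hf φ h1 h2 h3, mul_neg]

/-- The Sobolev space `W_2^2(0,1)`. A function `f` is stored together with its distributional
derivatives as the triple `(f, f', f'')` of elements of `L_2(0,1)`, and the norm is the one
induced by the `ℓ_2`-sum, that is `(|f|_0 ^ 2 + |f'|_0 ^ 2 + |f''|_0 ^ 2) ^ (1/2)`. -/
def W22 : Submodule ℂ (PiLp 2 (fun _ : Fin 3 => L2)) where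
  carrier := {u | IsWeakDeriv (u 0) (u 1) ∧ IsWeakDeriv (u 1) (u 2)}
  zero_mem' := ⟨isWeakDeriv_zero, isWeakDeriv_zero⟩
  add_mem' := fun hu hv => ⟨hu.1.add hv.1, hu.2.add hv.2⟩
  smul_mem' := fun c _ hu => ⟨hu.1.smul c, hu.2.smul c⟩

/-- The embedding of `W_2^2(0,1)` into `L_2(0,1)`, `(f, f', f'') ↦ f`. -/
def W22.toL2 : W22 →L[ℂ] L2 :=
  (PiLp.proj (𝕜 := ℂ) 2 (fun _ : Fin 3 => L2) 0).comp W22.subtypeL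

section Interpolation

variable {X₀ X₁ : Type*} [NormedAddCommGroup X₀] [NormedSpace ℂ X₀]
  [NormedAddCommGroup X₁] [NormedSpace ℂ X₁]

/-- The functions of the complex method of interpolation, for a couple `(X₀, X₁)` in which `X₀` is
continuously embedded into `X₁` by `j` (so that `X₀ + X₁ = X₁`): `F` is a bounded continuous
`X₁`-valued function on the strip `0 ≤ Re z ≤ 1`, holomorphic in its interior, whose restrictions
to the lines `Re z = 0` and `Re z = 1` are continuous functions with values in `X₀` and `X₁`
respectively that tend to zero at infinity. The function `g` is the restriction to `Re z = 0`,
as a function with values in `X₀`. -/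
structure IsStripFunction (j : X₀ →L[ℂ] X₁) (F : ℂ → X₁) (g : ℝ → X₀) : Prop where
  continuousOn : ContinuousOn F {z | 0 ≤ z.re ∧ z.re ≤ 1}
  bounded : ∃ B : ℝ, ∀ z : ℂ, 0 ≤ z.re → z.re ≤ 1 → ‖F z‖ ≤ B
  differentiableOn : DifferentiableOn ℂ F {z | 0 < z.re ∧ z.re < 1}
  left_eq : ∀ t : ℝ, F (t * Complex.I) = j (g t)
  left_continuous : Continuous g
  left_tendsto : Tendsto g (cocompact ℝ) (𝓝 0)
  right_continuous : Continuous fun t : ℝ => F (1 + t * Complex.I)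
  right_tendsto : Tendsto (fun t : ℝ => F (1 + t * Complex.I)) (cocompact ℝ) (𝓝 0)

/-- The numbers `M` such that `x = F(θ)` for a strip function `F` with
`sup_t |F(it)|_{X₀} ≤ M` and `sup_t |F(1+it)|_{X₁} ≤ M`. The complex interpolation space
`[X₀, X₁]_θ` consists of the `x` for which there is such a number, and the norm of `x` in
`[X₀, X₁]_θ` is the infimum of these numbers. -/
def interpBounds (j : X₀ →L[ℂ] X₁) (θ : ℝ) (x : X₁) : Set ℝ :=
  {M | ∃ (F : ℂ → X₁) (g : ℝ → X₀), IsStripFunction j F g ∧ F (θ : ℂ) = x ∧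
    (∀ t, ‖g t‖ ≤ M) ∧ ∀ t : ℝ, ‖F (1 + t * Complex.I)‖ ≤ M}

end Interpolation

/-- Upper bounds for the norm of `f` in `W_2^s(0,1)`, `0 ≤ s ≤ 2`, where `W_2^0 = L_2`, where
`W_2^2` is as above, and where `W_2^s = [W_2^2, W_2^0]_{1 - s/2}` for `0 < s < 2`. Functions that
agree almost everywhere on `(0,1)` are identified. -/
def sobolevBounds (s : ℝ) (f : ℝ → ℂ) : Set ℝ :=
  if s = 0 then {M | ∃ h : L2, h =ᵐ[unitMeasure] f ∧ ‖h‖ ≤ M}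
  else if s = 2 then {M | ∃ u : W22, W22.toL2 u =ᵐ[unitMeasure] f ∧ ‖u‖ ≤ M}
  else {M | ∃ h : L2, h =ᵐ[unitMeasure] f ∧ M ∈ interpBounds W22.toL2 (1 - s / 2) h}

/-- `f ∈ W_2^s(0,1)`, for `0 ≤ s ≤ 2`. -/
def MemW (s : ℝ) (f : ℝ → ℂ) : Prop := (sobolevBounds s f).Nonempty

/-- The norm `|f|_s` of `f ∈ W_2^s(0,1)`, for `0 ≤ s ≤ 2`. -/
def normW (s : ℝ) (f : ℝ → ℂ) : ℝ := sInf (sobolevBounds s f)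

/-! ### The multilinear integrals and the functions `τ_n`, `τ^±` -/

/-- `ξ_n(y) = y_1 - y_2 + y_3 - ⋯ + (-1)^{n+1} y_n`. -/
def altSum {n : ℕ} (y : Fin n → ℝ) : ℝ := ∑ i : Fin n, (-1) ^ (i : ℕ) * y i

/-- `Π*_n(s) = {y ∈ ℝ^n | 0 ≤ y_n ≤ ⋯ ≤ y_1 ≤ s + ξ_n(y) ≤ 1}`, for `n ≥ 1`. -/
def slice (n : ℕ) (s : ℝ) : Set (Fin n → ℝ) :=
  {y | (∀ i, 0 ≤ y i) ∧ Antitone y ∧ (∀ i, y i ≤ s + altSum y) ∧ s + altSum y ≤ 1}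

/-- The integrand `f_1(s + ξ_n(y)) f_2(y_1) ⋯ f_{n+1}(y_n)`. -/
def integrand {n : ℕ} (f : Fin (n + 1) → ℝ → ℂ) (s : ℝ) (y : Fin n → ℝ) : ℂ :=
  f 0 (s + altSum y) * ∏ i : Fin n, f i.succ (y i)

/-- The `(n+1)`-linear mapping `I_{n+1}`, for `n ≥ 1`:
`I_{n+1}(f)(s) = ∫_{Π*_n(s)} f_1(s + ξ_n(y)) f_2(y_1) ⋯ f_{n+1}(y_n) dy_1 ⋯ dy_n`. -/
def multInt {n : ℕ} (f : Fin (n + 1) → ℝ → ℂ) (s : ℝ) : ℂ :=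
  ∫ y in slice n s, integrand f s y

/-- `τ_1 = τ` and `τ_n = I_n(τ, …, τ)` for `n ≥ 2` (and `0` for the unused index `n = 0`). -/
def tauSeq (τ : ℝ → ℂ) : ℕ → ℝ → ℂ
  | 0 => 0
  | 1 => τ
  | n + 2 => multInt (n := n + 1) fun _ => τ

/-- `T` is the sum in `L_2(0,1)` of the series `∑_{n ≥ 1} ε^n τ_n`; it is `τ^+` for `ε = 1` and
`τ^-` for `ε = -1`. -/
def IsTauSum (ε : ℂ) (τ T : ℝ → ℂ) : Prop :=
  (∀ n, MemLp (tauSeq τ n) 2 unitMeasure) ∧ MemLp T 2 unitMeasure ∧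
    Tendsto (fun N : ℕ =>
      eLpNorm (fun s => T s - ∑ n ∈ Finset.Icc 1 N, ε ^ n * tauSeq τ n s) 2 unitMeasure)
      atTop (𝓝 0)

/-- The integrals that define `τ_2, τ_3, …` converge absolutely at almost every `s ∈ (0,1)`. -/
def TauIntegrable (τ : ℝ → ℂ) : Prop :=
  ∀ n : ℕ, 1 ≤ n → ∀ᵐ s ∂unitMeasure, IntegrableOn (integrand (n := n) (fun _ => τ) s) (slice n s)

end SobolevInterval

end

open SobolevInterval

/-! Regularity is read off Fourier coefficients. Weighted reflections extend a function on (0,1) to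
one of period 2, boundedly in L_2 and in the orders 1 and 2. So the coefficients `aCoef k` of the
extension make (W_2^2, L_2) a retract of a couple of weighted ℓ_2 spaces, the left inverse being
restriction of Fourier series to (0,1). Hence W_2^s is described by square summability of the
coefficients with weights (1+|k|)^s: the three lines theorem gives one direction
(`sum_wt_rpow_aCoef_le_of_mem_interpBounds`), an explicit strip function the other
(`exists_mem_sobolevBounds`).

To see that τ_{m+3} is regular, pair it with a function η and substitute z = s + ξ(y). The pairing
becomes the integral of τ(z) τ(y) τ(x) η(z − y + x − ξ_m(t)) ∏ τ(t_i) over 1 ≥ z ≥ y ≥ x ≥ t_1 ≥ … ≥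
t_m ≥ 0 (`integral_multInt_mul`). The tail t is frozen as a weight, and a quadrilinear form T(f₀,
f₁, f₂, η) remains. For η = φ' the derivative can be moved to any of the three factors. Integration
by parts in y produces only diagonal terms: T(f₀, f₁, f₂, φ') = T(f₀, f₁', f₂, φ) − B(f₀, f₁, f₂, φ)
+ A(f₀, f₁, f₂, φ), with A from y = x and B from y = z. Composing A and B with a primitive in the
last slot and correcting T by them gives a form `main` with main(φ') = T(f₀, f₁', f₂, φ). It
therefore admits a second integration by parts, in z or in x.

Write (a₀, a₁, a₂; −a₃) for a bound in norms of these orders in the four slots. Then `main` is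
bounded at (0,0,0; 0), (0,0,1; −1), (1,1,0; −2) and (0,1,1; −2). The corrections are bounded at
(0,0,0; −1) and at order −2 with derivatives on two of the factors. Multilinear interpolation
(`HasBound.interp`) gives (α,α,α; −γ) for T (`IsFormTriple.hasBound`): the limit 3α comes from
`main` with α ≤ 1/2, the limit 1 + α from the other cases. Density of trigonometric polynomials and
duality turn this into a bound for the weighted coefficients of τ_{m+3} (`IsTail.sum_wt_le`).

The factorial comes from the ordered tail. Cauchy–Schwarz, one variable at a time, bounds the
integral of ∏|τ(t_i)| by |τ|_0^m/√(m!), and boundary terms use up at most two tail variables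
(`isTail_tailWeight`). The same estimate in L_2 (`memLp_multInt`) and the convergence of ∑ t^n/√(n!)
give the two series, whose terms from the third on add up in W_2^γ. -/

noncomputable section

namespace SobolevInterval

/-! ### Classes of functions, the bilinear pairing, and test functions -/

/-- The class in `L_2(0,1)` of a square integrable function, and zero for other functions. -/
def cls (f : ℝ → ℂ) : L2 :=
  open scoped Classical in if h : MemLp f 2 unitMeasure then h.toLp f else 0

instance : IsProbabilityMeasure unitMeasure := ⟨by simp⟩

lemma cls_ae {f : ℝ → ℂ} (h : MemLp f 2 unitMeasure) : cls f =ᵐ[unitMeasure] f := by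
  rw [cls, dif_pos h]; exact h.coeFn_toLp

lemma cls_congr {f g : ℝ → ℂ} (h : f =ᵐ[unitMeasure] g) : cls f = cls g := by
  by_cases hf : MemLp f 2 unitMeasure
  · have hg := hf.ae_eq h
    exact Lp.ext ((cls_ae hf).trans (h.trans (cls_ae hg).symm))
  · have hg : ¬ MemLp g 2 unitMeasure := fun hg => hf (hg.ae_eq h.symm)
    rw [cls, cls, dif_neg hf, dif_neg hg]

lemma cls_coe (u : L2) : cls u = u := Lp.ext (cls_ae (Lp.memLp u))

lemma cls_add {f g : ℝ → ℂ} (hf : MemLp f 2 unitMeasure) (hg : MemLp g 2 unitMeasure) :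
    cls (f + g) = cls f + cls g := by
  refine Lp.ext ((cls_ae (hf.add hg)).trans ?_)
  filter_upwards [cls_ae hf, cls_ae hg, Lp.coeFn_add (cls f) (cls g)] with x h1 h2 h3
  rw [h3, Pi.add_apply, Pi.add_apply, h1, h2]

lemma cls_smul (c : ℂ) {f : ℝ → ℂ} (hf : MemLp f 2 unitMeasure) :
    cls (c • f) = c • cls f := by
  refine Lp.ext ((cls_ae (hf.const_smul c)).trans ?_)
  filter_upwards [cls_ae hf, Lp.coeFn_smul c (cls f)] with x h1 h3
  rw [h3, Pi.smul_apply, Pi.smul_apply, h1]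

lemma norm_cls {f : ℝ → ℂ} (h : MemLp f 2 unitMeasure) :
    ‖cls f‖ = (eLpNorm f 2 unitMeasure).toReal := by
  rw [Lp.norm_def, eLpNorm_congr_ae (cls_ae h)]

lemma norm_cls_le_of_bound {f : ℝ → ℂ} {B : ℝ} (hB : 0 ≤ B) (h : ∀ x ∈ Ioo (0 : ℝ) 1, ‖f x‖ ≤ B) :
    ‖cls f‖ ≤ B := by
  by_cases hf : MemLp f 2 unitMeasure
  · have := Lp.norm_le_of_ae_bound (f := cls f) (C := B) hB (by
      filter_upwards [cls_ae hf, ae_restrict_mem measurableSet_Ioo] with x hx h2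
      rw [hx]; exact h x h2)
    simpa [measureUnivNNReal] using this
  · rw [cls, dif_neg hf, norm_zero]; exact hB

lemma memLp_of_continuous {f : ℝ → ℂ} (hf : Continuous f) : MemLp f 2 unitMeasure := by
  obtain ⟨B, hB⟩ := isCompact_Icc.exists_bound_of_continuousOn (s := Icc (0 : ℝ) 1)
    hf.continuousOn
  refine MemLp.of_bound hf.aestronglyMeasurable B ?_
  filter_upwards [ae_restrict_mem measurableSet_Ioo] with x hx
  exact hB x (Ioo_subset_Icc_self hx)

/-- Complex-valued smooth functions with compact support in `(0,1)`. -/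
def testFun : Submodule ℂ (ℝ → ℂ) where
  carrier := {φ | ContDiff ℝ ∞ φ ∧ HasCompactSupport φ ∧ tsupport φ ⊆ Ioo 0 1}
  zero_mem' := ⟨contDiff_const, HasCompactSupport.zero, by simp [tsupport]⟩
  add_mem' := fun {f g} hf hg => ⟨hf.1.add hg.1, hf.2.1.add hg.2.1,
    (tsupport_add f g).trans (union_subset hf.2.2 hg.2.2)⟩
  smul_mem' := fun c f hf => ⟨hf.1.const_smul c, hf.2.1.smul_left (f := fun _ => c),
    (tsupport_smul_subset_right (fun _ => c) f).trans hf.2.2⟩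

lemma testFun.deriv_mem {φ : ℝ → ℂ} (h : φ ∈ testFun) : deriv φ ∈ testFun :=
  ⟨(contDiff_infty_iff_deriv.1 h.1).2, h.2.1.deriv, (tsupport_deriv_subset (f := φ)).trans h.2.2⟩

lemma testFun.differentiable {φ : ℝ → ℂ} (h : φ ∈ testFun) : Differentiable ℝ φ :=
  h.1.differentiable (by simp)

lemma testFun.hasDerivAt {φ : ℝ → ℂ} (h : φ ∈ testFun) (x : ℝ) : HasDerivAt φ (deriv φ x) x :=
  (testFun.differentiable h x).hasDerivAt

lemma testFun.continuous {φ : ℝ → ℂ} (h : φ ∈ testFun) : Continuous φ := h.1.continuous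

lemma testFun.eq_zero {φ : ℝ → ℂ} (h : φ ∈ testFun) {x : ℝ} (hx : x ∉ Ioo (0 : ℝ) 1) : φ x = 0 :=
  image_eq_zero_of_notMem_tsupport fun h' => hx (h.2.2 h')

lemma testFun.memLp {φ : ℝ → ℂ} (h : φ ∈ testFun) : MemLp φ 2 unitMeasure :=
  memLp_of_continuous (testFun.continuous h)

lemma ofReal_mem_testFun {φ : ℝ → ℝ} (h1 : ContDiff ℝ ∞ φ) (h2 : HasCompactSupport φ)
    (h3 : tsupport φ ⊆ Ioo 0 1) : (fun x => (φ x : ℂ)) ∈ testFun :=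
  ⟨Complex.ofRealCLM.contDiff.comp h1, h2.comp_left (g := Complex.ofReal) rfl,
    (tsupport_comp_subset (g := Complex.ofReal) rfl φ).trans h3⟩

/-- The bilinear pairing `(u, ψ) ↦ ∫ u ψ` on `L_2(0,1)`. -/
def pair (u ψ : L2) : ℂ := ∫ x, u x * ψ x ∂unitMeasure

lemma star_ae (u : L2) : (star u : L2) =ᵐ[unitMeasure] fun x => star (u x) :=
  Lp.coeFn_star u

lemma pair_eq_inner (u ψ : L2) : pair u ψ = inner ℂ (star u) ψ := by
  rw [MeasureTheory.L2.inner_def, pair]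
  refine integral_congr_ae ?_
  filter_upwards [star_ae u] with x hx
  rw [hx]
  simp [mul_comm]

lemma norm_star_L2 (u : L2) : ‖star u‖ = ‖u‖ := by
  rw [Lp.norm_def, Lp.norm_def]
  congr 1
  refine eLpNorm_congr_norm_ae ?_
  filter_upwards [star_ae u] with x hx
  rw [hx]; simp

lemma norm_pair_le (u ψ : L2) : ‖pair u ψ‖ ≤ ‖u‖ * ‖ψ‖ := by
  rw [pair_eq_inner, ← norm_star_L2 u]; exact norm_inner_le_norm _ _

lemma pair_cls {f g : ℝ → ℂ} (hf : MemLp f 2 unitMeasure) (hg : MemLp g 2 unitMeasure) :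
    pair (cls f) (cls g) = ∫ x, f x * g x ∂unitMeasure := by
  refine integral_congr_ae ?_
  filter_upwards [cls_ae hf, cls_ae hg] with x h1 h2
  rw [h1, h2]

/-- The functional `∫ u ·` on `L_2(0,1)`. -/
def pairCLM (u : L2) : L2 →L[ℂ] ℂ := InnerProductSpace.toDual ℂ L2 (star u)

lemma pairCLM_apply (u ψ : L2) : pairCLM u ψ = pair u ψ := by
  rw [pair_eq_inner]; rfl

lemma pair_comm (u ψ : L2) : pair u ψ = pair ψ u := by
  simp only [pair, mul_comm]

lemma exists_pair_eq (l : L2 →L[ℂ] ℂ) : ∃ u : L2, (∀ ψ, l ψ = pair u ψ) ∧ ‖u‖ = ‖l‖ := by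
  refine ⟨star ((InnerProductSpace.toDual ℂ L2).symm l), fun ψ => ?_, ?_⟩
  · rw [pair_eq_inner, star_star, InnerProductSpace.toDual_symm_apply]
  · rw [norm_star_L2, LinearIsometryEquiv.norm_map]

/-- A functional that is bounded in the `L_2`-norm on test functions is a pairing. -/
lemma exists_pair_eq_of_test_bound (δ : testFun →ₗ[ℂ] ℂ) {N : ℝ} (hN : 0 ≤ N)
    (h : ∀ φ : testFun, ‖δ φ‖ ≤ N * ‖cls φ‖) :
    ∃ v : L2, (∀ φ : testFun, δ φ = pair v (cls φ)) ∧ ‖v‖ ≤ N := by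
  let ι : testFun →ₗ[ℂ] L2 :=
    { toFun := fun φ => cls φ
      map_add' := fun φ ψ => cls_add (testFun.memLp φ.2) (testFun.memLp ψ.2)
      map_smul' := fun c φ => cls_smul c (testFun.memLp φ.2) }
  -- `r` chooses preimages linearly. The choice is immaterial, since the bound forces `δ` to vanish
  -- on test functions of class zero; Hahn–Banach then extends `δ ∘ r` from the range.
  obtain ⟨r, hr⟩ := ι.rangeRestrict.exists_rightInverse_of_surjective ι.range_rangeRestrict
  have hr' (w : LinearMap.range ι) : ι (r w) = w := by
    have := congrArg Subtype.val (LinearMap.congr_fun hr w)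
    simpa using this
  let g : LinearMap.range ι →L[ℂ] ℂ := (δ ∘ₗ r).mkContinuous N fun w => by
    have := h (r w)
    change ‖δ (r w)‖ ≤ N * ‖ι (r w)‖ at this
    rw [hr'] at this
    exact this
  obtain ⟨G, hG, hGn⟩ := exists_extension_norm_eq (LinearMap.range ι) g
  obtain ⟨v, hv, hvn⟩ := exists_pair_eq G
  refine ⟨v, fun φ => ?_, ?_⟩
  · rw [← hv]
    have h1 := hG ⟨ι φ, LinearMap.mem_range_self ι φ⟩
    change G (cls φ) = δ (r ⟨ι φ, _⟩) at h1
    rw [h1, ← sub_eq_zero, ← map_sub, ← norm_le_zero_iff]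
    refine (h _).trans ?_
    change N * ‖ι (φ - r ⟨ι φ, _⟩)‖ ≤ 0
    rw [map_sub, hr']
    simp
  · rw [hvn, hGn]
    exact LinearMap.mkContinuous_norm_le _ hN _

lemma deriv_ofReal_comp {φ : ℝ → ℝ} (h : Differentiable ℝ φ) :
    deriv (fun x => (φ x : ℂ)) = fun x => ((deriv φ x : ℝ) : ℂ) := by
  ext x
  exact ((h x).hasDerivAt.ofReal_comp).deriv

lemma pair_cls_right (u : L2) {f : ℝ → ℂ} (hf : MemLp f 2 unitMeasure) :
    pair u (cls f) = ∫ x, f x * u x ∂unitMeasure := by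
  refine integral_congr_ae ?_
  filter_upwards [cls_ae hf] with x hx
  rw [hx, mul_comm]

lemma isWeakDeriv_iff {u v : L2} : IsWeakDeriv u v ↔
    ∀ φ : ℝ → ℝ, ContDiff ℝ ∞ φ → HasCompactSupport φ → tsupport φ ⊆ Ioo 0 1 →
      pair u (cls fun x => ((deriv φ x : ℝ) : ℂ)) = - pair v (cls fun x => (φ x : ℂ)) := by
  refine forall_congr' fun φ => forall_congr' fun h1 => forall_congr' fun h2 =>
    forall_congr' fun h3 => ?_
  have hm := ofReal_mem_testFun h1 h2 h3
  have hm' := testFun.deriv_mem hm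
  rw [deriv_ofReal_comp (h1.differentiable (by simp))] at hm'
  rw [pair_cls_right u (testFun.memLp hm'), pair_cls_right v (testFun.memLp hm)]

/-- Dual description of first-order regularity: the functional φ ↦ −∫ u φ' is bounded in L_2, so it
is represented by some v. The last clause keeps the identity for complex test functions, which
allows iteration. -/
lemma exists_isWeakDeriv {u : L2} {N : ℝ} (hN : 0 ≤ N)
    (h : ∀ φ ∈ testFun, ‖pair u (cls (deriv φ))‖ ≤ N * ‖cls φ‖) :
    ∃ v : L2, ‖v‖ ≤ N ∧ IsWeakDeriv u v ∧
      ∀ φ ∈ testFun, pair u (cls (deriv φ)) = - pair v (cls φ) := by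
  let δ : testFun →ₗ[ℂ] ℂ :=
    { toFun := fun φ => - pairCLM u (cls (deriv φ))
      map_add' := fun φ ψ => by
        have : deriv ((φ + ψ : testFun) : ℝ → ℂ) = deriv φ + deriv ψ := by
          ext x
          exact deriv_add (testFun.differentiable φ.2 x) (testFun.differentiable ψ.2 x)
        rw [this, cls_add (testFun.memLp (testFun.deriv_mem φ.2))
          (testFun.memLp (testFun.deriv_mem ψ.2)), map_add, neg_add]
      map_smul' := fun c φ => by
        have : deriv ((c • φ : testFun) : ℝ → ℂ) = c • deriv φ := by
          ext x
          exact deriv_const_smul c (testFun.differentiable φ.2 x)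
        rw [this, cls_smul c (testFun.memLp (testFun.deriv_mem φ.2)), map_smul]
        simp }
  obtain ⟨v, hv, hvn⟩ := exists_pair_eq_of_test_bound δ hN fun φ => by
    change ‖- pairCLM u (cls (deriv φ))‖ ≤ _
    rw [norm_neg, pairCLM_apply]
    exact h φ φ.2
  have key : ∀ φ ∈ testFun, pair u (cls (deriv φ)) = - pair v (cls φ) := fun φ hφ => by
    have := hv ⟨φ, hφ⟩
    change - pairCLM u (cls (deriv φ)) = _ at this
    rw [pairCLM_apply] at this
    rw [← this, neg_neg]
  refine ⟨v, hvn, isWeakDeriv_iff.2 fun φ h1 h2 h3 => ?_, key⟩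
  rw [← deriv_ofReal_comp (h1.differentiable (by simp))]
  exact key _ (ofReal_mem_testFun h1 h2 h3)

/-! ### Functions with a weak derivative in `L_2` are primitives -/

/-- The primitive taken from the left of the support vanishes to its right precisely because the
total integral is zero. -/
lemma exists_testFun_primitive {ψ : ℝ → ℝ} (h1 : ContDiff ℝ ∞ ψ) (h2 : HasCompactSupport ψ)
    (h3 : tsupport ψ ⊆ Ioo 0 1) (h0 : ∫ x, ψ x = 0) :
    ∃ φ : ℝ → ℝ, ContDiff ℝ ∞ φ ∧ HasCompactSupport φ ∧ tsupport φ ⊆ Ioo 0 1 ∧ deriv φ = ψ := by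
  obtain ⟨a, b, ha, hb, hab⟩ : ∃ a b : ℝ, 0 < a ∧ b < 1 ∧ tsupport ψ ⊆ Icc a b := by
    rcases (tsupport ψ).eq_empty_or_nonempty with he | hne
    · exact ⟨1/2, 1/2, by norm_num, by norm_num, by simp [he]⟩
    · obtain ⟨a, ha⟩ := h2.isCompact.exists_isLeast hne
      obtain ⟨b, hb⟩ := h2.isCompact.exists_isGreatest hne
      exact ⟨a, b, (h3 ha.1).1, (h3 hb.1).2, fun x hx => ⟨ha.2 hx, hb.2 hx⟩⟩
  have hz : ∀ x, x ∉ Icc a b → ψ x = 0 := fun x hx =>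
    image_eq_zero_of_notMem_tsupport fun h => hx (hab h)
  have hd : ∀ x, HasDerivAt (fun y => ∫ t in a..y, ψ t) (ψ x) x := fun x =>
    h1.continuous.integral_hasStrictDerivAt a x |>.hasDerivAt
  have hderiv : deriv (fun y => ∫ t in a..y, ψ t) = ψ := funext fun x => (hd x).deriv
  have hsupp : Function.support (fun y => ∫ t in a..y, ψ t) ⊆ Icc a b := by
    intro y hy
    by_contra hyn
    refine hy ?_
    rcases lt_or_ge y a with hya | hya
    · refine (intervalIntegral.integral_congr_ae ?_).trans intervalIntegral.integral_zero
      have : ∀ᵐ x : ℝ, x ≠ a := by simp [ae_iff, measure_singleton]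
      filter_upwards [this] with x hx hxm
      rw [uIoc_of_ge hya.le] at hxm
      exact hz x fun h => hx (le_antisymm hxm.2 h.1)
    · have hyb : b < y := by
        by_contra h
        exact hyn ⟨hya, not_lt.1 h⟩
      change ∫ t in a..y, ψ t = 0
      rw [intervalIntegral.integral_of_le hya, ← integral_Icc_eq_integral_Ioc,
        setIntegral_eq_integral_of_forall_compl_eq_zero, h0]
      intro x hx
      exact hz x fun h => hx ⟨h.1, h.2.trans hyb.le⟩
  have hts : tsupport (fun y => ∫ t in a..y, ψ t) ⊆ Icc a b := closure_minimal hsupp isClosed_Icc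
  refine ⟨fun y => ∫ t in a..y, ψ t, ?_, ?_, ?_, hderiv⟩
  · rw [contDiff_infty_iff_deriv, hderiv]
    exact ⟨fun x => (hd x).differentiableAt, h1⟩
  · exact HasCompactSupport.of_support_subset_isCompact isCompact_Icc hsupp
  · exact hts.trans fun x hx => ⟨ha.trans_le hx.1, hx.2.trans_lt hb⟩

/-- Du Bois-Reymond's argument: a test function minus its integral times a fixed bump `ρ` of mass
one has mean zero, hence is the derivative of a test function. So w integrates against test
functions like the constant ∫ ρ w. -/
lemma ae_const_of_isWeakDeriv_zero {w : L2}
    (h : ∀ φ : ℝ → ℝ, ContDiff ℝ ∞ φ → HasCompactSupport φ → tsupport φ ⊆ Ioo 0 1 →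
      ∫ x, ((deriv φ x : ℝ) : ℂ) * w x ∂unitMeasure = 0) :
    ∃ c : ℂ, w =ᵐ[unitMeasure] fun _ => c := by
  let B : ContDiffBump (1 / 2 : ℝ) := ⟨1 / 8, 1 / 4, by norm_num, by norm_num⟩
  let ρ : ℝ → ℝ := B.normed volume
  have hρ1 : ContDiff ℝ ∞ ρ := B.contDiff_normed
  have hρ2 : HasCompactSupport ρ := B.hasCompactSupport_normed
  have hρ3 : tsupport ρ ⊆ Ioo 0 1 := by
    rw [B.tsupport_normed_eq]
    intro x hx
    rw [Metric.mem_closedBall, Real.dist_eq, abs_le] at hx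
    change _ ≤ x - 1 / 2 ∧ x - 1 / 2 ≤ 1 / 4 at hx
    have : B.rOut = 1 / 4 := rfl
    rw [this] at hx
    constructor <;> linarith [hx.1, hx.2]
  have hρ4 : ∫ x, ρ x = 1 := B.integral_normed
  let c : ℂ := ∫ x, (ρ x : ℂ) * w x ∂unitMeasure
  refine ⟨c, ?_⟩
  have hres : ∀ {g : ℝ → ℝ}, tsupport g ⊆ Ioo 0 1 → ∫ x, (g x : ℂ) ∂unitMeasure = ∫ x, (g x : ℂ) :=
    fun {g} hg => setIntegral_eq_integral_of_forall_compl_eq_zero fun x hx => by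
      rw [image_eq_zero_of_notMem_tsupport fun h => hx (hg h), Complex.ofReal_zero]
  have key : ∀ᵐ x, x ∈ Ioo (0 : ℝ) 1 → w x - c = 0 := by
    have hwi : Integrable (fun x => w x - c) unitMeasure :=
      ((Lp.memLp w).integrable (by norm_num)).sub (integrable_const c)
    refine isOpen_Ioo.ae_eq_zero_of_integral_contDiff_smul_eq_zero
      (IntegrableOn.locallyIntegrableOn hwi) fun g g1 g2 g3 => ?_
    have hm : tsupport (fun x => g x - (∫ y, g y) * ρ x) ⊆ Ioo 0 1 :=
      (tsupport_sub _ _).trans (union_subset g3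
        ((tsupport_mul_subset_right (f := fun _ => ∫ y, g y)).trans hρ3))
    obtain ⟨φ, f1, f2, f3, f4⟩ := exists_testFun_primitive
      (ψ := fun x => g x - (∫ y, g y) * ρ x) (g1.sub (contDiff_const.mul hρ1))
      (g2.sub hρ2.mul_left) hm (by
        rw [integral_sub (g1.continuous.integrable_of_hasCompactSupport g2)
          ((hρ1.continuous.integrable_of_hasCompactSupport hρ2).const_mul _),
          integral_const_mul, hρ4, mul_one, sub_self])
    have h5 := h φ f1 f2 f3
    rw [f4] at h5
    have i1 := integrable_ofReal_mul g1.continuous g2 w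
    have i2 := (integrable_ofReal_mul hρ1.continuous hρ2 w).const_mul ((∫ y, g y : ℝ) : ℂ)
    have i3 : Integrable (fun x => (g x : ℂ) * c) unitMeasure :=
      ((g1.continuous.integrable_of_hasCompactSupport g2).ofReal.mul_const c).integrableOn
    have h6 : ∫ x, (g x : ℂ) * w x ∂unitMeasure = ((∫ y, g y : ℝ) : ℂ) * c := by
      rw [← integral_const_mul, ← sub_eq_zero, ← integral_sub i1 i2, ← h5]
      refine integral_congr_ae (Eventually.of_forall fun x => ?_)
      push_cast
      ring
    rw [← setIntegral_eq_integral_of_forall_compl_eq_zero (s := Ioo 0 1)]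
    · have : ∀ x, g x • (w x - c) = (g x : ℂ) * w x - (g x : ℂ) * c := fun x => by
        rw [Complex.real_smul]; ring
      simp_rw [this]
      rw [integral_sub i1 i3, h6, integral_mul_const, hres g3, integral_complex_ofReal, sub_self]
    · intro x hx
      rw [image_eq_zero_of_notMem_tsupport fun h => hx (g3 h), zero_smul]
  filter_upwards [(ae_restrict_iff' measurableSet_Ioo).2 key] with x hx
  exact sub_eq_zero.1 hx

/-- The primitive of `v` that vanishes at `0`. -/
def prim (v : ℝ → ℂ) (x : ℝ) : ℂ := ∫ t in (0 : ℝ)..x, v t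

lemma intervalIntegrable_of_memLp {v : ℝ → ℂ} (hv : MemLp v 2 unitMeasure) {a b : ℝ}
    (ha : a ∈ Icc (0 : ℝ) 1) (hb : b ∈ Icc (0 : ℝ) 1) : IntervalIntegrable v volume a b := by
  have h : IntegrableOn v (Ioo 0 1) volume := hv.integrable (by norm_num)
  rw [← integrableOn_Icc_iff_integrableOn_Ioo] at h
  rw [intervalIntegrable_iff]
  exact h.mono_set (uIoc_subset_uIcc.trans (uIcc_subset_Icc ha hb))

lemma integral_norm_le_norm (v : L2) : ∫ x, ‖v x‖ ∂unitMeasure ≤ ‖v‖ := by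
  have h1 : MemLp v 1 unitMeasure := (Lp.memLp v).mono_exponent (by norm_num)
  rw [integral_norm_eq_lintegral_enorm (Lp.aestronglyMeasurable v), ← eLpNorm_one_eq_lintegral_enorm,
    Lp.norm_def]
  exact ENNReal.toReal_mono (Lp.eLpNorm_ne_top v)
    (eLpNorm_le_eLpNorm_of_exponent_le (by norm_num) (Lp.aestronglyMeasurable v))

lemma norm_prim_le (v : L2) {x : ℝ} (hx : x ∈ Icc (0 : ℝ) 1) : ‖prim v x‖ ≤ ‖v‖ := by
  refine (intervalIntegral.norm_integral_le_integral_norm hx.1).trans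
    (le_trans ?_ (integral_norm_le_norm v))
  rw [intervalIntegral.integral_of_le hx.1, ← integral_Ioc_eq_integral_Ioo]
  refine setIntegral_mono_set ?_ (Eventually.of_forall fun _ => norm_nonneg _)
    (Ioc_subset_Ioc_right hx.2).eventuallyLE
  exact (integrableOn_Ioc_iff_integrableOn_Ioo).2 ((Lp.memLp v).integrable (by norm_num)).norm

lemma memLp_prim {v : ℝ → ℂ} (hv : MemLp v 2 unitMeasure) : MemLp (prim v) 2 unitMeasure := by
  have hc : ContinuousOn (prim v) (Icc 0 1) := by
    have := intervalIntegral.continuousOn_primitive_interval (f := v) (μ := volume) (a := 0) (b := 1)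
    rw [uIcc_of_le zero_le_one] at this
    exact this ((integrableOn_Icc_iff_integrableOn_Ioo).2 (hv.integrable (by norm_num)))
  obtain ⟨B, hB⟩ := isCompact_Icc.exists_bound_of_continuousOn hc
  refine MemLp.of_bound
    ((hc.mono Ioo_subset_Icc_self).aestronglyMeasurable measurableSet_Ioo) B ?_
  filter_upwards [ae_restrict_mem measurableSet_Ioo] with x hx
  exact hB x (Ioo_subset_Icc_self hx)

lemma prim_congr {f g : ℝ → ℂ} (h : f =ᵐ[unitMeasure] g) {x : ℝ} (hx : x ∈ Icc (0 : ℝ) 1) :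
    prim f x = prim g x := by
  refine intervalIntegral.integral_congr_ae ?_
  have h' := (ae_restrict_iff' measurableSet_Ioo).1 h
  have h1 : ∀ᵐ y : ℝ, y ≠ 1 := by simp [ae_iff, measure_singleton]
  filter_upwards [h', h1] with y hy hy1 hm
  rw [uIoc_of_le hx.1] at hm
  exact hy ⟨hm.1, lt_of_le_of_ne (hm.2.trans hx.2) hy1⟩

/-- Taking the primitive that vanishes at `0`, as an operator on `L_2(0,1)`. -/
def primCLM : L2 →L[ℂ] L2 :=
  LinearMap.mkContinuous
    { toFun := fun v => cls (prim v)
      map_add' := fun v w => by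
        rw [← cls_add (memLp_prim (Lp.memLp v)) (memLp_prim (Lp.memLp w))]
        refine cls_congr ?_
        filter_upwards [ae_restrict_mem measurableSet_Ioo] with x hx
        have hx' := Ioo_subset_Icc_self hx
        rw [prim_congr (Lp.coeFn_add v w) hx', Pi.add_apply]
        exact intervalIntegral.integral_add
          (intervalIntegrable_of_memLp (Lp.memLp v) (left_mem_Icc.2 zero_le_one) hx')
          (intervalIntegrable_of_memLp (Lp.memLp w) (left_mem_Icc.2 zero_le_one) hx')
      map_smul' := fun c v => by
        rw [RingHom.id_apply, ← cls_smul c (memLp_prim (Lp.memLp v))]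
        refine cls_congr ?_
        filter_upwards [ae_restrict_mem measurableSet_Ioo] with x hx
        rw [prim_congr (Lp.coeFn_smul c v) (Ioo_subset_Icc_self hx)]
        exact intervalIntegral.integral_smul c _ }
    1 fun v => by
      rw [one_mul]
      exact norm_cls_le_of_bound (norm_nonneg v) fun x hx =>
        norm_prim_le v (Ioo_subset_Icc_self hx)

lemma norm_primCLM_le (v : L2) : ‖primCLM v‖ ≤ ‖v‖ :=
  norm_cls_le_of_bound (norm_nonneg v) fun _ hx => norm_prim_le v (Ioo_subset_Icc_self hx)

lemma primCLM_cls {v : ℝ → ℂ} (hv : MemLp v 2 unitMeasure) : primCLM (cls v) = cls (prim v) := by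
  refine cls_congr ?_
  filter_upwards [ae_restrict_mem measurableSet_Ioo] with x hx
  exact prim_congr (cls_ae hv) (Ioo_subset_Icc_self hx)

/-- Primitives of continuous functions are C¹; approximation by them reduces statements about weak
derivatives to classical calculus. -/
lemma exists_continuous_tendsto (v : L2) :
    ∃ g : ℕ → ℝ → ℂ, (∀ n, Continuous (g n)) ∧ Tendsto (fun n => cls (g n)) atTop (𝓝 v) := by
  have h (n : ℕ) : ∃ g : ℝ → ℂ, Continuous g ∧ ‖cls g - v‖ ≤ 1 / ((n : ℝ) + 1) := by
    obtain ⟨g, hg, hg2⟩ := (Lp.memLp v).exists_boundedContinuous_eLpNorm_sub_le (by norm_num)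
      (ε := ENNReal.ofReal (1 / ((n : ℝ) + 1))) (by positivity)
    refine ⟨g, g.continuous, ?_⟩
    rw [Lp.norm_def]
    refine ENNReal.toReal_le_of_le_ofReal (by positivity) (le_trans (le_of_eq ?_) hg)
    rw [← eLpNorm_neg]
    refine eLpNorm_congr_ae ?_
    filter_upwards [cls_ae hg2, Lp.coeFn_sub (cls g) v] with x h1 h2
    rw [Pi.neg_apply, h2, Pi.sub_apply, Pi.sub_apply, h1, neg_sub]
  choose g hg1 hg2 using h
  refine ⟨g, hg1, tendsto_iff_norm_sub_tendsto_zero.2 ?_⟩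
  exact squeeze_zero (fun _ => norm_nonneg _) hg2 tendsto_one_div_add_atTop_nhds_zero_nat

lemma hasDerivAt_prim {v : ℝ → ℂ} (hv : Continuous v) (x : ℝ) : HasDerivAt (prim v) (v x) x :=
  (hv.integral_hasStrictDerivAt 0 x).hasDerivAt

/-- Both sides are continuous in v. For continuous v this is integration by parts, with no boundary
terms as φ vanishes at 0 and 1. -/
lemma pair_primCLM_deriv (v : L2) {φ : ℝ → ℂ} (hφ : φ ∈ testFun) :
    pair (primCLM v) (cls (deriv φ)) = - pair v (cls φ) := by
  obtain ⟨g, hg, ht⟩ := exists_continuous_tendsto v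
  have hcomm : ∀ a b : L2, pair a b = pairCLM b a := fun a b => by rw [pairCLM_apply, pair_comm]
  rw [hcomm, hcomm]
  refine tendsto_nhds_unique (((pairCLM (cls (deriv φ))).comp primCLM).continuous.tendsto v |>.comp ht)
    (Tendsto.congr (fun n => ?_) (((pairCLM (cls φ)).continuous.tendsto v |>.comp ht).neg))
  have hp : Continuous (prim (g n)) :=
    continuous_iff_continuousAt.2 fun x => (hasDerivAt_prim (hg n) x).continuousAt
  have hφc := testFun.continuous hφ
  have hφd := testFun.continuous (testFun.deriv_mem hφ)
  simp only [Function.comp_apply, ContinuousLinearMap.comp_apply]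
  rw [← hcomm, ← hcomm, primCLM_cls (memLp_of_continuous (hg n)),
    pair_cls (memLp_of_continuous (hg n)) (testFun.memLp hφ),
    pair_cls (memLp_of_continuous hp) (testFun.memLp (testFun.deriv_mem hφ)),
    ← integral_Ioc_eq_integral_Ioo, ← integral_Ioc_eq_integral_Ioo,
    ← intervalIntegral.integral_of_le zero_le_one, ← intervalIntegral.integral_of_le zero_le_one,
    intervalIntegral.integral_mul_deriv_eq_deriv_mul (fun x _ => hasDerivAt_prim (hg n) x)
      (fun x _ => testFun.hasDerivAt hφ x) ((hg n).intervalIntegrable _ _)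
      (hφd.intervalIntegrable _ _),
    testFun.eq_zero hφ (x := 1) (by simp), testFun.eq_zero hφ (x := 0) (by simp)]
  simp

/-- A function with a weak derivative is, up to a constant, the primitive of that derivative. -/
lemma IsWeakDeriv.exists_eq_const_add_prim {u v : L2} (h : IsWeakDeriv u v) :
    ∃ c : ℂ, u = cls (fun _ => c) + primCLM v ∧ ‖c‖ ≤ ‖u‖ + ‖v‖ := by
  obtain ⟨c, hc⟩ := ae_const_of_isWeakDeriv_zero (w := u - primCLM v) fun φ h1 h2 h3 => by
    have hm := ofReal_mem_testFun h1 h2 h3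
    have hm' := testFun.deriv_mem hm
    have hp := pair_primCLM_deriv v hm
    rw [deriv_ofReal_comp (h1.differentiable (by simp))] at hm' hp
    rw [← pair_cls_right _ (testFun.memLp hm'), pair_comm, ← pairCLM_apply, map_sub, pairCLM_apply,
      pairCLM_apply, pair_comm, isWeakDeriv_iff.1 h φ h1 h2 h3, pair_comm _ (primCLM v), hp, sub_self]
  have h2 : u - primCLM v = cls fun _ => c := by
    rw [← cls_coe (u - primCLM v)]; exact cls_congr hc
  have h3 : ‖cls fun _ => c‖ = ‖c‖ := by
    rw [norm_cls (memLp_const c), eLpNorm_const _ (by norm_num) (NeZero.ne _)]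
    simp
  refine ⟨c, by rw [← h2]; abel, ?_⟩
  rw [← h3, ← h2]
  exact (norm_sub_le _ _).trans (add_le_add_right (norm_primCLM_le v) _)

/-! ### Fourier coefficients on `(0,2)` -/

/-- Lebesgue measure on `(0,2]`. -/
abbrev doubleMeasure : Measure ℝ := volume.restrict (Ioc (0 : ℝ) 2)

/-- The functions `x ↦ exp (i π k x)`. -/
def expPi (k : ℤ) (x : ℝ) : ℂ := Complex.exp (Real.pi * Complex.I * k * x)

lemma continuous_expPi (k : ℤ) : Continuous (expPi k) := by unfold expPi; fun_prop

lemma hasDerivAt_expPi (k : ℤ) (x : ℝ) :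
    HasDerivAt (expPi k) (Real.pi * Complex.I * k * expPi k x) x := by
  have h := ((hasDerivAt_id (x : ℂ)).const_mul (Real.pi * Complex.I * k : ℂ)).cexp.comp_ofReal
  convert! h using 1
  rw [expPi, mul_one, mul_comm]
  rfl

lemma norm_expPi (k : ℤ) (x : ℝ) : ‖expPi k x‖ = 1 := by
  have : (Real.pi * Complex.I * k * x : ℂ) = ((Real.pi * k * x : ℝ) : ℂ) * Complex.I := by
    push_cast; ring
  rw [expPi, this, Complex.norm_exp_ofReal_mul_I]

/-- The Fourier coefficients on `(0,2)`. -/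
def fcoef (f : ℝ → ℂ) (k : ℤ) : ℂ := fourierCoeffOn (two_pos : (0 : ℝ) < 2) f k

lemma fourier_eq_expPi (k : ℤ) (x : ℝ) : fourier k (x : AddCircle ((2 : ℝ) - 0)) = expPi k x := by
  rw [fourier_coe_apply, expPi]
  congr 1
  push_cast
  ring

lemma fcoef_eq (f : ℝ → ℂ) (k : ℤ) :
    fcoef f k = (1 / 2 : ℝ) • ∫ x, expPi (-k) x * f x ∂doubleMeasure := by
  rw [fcoef, fourierCoeffOn_eq_integral, intervalIntegral.integral_of_le zero_le_two]
  simp only [fourier_eq_expPi, smul_eq_mul, sub_zero]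

lemma integrable_expPi_mul (k : ℤ) {f : ℝ → ℂ} (hf : MemLp f 2 doubleMeasure) :
    Integrable (fun x => expPi k x * f x) doubleMeasure :=
  (hf.integrable (by norm_num)).bdd_mul (c := 1)
    (continuous_expPi k).aestronglyMeasurable (Eventually.of_forall fun x => (norm_expPi k x).le)

lemma fcoef_add {f g : ℝ → ℂ} (hf : MemLp f 2 doubleMeasure) (hg : MemLp g 2 doubleMeasure)
    (k : ℤ) : fcoef (fun x => f x + g x) k = fcoef f k + fcoef g k := by
  simp only [fcoef_eq, mul_add]
  rw [integral_add (integrable_expPi_mul _ hf) (integrable_expPi_mul _ hg), smul_add]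

lemma fcoef_const_mul (c : ℂ) (f : ℝ → ℂ) (k : ℤ) : fcoef (fun x => c * f x) k = c * fcoef f k :=
  fourierCoeffOn.const_mul _ _ _ _

lemma fcoef_congr {f g : ℝ → ℂ} (h : f =ᵐ[doubleMeasure] g) (k : ℤ) : fcoef f k = fcoef g k := by
  simp only [fcoef]; rw [fourierCoeffOn_congr_ae _ h]

lemma hasSum_sq_fcoef {f : ℝ → ℂ} (hf : MemLp f 2 doubleMeasure) :
    HasSum (fun k => ‖fcoef f k‖ ^ 2) ((eLpNorm f 2 doubleMeasure).toReal ^ 2 / 2) := by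
  convert! hasSum_sq_fourierCoeffOn two_pos hf using 1
  rw [hf.eLpNorm_eq_integral_rpow_norm (by norm_num) (by norm_num),
    ENNReal.toReal_ofReal (by positivity), intervalIntegral.integral_of_le zero_le_two]
  simp only [ENNReal.toReal_ofNat, Real.rpow_two]
  rw [← Real.rpow_natCast, ← Real.rpow_mul (by positivity)]
  norm_num
  ring

lemma memLp_double_of_continuous {f : ℝ → ℂ} (hf : Continuous f) : MemLp f 2 doubleMeasure := by
  obtain ⟨B, hB⟩ := isCompact_Icc.exists_bound_of_continuousOn (s := Icc (0 : ℝ) 2)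
    hf.continuousOn
  refine MemLp.of_bound hf.aestronglyMeasurable B ?_
  filter_upwards [ae_restrict_mem measurableSet_Ioc] with x hx
  exact hB x (Ioc_subset_Icc_self hx)

lemma fcoef_expPi (j k : ℤ) : fcoef (expPi j) k = if j = k then 1 else 0 := by
  have h1 : ∀ x, expPi (-k) x * expPi j x = expPi (j - k) x := fun x => by
    rw [expPi, expPi, expPi, ← Complex.exp_add]
    congr 1
    push_cast
    ring
  simp only [fcoef_eq, h1]
  rw [← intervalIntegral.integral_of_le zero_le_two]
  split_ifs with h
  · subst h
    simp [expPi]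
  · have h2 : (Real.pi * Complex.I * ((j - k : ℤ) : ℂ)) ≠ 0 := by
      refine mul_ne_zero (mul_ne_zero ?_ Complex.I_ne_zero) ?_
      · exact_mod_cast Real.pi_ne_zero
      · exact_mod_cast sub_ne_zero.2 h
    simp only [expPi]
    rw [integral_exp_mul_complex h2]
    have h3 : Real.pi * Complex.I * ((j - k : ℤ) : ℂ) * ((2 : ℝ) : ℂ)
        = ((j - k : ℤ) : ℂ) * (2 * Real.pi * Complex.I) := by push_cast; ring
    rw [h3, Complex.exp_int_mul_two_pi_mul_I]
    simp

/-- Trigonometric polynomials. -/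
def trig (c : ℤ →₀ ℂ) (x : ℝ) : ℂ := c.sum fun k a => a * expPi k x

lemma trig_apply (c : ℤ →₀ ℂ) (x : ℝ) : trig c x = ∑ k ∈ c.support, c k * expPi k x := rfl

lemma continuous_trig (c : ℤ →₀ ℂ) : Continuous (trig c) := by
  simp only [funext (trig_apply c)]
  exact continuous_finsetSum _ fun k _ => (continuous_expPi k).const_mul _ 

lemma fcoef_sum (S : Finset ℤ) (c : ℤ → ℂ) (k : ℤ) :
    fcoef (fun x => ∑ j ∈ S, c j * expPi j x) k = if k ∈ S then c k else 0 := by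
  classical
  induction S using Finset.induction_on with
  | empty => simp [fcoef_eq]
  | insert a s ha ih =>
    have hm (j : ℤ) : MemLp (fun x => c j * expPi j x) 2 doubleMeasure :=
      memLp_double_of_continuous ((continuous_expPi j).const_mul _)
    have h2 : MemLp (fun x => ∑ j ∈ s, c j * expPi j x) 2 doubleMeasure :=
      memLp_double_of_continuous (continuous_finsetSum _ fun k _ => (continuous_expPi k).const_mul _)
    simp only [Finset.sum_insert ha]
    rw [fcoef_add (hm a) h2, ih, fcoef_const_mul, fcoef_expPi]
    by_cases h : a = k
    · subst h; simp [ha]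
    · simp [h, Finset.mem_insert, Ne.symm h]

/-- The class of `expPi k` in `L_2(0,1)`. -/
def expL2 (k : ℤ) : L2 := cls (expPi k)

lemma cls_sum (S : Finset ℤ) (c : ℤ → ℂ) :
    cls (fun x => ∑ k ∈ S, c k * expPi k x) = ∑ k ∈ S, c k • expL2 k := by
  classical
  induction S using Finset.induction_on with
  | empty =>
    have : cls (fun _ => (0 : ℂ)) = 0 :=
      Lp.ext ((cls_ae (memLp_const 0)).trans (Lp.coeFn_zero _ _ _).symm)
    simpa using this
  | insert a s ha ih =>
    simp only [Finset.sum_insert ha]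
    have h1 : MemLp (c a • expPi a) 2 unitMeasure :=
      memLp_of_continuous ((continuous_expPi a).const_smul _)
    have h2 : MemLp (fun x => ∑ k ∈ s, c k * expPi k x) 2 unitMeasure :=
      memLp_of_continuous (continuous_finsetSum _ fun k _ => (continuous_expPi k).const_mul _)
    rw [← ih, expL2, ← cls_smul _ (memLp_of_continuous (continuous_expPi a)), ← cls_add h1 h2]
    rfl

lemma norm_cls_le_double {f : ℝ → ℂ} (hf : MemLp f 2 doubleMeasure) :
    ‖cls f‖ ≤ (eLpNorm f 2 doubleMeasure).toReal := by
  have hle : unitMeasure ≤ doubleMeasure :=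
    Measure.restrict_mono (Ioo_subset_Ioc_self.trans (Ioc_subset_Ioc_right one_le_two)) le_rfl
  rw [norm_cls (hf.mono_measure hle)]
  exact ENNReal.toReal_mono hf.2.ne (eLpNorm_mono_measure _ hle)

/-- The exponentials are orthogonal on (0,2) only. Parseval there gives the factor 2, the length of
the interval, and restriction to (0,1) decreases the norm. -/
lemma norm_sum_expL2_sq_le (S : Finset ℤ) (c : ℤ → ℂ) :
    ‖∑ k ∈ S, c k • expL2 k‖ ^ 2 ≤ 2 * ∑ k ∈ S, ‖c k‖ ^ 2 := by
  have hm : MemLp (fun x => ∑ k ∈ S, c k * expPi k x) 2 doubleMeasure :=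
    memLp_double_of_continuous (continuous_finsetSum _ fun k _ => (continuous_expPi k).const_mul _)
  have h := hasSum_sq_fcoef hm
  simp only [fcoef_sum] at h
  have h2 : HasSum (fun k => ‖if k ∈ S then c k else 0‖ ^ 2) (∑ k ∈ S, ‖c k‖ ^ 2) := by
    have := hasSum_sum_of_ne_finset_zero (s := S) (f := fun k => ‖if k ∈ S then c k else 0‖ ^ 2)
      (L := SummationFilter.unconditional ℤ) (fun k hk => by simp [hk])
    rwa [Finset.sum_congr rfl fun k hk => by rw [if_pos hk]] at this
  have h3 := h.unique h2
  rw [← cls_sum]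
  have h4 := norm_cls_le_double hm
  have h5 := pow_le_pow_left₀ (norm_nonneg _) h4 2
  linarith

/-! ### Extension from `(0,1)` to a function of period `2` -/

/-- A combination of rescaled reflections, mapping functions on `(0,1)` to functions on `(1,2)`. -/
def refl (p q r : ℝ → ℝ) (g : ℝ → ℂ) (x : ℝ) : ℂ :=
  p x * g (2 - x) + q x * g ((3 - x) / 2) + r x * g ((2 - x) / 2)

/-- The function that equals `f` up to `1` and `g` beyond. -/
def glue (f g : ℝ → ℂ) (x : ℝ) : ℂ := if x ≤ 1 then f x else g x

/-- The factor `e` is the Jacobian. The point 2 is excepted because its image may be the endpoint 0.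
-/
lemma map_affine_le {d e : ℝ} (he : 0 < e) (h : ∀ x ∈ Ioc (1 : ℝ) 2, x ≠ 2 → (d - x) / e ∈ Ioo (0 : ℝ) 1) :
    (volume.restrict (Ioc (1 : ℝ) 2)).map (fun x => (d - x) / e)
      ≤ ENNReal.ofReal e • unitMeasure := by
  have hm : Measurable fun x : ℝ => (d - x) / e := by fun_prop
  refine Measure.le_iff.2 fun s hs => ?_
  rw [Measure.map_apply hm hs, Measure.restrict_apply (hm hs), Measure.smul_apply,
    Measure.restrict_apply hs, smul_eq_mul]
  have h1 : (fun x : ℝ => (d - x) / e) ⁻¹' (s ∩ Ioo 0 1)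
      = (fun x => -e⁻¹ * x) ⁻¹' ((fun x => d / e + x) ⁻¹' (s ∩ Ioo 0 1)) := by
    ext x
    have : (d - x) / e = d / e + -e⁻¹ * x := by field_simp; ring
    simp only [mem_preimage, this]
  have h2 : volume ((fun x : ℝ => (d - x) / e) ⁻¹' (s ∩ Ioo 0 1))
      = ENNReal.ofReal e * volume (s ∩ Ioo 0 1) := by
    rw [h1, Real.volume_preimage_mul_left (by simp [he.ne']), measure_preimage_add]
    congr 2
    rw [inv_neg, inv_inv, abs_neg, abs_of_pos he]
  rw [← h2]
  refine (measure_mono (t := (fun x : ℝ => (d - x) / e) ⁻¹' (s ∩ Ioo 0 1) ∪ {2}) ?_).trans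
    ((measure_union_le _ _).trans (by simp))
  rintro x ⟨hx1, hx2⟩
  by_cases hx : x = 2
  · exact Or.inr hx
  · exact Or.inl ⟨hx1, h x hx2 hx⟩

lemma memLp_comp_affine {d e : ℝ} (he : 0 < e) (he2 : e ≤ 4)
    (h : ∀ x ∈ Ioc (1 : ℝ) 2, x ≠ 2 → (d - x) / e ∈ Ioo (0 : ℝ) 1)
    {g : ℝ → ℂ} (hg : MemLp g 2 unitMeasure) {p : ℝ → ℝ} (hp : Continuous p) {B : ℝ} 
    (hB : ∀ x ∈ Ioc (1 : ℝ) 2, |p x| ≤ B) :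
    MemLp (fun x => p x * g ((d - x) / e)) 2 (volume.restrict (Ioc (1 : ℝ) 2)) ∧
      (eLpNorm (fun x => p x * g ((d - x) / e)) 2 (volume.restrict (Ioc (1 : ℝ) 2))).toReal
        ≤ 2 * B * (eLpNorm g 2 unitMeasure).toReal := by
  have hB0 : 0 ≤ B := (abs_nonneg _).trans (hB 2 (by norm_num))
  have hm : Measurable fun x : ℝ => (d - x) / e := by fun_prop
  have hle := map_affine_le he h
  have hg2 : MemLp g 2 (ENNReal.ofReal e • unitMeasure) := hg.smul_measure ENNReal.ofReal_ne_top
  have hg3 := hg2.mono_measure hle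
  have hg4 : MemLp (fun x => g ((d - x) / e)) 2 (volume.restrict (Ioc (1 : ℝ) 2)) :=
    hg3.comp_of_map hm.aemeasurable
  have e1 : eLpNorm (fun x => g ((d - x) / e)) 2 (volume.restrict (Ioc (1 : ℝ) 2))
      ≤ 2 * eLpNorm g 2 unitMeasure := by
    have := eLpNorm_map_measure (p := 2) hg3.1 hm.aemeasurable
    rw [← Function.comp_def g, ← this]
    refine (eLpNorm_mono_measure _ hle).trans ?_
    rw [eLpNorm_smul_measure_of_ne_top (by norm_num), smul_eq_mul]
    gcongr
    -- The change of variables costs √e, at most 2.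
    have : ENNReal.ofReal e ≤ (2 : ℝ≥0∞) ^ (2 : ℝ) := by
      rw [ENNReal.rpow_two]
      refine ENNReal.ofReal_le_of_le_toReal (he2.trans ?_)
      norm_num
    refine (ENNReal.rpow_le_rpow this (by simp)).trans (le_of_eq ?_)
    rw [← ENNReal.rpow_mul]
    norm_num
  have e2 : ∀ᵐ x ∂(volume.restrict (Ioc (1 : ℝ) 2)),
      ‖(p x : ℂ) * g ((d - x) / e)‖ ≤ B * ‖g ((d - x) / e)‖ := by
    filter_upwards [ae_restrict_mem measurableSet_Ioc] with x hx
    rw [norm_mul, Complex.norm_real]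
    gcongr
    exact hB x hx
  refine ⟨hg4.of_le_mul ((Complex.continuous_ofReal.comp hp).aestronglyMeasurable.mul hg4.1) e2, ?_⟩
  have e3 := eLpNorm_le_mul_eLpNorm_of_ae_le_mul e2 2
  refine ENNReal.toReal_le_of_le_ofReal (by positivity) (e3.trans ?_)
  calc _ ≤ ENNReal.ofReal B * (2 * eLpNorm g 2 unitMeasure) := by gcongr
    _ = _ := by
      rw [mul_assoc, mul_comm B, ENNReal.ofReal_mul (by norm_num), ENNReal.ofReal_mul (by positivity),
        ENNReal.ofReal_toReal hg.2.ne]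
      norm_num
      ring

lemma memLp_refl {p q r : ℝ → ℝ} (hp : Continuous p) (hq : Continuous q) (hr : Continuous r) {B : ℝ}
    (hB : ∀ x ∈ Ioc (1 : ℝ) 2, |p x| ≤ B ∧ |q x| ≤ B ∧ |r x| ≤ B) {g : ℝ → ℂ}
    (hg : MemLp g 2 unitMeasure) :
    MemLp (refl p q r g) 2 (volume.restrict (Ioc (1 : ℝ) 2)) ∧
      (eLpNorm (refl p q r g) 2 (volume.restrict (Ioc (1 : ℝ) 2))).toReal
        ≤ 6 * B * (eLpNorm g 2 unitMeasure).toReal := by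
  have h1 := memLp_comp_affine (d := 2) (e := 1) one_pos (by norm_num) (fun x hx hx2 => by
    have := lt_of_le_of_ne hx.2 hx2
    constructor <;> linarith [hx.1]) hg hp fun x hx => (hB x hx).1
  have h2 := memLp_comp_affine (d := 3) (e := 2) two_pos (by norm_num) (fun x hx hx2 => by
    have := lt_of_le_of_ne hx.2 hx2
    constructor <;> linarith [hx.1]) hg hq fun x hx => (hB x hx).2.1
  have h3 := memLp_comp_affine (d := 2) (e := 2) two_pos (by norm_num) (fun x hx hx2 => by
    have := lt_of_le_of_ne hx.2 hx2
    constructor <;> linarith [hx.1]) hg hr fun x hx => (hB x hx).2.2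
  simp only [div_one] at h1
  refine ⟨(h1.1.add h2.1).add h3.1, ?_⟩
  have t1 := eLpNorm_add_le (h1.1.add h2.1).1 h3.1.1 (p := 2) (by norm_num)
  have t2 := eLpNorm_add_le h1.1.1 h2.1.1 (p := 2) (by norm_num)
  have t3 := t1.trans (add_le_add_left t2 _)
  have t4 := ENNReal.toReal_mono (by finiteness [h1.1.2.ne, h2.1.2.ne, h3.1.2.ne]) t3
  rw [ENNReal.toReal_add (by finiteness [h1.1.2.ne, h2.1.2.ne]) h3.1.2.ne,
    ENNReal.toReal_add h1.1.2.ne h2.1.2.ne] at t4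
  refine le_trans t4 ?_
  linarith [h1.2, h2.2, h3.2]

lemma memLp_glue {f g : ℝ → ℂ} (hf : MemLp f 2 unitMeasure)
    (hg : MemLp g 2 (volume.restrict (Ioc (1 : ℝ) 2))) :
    MemLp (glue f g) 2 doubleMeasure ∧ (eLpNorm (glue f g) 2 doubleMeasure).toReal
      ≤ (eLpNorm f 2 unitMeasure).toReal
        + (eLpNorm g 2 (volume.restrict (Ioc (1 : ℝ) 2))).toReal := by
  have hres : volume.restrict (Ioc (0 : ℝ) 1) = unitMeasure :=
    (restrict_Ioo_eq_restrict_Ioc).symm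
  have e0 : glue f g =ᵐ[doubleMeasure] (Ioc 0 1).indicator f + (Ioc 1 2).indicator g := by
    filter_upwards [ae_restrict_mem measurableSet_Ioc] with x hx
    by_cases h : x ≤ 1
    · have h1 : x ∈ Ioc (0 : ℝ) 1 := ⟨hx.1, h⟩
      have h2 : x ∉ Ioc (1 : ℝ) 2 := fun h' => absurd h'.1 (not_lt.2 h)
      simp [glue, h, h1, h2]
    · have h1 : x ∉ Ioc (0 : ℝ) 1 := fun h' => h h'.2
      have h2 : x ∈ Ioc (1 : ℝ) 2 := ⟨not_le.1 h, hx.2⟩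
      simp [glue, h, h1, h2]
  have r1 : doubleMeasure.restrict (Ioc 0 1) = unitMeasure := by
    rw [Measure.restrict_restrict measurableSet_Ioc, ← hres,
      inter_eq_left.2 (Ioc_subset_Ioc_right one_le_two)]
  have r2 : doubleMeasure.restrict (Ioc 1 2) = volume.restrict (Ioc (1 : ℝ) 2) := by
    rw [Measure.restrict_restrict measurableSet_Ioc,
      inter_eq_left.2 (Ioc_subset_Ioc_left zero_le_one)]
  have m1 : MemLp ((Ioc 0 1).indicator f) 2 doubleMeasure := by
    rw [memLp_indicator_iff_restrict measurableSet_Ioc, r1]; exact hf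
  have m2 : MemLp ((Ioc 1 2).indicator g) 2 doubleMeasure := by
    rw [memLp_indicator_iff_restrict measurableSet_Ioc, r2]; exact hg
  refine ⟨(m1.add m2).ae_eq e0.symm, ?_⟩
  rw [eLpNorm_congr_ae e0]
  refine (ENNReal.toReal_mono (by finiteness [m1.2.ne, m2.2.ne]) 
    (eLpNorm_add_le m1.1 m2.1 (by norm_num))).trans ?_
  rw [ENNReal.toReal_add m1.2.ne m2.2.ne, eLpNorm_indicator_eq_eLpNorm_restrict measurableSet_Ioc,
    eLpNorm_indicator_eq_eLpNorm_restrict measurableSet_Ioc, r1, r2]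

lemma ae_comp_affine {d e : ℝ} (he : 0 < e)
    (h : ∀ x ∈ Ioc (1 : ℝ) 2, x ≠ 2 → (d - x) / e ∈ Ioo (0 : ℝ) 1) {P : ℝ → Prop}
    (hP : ∀ᵐ x ∂unitMeasure, P x) : ∀ᵐ x ∂(volume.restrict (Ioc (1 : ℝ) 2)), P ((d - x) / e) :=
  ae_of_ae_map (f := fun x => (d - x) / e) (by fun_prop)
    ((Measure.absolutelyContinuous_of_le (map_affine_le he h)).ae_le
      (Measure.ae_smul_measure hP _))

lemma refl_congr (p q r : ℝ → ℝ) {f g : ℝ → ℂ} (h : f =ᵐ[unitMeasure] g) :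
    refl p q r f =ᵐ[volume.restrict (Ioc (1 : ℝ) 2)] refl p q r g := by
  have h1 := ae_comp_affine (d := 2) (e := 1) one_pos (fun x hx hx2 => by
    have := lt_of_le_of_ne hx.2 hx2
    constructor <;> linarith [hx.1]) h
  have h2 := ae_comp_affine (d := 3) (e := 2) two_pos (fun x hx hx2 => by
    have := lt_of_le_of_ne hx.2 hx2
    constructor <;> linarith [hx.1]) h
  have h3 := ae_comp_affine (d := 2) (e := 2) two_pos (fun x hx hx2 => by
    have := lt_of_le_of_ne hx.2 hx2
    constructor <;> linarith [hx.1]) h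
  filter_upwards [h1, h2, h3] with x e1 e2 e3
  rw [div_one] at e1
  rw [refl, refl, e1, e2, e3]

lemma glue_congr {f f' g g' : ℝ → ℂ} (h : f =ᵐ[unitMeasure] f')
    (h' : g =ᵐ[volume.restrict (Ioc (1 : ℝ) 2)] g') :
    glue f g =ᵐ[doubleMeasure] glue f' g' := by
  have h1 := (ae_restrict_iff' measurableSet_Ioo).1 h
  have h2 := (ae_restrict_iff' measurableSet_Ioc).1 h'
  have h3 : ∀ᵐ y : ℝ, y ≠ 1 := by simp [ae_iff, measure_singleton]
  filter_upwards [ae_restrict_of_ae h1, ae_restrict_of_ae h2, ae_restrict_of_ae h3,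
    ae_restrict_mem measurableSet_Ioc] with x e1 e2 e3 e4
  by_cases h : x ≤ 1
  · simp [glue, h, e1 ⟨e4.1, lt_of_le_of_ne h e3⟩]
  · simp [glue, h, e2 ⟨not_le.1 h, e4.2⟩]

/-! ### The extension operator, its derivatives and their Fourier coefficients -/

/-- The weight of one of the reflections in the extension operator. -/
def cut (x : ℝ) : ℝ := 4 * (1 - 3 * (x - 1) ^ 2 + 2 * (x - 1) ^ 3)

/-- The derivative of `cut`. -/
def cut₁ (x : ℝ) : ℝ := 4 * (-6 * (x - 1) + 6 * (x - 1) ^ 2)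

/-- The second derivative of `cut`. -/
def cut₂ (x : ℝ) : ℝ := 4 * (-6 + 12 * (x - 1))

lemma hasDerivAt_cut (x : ℝ) : HasDerivAt cut (cut₁ x) x := by
  have h := (((hasDerivAt_id x).sub_const 1).pow 2 |>.const_mul 3 |>.const_sub 1 |>.add
    (((hasDerivAt_id x).sub_const 1).pow 3 |>.const_mul 2)).const_mul 4
  convert! h using 1
  simp only [cut₁, id]
  push_cast
  ring

lemma hasDerivAt_cut₁ (x : ℝ) : HasDerivAt cut₁ (cut₂ x) x := by
  have h := (((hasDerivAt_id x).sub_const 1).const_mul (-6) |>.add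
    (((hasDerivAt_id x).sub_const 1).pow 2 |>.const_mul 6)).const_mul 4
  convert! h using 1
  simp only [cut₂, id]
  push_cast
  ring

lemma continuous_cut : Continuous cut := by unfold cut; fun_prop
lemma continuous_cut₁ : Continuous cut₁ := by unfold cut₁; fun_prop
lemma continuous_cut₂ : Continuous cut₂ := by unfold cut₂; fun_prop

lemma cut_bounds {x : ℝ} (hx : x ∈ Ioc (1 : ℝ) 2) :
    0 ≤ cut x ∧ cut x ≤ 4 ∧ |cut₁ x| ≤ 24 ∧ |cut₂ x| ≤ 24 := by
  obtain ⟨h1, h2⟩ := hx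
  have h3 : 0 ≤ x - 1 := by linarith
  have h4 : 0 ≤ 2 - x := by linarith
  refine ⟨?_, ?_, ?_, ?_⟩
  · have : cut x = 4 * ((2 - x) ^ 2 * (1 + 2 * (x - 1))) := by unfold cut; ring
    rw [this]; positivity
  · have : cut x = 4 - 4 * ((x - 1) ^ 2 * (3 - 2 * (x - 1))) := by unfold cut; ring
    have h5 : 0 ≤ (x - 1) ^ 2 * (3 - 2 * (x - 1)) := mul_nonneg (sq_nonneg _) (by linarith)
    linarith
  · have : cut₁ x = -(24 * ((x - 1) * (2 - x))) := by unfold cut₁; ring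
    rw [this, abs_neg, abs_of_nonneg (by positivity)]
    nlinarith
  · unfold cut₂; rw [abs_le]; constructor <;> linarith

/-- The extension of a function on `(0,1)` to `(0,2)`. -/
def ext (f : ℝ → ℂ) : ℝ → ℂ := glue f (refl (fun _ => -3) cut (fun x => 4 - cut x) f)

/-- The derivative of `ext f` in terms of `f` and `f'`. -/
def ext₁ (f f' : ℝ → ℂ) : ℝ → ℂ := glue f' fun x =>
  refl (fun _ => 3) (fun x => -cut x / 2) (fun x => -(4 - cut x) / 2) f' x
    + refl (fun _ => 0) cut₁ (fun x => -cut₁ x) f x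

/-- The second derivative of `ext f` in terms of `f`, `f'` and `f''`. -/
def ext₂ (f f' f'' : ℝ → ℂ) : ℝ → ℂ := glue f'' fun x =>
  refl (fun _ => -3) (fun x => cut x / 4) (fun x => (4 - cut x) / 4) f'' x
    + refl (fun _ => 0) (fun x => -cut₁ x) cut₁ f' x
    + refl (fun _ => 0) cut₂ (fun x => -cut₂ x) f x

lemma ext_congr {f g : ℝ → ℂ} (h : f =ᵐ[unitMeasure] g) : ext f =ᵐ[doubleMeasure] ext g :=
  glue_congr h (refl_congr _ _ _ h)

lemma toReal_eLpNorm_add_le {f g : ℝ → ℂ} {μ : Measure ℝ} (hf : MemLp f 2 μ) (hg : MemLp g 2 μ) :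
    (eLpNorm (fun x => f x + g x) 2 μ).toReal
      ≤ (eLpNorm f 2 μ).toReal + (eLpNorm g 2 μ).toReal := by
  rw [← ENNReal.toReal_add hf.2.ne hg.2.ne]
  exact ENNReal.toReal_mono (by finiteness [hf.2.ne, hg.2.ne])
    (eLpNorm_add_le hf.1 hg.1 (by norm_num))

lemma memLp_ext {f : ℝ → ℂ} (hf : MemLp f 2 unitMeasure) : MemLp (ext f) 2 doubleMeasure ∧
    (eLpNorm (ext f) 2 doubleMeasure).toReal ≤ 400 * ‖cls f‖ := by
  have h1 := memLp_refl (p := fun _ => -3) (q := cut) (r := fun x => 4 - cut x) (B := 4)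
    continuous_const continuous_cut (continuous_const.sub continuous_cut) (fun x hx => by
      have := cut_bounds hx
      refine ⟨by norm_num, ?_, ?_⟩ <;> rw [abs_le] <;> constructor <;> linarith) hf
  have h2 := memLp_glue hf h1.1
  refine ⟨h2.1, h2.2.trans ?_⟩
  rw [norm_cls hf]
  linarith [h1.2, ENNReal.toReal_nonneg (a := eLpNorm f 2 unitMeasure)]

lemma memLp_ext₁ {f f' : ℝ → ℂ} (hf : MemLp f 2 unitMeasure) (hf' : MemLp f' 2 unitMeasure) :
    MemLp (ext₁ f f') 2 doubleMeasure ∧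
      (eLpNorm (ext₁ f f') 2 doubleMeasure).toReal ≤ 400 * (‖cls f‖ + ‖cls f'‖) := by
  have h1 := memLp_refl (p := fun _ => 3) (q := fun x => -cut x / 2)
    (r := fun x => -(4 - cut x) / 2) (B := 24)
    continuous_const (continuous_cut.neg.div_const _)
    ((continuous_const.sub continuous_cut).neg.div_const _) (fun x hx => by
      have := cut_bounds hx
      refine ⟨by norm_num, ?_, ?_⟩ <;> rw [abs_le] <;> constructor <;> linarith) hf'
  have h0 := memLp_refl (p := fun _ => 0) (q := cut₁)
    (r := fun x => -cut₁ x) (B := 24)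
    continuous_const continuous_cut₁ continuous_cut₁.neg (fun x hx => by
      have := cut_bounds hx
      exact ⟨by norm_num, this.2.2.1, by rw [abs_neg]; exact this.2.2.1⟩) hf
  have h2 := memLp_glue hf' (h1.1.add h0.1)
  refine ⟨h2.1, h2.2.trans ?_⟩
  have h3 := toReal_eLpNorm_add_le h1.1 h0.1
  rw [norm_cls hf, norm_cls hf']
  simp only [Pi.add_def]
  linarith [h1.2, h0.2, ENNReal.toReal_nonneg (a := eLpNorm f 2 unitMeasure),
    ENNReal.toReal_nonneg (a := eLpNorm f' 2 unitMeasure)]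

lemma memLp_ext₂ {f f' f'' : ℝ → ℂ} (hf : MemLp f 2 unitMeasure) (hf' : MemLp f' 2 unitMeasure)
    (hf'' : MemLp f'' 2 unitMeasure) :
    MemLp (ext₂ f f' f'') 2 doubleMeasure ∧ (eLpNorm (ext₂ f f' f'') 2 doubleMeasure).toReal
      ≤ 400 * (‖cls f‖ + ‖cls f'‖ + ‖cls f''‖) := by
  have h1 := memLp_refl (p := fun _ => -3) (q := fun x => cut x / 4)
    (r := fun x => (4 - cut x) / 4) (B := 24)
    continuous_const (continuous_cut.div_const _)
    ((continuous_const.sub continuous_cut).div_const _) (fun x hx => by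
      have := cut_bounds hx
      refine ⟨by norm_num, ?_, ?_⟩ <;> rw [abs_le] <;> constructor <;> linarith) hf''
  have h0 := memLp_refl (p := fun _ => 0) (q := fun x => -cut₁ x)
    (r := cut₁) (B := 24)
    continuous_const continuous_cut₁.neg continuous_cut₁ (fun x hx => by
      have := cut_bounds hx
      exact ⟨by norm_num, by rw [abs_neg]; exact this.2.2.1, this.2.2.1⟩) hf'
  have h0' := memLp_refl (p := fun _ => 0) (q := cut₂)
    (r := fun x => -cut₂ x) (B := 24)
    continuous_const continuous_cut₂ continuous_cut₂.neg (fun x hx => by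
      have := cut_bounds hx
      exact ⟨by norm_num, this.2.2.2, by rw [abs_neg]; exact this.2.2.2⟩) hf
  have h2 := memLp_glue hf'' ((h1.1.add h0.1).add h0'.1)
  refine ⟨h2.1, h2.2.trans ?_⟩
  have h3 := toReal_eLpNorm_add_le (h1.1.add h0.1) h0'.1
  have h4 := toReal_eLpNorm_add_le h1.1 h0.1
  rw [norm_cls hf, norm_cls hf', norm_cls hf'']
  simp only [Pi.add_def] at h3 ⊢
  linarith [h1.2, h0.2, h0'.2, ENNReal.toReal_nonneg (a := eLpNorm f 2 unitMeasure),
    ENNReal.toReal_nonneg (a := eLpNorm f' 2 unitMeasure),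
    ENNReal.toReal_nonneg (a := eLpNorm f'' 2 unitMeasure)]

lemma hasDerivAt_refl {p q r p' q' r' : ℝ → ℝ} {f f' : ℝ → ℂ} (hf : ∀ x, HasDerivAt f (f' x) x)
    {x : ℝ} (hp : HasDerivAt p (p' x) x) (hq : HasDerivAt q (q' x) x) (hr : HasDerivAt r (r' x) x) :
    HasDerivAt (refl p q r f)
      (refl (fun x => -p x) (fun x => -q x / 2) (fun x => -r x / 2) f' x + refl p' q' r' f x) x := by
  have a1 : HasDerivAt (fun x : ℝ => 2 - x) (-1) x := by simpa using (hasDerivAt_id x).const_sub 2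
  have a2 : HasDerivAt (fun x : ℝ => (3 - x) / 2) (-1 / 2) x := by
    simpa using ((hasDerivAt_id x).const_sub 3).div_const 2
  have a3 : HasDerivAt (fun x : ℝ => (2 - x) / 2) (-1 / 2) x := by
    simpa using ((hasDerivAt_id x).const_sub 2).div_const 2
  have b1 := hp.ofReal_comp.mul ((hf (2 - x)).scomp x a1)
  have b2 := hq.ofReal_comp.mul ((hf ((3 - x) / 2)).scomp x a2)
  have b3 := hr.ofReal_comp.mul ((hf ((2 - x) / 2)).scomp x a3)
  convert! (b1.add b2).add b3 using 1
  simp only [refl, Function.comp_apply, Complex.real_smul]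
  push_cast
  ring

lemma continuous_refl {p q r : ℝ → ℝ} {f : ℝ → ℂ} (hp : Continuous p) (hq : Continuous q)
    (hr : Continuous r) (hf : Continuous f) : Continuous (refl p q r f) := by
  unfold refl; fun_prop

lemma continuous_glue {f g : ℝ → ℂ} (hf : Continuous f) (hg : Continuous g) (h : f 1 = g 1) :
    Continuous (glue f g) :=
  Continuous.if_le hf hg continuous_id continuous_const fun x hx => by
    change x = 1 at hx; rw [hx, h]

/-- Integration by parts over a period: continuity at 1 and equality of the end values remove the
boundary terms, so differentiation multiplies the k-th coefficient by iπk. The factor π ≥ 1 is given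
away. -/
lemma norm_fcoef_glue {f f' g g' : ℝ → ℂ} (hf : ∀ x, HasDerivAt f (f' x) x)
    (hg : ∀ x, HasDerivAt g (g' x) x) (hf' : Continuous f') (hg' : Continuous g') (h1 : f 1 = g 1)
    (h2 : f 0 = g 2) (k : ℤ) :
    |(k : ℝ)| * ‖fcoef (glue f g) k‖ ≤ ‖fcoef (glue f' g') k‖ := by
  by_cases hk : k = 0
  · simp [hk]
  have hc : Continuous (glue f g) :=
    continuous_glue (continuous_iff_continuousAt.2 fun x => (hf x).continuousAt)
      (continuous_iff_continuousAt.2 fun x => (hg x).continuousAt) h1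
  -- The right derivative at 1 is that of `g`, while `glue` takes the left piece there; this is a
  -- difference at one point.
  have hae : (fun x => if x < 1 then f' x else g' x) =ᵐ[doubleMeasure] glue f' g' := by
    have h3 : ∀ᵐ y : ℝ, y ≠ 1 := by simp [ae_iff, measure_singleton]
    filter_upwards [ae_restrict_of_ae h3] with x hx
    by_cases h : x < 1
    · simp [glue, h, h.le]
    · simp [glue, h, not_le.2 (lt_of_le_of_ne (not_lt.1 h) hx.symm)]
  have hm' : MemLp (glue f' g') 2 doubleMeasure :=
    (memLp_glue (memLp_of_continuous hf') (by
      obtain ⟨B, hB⟩ := isCompact_Icc.exists_bound_of_continuousOn (s := Icc (1 : ℝ) 2)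
        hg'.continuousOn
      refine MemLp.of_bound hg'.aestronglyMeasurable B ?_
      filter_upwards [ae_restrict_mem measurableSet_Ioc] with x hx
      exact hB x (Ioc_subset_Icc_self hx))).1
  have key := fourierCoeffOn_of_hasDeriv_right (two_pos : (0 : ℝ) < 2) hk hc.continuousOn
    (f' := fun x => if x < 1 then f' x else g' x) (fun x _ => by
      rcases lt_or_ge x 1 with hx | hx
      · rw [if_pos hx]
        refine ((hf x).congr_of_eventuallyEq ?_).hasDerivWithinAt
        filter_upwards [Iio_mem_nhds hx] with y hy
        exact if_pos (le_of_lt hy)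
      · have e2 : glue f g x = g x := by
          rcases eq_or_lt_of_le hx with rfl | hx
          · simp [glue, h1]
          · exact if_neg (not_le.2 hx)
        rw [if_neg (not_lt.2 hx)]
        exact (hg x).hasDerivWithinAt.congr
          (fun y hy => if_neg (not_le.2 (lt_of_le_of_lt hx hy))) e2)
    (by
      rw [intervalIntegrable_iff_integrableOn_Ioc_of_le zero_le_two]
      exact (hm'.integrable (by norm_num)).congr hae.symm)
  rw [fourierCoeffOn_congr_ae _ hae] at key
  have e0 : glue f g 0 = f 0 := if_pos zero_le_one
  have e2 : glue f g 2 = g 2 := if_neg (by norm_num)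
  rw [e0, e2, h2, sub_self, mul_zero, zero_sub] at key
  change fcoef (glue f g) k = _ * -(_ * fcoef (glue f' g') k) at key
  have hpi := Real.pi_pos
  have hk' : 0 < |(k : ℝ)| := abs_pos.2 (Int.cast_ne_zero.2 hk)
  rw [key]
  simp only [norm_mul, norm_neg, norm_div, norm_one, Complex.norm_I, Complex.norm_real,
    Complex.norm_intCast, Complex.norm_ofNat, Real.norm_eq_abs, abs_of_pos hpi]
  norm_num
  rw [show |(k : ℝ)| * (|(k : ℝ)|⁻¹ * (Real.pi⁻¹ * (1 / 2)) * (2 * ‖fcoef (glue f' g') k‖))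
    = (|(k : ℝ)| * |(k : ℝ)|⁻¹) * (Real.pi⁻¹ * ‖fcoef (glue f' g') k‖) by ring,
    mul_inv_cancel₀ hk'.ne', one_mul]
  refine mul_le_of_le_one_left (norm_nonneg _) (inv_le_one_of_one_le₀ ?_)
  linarith [Real.pi_gt_three]

lemma norm_fcoef_ext₁ {f f' : ℝ → ℂ} (hf : ∀ x, HasDerivAt f (f' x) x) (hf' : Continuous f')
    (k : ℤ) : |(k : ℝ)| * ‖fcoef (ext f) k‖ ≤ ‖fcoef (ext₁ f f') k‖ := by
  have hfc : Continuous f := continuous_iff_continuousAt.2 fun x => (hf x).continuousAt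
  have hd (x : ℝ) := hasDerivAt_refl (p := fun _ => -3) (q := cut) (r := fun x => 4 - cut x)
    (p' := fun _ => 0) (q' := cut₁) (r' := fun x => -cut₁ x) hf (x := x) (hasDerivAt_const _ _)
    (hasDerivAt_cut x) ((hasDerivAt_cut x).const_sub 4)
  simp only [neg_neg] at hd
  refine norm_fcoef_glue hf hd hf' ?_ ?_ ?_ k
  · exact (continuous_refl continuous_const (continuous_cut.neg.div_const _)
      ((continuous_const.sub continuous_cut).neg.div_const _) hf').add
      (continuous_refl continuous_const continuous_cut₁ continuous_cut₁.neg hfc)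
  -- `cut` falls from 4 at x = 1 to 0 at x = 2, so the reflected piece takes the values −3f(1) +
  -- 4f(1) and −3f(0) + 4f(0) at the joints.
  · norm_num [refl, cut]; ring
  · norm_num [refl, cut]; ring

lemma norm_fcoef_ext₂ {f f' f'' : ℝ → ℂ} (hf : ∀ x, HasDerivAt f (f' x) x)
    (hf' : ∀ x, HasDerivAt f' (f'' x) x) (hf'' : Continuous f'')
    (k : ℤ) : |(k : ℝ)| * ‖fcoef (ext₁ f f') k‖ ≤ ‖fcoef (ext₂ f f' f'') k‖ := by
  have hfc : Continuous f := continuous_iff_continuousAt.2 fun x => (hf x).continuousAt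
  have hfc' : Continuous f' := continuous_iff_continuousAt.2 fun x => (hf' x).continuousAt
  have hd1 (x : ℝ) := hasDerivAt_refl (p := fun _ => 3) (q := fun x => -cut x / 2)
    (r := fun x => -(4 - cut x) / 2)
    (p' := fun _ => 0) (q' := fun x => -cut₁ x / 2) (r' := fun x => -(-cut₁ x) / 2) hf' (x := x)
    (hasDerivAt_const _ _) ((hasDerivAt_cut x).neg.div_const 2)
    (((hasDerivAt_cut x).const_sub 4).neg.div_const 2)
  have hd2 (x : ℝ) := hasDerivAt_refl (p := fun _ => 0) (q := cut₁)
    (r := fun x => -cut₁ x)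
    (p' := fun _ => 0) (q' := cut₂) (r' := fun x => -cut₂ x) hf (x := x)
    (hasDerivAt_const _ _) (hasDerivAt_cut₁ x) (hasDerivAt_cut₁ x).neg
  refine norm_fcoef_glue (g' := fun x =>
    refl (fun _ => -3) (fun x => cut x / 4) (fun x => (4 - cut x) / 4) f'' x
    + refl (fun _ => 0) (fun x => -cut₁ x) cut₁ f' x
    + refl (fun _ => 0) cut₂ (fun x => -cut₂ x) f x) hf' (fun x => ?_) hf'' ?_ ?_ ?_ k
  · convert! (hd1 x).add (hd2 x) using 1
    simp only [refl]
    push_cast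
    ring
  · exact ((continuous_refl continuous_const (continuous_cut.div_const _)
      ((continuous_const.sub continuous_cut).div_const _) hf'').add
      (continuous_refl continuous_const continuous_cut₁.neg continuous_cut₁ hfc')).add
      (continuous_refl continuous_const continuous_cut₂ continuous_cut₂.neg hfc)
  -- First derivatives also match: they are 3f'(1) − 2f'(1) and 3f'(0) − 2f'(0), because `cut₁`
  -- vanishes at both joints. The halved arguments exist for this purpose.
  · norm_num [refl, cut, cut₁]; ring
  · norm_num [refl, cut, cut₁]; ring

lemma sum_sq_fcoef_le {f : ℝ → ℂ} {M : ℝ} (hf : MemLp f 2 doubleMeasure)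
    (h : (eLpNorm f 2 doubleMeasure).toReal ≤ M) (S : Finset ℤ) :
    ∑ k ∈ S, ‖fcoef f k‖ ^ 2 ≤ M ^ 2 / 2 := by
  refine (sum_le_hasSum S (fun _ _ => by positivity) (hasSum_sq_fcoef hf)).trans ?_
  gcongr

lemma norm_fcoef_le {f : ℝ → ℂ} {M : ℝ} (hf : MemLp f 2 doubleMeasure)
    (h : (eLpNorm f 2 doubleMeasure).toReal ≤ M) (k : ℤ) : ‖fcoef f k‖ ≤ M := by
  have h1 := sum_sq_fcoef_le hf h {k}
  have h2 : 0 ≤ M := ENNReal.toReal_nonneg.trans h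
  rw [Finset.sum_singleton] at h1
  refine le_of_sq_le_sq ?_ h2
  nlinarith [sq_nonneg M]

lemma ext_add (f g : ℝ → ℂ) : ext (fun x => f x + g x) = fun x => ext f x + ext g x := by
  ext x
  by_cases h : x ≤ 1
  · simp [ext, glue, h]
  · simp only [ext, glue, h, if_false, refl]; ring

lemma ext_const_mul (c : ℂ) (f : ℝ → ℂ) : ext (fun x => c * f x) = fun x => c * ext f x := by
  ext x
  by_cases h : x ≤ 1
  · simp [ext, glue, h]
  · simp only [ext, glue, h, if_false, refl]; ring

/-! ### Coefficients of functions on (0,1) and their weighted bounds -/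

/-- The Fourier coefficients of the extension of a function on `(0,1)`. -/
def aCoef (k : ℤ) : L2 →L[ℂ] ℂ :=
  LinearMap.mkContinuous
    { toFun := fun u => fcoef (ext u) k
      map_add' := fun u v => by
        rw [← fcoef_add (memLp_ext (Lp.memLp u)).1 (memLp_ext (Lp.memLp v)).1, ← ext_add]
        exact fcoef_congr (ext_congr (Lp.coeFn_add u v)) k
      map_smul' := fun c u => by
        rw [RingHom.id_apply, smul_eq_mul, ← fcoef_const_mul, ← ext_const_mul]
        exact fcoef_congr (ext_congr (Lp.coeFn_smul c u)) k }
    400 fun u => by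
      have h := memLp_ext (Lp.memLp u)
      rw [cls_coe] at h
      exact norm_fcoef_le h.1 h.2 k

lemma aCoef_apply (k : ℤ) (u : L2) : aCoef k u = fcoef (ext u) k := rfl

lemma aCoef_cls {f : ℝ → ℂ} (hf : MemLp f 2 unitMeasure) (k : ℤ) :
    aCoef k (cls f) = fcoef (ext f) k :=
  fcoef_congr (ext_congr (cls_ae hf)) k

lemma sum_sq_aCoef_le (u : L2) (S : Finset ℤ) : ∑ k ∈ S, ‖aCoef k u‖ ^ 2 ≤ (400 * ‖u‖) ^ 2 := by
  have h := memLp_ext (Lp.memLp u)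
  rw [cls_coe] at h
  refine (sum_sq_fcoef_le h.1 h.2 S).trans ?_
  have := sq_nonneg (400 * ‖u‖)
  linarith

/-- Fourier expansion of a function on `(0,1)`, by way of its extension. -/
lemma hasSum_aCoef (u : L2) : HasSum (fun k => aCoef k u • expL2 k) u := by
  have hm := (memLp_ext (Lp.memLp u)).1
  have hs := hasSum_sq_fcoef hm
  set T := (eLpNorm (ext u) 2 doubleMeasure).toReal ^ 2 / 2
  -- Up to sign, the coefficients of the partial sum minus `ext u` are those of `ext u` outside `S`.
  -- Parseval on (0,2) then controls the difference, and on (0,1) the extension is u itself.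
  have key (S : Finset ℤ) : ‖∑ k ∈ S, aCoef k u • expL2 k - u‖ ^ 2
      ≤ 2 * (T - ∑ k ∈ S, ‖aCoef k u‖ ^ 2) := by
    let p : ℝ → ℂ := fun x => ∑ k ∈ S, aCoef k u * expPi k x
    have hpc : Continuous p :=
      continuous_finsetSum _ fun k _ => (continuous_expPi k).const_mul _
    have hp := memLp_double_of_continuous hpc
    have hn : MemLp (fun x => (-1 : ℂ) * ext u x) 2 doubleMeasure := hm.const_mul _
    have hm2 : MemLp (fun x => p x + (-1) * ext u x) 2 doubleMeasure := hp.add hn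
    have h1 := hasSum_sq_fcoef hm2
    have h2 : ∀ k, fcoef (fun x => p x + (-1) * ext u x) k
        = (if k ∈ S then aCoef k u else 0) - aCoef k u := fun k => by
      rw [fcoef_add hp hn, fcoef_const_mul, fcoef_sum, aCoef_apply]; ring
    simp only [h2] at h1
    have h3 : HasSum (fun k => ‖(if k ∈ S then aCoef k u else 0) - aCoef k u‖ ^ 2)
        (T - ∑ k ∈ S, ‖aCoef k u‖ ^ 2) := by
      have h4 := hasSum_sum_of_ne_finset_zero (s := S)
        (f := fun k => if k ∈ S then ‖aCoef k u‖ ^ 2 else 0)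
        (L := SummationFilter.unconditional ℤ) (fun k hk => by simp [hk])
      rw [Finset.sum_congr rfl fun k hk => by rw [if_pos hk]] at h4
      convert! hs.sub h4 using 1
      ext k
      rw [← aCoef_apply]
      split_ifs <;> simp
    rw [← h1.unique h3]
    have h5 : ∑ k ∈ S, aCoef k u • expL2 k - u = cls (fun x => p x + (-1) * ext u x) := by
      have hpu : MemLp p 2 unitMeasure := memLp_of_continuous hpc
      have hnu : MemLp ((-1 : ℂ) • (u : ℝ → ℂ)) 2 unitMeasure := (Lp.memLp u).const_smul _
      have e2 : (fun x => p x + (-1) * ext u x) =ᵐ[unitMeasure] p + (-1 : ℂ) • (u : ℝ → ℂ) := by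
        filter_upwards [ae_restrict_mem measurableSet_Ioo] with x hx
        simp [ext, glue, hx.2.le]
      rw [cls_congr e2, cls_add hpu hnu, cls_smul _ (Lp.memLp u), cls_coe, ← cls_sum]
      simp [sub_eq_add_neg, p]
    rw [h5]
    have h6 := pow_le_pow_left₀ (norm_nonneg _) (norm_cls_le_double hm2) 2
    linarith
  rw [HasSum, tendsto_iff_norm_sub_tendsto_zero]
  have h0 : Tendsto (fun S : Finset ℤ => √(2 * (T - ∑ k ∈ S, ‖aCoef k u‖ ^ 2))) atTop (𝓝 0) := by
    have h1 := (hs.const_sub T).const_mul 2 |>.sqrt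
    simpa [aCoef_apply] using h1
  refine squeeze_zero (fun _ => norm_nonneg _) (fun S => ?_) h0
  exact Real.le_sqrt_of_sq_le (key S)

/-- The weights that measure smoothness. -/
def wt (k : ℤ) : ℝ := 1 + |(k : ℝ)|

lemma one_le_wt (k : ℤ) : 1 ≤ wt k := by unfold wt; linarith [abs_nonneg (k : ℝ)]

lemma wt_pos (k : ℤ) : 0 < wt k := one_pos.trans_le (one_le_wt k)

lemma sum_wt_sq_le {x y : ℤ → ℝ} (S : Finset ℤ) {M N : ℝ} (hx0 : ∀ k, 0 ≤ x k) 
    (hxy : ∀ k : ℤ, |(k : ℝ)| * x k ≤ y k)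
    (hx : ∑ k ∈ S, x k ^ 2 ≤ M ^ 2 / 2) (hy : ∑ k ∈ S, y k ^ 2 ≤ N ^ 2 / 2) :
    ∑ k ∈ S, (wt k * x k) ^ 2 ≤ M ^ 2 + N ^ 2 := by
  have : ∀ k ∈ S, (wt k * x k) ^ 2 ≤ 2 * x k ^ 2 + 2 * y k ^ 2 := fun k _ => by
    have h1 : wt k * x k ≤ x k + y k := by unfold wt; linarith [hxy k]
    have h2 : 0 ≤ wt k * x k := mul_nonneg (wt_pos k).le (hx0 k)
    have h3 := pow_le_pow_left₀ h2 h1 2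
    nlinarith [sq_nonneg (x k - y k)]
  refine (Finset.sum_le_sum this).trans ?_
  rw [Finset.sum_add_distrib, ← Finset.mul_sum, ← Finset.mul_sum]
  linarith

lemma sum_wt_aCoef_of_continuous {f f' : ℝ → ℂ} (hf : ∀ x, HasDerivAt f (f' x) x)
    (hf' : Continuous f') (S : Finset ℤ) :
    ∑ k ∈ S, (wt k * ‖aCoef k (cls f)‖) ^ 2 ≤ (2000 * (‖cls f‖ + ‖cls f'‖)) ^ 2 := by
  have hfc : Continuous f := continuous_iff_continuousAt.2 fun x => (hf x).continuousAt
  have m := memLp_of_continuous hfc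
  have m' := memLp_of_continuous hf'
  have h1 := sum_sq_fcoef_le (memLp_ext m).1 (memLp_ext m).2 S
  have h2 := sum_sq_fcoef_le (memLp_ext₁ m m').1 (memLp_ext₁ m m').2 S
  simp only [aCoef_cls m]
  refine (sum_wt_sq_le S (fun _ => norm_nonneg _) (norm_fcoef_ext₁ hf hf') h1 h2).trans ?_
  nlinarith [norm_nonneg (cls f), norm_nonneg (cls f'), mul_nonneg (norm_nonneg (cls f))
    (norm_nonneg (cls f'))]

lemma sum_wt_sq_aCoef_of_continuous {f f' f'' : ℝ → ℂ} (hf : ∀ x, HasDerivAt f (f' x) x)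
    (hf' : ∀ x, HasDerivAt f' (f'' x) x) (hf'' : Continuous f'') (S : Finset ℤ) :
    ∑ k ∈ S, (wt k ^ 2 * ‖aCoef k (cls f)‖) ^ 2
      ≤ (2000 * (‖cls f‖ + ‖cls f'‖ + ‖cls f''‖)) ^ 2 := by
  have hfc : Continuous f := continuous_iff_continuousAt.2 fun x => (hf x).continuousAt
  have hfc' : Continuous f' := continuous_iff_continuousAt.2 fun x => (hf' x).continuousAt
  have m := memLp_of_continuous hfc
  have m' := memLp_of_continuous hfc'
  have m'' := memLp_of_continuous hf''
  have h1 := sum_sq_fcoef_le (memLp_ext m).1 (memLp_ext m).2 S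
  have h3 := sum_sq_fcoef_le (memLp_ext₂ m m' m'').1 (memLp_ext₂ m m' m'').2 S
  simp only [aCoef_cls m]
  have key : ∀ k ∈ S, (wt k ^ 2 * ‖fcoef (ext f) k‖) ^ 2
      ≤ 8 * ‖fcoef (ext f) k‖ ^ 2 + 8 * ‖fcoef (ext₂ f f' f'') k‖ ^ 2 := fun k _ => by
    have e1 := norm_fcoef_ext₁ hf hfc' k
    have e2 := norm_fcoef_ext₂ hf hf' hf'' k
    have e3 := (mul_le_mul_of_nonneg_left e1 (abs_nonneg (k : ℝ))).trans e2
    have e4 : wt k ^ 2 ≤ 2 + 2 * |(k : ℝ)| ^ 2 := by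
      unfold wt; nlinarith [sq_nonneg (1 - |(k : ℝ)|)]
    have e5 : wt k ^ 2 * ‖fcoef (ext f) k‖
        ≤ 2 * ‖fcoef (ext f) k‖ + 2 * ‖fcoef (ext₂ f f' f'') k‖ := by
      have := mul_le_mul_of_nonneg_right e4 (norm_nonneg (fcoef (ext f) k))
      nlinarith
    have e6 := pow_le_pow_left₀ (by positivity) e5 2
    nlinarith [sq_nonneg (‖fcoef (ext f) k‖ - ‖fcoef (ext₂ f f' f'') k‖)]
  refine (Finset.sum_le_sum key).trans ?_
  rw [Finset.sum_add_distrib, ← Finset.mul_sum, ← Finset.mul_sum]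
  have n1 := norm_nonneg (cls f)
  have n2 := norm_nonneg (cls f')
  have n3 := norm_nonneg (cls f'')
  have : ‖cls f‖ ^ 2 ≤ (‖cls f‖ + ‖cls f'‖ + ‖cls f''‖) ^ 2 :=
    pow_le_pow_left₀ n1 (by linarith) 2
  nlinarith

lemma cls_const_add_prim {c : ℂ} {g : ℝ → ℂ} (hg : Continuous g) :
    cls (fun x => c + prim g x) = cls (fun _ => c) + primCLM (cls g) := by
  rw [primCLM_cls (memLp_of_continuous hg)]
  exact cls_add (memLp_const c) (memLp_prim (memLp_of_continuous hg))

/-- Write u = c + ∫₀ v and approximate v by continuous functions with c fixed. For a finite set of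
indices both sides of the classical estimate pass to the limit. -/
lemma sum_wt_aCoef_le {u v : L2} (h : IsWeakDeriv u v) (S : Finset ℤ) :
    ∑ k ∈ S, (wt k * ‖aCoef k u‖) ^ 2 ≤ (2000 * (‖u‖ + ‖v‖)) ^ 2 := by
  obtain ⟨c, hc, -⟩ := h.exists_eq_const_add_prim
  obtain ⟨g, hg, ht⟩ := exists_continuous_tendsto v
  have hu : Tendsto (fun n => cls (fun x => c + prim (g n) x)) atTop (𝓝 u) := by
    simp only [fun n => cls_const_add_prim (c := c) (hg n)]
    rw [hc]
    exact ((primCLM.continuous.tendsto v).comp ht).const_add _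
  have key (n : ℕ) := sum_wt_aCoef_of_continuous
    (f := fun x => c + prim (g n) x) (fun x => (hasDerivAt_prim (hg n) x).const_add c) (hg n) S
  refine le_of_tendsto_of_tendsto' (b := atTop) (tendsto_finsetSum _ fun k _ => ?_) ?_ key
  · exact (((((aCoef k).continuous.tendsto u).comp hu).norm).const_mul _).pow 2
  · exact ((hu.norm.add ht.norm).const_mul _).pow 2

/-- The same density argument with two nested primitives and both constants fixed. -/
lemma sum_wt_sq_aCoef_le {u v w : L2} (h : IsWeakDeriv u v) (h' : IsWeakDeriv v w)
    (S : Finset ℤ) :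
    ∑ k ∈ S, (wt k ^ 2 * ‖aCoef k u‖) ^ 2 ≤ (2000 * (‖u‖ + ‖v‖ + ‖w‖)) ^ 2 := by
  obtain ⟨c, hc, -⟩ := h.exists_eq_const_add_prim
  obtain ⟨c', hc', -⟩ := h'.exists_eq_const_add_prim
  obtain ⟨g, hg, ht⟩ := exists_continuous_tendsto w
  have hp (n : ℕ) : Continuous fun x => c' + prim (g n) x := 
    continuous_iff_continuousAt.2 fun x => ((hasDerivAt_prim (hg n) x).const_add c').continuousAt
  have hv : Tendsto (fun n => cls (fun x => c' + prim (g n) x)) atTop (𝓝 v) := by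
    simp only [fun n => cls_const_add_prim (c := c') (hg n)]
    rw [hc']
    exact ((primCLM.continuous.tendsto w).comp ht).const_add _
  have hu : Tendsto (fun n => cls (fun x => c + prim (fun x => c' + prim (g n) x) x))
      atTop (𝓝 u) := by
    simp only [fun n => cls_const_add_prim (c := c) (hp n)]
    rw [hc]
    exact ((primCLM.continuous.tendsto v).comp hv).const_add _
  have key (n : ℕ) := sum_wt_sq_aCoef_of_continuous
    (f := fun x => c + prim (fun x => c' + prim (g n) x) x)
    (fun x => (hasDerivAt_prim (hp n) x).const_add c)
    (fun x => (hasDerivAt_prim (hg n) x).const_add c') (hg n) S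
  refine le_of_tendsto_of_tendsto' (b := atTop) (tendsto_finsetSum _ fun k _ => ?_) ?_ key
  · exact (((((aCoef k).continuous.tendsto u).comp hu).norm).const_mul _).pow 2
  · exact (((hu.norm.add hv.norm).add ht.norm).const_mul _).pow 2

/-! ### Bessel families and sums with coefficients -/

section Bessel

variable {X : Type*} [NormedAddCommGroup X] [NormedSpace ℂ X]

/-- The finite sums `∑ c_k x_k` are bounded by `C (∑ (r_k |c_k|)^2)^(1/2)`. -/
def IsBessel (x : ℤ → X) (r : ℤ → ℝ) (C : ℝ) : Prop :=
  ∀ (S : Finset ℤ) (c : ℤ → ℂ), ‖∑ k ∈ S, c k • x k‖ ≤ C * √(∑ k ∈ S, (r k * ‖c k‖) ^ 2)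

lemma IsBessel.summable [CompleteSpace X] {x : ℤ → X} {r : ℤ → ℝ} {C : ℝ} (h : IsBessel x r C)
    {c : ℤ → ℂ} (hc : Summable fun k => (r k * ‖c k‖) ^ 2) : Summable fun k => c k • x k := by
  rw [summable_iff_vanishing_norm]
  intro ε hε
  obtain ⟨S, hS⟩ := summable_iff_vanishing_norm.1 hc ((ε / (|C| + 1)) ^ 2) (by positivity)
  refine ⟨S, fun T hT => (h T c).trans_lt ?_⟩
  have h1 := hS T hT
  rw [Real.norm_of_nonneg (Finset.sum_nonneg fun _ _ => sq_nonneg _)] at h1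
  have h2 : √(∑ k ∈ T, (r k * ‖c k‖) ^ 2) < ε / (|C| + 1) := (Real.sqrt_lt' (by positivity)).2 h1
  calc C * √(∑ k ∈ T, (r k * ‖c k‖) ^ 2) ≤ |C| * √(∑ k ∈ T, (r k * ‖c k‖) ^ 2) := by
        gcongr; exact le_abs_self C
    _ ≤ |C| * (ε / (|C| + 1)) := by gcongr
    _ < (|C| + 1) * (ε / (|C| + 1)) := by gcongr; linarith
    _ = ε := by field_simp

lemma IsBessel.norm_tsum_le [CompleteSpace X] {x : ℤ → X} {r : ℤ → ℝ} {C : ℝ} (h : IsBessel x r C)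
    {c : ℤ → ℂ} (hc : Summable fun k => (r k * ‖c k‖) ^ 2) :
    ‖∑' k, c k • x k‖ ≤ C * √(∑' k, (r k * ‖c k‖) ^ 2) :=
  le_of_tendsto_of_tendsto' (h.summable hc).hasSum.norm
    (hc.hasSum.sqrt.const_mul C) fun S => h S c

/-- Multipliers of modulus at most one do not increase the tails, so convergence is uniform in the
parameter. This yields continuity and holomorphy of the strip functions constructed from series. -/
lemma IsBessel.tendstoUniformlyOn [CompleteSpace X] {x : ℤ → X} {r : ℤ → ℝ} {C : ℝ} (hC : 0 ≤ C)
    (h : IsBessel x r C) {c : ℤ → ℂ} (hc : Summable fun k => (r k * ‖c k‖) ^ 2) {T : Type*}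
    {U : Set T} {w : T → ℤ → ℂ} (hw : ∀ t ∈ U, ∀ k, ‖w t k‖ ≤ 1) :
    TendstoUniformlyOn (fun (S : Finset ℤ) t => ∑ k ∈ S, (w t k * c k) • x k)
      (fun t => ∑' k, (w t k * c k) • x k) atTop U := by
  have hle : ∀ t ∈ U, ∀ k, (r k * ‖w t k * c k‖) ^ 2 ≤ (r k * ‖c k‖) ^ 2 := fun t ht k => by
    rw [norm_mul, mul_pow, mul_pow (r k)]
    have := mul_le_of_le_one_left (norm_nonneg (c k)) (hw t ht k)
    exact mul_le_mul_of_nonneg_left (pow_le_pow_left₀ (by positivity) this 2) (sq_nonneg _)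
  rw [Metric.tendstoUniformlyOn_iff]
  intro ε hε
  have h0 := tendsto_tsum_compl_atTop_zero fun k => (r k * ‖c k‖) ^ 2
  have h1 := (h0.sqrt.const_mul C)
  rw [Real.sqrt_zero, mul_zero] at h1
  filter_upwards [h1.eventually (gt_mem_nhds hε)] with S hS t ht
  classical
  have hs : Summable fun k => (r k * ‖w t k * c k‖) ^ 2 :=
    hc.of_nonneg_of_le (fun _ => sq_nonneg _) (hle t ht)
  let d : ℤ → ℂ := fun k => if k ∈ S then 0 else w t k * c k
  have hds : Summable fun k => (r k * ‖d k‖) ^ 2 := by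
    refine hs.of_nonneg_of_le (fun _ => sq_nonneg _) fun k => ?_
    by_cases hk : k ∈ S
    · simp [d, hk, mul_pow]
      positivity
    · simp [d, hk]
  have e1 : ∑' k, (w t k * c k) • x k - ∑ k ∈ S, (w t k * c k) • x k = ∑' k, d k • x k := by
    have h2 := hasSum_sum_of_ne_finset_zero (s := S)
      (f := fun k => if k ∈ S then (w t k * c k) • x k else 0)
      (L := SummationFilter.unconditional ℤ) (fun k hk => by simp [hk])
    rw [Finset.sum_congr rfl fun k hk => by rw [if_pos hk]] at h2
    rw [← ((h.summable hs).hasSum.sub h2).tsum_eq]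
    refine tsum_congr fun k => ?_
    by_cases hk : k ∈ S <;> simp [d, hk]
  rw [dist_eq_norm, e1]
  refine lt_of_le_of_lt (h.norm_tsum_le hds) (lt_of_le_of_lt ?_ hS)
  gcongr
  rw [← tsum_subtype_eq_of_support_subset (s := {k | k ∉ S})]
  · refine Summable.tsum_le_tsum (fun k => ?_) (hds.subtype _) (hc.subtype _)
    have hk : (k : ℤ) ∉ S := k.2
    simp only [d, hk, if_false]
    exact hle t ht k
  · intro k hk
    by_contra h'
    have : k ∈ S := not_not.1 h'
    simp [d, this] at hk

end Bessel

lemma isBessel_expL2 : IsBessel expL2 (fun _ => 1) 2 := by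
  intro S c
  refine le_of_sq_le_sq ((norm_sum_expL2_sq_le S c).trans ?_) (by positivity)
  rw [mul_pow, Real.sq_sqrt (Finset.sum_nonneg fun _ _ => sq_nonneg _)]
  simp only [one_mul]
  gcongr
  norm_num

/-! ### `W_2^2(0,1)` -/

lemma isWeakDeriv_cls {f f' : ℝ → ℂ} (hf : ∀ x, HasDerivAt f (f' x) x) (hf' : Continuous f') :
    IsWeakDeriv (cls f) (cls f') := by
  have hfc : Continuous f := continuous_iff_continuousAt.2 fun x => (hf x).continuousAt
  refine isWeakDeriv_iff.2 fun φ h1 h2 h3 => ?_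
  have hm := ofReal_mem_testFun h1 h2 h3
  have hm' := testFun.deriv_mem hm
  rw [← deriv_ofReal_comp (h1.differentiable (by simp)), pair_cls (memLp_of_continuous hfc)
    (testFun.memLp hm'), pair_cls (memLp_of_continuous hf') (testFun.memLp hm),
    ← integral_Ioc_eq_integral_Ioo, ← integral_Ioc_eq_integral_Ioo,
    ← intervalIntegral.integral_of_le zero_le_one, ← intervalIntegral.integral_of_le zero_le_one,
    intervalIntegral.integral_mul_deriv_eq_deriv_mul (fun x _ => hf x)
      (fun x _ => testFun.hasDerivAt hm x) (hf'.intervalIntegrable _ _)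
      ((testFun.continuous hm').intervalIntegrable _ _),
    testFun.eq_zero hm (x := 1) (by simp), testFun.eq_zero hm (x := 0) (by simp)]
  simp

lemma isWeakDeriv_expL2 (k : ℤ) : IsWeakDeriv (expL2 k) ((Real.pi * Complex.I * k : ℂ) • expL2 k) := by
  rw [expL2, ← cls_smul _ (memLp_of_continuous (continuous_expPi k))]
  exact isWeakDeriv_cls (hasDerivAt_expPi k) ((continuous_expPi k).const_smul _)

/-- Each test function imposes a closed condition. Closedness makes `W22` complete, so that series
can be summed in it. -/
lemma isClosed_setOf_isWeakDeriv (i j : Fin 3) :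
    IsClosed {u : PiLp 2 (fun _ : Fin 3 => L2) | IsWeakDeriv (u i) (u j)} := by
  simp only [isWeakDeriv_iff, ofPred_forall]
  refine isClosed_iInter fun φ => isClosed_iInter fun h1 => isClosed_iInter fun h2 =>
    isClosed_iInter fun h3 => ?_
  refine isClosed_eq ?_ ?_
  · simp only [fun u : PiLp 2 (fun _ : Fin 3 => L2) => pair_comm (u i)]
    simp only [← pairCLM_apply]
    exact (pairCLM _).continuous.comp (PiLp.continuous_apply 2 _ i)
  · simp only [fun u : PiLp 2 (fun _ : Fin 3 => L2) => pair_comm (u j)]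
    simp only [← pairCLM_apply]
    exact ((pairCLM _).continuous.comp (PiLp.continuous_apply 2 _ j)).neg

instance : CompleteSpace W22 := by
  refine IsClosed.completeSpace_coe (hs := ?_)
  exact (isClosed_setOf_isWeakDeriv 0 1).inter (isClosed_setOf_isWeakDeriv 1 2)

/-- `expPi k` as an element of `W_2^2(0,1)`. -/
def expW (k : ℤ) : W22 :=
  ⟨WithLp.toLp 2 ![expL2 k, (Real.pi * Complex.I * k : ℂ) • expL2 k,
    (Real.pi * Complex.I * k : ℂ) • (Real.pi * Complex.I * k : ℂ) • expL2 k],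
    ⟨isWeakDeriv_expL2 k, (isWeakDeriv_expL2 k).smul _⟩⟩

lemma toL2_expW (k : ℤ) : W22.toL2 (expW k) = expL2 k := rfl

lemma norm_sq_W22 (u : W22) : ‖u‖ ^ 2 = ‖u.1 0‖ ^ 2 + ‖u.1 1‖ ^ 2 + ‖u.1 2‖ ^ 2 := by
  change ‖u.1‖ ^ 2 = _
  rw [PiLp.norm_sq_eq_of_L2, Fin.sum_univ_three]

lemma isBessel_expW : IsBessel expW (fun k => wt k ^ 2) 25 := by
  intro S c
  refine le_of_sq_le_sq ?_ (by positivity)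
  rw [mul_pow, Real.sq_sqrt (Finset.sum_nonneg fun _ _ => sq_nonneg _), norm_sq_W22]
  have e (i : Fin 3) : (∑ k ∈ S, c k • expW k : W22).1 i = ∑ k ∈ S, c k • (expW k).1 i := by
    rw [Submodule.coe_sum, WithLp.ofLp_sum, Finset.sum_apply]
    rfl
  rw [e 0, e 1, e 2]
  have e0 : ∑ k ∈ S, c k • (expW k).1 0 = ∑ k ∈ S, c k • expL2 k := rfl
  have e1 : ∑ k ∈ S, c k • (expW k).1 1 = ∑ k ∈ S, (c k * (Real.pi * Complex.I * k)) • expL2 k :=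
    Finset.sum_congr rfl fun k _ => smul_smul _ _ _
  have e2 : ∑ k ∈ S, c k • (expW k).1 2
      = ∑ k ∈ S, (c k * ((Real.pi * Complex.I * k) * (Real.pi * Complex.I * k))) • expL2 k :=
    Finset.sum_congr rfl fun k _ => by
      change c k • _ • _ • _ = _
      rw [smul_smul, smul_smul, mul_assoc]
  rw [e0, e1, e2]
  have b0 := norm_sum_expL2_sq_le S c
  have b1 := norm_sum_expL2_sq_le S fun k => c k * (Real.pi * Complex.I * k)
  have b2 := norm_sum_expL2_sq_le S fun k =>
    c k * ((Real.pi * Complex.I * k) * (Real.pi * Complex.I * k))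
  refine (add_le_add (add_le_add b0 b1) b2).trans ?_
  rw [← mul_add, ← mul_add, ← Finset.sum_add_distrib, ← Finset.sum_add_distrib, Finset.mul_sum,
    Finset.mul_sum]
  refine Finset.sum_le_sum fun k _ => ?_
  have hpi := Real.pi_pos
  have hpi4 := Real.pi_le_four
  simp only [norm_mul, Complex.norm_I, Complex.norm_real, Complex.norm_intCast, Real.norm_eq_abs,
    abs_of_pos hpi, mul_one]
  have hk : |(k : ℝ)| ≤ wt k := by unfold wt; linarith
  have hw := one_le_wt k
  have h4 : Real.pi * |(k : ℝ)| ≤ 4 * wt k := mul_le_mul hpi4 hk (abs_nonneg _) (by norm_num)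
  have h5 : (Real.pi * |(k : ℝ)|) ^ 2 ≤ 16 * wt k ^ 4 := by
    refine (pow_le_pow_left₀ (by positivity) h4 2).trans ?_
    have := pow_le_pow_right₀ hw (show 2 ≤ 4 by norm_num)
    linarith
  have h6 : (Real.pi * |(k : ℝ)| * (Real.pi * |(k : ℝ)|)) ^ 2 ≤ 256 * wt k ^ 4 := by
    have := pow_le_pow_left₀ (by positivity) h4 4
    linarith
  have h7 : 1 ≤ wt k ^ 4 := one_le_pow₀ hw
  -- With π ≤ 4 the three components contribute 1 + 16 + 256 = 273, and 2 · 273 ≤ 25².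
  have h8 : 1 + (Real.pi * |(k : ℝ)|) ^ 2 + (Real.pi * |(k : ℝ)| * (Real.pi * |(k : ℝ)|)) ^ 2
      ≤ 273 * wt k ^ 4 := by linarith
  have h9 := mul_le_mul_of_nonneg_right h8 (sq_nonneg ‖c k‖)
  have h10 : 0 ≤ wt k ^ 4 * ‖c k‖ ^ 2 := by positivity
  nlinarith

/-! ### The interpolation spaces in terms of the coefficients -/

/-- Hadamard's three lines theorem with one bound for both lines. It serves both for the
interpolation spaces and for the multilinear forms. -/
lemma norm_le_of_strip {E : Type*} [NormedAddCommGroup E] [NormedSpace ℂ E] {f : ℂ → E} {M : ℝ}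
    (hc : ContinuousOn f {z | 0 ≤ z.re ∧ z.re ≤ 1})
    (hd : DifferentiableOn ℂ f {z | 0 < z.re ∧ z.re < 1})
    (hB : ∃ B : ℝ, ∀ z : ℂ, 0 ≤ z.re → z.re ≤ 1 → ‖f z‖ ≤ B)
    (h0 : ∀ t : ℝ, ‖f (t * Complex.I)‖ ≤ M) (h1 : ∀ t : ℝ, ‖f (1 + t * Complex.I)‖ ≤ M)
    {θ : ℝ} (hθ : 0 ≤ θ) (hθ' : θ ≤ 1) : ‖f θ‖ ≤ M := by
  have hM : 0 ≤ M := (norm_nonneg _).trans (h0 0)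
  obtain ⟨B, hB⟩ := hB
  have key := Complex.HadamardThreeLines.norm_le_interp_of_mem_verticalClosedStrip₀₁' f
    (z := (θ : ℂ)) (a := M) (b := M) ⟨by simpa using hθ, by simpa using hθ'⟩ ⟨hd, ?_⟩ ?_ ?_ ?_
  · refine key.trans (le_of_eq ?_)
    rw [Complex.ofReal_re]
    rcases hM.eq_or_lt with h | h
    · rcases eq_or_ne θ 0 with h' | h'
      · simp [← h, h']
      · simp [← h, Real.zero_rpow h']
    · rw [← Real.rpow_add h]; simp
  · refine hc.mono ?_
    rw [Complex.HadamardThreeLines.verticalStrip, Complex.closure_preimage_re,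
      closure_Ioo zero_ne_one]
    exact fun z hz => hz
  · refine ⟨B, ?_⟩
    rintro _ ⟨z, hz, rfl⟩
    exact hB z hz.1 hz.2
  · intro z hz
    have : z = z.im * Complex.I := by
      apply Complex.ext <;> simp
      exact hz
    rw [this]; exact h0 _
  · intro z hz
    have : z = 1 + z.im * Complex.I := by
      apply Complex.ext <;> simp
      exact hz
    rw [this]; exact h1 _

lemma norm_wt_cpow (k : ℤ) (z : ℂ) : ‖(wt k : ℂ) ^ z‖ = wt k ^ z.re :=
  Complex.norm_cpow_eq_rpow_re_of_pos (wt_pos k) z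

lemma differentiable_wt_cpow (k : ℤ) : Differentiable ℂ fun z : ℂ => (wt k : ℂ) ^ z :=
  fun z => (differentiableAt_id).const_cpow (Or.inl (by exact_mod_cast (wt_pos k).ne'))

lemma wt_cpow_ofReal (k : ℤ) (x : ℝ) : (wt k : ℂ) ^ (x : ℂ) = ((wt k ^ x : ℝ) : ℂ) :=
  (Complex.ofReal_cpow (wt_pos k).le x).symm

lemma norm_toL2_le (u : W22) : ‖W22.toL2 u‖ ≤ ‖u‖ := by
  have h := norm_sq_W22 u
  have : ‖W22.toL2 u‖ ^ 2 ≤ ‖u‖ ^ 2 := by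
    rw [h]
    change ‖u.1 0‖ ^ 2 ≤ _
    nlinarith [sq_nonneg ‖u.1 1‖, sq_nonneg ‖u.1 2‖]
  exact le_of_sq_le_sq this (norm_nonneg _)

lemma norm_component_le (u : W22) (i : Fin 3) : ‖u.1 i‖ ≤ ‖u‖ :=
  PiLp.norm_apply_le u.1 i

lemma sum_wt_sq_aCoef_W22_le (u : W22) (S : Finset ℤ) :
    ∑ k ∈ S, (wt k ^ 2 * ‖aCoef k (W22.toL2 u)‖) ^ 2 ≤ (6000 * ‖u‖) ^ 2 := by
  refine (sum_wt_sq_aCoef_le u.2.1 u.2.2 S).trans ?_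
  have h0 := norm_component_le u 0
  have h1 := norm_component_le u 1
  have h2 := norm_component_le u 2
  exact pow_le_pow_left₀ (by positivity) (by linarith) 2

lemma norm_sum_mul_le (S : Finset ℤ) (a b : ℤ → ℂ) :
    ‖∑ k ∈ S, a k * b k‖ ≤ √(∑ k ∈ S, ‖a k‖ ^ 2) * √(∑ k ∈ S, ‖b k‖ ^ 2) := by
  refine (norm_sum_le _ _).trans ?_
  simp only [norm_mul]
  exact Real.sum_mul_le_sqrt_mul_sqrt S _ _

lemma nonneg_of_mem_interpBounds {θ : ℝ} {x : L2} {M : ℝ} (h : M ∈ interpBounds W22.toL2 θ x) :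
    0 ≤ M := by
  obtain ⟨F, g, -, -, hM, -⟩ := h
  exact (norm_nonneg _).trans (hM 0)

lemma norm_le_of_mem_interpBounds {θ : ℝ} (hθ : 0 ≤ θ) (hθ' : θ ≤ 1) {x : L2} {M : ℝ}
    (h : M ∈ interpBounds W22.toL2 θ x) : ‖x‖ ≤ M := by
  obtain ⟨F, g, hF, rfl, hM, hM'⟩ := h
  refine norm_le_of_strip hF.continuousOn hF.differentiableOn hF.bounded (fun t => ?_) hM' hθ hθ'
  rw [hF.left_eq]
  exact (norm_toL2_le _).trans (hM t)

/-- The coefficient map is bounded from W_2^2 and from L_2 into ℓ_2 with weights wt² and 1. The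
three lines theorem, applied to a scalar function made from a strip function and a dual sequence,
gives T ≤ √T · 6000M for the square sum T. -/
lemma sum_wt_rpow_aCoef_le_of_mem_interpBounds {α : ℝ} (hα : 0 ≤ α) (hα' : α ≤ 2) {x : L2} {M : ℝ}
    (h : M ∈ interpBounds W22.toL2 (1 - α / 2) x) (S : Finset ℤ) :
    ∑ k ∈ S, (wt k ^ α * ‖aCoef k x‖) ^ 2 ≤ (6000 * M) ^ 2 := by
  have hM0 := nonneg_of_mem_interpBounds h
  obtain ⟨F, g, hF, rfl, hM, hM'⟩ := h
  set θ := 1 - α / 2 with hθ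
  set T := ∑ k ∈ S, (wt k ^ α * ‖aCoef k (F θ)‖) ^ 2 with hT
  have hT0 : 0 ≤ T := Finset.sum_nonneg fun _ _ => sq_nonneg _
  -- `d` is dual to the weighted coefficients at θ, whence φ(θ) = T. The exponent 2(1 − z) has real
  -- part 2 on the line where F takes values in W_2^2 and 0 on the other line, and it equals α at θ.
  let d : ℤ → ℂ := fun k => (wt k ^ α : ℝ) * star (aCoef k (F θ))
  have hd : ∑ k ∈ S, ‖d k‖ ^ 2 = T := by
    refine Finset.sum_congr rfl fun k _ => ?_
    have : 0 ≤ wt k ^ α := Real.rpow_nonneg (wt_pos k).le _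
    simp [d, abs_of_nonneg this]
  let φ : ℂ → ℂ := fun z => ∑ k ∈ S, d k * ((wt k : ℂ) ^ (2 * (1 - z)) * aCoef k (F z))
  have hval : φ θ = T := by
    rw [hT]
    push_cast
    refine Finset.sum_congr rfl fun k _ => ?_
    have e1 : (2 * (1 - (θ : ℂ))) = (α : ℂ) := by rw [hθ]; push_cast; ring
    rw [e1, wt_cpow_ofReal]
    simp only [d]
    have e2 : star (aCoef k (F θ)) * aCoef k (F θ) = ((‖aCoef k (F θ)‖ : ℝ) : ℂ) ^ 2 := by
      rw [Complex.star_def, mul_comm, Complex.mul_conj, Complex.normSq_eq_norm_sq]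
      push_cast; rfl
    linear_combination (((wt k ^ α : ℝ) : ℂ) ^ 2) * e2
  have hwd (k : ℤ) : Differentiable ℂ fun z : ℂ => (wt k : ℂ) ^ (2 * (1 - z)) :=
    (differentiable_wt_cpow k).comp ((differentiable_id.const_sub 1).const_mul 2)
  have hwb (k : ℤ) (z : ℂ) (hz : 0 ≤ z.re) : ‖(wt k : ℂ) ^ (2 * (1 - z))‖ ≤ wt k ^ (2 : ℝ) := by
    rw [norm_wt_cpow]
    refine Real.rpow_le_rpow_of_exponent_le (one_le_wt k) ?_
    simp; linarith
  have bound (z : ℂ) {N : ℝ} (hN : 0 ≤ N)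
      (hz : ∑ k ∈ S, (‖(wt k : ℂ) ^ (2 * (1 - z))‖ * ‖aCoef k (F z)‖) ^ 2 ≤ N ^ 2) :
      ‖φ z‖ ≤ √T * N := by
    refine (norm_sum_mul_le S _ _).trans ?_
    rw [hd]
    simp only [norm_mul]
    gcongr
    exact (Real.sqrt_le_left hN).2 hz
  have key : ‖φ θ‖ ≤ √T * (6000 * M) := by
    refine norm_le_of_strip (f := φ) ?_ ?_ ?_ (fun t => ?_) (fun t => ?_) (by linarith)
      (by linarith)
    · refine continuousOn_finsetSum _ fun k _ => continuousOn_const.mul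
        ((hwd k).continuous.continuousOn.mul ((aCoef k).continuous.comp_continuousOn hF.continuousOn))
    · exact DifferentiableOn.fun_sum fun k _ => (differentiableOn_const _).mul
        ((hwd k).differentiableOn.mul ((aCoef k).differentiable.comp_differentiableOn hF.differentiableOn))
    · obtain ⟨B, hB⟩ := hF.bounded
      refine ⟨∑ k ∈ S, ‖d k‖ * (wt k ^ (2 : ℝ) * (‖aCoef k‖ * B)), fun z hz hz' => ?_⟩
      refine (norm_sum_le _ _).trans (Finset.sum_le_sum fun k _ => ?_)
      rw [norm_mul, norm_mul ((wt k : ℂ) ^ _)]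
      refine mul_le_mul_of_nonneg_left (mul_le_mul ?_ ?_ (norm_nonneg _)
        (Real.rpow_nonneg (wt_pos k).le _)) (norm_nonneg _)
      · exact hwb k z hz
      · exact (aCoef k).le_opNorm_of_le (hB z hz hz')
    · refine bound _ (by positivity) ?_
      have e1 (k : ℤ) : ‖(wt k : ℂ) ^ (2 * (1 - (t * Complex.I : ℂ)))‖ = wt k ^ 2 := by
        rw [norm_wt_cpow]; norm_num
      simp only [e1, hF.left_eq]
      refine (sum_wt_sq_aCoef_W22_le (g t) S).trans ?_
      gcongr
      exact hM t
    · refine bound _ (by positivity) ?_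
      have e1 (k : ℤ) : ‖(wt k : ℂ) ^ (2 * (1 - (1 + t * Complex.I : ℂ)))‖ = 1 := by
        rw [norm_wt_cpow]; norm_num
      simp only [e1, one_mul]
      refine (sum_sq_aCoef_le _ S).trans ?_
      have := hM' t
      gcongr
      norm_num
  rw [hval, Complex.norm_real, Real.norm_of_nonneg hT0] at key
  rcases hT0.eq_or_lt with h | h
  · rw [← h]; positivity
  · have h1 : √T * √T = T := Real.mul_self_sqrt hT0
    have h2 : 0 < √T := Real.sqrt_pos.2 h
    have h3 : √T ≤ 6000 * M := by
      rw [← h1] at key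
      rw [Real.sqrt_mul_self h2.le] at key
      exact le_of_mul_le_mul_left key h2
    rw [← h1, ← sq]
    gcongr

lemma norm_exp_sq_le {z : ℂ} {θ : ℝ} (hθ : 0 ≤ θ) (hθ' : θ ≤ 1) (hz : 0 ≤ z.re) (hz' : z.re ≤ 1) :
    ‖Complex.exp ((z - θ) ^ 2)‖ ≤ Real.exp (1 - z.im ^ 2) := by
  rw [Complex.norm_exp]
  refine Real.exp_le_exp.2 ?_
  have : ((z - θ) ^ 2).re = (z.re - θ) ^ 2 - z.im ^ 2 := by
    simp [sq]
  rw [this]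
  nlinarith

lemma tendsto_exp_one_sub_sq : Tendsto (fun t : ℝ => Real.exp (1 - t ^ 2)) (cocompact ℝ) (𝓝 0) := by
  refine Real.tendsto_exp_atBot.comp ?_
  have h1 : Tendsto (fun t : ℝ => t ^ 2) (cocompact ℝ) atTop := by
    have := (tendsto_pow_atTop two_ne_zero).comp (tendsto_norm_cocompact_atTop (E := ℝ))
    simpa [Function.comp_def] using this
  exact tendsto_atBot_add_const_left _ _ (tendsto_neg_atTop_atBot.comp h1)

lemma tsum_sq_le_of_sum_le {x : ℤ → ℝ} {B : ℝ} (h : ∀ S : Finset ℤ, ∑ k ∈ S, x k ^ 2 ≤ B ^ 2) :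
    Summable (fun k => x k ^ 2) ∧ ∑' k, x k ^ 2 ≤ B ^ 2 :=
  have hs := summable_of_sum_le (fun _ => sq_nonneg _) h
  ⟨hs, hs.tsum_le_of_sum_le h⟩

/-- A function whose coefficients are square summable with the weights of order `γ` belongs to
`W_2^γ(0,1)`. -/
lemma exists_mem_sobolevBounds {γ : ℝ} (hγ : 0 < γ) (hγ' : γ ≤ 2) {c : ℤ → ℂ} {B : ℝ} (hB : 0 ≤ B)
    (hc : ∀ S : Finset ℤ, ∑ k ∈ S, (wt k ^ γ * ‖c k‖) ^ 2 ≤ B ^ 2) {u : L2}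
    (hu : HasSum (fun k => c k • expL2 k) u) {f : ℝ → ℂ} (hf : u =ᵐ[unitMeasure] f) :
    ∃ M ∈ sobolevBounds γ f, M ≤ 100 * B := by
  -- For γ = 2 there is nothing to interpolate: the series converges in W_2^2.
  rcases hγ'.eq_or_lt with rfl | hγ2
  · have hc' : ∀ S : Finset ℤ, ∑ k ∈ S, (wt k ^ 2 * ‖c k‖) ^ 2 ≤ B ^ 2 := by simpa using hc
    obtain ⟨hs, hle⟩ := tsum_sq_le_of_sum_le hc'
    have hw := (isBessel_expW.summable hs).hasSum
    have hn := isBessel_expW.norm_tsum_le hs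
    have h1 := W22.toL2.hasSum hw
    simp only [map_smul, toL2_expW] at h1
    have h2 := h1.unique hu
    refine ⟨‖∑' k, c k • expW k‖, ?_, ?_⟩
    · rw [sobolevBounds, if_neg two_ne_zero, if_pos rfl]
      exact ⟨_, by rw [h2]; exact hf, le_rfl⟩
    · have : √(∑' k, (wt k ^ 2 * ‖c k‖) ^ 2) ≤ B := (Real.sqrt_le_left hB).2 hle
      linarith
  set θ := 1 - γ / 2 with hθ
  have hθ0 : 0 ≤ θ := by linarith
  have hθ1 : θ ≤ 1 := by linarith
  -- `b` lies in ℓ_2 with norm at most B. The series with coefficients wt^(2(z−1)) b has the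
  -- coefficients `c` at z = θ and stays in L_2 on the strip. On Re z = 0 the multiplier has modulus
  -- wt⁻², so there it is summed in W_2^2 through `b'`.
  let b : ℤ → ℂ := fun k => ((wt k ^ γ : ℝ) : ℂ) * c k
  have hbn (k : ℤ) : ‖b k‖ = wt k ^ γ * ‖c k‖ := by
    simp only [b]
    rw [norm_mul, Complex.norm_real, Real.norm_of_nonneg (Real.rpow_nonneg (wt_pos k).le _)]
  have hb : ∀ S : Finset ℤ, ∑ k ∈ S, (1 * ‖b k‖) ^ 2 ≤ B ^ 2 := by
    simpa only [hbn, one_mul] using hc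
  obtain ⟨hbs, hble⟩ := tsum_sq_le_of_sum_le hb
  let b' : ℤ → ℂ := fun k => ((wt k ^ 2 : ℝ) : ℂ)⁻¹ * b k
  have hb'n (k : ℤ) : wt k ^ 2 * ‖b' k‖ = 1 * ‖b k‖ := by
    simp only [b']
    have := (wt_pos k).ne'
    rw [norm_mul, norm_inv, Complex.norm_real, Real.norm_of_nonneg (sq_nonneg _)]
    field_simp
  have hbs' : Summable fun k => (wt k ^ 2 * ‖b' k‖) ^ 2 := by simpa only [hb'n] using hbs
  have hble' : ∑' k, (wt k ^ 2 * ‖b' k‖) ^ 2 ≤ B ^ 2 := by simpa only [hb'n] using hble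
  let w : ℂ → ℤ → ℂ := fun z k => (wt k : ℂ) ^ (2 * (z - 1))
  have hwd (k : ℤ) : Differentiable ℂ fun z : ℂ => w z k :=
    (differentiable_wt_cpow k).comp ((differentiable_id.sub_const 1).const_mul 2)
  have hw (z : ℂ) (hz : z.re ≤ 1) (k : ℤ) : ‖w z k‖ ≤ 1 := by
    rw [norm_wt_cpow]
    exact Real.rpow_le_one_of_one_le_of_nonpos (one_le_wt k) (by simp; linarith)
  let G : ℂ → L2 := fun z => ∑' k, (w z k * b k) • expL2 k
  -- The Gaussian factor is 1 at θ and forces decay along both lines. Its modulus is at most e < 3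
  -- on the strip, so the bounds 3 · 25B and 3 · 2B fit under 100B.
  let F : ℂ → L2 := fun z => Complex.exp ((z - θ) ^ 2) • G z
  let v : ℝ → ℤ → ℂ := fun t k => (wt k : ℂ) ^ (2 * (t * Complex.I))
  have hv (t : ℝ) (k : ℤ) : ‖v t k‖ ≤ 1 := by
    rw [norm_wt_cpow]; simp
  let H : ℝ → W22 := fun t => ∑' k, (v t k * b' k) • expW k
  let g : ℝ → W22 := fun t => Complex.exp ((t * Complex.I - θ) ^ 2) • H t
  have hGn (z : ℂ) (hz : z.re ≤ 1) : ‖G z‖ ≤ 2 * B := by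
    have hle : ∀ k, (1 * ‖w z k * b k‖) ^ 2 ≤ (1 * ‖b k‖) ^ 2 := fun k => by
      rw [norm_mul, one_mul, one_mul]
      exact pow_le_pow_left₀ (by positivity)
        (mul_le_of_le_one_left (norm_nonneg _) (hw z hz k)) 2
    have hs := hbs.of_nonneg_of_le (fun _ => sq_nonneg _) hle
    refine (isBessel_expL2.norm_tsum_le hs).trans ?_
    gcongr
    exact (Real.sqrt_le_left hB).2 ((hs.tsum_le_tsum hle hbs).trans hble)
  have hHs (t : ℝ) : (Summable fun k => (wt k ^ 2 * ‖v t k * b' k‖) ^ 2) ∧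
      (∑' k, (wt k ^ 2 * ‖v t k * b' k‖) ^ 2) ≤ B ^ 2 := by
    have hle : ∀ k, (wt k ^ 2 * ‖v t k * b' k‖) ^ 2 ≤ (wt k ^ 2 * ‖b' k‖) ^ 2 := fun k => by
      rw [norm_mul]
      have := mul_le_of_le_one_left (norm_nonneg (b' k)) (hv t k)
      exact pow_le_pow_left₀ (by positivity) (mul_le_mul_of_nonneg_left this (sq_nonneg _)) 2
    have hs := hbs'.of_nonneg_of_le (fun _ => sq_nonneg _) hle
    exact ⟨hs, (hs.tsum_le_tsum hle hbs').trans hble'⟩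
  have hHn (t : ℝ) : ‖H t‖ ≤ 25 * B := by
    refine (isBessel_expW.norm_tsum_le (hHs t).1).trans ?_
    gcongr
    exact (Real.sqrt_le_left hB).2 (hHs t).2
  have hGu : TendstoUniformlyOn (fun (S : Finset ℤ) z => ∑ k ∈ S, (w z k * b k) • expL2 k) G atTop
      {z | z.re ≤ 1} :=
    isBessel_expL2.tendstoUniformlyOn zero_le_two hbs hw
  have hHu : TendstoUniformlyOn (fun (S : Finset ℤ) t => ∑ k ∈ S, (v t k * b' k) • expW k) H atTop
      univ :=
    isBessel_expW.tendstoUniformlyOn (by norm_num) hbs' fun t _ => hv t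
  have hGc : ContinuousOn G {z | z.re ≤ 1} :=
    hGu.continuousOn (Frequently.of_forall fun S => continuousOn_finsetSum _ fun k _ =>
      ((hwd k).continuous.mul continuous_const).continuousOn.smul continuousOn_const)
  have hHc : Continuous H := by
    rw [← continuousOn_univ]
    refine hHu.continuousOn (Frequently.of_forall fun S => continuousOn_finsetSum _ fun k _ =>
      Continuous.continuousOn (Continuous.fun_smul (Continuous.mul ?_ continuous_const)
        continuous_const))
    exact (differentiable_wt_cpow k).continuous.comp (by fun_prop)
  have hGd : DifferentiableOn ℂ G {z | 0 < z.re ∧ z.re < 1} := by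
    have hopen : IsOpen {z : ℂ | 0 < z.re ∧ z.re < 1} :=
      (isOpen_lt continuous_const Complex.continuous_re).inter
        (isOpen_lt Complex.continuous_re continuous_const)
    refine ((hGu.mono fun z hz => hz.2.le).tendstoLocallyUniformlyOn).differentiableOn
      (Eventually.of_forall fun S => ?_) hopen
    exact DifferentiableOn.fun_sum fun k _ =>
      ((hwd k).differentiableOn.mul (differentiableOn_const _)).smul_const _
  have hexp : Differentiable ℂ fun z : ℂ => Complex.exp ((z - θ) ^ 2) := by fun_prop
  have hFn (z : ℂ) (hz : 0 ≤ z.re) (hz' : z.re ≤ 1) : ‖F z‖ ≤ Real.exp (1 - z.im ^ 2) * (2 * B) := by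
    simp only [F, norm_smul]
    exact mul_le_mul (norm_exp_sq_le hθ0 hθ1 hz hz') (hGn z hz') (norm_nonneg _)
      (Real.exp_pos _).le
  have hgn (t : ℝ) : ‖g t‖ ≤ Real.exp (1 - t ^ 2) * (25 * B) := by
    simp only [g, norm_smul]
    have h1 := norm_exp_sq_le (z := t * Complex.I) hθ0 hθ1 (by simp) (by simp)
    have h2 : (t * Complex.I : ℂ).im = t := by simp
    rw [h2] at h1
    exact mul_le_mul h1 (hHn t) (norm_nonneg _) (Real.exp_pos _).le
  have hexp3 (t : ℝ) : Real.exp (1 - t ^ 2) ≤ 3 := by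
    refine (Real.exp_le_exp.2 (show 1 - t ^ 2 ≤ 1 by nlinarith)).trans ?_
    linarith [Real.exp_one_lt_d9]
  have hline (t : ℝ) : (1 + t * Complex.I : ℂ).re = 1 ∧ (1 + t * Complex.I : ℂ).im = t := by simp
  have hFline (t : ℝ) : ‖F (1 + t * Complex.I)‖ ≤ Real.exp (1 - t ^ 2) * (2 * B) := by
    have := hFn (1 + t * Complex.I) (by rw [(hline t).1]; norm_num) (hline t).1.le
    rwa [(hline t).2] at this
  have hFθ : F θ = u := by
    have e1 : ∀ k, w θ k * b k = c k := fun k => by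
      have : (2 * ((θ : ℂ) - 1)) = ((-γ : ℝ) : ℂ) := by rw [hθ]; push_cast; ring
      simp only [w, b]
      rw [this, wt_cpow_ofReal, ← mul_assoc, ← Complex.ofReal_mul, ← Real.rpow_add (wt_pos k)]
      simp
    simp only [F, G, e1]
    simp [hu.tsum_eq]
  have hleft (t : ℝ) : F (t * Complex.I) = W22.toL2 (g t) := by
    simp only [F, g, map_smul]
    congr 1
    have h1 := W22.toL2.hasSum (isBessel_expW.summable (hHs t).1).hasSum
    simp only [map_smul, toL2_expW] at h1
    change G _ = W22.toL2 (H t)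
    rw [← h1.tsum_eq]
    refine tsum_congr fun k => ?_
    congr 1
    simp only [w, v, b']
    have : (2 * (t * Complex.I - 1) : ℂ) = 2 * (t * Complex.I) + ((-2 : ℝ) : ℂ) := by push_cast; ring
    rw [this, Complex.cpow_add _ _ (by exact_mod_cast (wt_pos k).ne'), wt_cpow_ofReal, mul_assoc]
    congr 2
    rw [Real.rpow_neg (wt_pos k).le]
    push_cast
    norm_cast
  refine ⟨100 * B, ?_, le_rfl⟩
  rw [sobolevBounds, if_neg hγ.ne', if_neg hγ2.ne]
  refine ⟨u, hf, F, g, ?_, hFθ, fun t => (hgn t).trans ?_, fun t => (hFline t).trans ?_⟩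
  · refine ⟨?_, ?_, ?_, hleft, ?_, ?_, ?_, ?_⟩
    · exact hexp.continuous.continuousOn.smul (hGc.mono fun z hz => hz.2)
    · refine ⟨3 * (2 * B), fun z hz hz' => (hFn z hz hz').trans ?_⟩
      gcongr
      exact hexp3 _
    · exact hexp.differentiableOn.smul hGd
    · refine Continuous.fun_smul (f := fun t : ℝ => Complex.exp ((t * Complex.I - θ) ^ 2)) ?_ hHc
      fun_prop
    · refine squeeze_zero_norm hgn ?_
      simpa using tendsto_exp_one_sub_sq.mul_const (25 * B)
    · refine Continuous.fun_smul (f := fun t : ℝ => Complex.exp ((1 + t * Complex.I - θ) ^ 2)) (g := fun t : ℝ => G (1 + t * Complex.I)) ?_ ?_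
      · fun_prop
      · exact hGc.comp_continuous (by fun_prop) fun t => (hline t).1.le
    · refine squeeze_zero_norm hFline ?_
      simpa using tendsto_exp_one_sub_sq.mul_const (2 * B)
  · nlinarith [hexp3 t]
  · nlinarith [hexp3 t]

/-! ### Interpolation of multilinear forms on finitely supported sequences -/

/-- The weighted `ℓ_2`-norm of order `a` of a finitely supported sequence. -/
def nrm (a : ℝ) (c : ℤ →₀ ℂ) : ℝ := √(∑ k ∈ c.support, (wt k ^ a * ‖c k‖) ^ 2)

lemma nrm_nonneg (a : ℝ) (c : ℤ →₀ ℂ) : 0 ≤ nrm a c := Real.sqrt_nonneg _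

lemma sq_nrm (a : ℝ) (c : ℤ →₀ ℂ) : nrm a c ^ 2 = ∑ k ∈ c.support, (wt k ^ a * ‖c k‖) ^ 2 :=
  Real.sq_sqrt (Finset.sum_nonneg fun _ _ => sq_nonneg _)

lemma nrm_mono {a b : ℝ} (h : a ≤ b) (c : ℤ →₀ ℂ) : nrm a c ≤ nrm b c := by
  refine Real.sqrt_le_sqrt (Finset.sum_le_sum fun k _ => ?_)
  have h1 := Real.rpow_nonneg (wt_pos k).le a
  have h2 := Real.rpow_le_rpow_of_exponent_le (one_le_wt k) h
  gcongr

/-- Multiplication of a finitely supported sequence by a sequence. -/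
def scale (w : ℤ → ℂ) (c : ℤ →₀ ℂ) : ℤ →₀ ℂ :=
  Finsupp.onFinset c.support (fun k => w k * c k) fun k hk => by
    rw [Finsupp.mem_support_iff]; exact right_ne_zero_of_mul hk

lemma support_scale_subset (w : ℤ → ℂ) (c : ℤ →₀ ℂ) : (scale w c).support ⊆ c.support :=
  Finsupp.support_onFinset_subset

lemma scale_eq_sum (w : ℤ → ℂ) (c : ℤ →₀ ℂ) :
    scale w c = ∑ k ∈ c.support, (w k * c k) • Finsupp.single k (1 : ℂ) := by
  ext j
  rw [Finsupp.finsetSum_apply]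
  simp only [Finsupp.smul_single, smul_eq_mul, mul_one, Finsupp.single_apply, scale,
    Finsupp.onFinset_apply]
  rw [Finset.sum_ite_eq' c.support j]
  split_ifs with h
  · rfl
  · rw [Finsupp.notMem_support_iff.1 h, mul_zero]

lemma nrm_scale {a b : ℝ} {w : ℤ → ℂ} (hw : ∀ k, wt k ^ a * ‖w k‖ = wt k ^ b) (c : ℤ →₀ ℂ) :
    nrm a (scale w c) = nrm b c := by
  rw [nrm, nrm]
  congr 1
  have hsub := support_scale_subset w c
  rw [Finset.sum_subset hsub fun k _ hk => by
    rw [Finsupp.notMem_support_iff.1 hk]; simp]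
  refine Finset.sum_congr rfl fun k _ => ?_
  rw [scale, Finsupp.onFinset_apply, norm_mul, ← mul_assoc, hw]

lemma scale_one (c : ℤ →₀ ℂ) : scale (fun _ => 1) c = c := by
  ext k; simp [scale]

/-- A form is bounded with respect to the weighted norms of orders `a`. -/
def HasBound (Φ : MultilinearMap ℂ (fun _ : Fin 4 => ℤ →₀ ℂ) ℂ) (a : Fin 4 → ℝ) (N : ℝ) : Prop :=
  ∀ c : Fin 4 → ℤ →₀ ℂ, ‖Φ c‖ ≤ N * ∏ i, nrm (a i) (c i)

lemma HasBound.mono {Φ : MultilinearMap ℂ (fun _ : Fin 4 => ℤ →₀ ℂ) ℂ} {a b : Fin 4 → ℝ} {N : ℝ}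
    (hN : 0 ≤ N) (h : HasBound Φ a N) (hab : ∀ i, a i ≤ b i) : HasBound Φ b N := fun c =>
  (h c).trans (mul_le_mul_of_nonneg_left
    (Finset.prod_le_prod (fun _ _ => nrm_nonneg _ _) fun i _ => nrm_mono (hab i) _) hN)

/-- Bounds for a multilinear form interpolate. -/
lemma HasBound.interp {Φ : MultilinearMap ℂ (fun _ : Fin 4 => ℤ →₀ ℂ) ℂ} {a b : Fin 4 → ℝ} {N : ℝ}
    (h0 : HasBound Φ a N) (h1 : HasBound Φ b N) {θ : ℝ} (hθ : 0 ≤ θ) (hθ' : θ ≤ 1) :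
    HasBound Φ (fun i => a i + θ * (b i - a i)) N := by
  intro c
  -- These multipliers equal 1 at z = θ. On Re z = 0 and on Re z = 1 they turn the norms of orders
  -- `a` and `b` into the same norm of the intermediate order.
  let w : ℂ → Fin 4 → ℤ → ℂ := fun z i k => (wt k : ℂ) ^ ((θ - z) * (b i - a i : ℝ))
  let φ : ℂ → ℂ := fun z => Φ fun i => scale (w z i) (c i)
  have hwn (z : ℂ) (i : Fin 4) (k : ℤ) : ‖w z i k‖ = wt k ^ ((θ - z.re) * (b i - a i)) := by
    rw [norm_wt_cpow]
    congr 1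
    rw [Complex.re_mul_ofReal]
    simp
  have hwd (i : Fin 4) (k : ℤ) : Differentiable ℂ fun z => w z i k :=
    (differentiable_wt_cpow k).comp ((differentiable_id.const_sub (θ : ℂ)).mul_const _)
  -- Finite supports make φ a finite sum of exponentials, hence entire and bounded on the strip.
  have hφ (z : ℂ) : φ z = ∑ r ∈ Fintype.piFinset fun i => (c i).support,
      (∏ i, w z i (r i) * c i (r i)) • Φ fun i => Finsupp.single (r i) (1 : ℂ) := by
    simp only [φ, scale_eq_sum]
    rw [MultilinearMap.map_sum_finset]
    refine Finset.sum_congr rfl fun r _ => ?_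
    rw [MultilinearMap.map_smul_univ]
  have hφd : Differentiable ℂ φ := by
    rw [funext hφ]
    refine Differentiable.fun_sum fun r _ => Differentiable.smul_const ?_ _
    exact Differentiable.fun_finsetProd fun i _ => (hwd i (r i)).mul_const _
  have hval : φ θ = Φ c := by
    simp only [φ, w, sub_self, zero_mul, Complex.cpow_zero, scale_one]
  rw [← hval]
  refine norm_le_of_strip hφd.continuous.continuousOn hφd.differentiableOn ?_ (fun t => ?_)
    (fun t => ?_) hθ hθ'
  · refine ⟨∑ r ∈ Fintype.piFinset fun i => (c i).support,
      (∏ i, wt (r i) ^ |b i - a i| * ‖c i (r i)‖) * ‖Φ fun i => Finsupp.single (r i) (1 : ℂ)‖,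
      fun z hz hz' => ?_⟩
    rw [hφ]
    refine (norm_sum_le _ _).trans (Finset.sum_le_sum fun r _ => ?_)
    rw [norm_smul, norm_prod]
    gcongr with i _
    rw [norm_mul, hwn]
    gcongr
    · exact one_le_wt _
    · refine (le_abs_self _).trans ?_
      rw [abs_mul]
      refine mul_le_of_le_one_left (abs_nonneg _) (abs_le.2 ⟨by linarith, by linarith⟩)
  · refine (h0 _).trans (le_of_eq ?_)
    congr 1
    refine Finset.prod_congr rfl fun i _ => nrm_scale (fun k => ?_) _
    rw [hwn, ← Real.rpow_add (wt_pos k)]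
    simp
  · refine (h1 _).trans (le_of_eq ?_)
    congr 1
    refine Finset.prod_congr rfl fun i _ => nrm_scale (fun k => ?_) _
    rw [hwn, ← Real.rpow_add (wt_pos k)]
    congr 1
    simp
    ring

/-! ### Trigonometric polynomials in weighted norms -/

/-- The trigonometric polynomial with given coefficients, as an element of `L_2(0,1)`. -/
def trigL2 : (ℤ →₀ ℂ) →ₗ[ℂ] L2 := Finsupp.linearCombination ℂ expL2

lemma trigL2_eq (c : ℤ →₀ ℂ) : trigL2 c = cls (trig c) := by
  rw [trigL2, Finsupp.linearCombination_apply, Finsupp.sum, ← cls_sum]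
  rfl

/-- The derivative of a trigonometric polynomial. -/
def trigDeriv (c : ℤ →₀ ℂ) : ℤ →₀ ℂ := scale (fun k => Real.pi * Complex.I * k) c

lemma trig_eq_sum {c : ℤ →₀ ℂ} {S : Finset ℤ} (h : c.support ⊆ S) (x : ℝ) :
    trig c x = ∑ k ∈ S, c k * expPi k x := by
  rw [trig_apply, Finset.sum_subset h fun k _ hk => by rw [Finsupp.notMem_support_iff.1 hk, zero_mul]]

lemma hasDerivAt_trig (c : ℤ →₀ ℂ) (x : ℝ) : HasDerivAt (trig c) (trig (trigDeriv c) x) x := by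
  have hsub : (trigDeriv c).support ⊆ c.support := support_scale_subset _ c
  rw [trig_eq_sum hsub, funext (trig_apply c)]
  refine HasDerivAt.fun_sum fun k _ => ?_
  convert! (hasDerivAt_expPi k x).const_mul (c k) using 1
  rw [trigDeriv, scale, Finsupp.onFinset_apply]
  ring

lemma norm_trigL2_le (c : ℤ →₀ ℂ) : ‖cls (trig c)‖ ≤ 4 * nrm 0 c := by
  rw [← trigL2_eq, trigL2, Finsupp.linearCombination_apply, Finsupp.sum]
  refine (isBessel_expL2 c.support c).trans ?_
  simp only [nrm, Real.rpow_zero]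
  gcongr
  norm_num

lemma norm_trigDeriv_le (c : ℤ →₀ ℂ) : ‖cls (trig (trigDeriv c))‖ ≤ 16 * nrm 1 c := by
  refine (norm_trigL2_le _).trans ?_
  have : nrm 0 (trigDeriv c) ≤ 4 * nrm 1 c := by
    refine le_of_sq_le_sq ?_ (by have := nrm_nonneg 1 c; positivity)
    rw [mul_pow, sq_nrm, sq_nrm, Finset.mul_sum]
    have hsub : (trigDeriv c).support ⊆ c.support := support_scale_subset _ c
    refine (Finset.sum_le_sum_of_subset_of_nonneg hsub fun _ _ _ => sq_nonneg _).trans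
      (Finset.sum_le_sum fun k _ => ?_)
    rw [trigDeriv, scale, Finsupp.onFinset_apply, ← mul_pow]
    simp only [norm_mul, Complex.norm_I, Complex.norm_real, Complex.norm_intCast, Real.norm_eq_abs,
      abs_of_pos Real.pi_pos, mul_one, Real.rpow_zero, one_mul, Real.rpow_one]
    have h1 : Real.pi * |(k : ℝ)| ≤ 4 * wt k :=
      mul_le_mul Real.pi_le_four (by unfold wt; linarith) (abs_nonneg _) (by norm_num)
    have := Real.pi_pos
    rw [← mul_assoc]
    gcongr
  linarith

/-- Trigonometric polynomials are bounded by their first-order norms. -/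
lemma exists_norm_trig_le : ∃ K : ℝ, 1 ≤ K ∧ ∀ (c : ℤ →₀ ℂ) (x : ℝ), ‖trig c x‖ ≤ K * nrm 1 c := by
  have hs : Summable fun k : ℤ => (wt k)⁻¹ ^ 2 := by
    have h := Real.summable_one_div_int_pow.2 (show 1 < 2 by norm_num)
    refine Summable.of_norm_bounded_eventually (g := fun k : ℤ => 1 / (k : ℝ) ^ 2) h ?_
    have : ∀ᶠ k : ℤ in cofinite, k ≠ 0 := (Set.finite_singleton (0 : ℤ)).compl_mem_cofinite
    filter_upwards [this] with k hk
    have h1 := wt_pos k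
    have h2 : 0 < |(k : ℝ)| := abs_pos.2 (Int.cast_ne_zero.2 hk)
    rw [Real.norm_of_nonneg (by positivity), inv_pow, ← one_div, ← sq_abs (k : ℝ)]
    gcongr
    unfold wt; linarith
  refine ⟨√(∑' k : ℤ, (wt k)⁻¹ ^ 2) + 1, by linarith [Real.sqrt_nonneg (∑' k : ℤ, (wt k)⁻¹ ^ 2)],
    fun c x => ?_⟩
  have h1 : trig c x = ∑ k ∈ c.support, ((wt k)⁻¹ : ℂ) * (wt k * (c k * expPi k x)) := by
    rw [trig_apply]
    refine Finset.sum_congr rfl fun k _ => ?_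
    have : (wt k : ℂ) ≠ 0 := by exact_mod_cast (wt_pos k).ne'
    field_simp
  rw [h1]
  refine (norm_sum_mul_le _ _ _).trans ?_
  have h2 : ∀ k, ‖(wt k : ℂ) * (c k * expPi k x)‖ ^ 2 = (wt k ^ (1 : ℝ) * ‖c k‖) ^ 2 := fun k => by
    rw [norm_mul, norm_mul, norm_expPi, mul_one, Complex.norm_real, Real.rpow_one,
      Real.norm_of_nonneg (wt_pos k).le]
  have h3 : ∀ k, ‖((wt k)⁻¹ : ℂ)‖ ^ 2 = (wt k)⁻¹ ^ 2 := fun k => by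
    rw [norm_inv, Complex.norm_real, Real.norm_of_nonneg (wt_pos k).le]
  simp only [h2, h3]
  have h4 : √(∑ k ∈ c.support, (wt k)⁻¹ ^ 2) ≤ √(∑' k : ℤ, (wt k)⁻¹ ^ 2) :=
    Real.sqrt_le_sqrt (hs.sum_le_tsum _ fun _ _ => sq_nonneg _)
  have h5 := nrm_nonneg 1 c
  have h6 := mul_le_mul_of_nonneg_right h4 h5
  change √_ * nrm 1 c ≤ _
  linarith

/-! ### Integral forms on `L_2(0,1)` -/

/-- The `L_2(0,1)`-norm of a nonnegative function. -/
def e2 (g : ℝ → ℝ≥0∞) : ℝ≥0∞ := (∫⁻ x, g x ^ (2 : ℝ) ∂unitMeasure) ^ (1 / (2 : ℝ))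

lemma e2_enorm (f : ℝ → ℂ) : e2 (fun x => ‖f x‖ₑ) = eLpNorm f 2 unitMeasure := by
  rw [e2, eLpNorm_eq_lintegral_rpow_enorm_toReal (by norm_num) (by norm_num)]
  simp

lemma e2_enorm_eq_ofReal {f : ℝ → ℂ} (hf : MemLp f 2 unitMeasure) :
    e2 (fun x => ‖f x‖ₑ) = ENNReal.ofReal ‖cls f‖ := by
  rw [e2_enorm, norm_cls hf, ENNReal.ofReal_toReal hf.2.ne]

lemma lintegral_Icc_eq (g : ℝ → ℝ≥0∞) :
    ∫⁻ x, (Icc (0 : ℝ) 1).indicator g x = ∫⁻ x, g x ∂unitMeasure := by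
  rw [lintegral_indicator measurableSet_Icc, setLIntegral_congr Ioo_ae_eq_Icc.symm]

lemma lintegral_Icc_le_e2 {g : ℝ → ℝ≥0∞} (hg : Measurable g) :
    ∫⁻ x, (Icc (0 : ℝ) 1).indicator g x ≤ e2 g := by
  rw [lintegral_Icc_eq]
  have := ENNReal.lintegral_mul_le_Lp_mul_Lq unitMeasure Real.HolderConjugate.two_two
    hg.aemeasurable (g := fun _ => 1) aemeasurable_const
  simpa [e2] using this

/-- Cauchy–Schwarz together with invariance of Lebesgue measure under translation and reflection.
This is the basic estimate: a single variable of integration pays for its own factor and for the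
test function, whatever the other variables are. -/
lemma lintegral_mul_affine_le {g φ : ℝ → ℝ≥0∞} (hg : Measurable g) (hφ : Measurable φ) {ε : ℝ}
    (hε : ε = 1 ∨ ε = -1) (c : ℝ) :
    ∫⁻ p, (Icc (0 : ℝ) 1).indicator g p * (Ioo (0 : ℝ) 1).indicator φ (ε * p + c)
      ≤ e2 g * e2 φ := by
  have hm : Measurable fun p : ℝ => ε * p + c := by fun_prop
  refine (ENNReal.lintegral_mul_le_Lp_mul_Lq volume Real.HolderConjugate.two_two
    (hg.indicator measurableSet_Icc).aemeasurable
    ((hφ.indicator measurableSet_Ioo).comp hm).aemeasurable).trans ?_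
  have hi (s : Set ℝ) (f : ℝ → ℝ≥0∞) (x : ℝ) : s.indicator f x ^ (2 : ℝ)
      = s.indicator (fun x => f x ^ (2 : ℝ)) x := by
    by_cases h : x ∈ s <;> simp [h]
  refine mul_le_mul' (le_of_eq ?_) (le_of_eq ?_)
  · simp only [hi]
    rw [lintegral_Icc_eq, e2]
  · simp only [Function.comp_apply, hi]
    rw [e2, ← lintegral_indicator measurableSet_Ioo]
    congr 1
    rcases hε with rfl | rfl
    · simp only [one_mul]
      exact lintegral_add_right_eq_self (fun x => (Ioo (0 : ℝ) 1).indicator (fun x => φ x ^ (2 : ℝ)) x) c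
    · have : ∀ p : ℝ, -1 * p + c = c - p := fun p => by ring
      simp only [this]
      exact lintegral_sub_left_eq_self (fun x => (Ioo (0 : ℝ) 1).indicator (fun x => φ x ^ (2 : ℝ)) x) c

section Slab

variable {W : Type*} [MeasurableSpace W] {μ : Measure W}

lemma lintegral_slab_le {G : W → ℝ≥0∞} (hG : Measurable G) {g φ : ℝ → ℝ≥0∞} (hg : Measurable g)
    (hφ : Measurable φ) {ε : ℝ} (hε : ε = 1 ∨ ε = -1) {c : W → ℝ} (hc : Measurable c) :
    ∫⁻ x, G x.1 * ((Icc (0 : ℝ) 1).indicator g x.2 *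
        (Ioo (0 : ℝ) 1).indicator φ (ε * x.2 + c x.1)) ∂(μ.prod volume)
      ≤ (∫⁻ w, G w ∂μ) * (e2 g * e2 φ) := by
  have m1 := hg.indicator (measurableSet_Icc (a := (0 : ℝ)) (b := 1))
  have m2 := hφ.indicator (measurableSet_Ioo (a := (0 : ℝ)) (b := 1))
  rw [lintegral_prod _ (by fun_prop), ← lintegral_mul_const _ hG]
  refine lintegral_mono fun w => ?_
  simp only
  rw [lintegral_const_mul _ (by fun_prop)]
  exact mul_le_mul_right (lintegral_mul_affine_le hg hφ hε _) _

lemma lintegral_mul_indicator_le {G : W → ℝ≥0∞} (hG : Measurable G) {g : ℝ → ℝ≥0∞}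
    (hg : Measurable g) :
    ∫⁻ x, G x.1 * (Icc (0 : ℝ) 1).indicator g x.2 ∂(μ.prod volume) ≤ (∫⁻ w, G w ∂μ) * e2 g := by
  rw [lintegral_prod_mul hG.aemeasurable (hg.indicator measurableSet_Icc).aemeasurable]
  exact mul_le_mul_right (lintegral_Icc_le_e2 hg) _

end Slab

section Form

variable {X : Type*} [MeasurableSpace X]

/-- The integral `∫ v(x) f_1(p_1(x)) ⋯ f_4(p_4(x)) dx`. -/
def formInt (m : Measure X) (v : X → ℂ) (p : Fin 4 → X → ℝ) (f : Fin 4 → ℝ → ℂ) : ℂ :=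
  ∫ x, v x * ∏ i, f i (p i x) ∂m

/-- The integral form with the given data is bounded by `N` on `L_2(0,1)`. -/
def IsFormBound (m : Measure X) (v : X → ℂ) (p : Fin 4 → X → ℝ) (N : ℝ) : Prop :=
  ∀ g : Fin 4 → ℝ → ℝ≥0∞, (∀ i, Measurable (g i)) →
    ∫⁻ x, ‖v x‖ₑ * ∏ i, g i (p i x) ∂m ≤ ENNReal.ofReal N * ∏ i, e2 (g i)

variable {m : Measure X} {v : X → ℂ} {p : Fin 4 → X → ℝ} {N : ℝ}

lemma lintegral_form_le (hN : 0 ≤ N) (H : IsFormBound m v p N) {f : Fin 4 → ℝ → ℂ}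
    (hf : ∀ i, Measurable (f i)) (hf2 : ∀ i, MemLp (f i) 2 unitMeasure) :
    ∫⁻ x, ‖v x * ∏ i, f i (p i x)‖ₑ ∂m ≤ ENNReal.ofReal (N * ∏ i, ‖cls (f i)‖) := by
  have h := H (fun i x => ‖f i x‖ₑ) fun i => (hf i).enorm
  simp only [e2_enorm_eq_ofReal (hf2 _)] at h
  rw [ENNReal.ofReal_mul hN, ENNReal.ofReal_prod_of_nonneg fun i _ => norm_nonneg _]
  refine le_trans (le_of_eq ?_) h
  refine lintegral_congr fun x => ?_
  rw [enorm_mul]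
  congr 1
  simp only [← ofReal_norm, norm_prod]
  rw [ENNReal.ofReal_prod_of_nonneg fun i _ => norm_nonneg _]

lemma integrable_form (hv : Measurable v) (hp : ∀ i, Measurable (p i)) (hN : 0 ≤ N)
    (H : IsFormBound m v p N) {f : Fin 4 → ℝ → ℂ}
    (hf : ∀ i, Measurable (f i)) (hf2 : ∀ i, MemLp (f i) 2 unitMeasure) :
    Integrable (fun x => v x * ∏ i, f i (p i x)) m :=
  ⟨(hv.mul (Finset.measurable_fun_prod _ fun i _ => (hf i).comp (hp i))).aestronglyMeasurable,
    (lintegral_form_le hN H hf hf2).trans_lt ENNReal.ofReal_lt_top⟩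

lemma norm_formInt_le (hN : 0 ≤ N) (H : IsFormBound m v p N) {f : Fin 4 → ℝ → ℂ}
    (hf : ∀ i, Measurable (f i)) (hf2 : ∀ i, MemLp (f i) 2 unitMeasure) :
    ‖formInt m v p f‖ ≤ N * ∏ i, ‖cls (f i)‖ := by
  have h := (enorm_integral_le_lintegral_enorm (μ := m) fun x => v x * ∏ i, f i (p i x)).trans
    (lintegral_form_le hN H hf hf2)
  rw [← ofReal_norm, ENNReal.ofReal_le_ofReal_iff (by positivity)] at h
  exact h

lemma prod_update_form {X : Type*} {p : Fin 4 → X → ℝ} (f : Fin 4 → ℝ → ℂ) (i : Fin 4) (g : ℝ → ℂ)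
    (x : X) :
    ∏ j, Function.update f i g j (p j x)
      = g (p i x) * ∏ j ∈ Finset.univ.erase i, f j (p j x) := by
  rw [← Finset.mul_prod_erase _ _ (Finset.mem_univ i), Function.update_self]
  congr 1
  exact Finset.prod_congr rfl fun j hj => by rw [Function.update_of_ne (Finset.ne_of_mem_erase hj)]

lemma forall_update {P : (ℝ → ℂ) → Prop} {f : Fin 4 → ℝ → ℂ} (hf : ∀ i, P (f i)) (i : Fin 4)
    {g : ℝ → ℂ} (hg : P g) (j : Fin 4) : P (Function.update f i g j) := by
  rcases eq_or_ne j i with rfl | h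
  · rwa [Function.update_self]
  · rw [Function.update_of_ne h]; exact hf j

lemma formInt_update_add (hv : Measurable v) (hp : ∀ i, Measurable (p i)) (hN : 0 ≤ N)
    (H : IsFormBound m v p N) {f : Fin 4 → ℝ → ℂ} (hf : ∀ i, Measurable (f i))
    (hf2 : ∀ i, MemLp (f i) 2 unitMeasure) (i : Fin 4) {g h : ℝ → ℂ} (hg : Measurable g)
    (hg2 : MemLp g 2 unitMeasure) (hh : Measurable h) (hh2 : MemLp h 2 unitMeasure) (a : ℂ) :
    formInt m v p (Function.update f i (g + a • h))
      = formInt m v p (Function.update f i g) + a * formInt m v p (Function.update f i h) := by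
  have i1 := integrable_form hv hp hN H (forall_update (P := Measurable) hf i hg) (forall_update (P := fun f => MemLp f 2 unitMeasure) hf2 i hg2)
  have i2 := integrable_form hv hp hN H (forall_update (P := Measurable) hf i hh) (forall_update (P := fun f => MemLp f 2 unitMeasure) hf2 i hh2)
  rw [formInt, formInt, formInt, ← integral_const_mul, ← integral_add i1 (i2.const_mul a)]
  refine integral_congr_ae (Eventually.of_forall fun x => ?_)
  simp only [prod_update_form, Pi.add_apply, Pi.smul_apply, smul_eq_mul]
  ring

lemma formInt_update_congr (hv : Measurable v) (hp : ∀ i, Measurable (p i)) (hN : 0 ≤ N)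
    (H : IsFormBound m v p N) {f : Fin 4 → ℝ → ℂ} (hf : ∀ i, Measurable (f i))
    (hf2 : ∀ i, MemLp (f i) 2 unitMeasure) (i : Fin 4) {g h : ℝ → ℂ} (hg : Measurable g)
    (hg2 : MemLp g 2 unitMeasure) (hh : Measurable h) (hgh : g =ᵐ[unitMeasure] h) :
    formInt m v p (Function.update f i g) = formInt m v p (Function.update f i h) := by
  have hh2 := hg2.ae_eq hgh
  have hd : Measurable (g + (-1 : ℂ) • h) := hg.add (hh.const_smul _)
  have hd2 : MemLp (g + (-1 : ℂ) • h) 2 unitMeasure := hg2.add (hh2.const_smul _)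
  have h1 := formInt_update_add hv hp hN H hf hf2 i hg hg2 hh hh2 (-1)
  have h2 := norm_formInt_le hN H (forall_update (P := Measurable) hf i hd) (forall_update (P := fun f => MemLp f 2 unitMeasure) hf2 i hd2)
  have h3 : cls (g + (-1 : ℂ) • h) = 0 := by
    rw [cls_add hg2 (hh2.const_smul _), cls_smul _ hh2, cls_congr hgh]
    simp
  have h4 : ∏ j, ‖cls (Function.update f i (g + (-1 : ℂ) • h) j)‖ = 0 :=
    Finset.prod_eq_zero (Finset.mem_univ i) (by rw [Function.update_self, h3, norm_zero])
  rw [h4, mul_zero, norm_le_zero_iff, h1] at h2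
  linear_combination h2

/-- The arguments are replaced one by one. Each replacement changes the form by its value at a
function of class zero, which the bound kills, so a form on functions descends to classes. -/
lemma formInt_congr (hv : Measurable v) (hp : ∀ i, Measurable (p i)) (hN : 0 ≤ N)
    (H : IsFormBound m v p N) {f g : Fin 4 → ℝ → ℂ} (hf : ∀ i, Measurable (f i))
    (hf2 : ∀ i, MemLp (f i) 2 unitMeasure) (hg : ∀ i, Measurable (g i))
    (hfg : ∀ i, f i =ᵐ[unitMeasure] g i) : formInt m v p f = formInt m v p g := by
  have hg2 (i : Fin 4) := (hf2 i).ae_eq (hfg i)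
  have key (S : Finset (Fin 4)) :
      formInt m v p f = formInt m v p (fun i => if i ∈ S then g i else f i) := by
    induction S using Finset.induction_on with
    | empty => simp
    | insert a S ha ih =>
      rw [ih]
      have hm (i : Fin 4) : Measurable (if i ∈ S then g i else f i) := by
        split_ifs; exacts [hg i, hf i]
      have hm2 (i : Fin 4) : MemLp (if i ∈ S then g i else f i) 2 unitMeasure := by
        split_ifs; exacts [hg2 i, hf2 i]
      have := formInt_update_congr hv hp hN H hm hm2 a (hf a) (hf2 a) (hg a) (hfg a)
      convert! this using 2
      · ext1 j
        rcases eq_or_ne j a with rfl | h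
        · simp [ha]
        · simp [h]
      · ext1 j
        rcases eq_or_ne j a with rfl | h
        · simp
        · simp [h]
  simpa using key Finset.univ

lemma measurable_coe (u : L2) : Measurable u := (Lp.stronglyMeasurable u).measurable

/-- A bounded integral form defines a continuous multilinear form on `L_2(0,1)`. -/
lemma exists_form (hv : Measurable v) (hp : ∀ i, Measurable (p i)) (hN : 0 ≤ N)
    (H : IsFormBound m v p N) :
    ∃ T : ContinuousMultilinearMap ℂ (fun _ : Fin 4 => L2) ℂ,
      (∀ f : Fin 4 → ℝ → ℂ, (∀ i, Measurable (f i)) → (∀ i, MemLp (f i) 2 unitMeasure) →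
        T (fun i => cls (f i)) = formInt m v p f) ∧
      ∀ ψ : Fin 4 → L2, ‖T ψ‖ ≤ N * ∏ i, ‖ψ i‖ := by
  have hup (ψ : Fin 4 → L2) (i : Fin 4) (a : L2) :
      (fun j => ((Function.update ψ i a j : L2) : ℝ → ℂ))
        = Function.update (fun j => (ψ j : ℝ → ℂ)) i a := by
    ext1 j
    rcases eq_or_ne j i with rfl | h
    · simp
    · simp [h]
  have hM (ψ : Fin 4 → L2) (i : Fin 4) := measurable_coe (ψ i)
  have hM2 (ψ : Fin 4 → L2) (i : Fin 4) := Lp.memLp (ψ i)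
  have hsm (ψ : Fin 4 → L2) (i : Fin 4) (a b : L2) (c : ℂ) :
      formInt m v p (fun j => ((Function.update ψ i (a + c • b) j : L2) : ℝ → ℂ))
      = formInt m v p (fun j => ((Function.update ψ i a j : L2) : ℝ → ℂ))
        + c * formInt m v p (fun j => ((Function.update ψ i b j : L2) : ℝ → ℂ)) := by
    rw [hup, hup, hup, ← formInt_update_add hv hp hN H (hM ψ) (hM2 ψ) i (measurable_coe a)
      (Lp.memLp a) (measurable_coe b) (Lp.memLp b)]
    refine formInt_update_congr hv hp hN H (hM ψ) (hM2 ψ) i (measurable_coe _) (Lp.memLp _)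
      ((measurable_coe a).add ((measurable_coe b).const_smul c)) ?_
    filter_upwards [Lp.coeFn_add a (c • b), Lp.coeFn_smul c b] with x h1 h2
    rw [h1, Pi.add_apply, h2, Pi.add_apply]
  have hz (ψ : Fin 4 → L2) (i : Fin 4) :
      formInt m v p (fun j => ((Function.update ψ i 0 j : L2) : ℝ → ℂ)) = 0 := by
    have := hsm ψ i 0 0 1
    simp only [smul_zero, add_zero, one_mul] at this
    linear_combination -this
  let T₀ : MultilinearMap ℂ (fun _ : Fin 4 => L2) ℂ :=
    { toFun := fun ψ => formInt m v p fun i => ψ i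
      map_update_add' := fun {inst} ψ i a b => by
        rw [Subsingleton.elim inst (instDecidableEqFin 4)]
        have := hsm ψ i a b 1
        simpa only [one_smul, one_mul] using this
      map_update_smul' := fun {inst} ψ i c a => by
        rw [Subsingleton.elim inst (instDecidableEqFin 4)]
        have := hsm ψ i 0 a c
        rw [zero_add, hz, zero_add] at this
        exact this }
  have hb (ψ : Fin 4 → L2) : ‖T₀ ψ‖ ≤ N * ∏ i, ‖ψ i‖ := by
    have := norm_formInt_le hN H (hM ψ) (hM2 ψ)
    change ‖formInt m v p fun i => (ψ i : ℝ → ℂ)‖ ≤ _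
    simpa only [cls_coe] using this
  refine ⟨T₀.mkContinuous N hb, fun f hf hf2 => ?_, hb⟩
  exact formInt_congr hv hp hN H (fun i => measurable_coe _) (fun i => Lp.memLp _) hf
    fun i => cls_ae (hf2 i)

end Form

/-! ### Integration by parts in product spaces -/

section Swap

variable {A : Type*} [MeasurableSpace A]

/-- The exchange of the last two coordinates. -/
def swapLast : (A × ℝ) × ℝ ≃ᵐ (A × ℝ) × ℝ :=
  MeasurableEquiv.ofInvolutive (fun q => ((q.1.1, q.2), q.1.2)) (fun _ => rfl) (by fun_prop)

lemma measurePreserving_swapLast (μ : Measure A) [SFinite μ] :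
    MeasurePreserving (swapLast (A := A)) ((μ.prod volume).prod volume)
      ((μ.prod volume).prod volume) :=
  ((measurePreserving_prodAssoc μ volume volume).symm _).comp
    (((MeasurePreserving.id μ).prod Measure.measurePreserving_swap).comp
      (measurePreserving_prodAssoc μ volume volume))

lemma integral_swapLast (μ : Measure A) [SFinite μ] (F : (A × ℝ) × ℝ → ℂ) :
    ∫ q, F q ∂((μ.prod volume).prod volume)
      = ∫ q, F ((q.1.1, q.2), q.1.2) ∂((μ.prod volume).prod volume) :=
  ((measurePreserving_swapLast μ).integral_comp' F).symm

lemma integral_rotate (μ : Measure A) [SFinite μ] (F : ((A × ℝ) × ℝ) × ℝ → ℂ) :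
    ∫ q, F q ∂(((μ.prod volume).prod volume).prod volume)
      = ∫ q, F (((q.1.1.1, q.2), q.1.1.2), q.1.2) ∂(((μ.prod volume).prod volume).prod volume) := by
  have h : MeasurePreserving ((swapLast (A := A)).prodCongr (MeasurableEquiv.refl ℝ))
      (((μ.prod volume).prod volume).prod volume) (((μ.prod volume).prod volume).prod volume) :=
    (measurePreserving_swapLast μ).prod (MeasurePreserving.id volume)
  rw [← h.integral_comp' F, integral_swapLast]
  rfl

end Swap

lemma integrable_mul_indicator_Icc {W : Type*} [MeasurableSpace W] {μ : Measure W} [SFinite μ]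
    {H : W → ℂ} (hH : Integrable H μ) {lo hi c : W → ℝ} (hlo : Measurable lo) (hhi : Measurable hi)
    (hc : Measurable c) (hr : ∀ w, H w ≠ 0 → 0 ≤ lo w ∧ lo w ≤ hi w ∧ hi w ≤ 1)
    {f η : ℝ → ℂ} (hf : Continuous f) (hη : Continuous η) {B : ℝ} (hb : ∀ x, ‖η x‖ ≤ B) (ε : ℝ) :
    Integrable (fun q : W × ℝ => H q.1 *
      ((Icc (lo q.1) (hi q.1)).indicator f q.2 * η (ε * q.2 + c q.1))) (μ.prod volume) := by
  obtain ⟨C, hC⟩ := isCompact_Icc.exists_bound_of_continuousOn (hf.continuousOn (s := Icc 0 1))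
  have hC0 : 0 ≤ C := (norm_nonneg _).trans (hC 0 (by simp))
  have hB0 : 0 ≤ B := (norm_nonneg _).trans (hb 0)
  have h1 : Integrable ((Icc (0 : ℝ) 1).indicator fun _ => C * B) volume :=
    (integrable_indicator_iff measurableSet_Icc).2 (integrableOn_const (by simp))
  have hS : MeasurableSet {q : W × ℝ | q.2 ∈ Icc (lo q.1) (hi q.1)} :=
    (measurableSet_le (hlo.comp measurable_fst) measurable_snd).inter
      (measurableSet_le measurable_snd (hhi.comp measurable_fst))
  have h2 : Measurable fun q : W × ℝ => (Icc (lo q.1) (hi q.1)).indicator f q.2 := by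
    have := (hf.measurable.comp (measurable_snd (α := W))).indicator hS
    exact this
  refine (hH.norm.mul_prod h1).mono' (hH.1.comp_fst.mul (h2.mul
    (hη.measurable.comp (by fun_prop))).aestronglyMeasurable) (Eventually.of_forall fun q => ?_)
  rw [norm_mul, norm_mul]
  by_cases h : H q.1 = 0
  · simp [h]
  obtain ⟨r1, r2, r3⟩ := hr _ h
  refine mul_le_mul_of_nonneg_left ?_ (norm_nonneg _)
  by_cases hq : q.2 ∈ Icc (lo q.1) (hi q.1)
  · have hq' : q.2 ∈ Icc (0 : ℝ) 1 := ⟨r1.trans hq.1, hq.2.trans r3⟩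
    rw [indicator_of_mem hq, indicator_of_mem hq']
    exact mul_le_mul (hC _ hq') (hb _) (norm_nonneg _) hC0
  · rw [indicator_of_notMem hq, norm_zero, zero_mul]
    exact indicator_nonneg (fun _ _ => mul_nonneg hC0 hB0) _

lemma integrable_mul_comp {W : Type*} [MeasurableSpace W] {μ : Measure W}
    {H : W → ℂ} (hH : Integrable H μ) {k c : W → ℝ} (hk : Measurable k) (hc : Measurable c)
    (hr : ∀ w, H w ≠ 0 → k w ∈ Icc (0 : ℝ) 1)
    {f η : ℝ → ℂ} (hf : Continuous f) (hη : Continuous η) {B : ℝ} (hb : ∀ x, ‖η x‖ ≤ B) :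
    Integrable (fun w => H w * (f (k w) * η (c w))) μ := by
  obtain ⟨C, hC⟩ := isCompact_Icc.exists_bound_of_continuousOn (hf.continuousOn (s := Icc 0 1))
  have hC0 : 0 ≤ C := (norm_nonneg _).trans (hC 0 (by simp))
  refine (hH.norm.mul_const (C * B)).mono' (hH.1.mul ((hf.measurable.comp hk).mul
    (hη.measurable.comp hc)).aestronglyMeasurable) (Eventually.of_forall fun w => ?_)
  rw [norm_mul, norm_mul]
  by_cases h : H w = 0
  · simp [h]
  exact mul_le_mul_of_nonneg_left (mul_le_mul (hC _ (hr w h)) (hb _) (norm_nonneg _) hC0)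
    (norm_nonneg _)

/-- Fubini, then integration by parts in the last variable over the fiber [lo w, hi w]. The number ε
is the coefficient of that variable in the argument of η. -/
lemma integral_prod_by_parts {W : Type*} [MeasurableSpace W] {μ : Measure W} [SFinite μ]
    {H : W → ℂ} (hH : Integrable H μ) {lo hi c : W → ℝ} (hlo : Measurable lo) (hhi : Measurable hi)
    (hc : Measurable c) (hr : ∀ w, H w ≠ 0 → 0 ≤ lo w ∧ lo w ≤ hi w ∧ hi w ≤ 1)
    {f f' η η' : ℝ → ℂ} (hf : ∀ x, HasDerivAt f (f' x) x) (hf' : Continuous f')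
    (hη : ∀ x, HasDerivAt η (η' x) x) (hη' : Continuous η') {B : ℝ} (hb : ∀ x, ‖η x‖ ≤ B)
    (hb' : ∀ x, ‖η' x‖ ≤ B) (ε : ℝ) :
    ε * ∫ q, H q.1 * ((Icc (lo q.1) (hi q.1)).indicator f q.2 * η' (ε * q.2 + c q.1))
        ∂(μ.prod volume)
      = ∫ w, H w * (f (hi w) * η (ε * hi w + c w)) ∂μ
        - ∫ w, H w * (f (lo w) * η (ε * lo w + c w)) ∂μ
        - ∫ q, H q.1 * ((Icc (lo q.1) (hi q.1)).indicator f' q.2 * η (ε * q.2 + c q.1))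
          ∂(μ.prod volume) := by
  have cf : Continuous f := continuous_iff_continuousAt.2 fun x => (hf x).continuousAt
  have cη : Continuous η := continuous_iff_continuousAt.2 fun x => (hη x).continuousAt
  have i1 := integrable_mul_indicator_Icc hH hlo hhi hc hr cf hη' hb' ε
  have i2 := integrable_mul_indicator_Icc hH hlo hhi hc hr hf' cη hb ε
  have i3 := integrable_mul_comp (c := fun w => ε * hi w + c w) hH hhi (by fun_prop)
    (fun w h => ⟨(hr w h).1.trans (hr w h).2.1, (hr w h).2.2⟩) cf cη hb
  have i4 := integrable_mul_comp (c := fun w => ε * lo w + c w) hH hlo (by fun_prop)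
    (fun w h => ⟨(hr w h).1, (hr w h).2.1.trans (hr w h).2.2⟩) cf cη hb
  have i34 : Integrable (fun w => H w * (f (hi w) * η (ε * hi w + c w))
      - H w * (f (lo w) * η (ε * lo w + c w))) μ := i3.sub i4
  rw [integral_prod _ i1, integral_prod _ i2, ← integral_const_mul, ← integral_sub i3 i4,
    ← integral_sub i34 i2.integral_prod_left]
  refine integral_congr_ae (Eventually.of_forall fun w => ?_)
  simp only
  rw [integral_const_mul, integral_const_mul]
  by_cases h : H w = 0
  · simp [h]
  obtain ⟨r1, r2, r3⟩ := hr _ h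
  have key (g k : ℝ → ℂ) : ∫ y, (Icc (lo w) (hi w)).indicator g y * k (ε * y + c w)
      = ∫ y in lo w..hi w, g y * k (ε * y + c w) := by
    rw [intervalIntegral.integral_of_le r2, ← integral_Icc_eq_integral_Ioc,
      ← integral_indicator measurableSet_Icc]
    refine integral_congr_ae (Eventually.of_forall fun y => ?_)
    by_cases hy : y ∈ Icc (lo w) (hi w) <;> simp [hy]
  rw [key, key]
  have hd (y : ℝ) : HasDerivAt (fun y : ℝ => η (ε * y + c w)) (ε * η' (ε * y + c w)) y := by
    have h1 : HasDerivAt (fun y : ℝ => ε * y + c w) ε y := by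
      simpa using ((hasDerivAt_id y).const_mul ε).add_const (c w)
    have h2 := (hη (ε * y + c w)).scomp y h1
    rwa [Complex.real_smul] at h2
  have := intervalIntegral.integral_mul_deriv_eq_deriv_mul (a := lo w) (b := hi w)
    (u := f) (v := fun y : ℝ => η (ε * y + c w)) (u' := f') (v' := fun y => ε * η' (ε * y + c w))
    (fun y _ => hf y) (fun y _ => hd y) (hf'.intervalIntegrable _ _)
    ((by fun_prop : Continuous fun y : ℝ => (ε : ℂ) * η' (ε * y + c w)).intervalIntegrable _ _)
  have e : ∫ y in lo w..hi w, f y * ((ε : ℂ) * η' (ε * y + c w))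
      = ε * ∫ y in lo w..hi w, f y * η' (ε * y + c w) := by
    rw [← intervalIntegral.integral_const_mul]
    congr 1; ext y; ring
  rw [e] at this
  linear_combination H w * this

/-! ### Forms with a tail -/

section Tail

variable {Y : Type*} [MeasurableSpace Y]

/-- The conditions on the weight `u`, the base point `b` and the shift `σ` that are used in the
estimates of the quadrilinear forms. -/
structure IsTail (ν : Measure Y) (u : Y → ℂ) (b σ : Y → ℝ) (N : ℝ) : Prop where
  measurable_weight : Measurable u
  measurable_base : Measurable b
  measurable_shift : Measurable σ
  nonneg : 0 ≤ N
  base_mem : ∀ t, b t ∈ Icc (0 : ℝ) 1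
  mass : ∫⁻ t, ‖u t‖ₑ ∂ν ≤ ENNReal.ofReal N
  jump_one : ∀ φ : ℝ → ℝ≥0∞, Measurable φ →
    ∫⁻ t, ‖u t‖ₑ * (Ioo (0 : ℝ) 1).indicator φ (1 - σ t) ∂ν ≤ ENNReal.ofReal N * e2 φ
  jump_base : ∀ φ : ℝ → ℝ≥0∞, Measurable φ →
    ∫⁻ t, ‖u t‖ₑ * (Ioo (0 : ℝ) 1).indicator φ (b t - σ t) ∂ν ≤ ENNReal.ofReal N * e2 φ

variable (ν : Measure Y) (u : Y → ℂ) (b : Y → ℝ)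

/-- The integral over `b ≤ x ≤ 1`. -/
def int₁ (F : Y → ℝ → ℂ) : ℂ :=
  ∫ q : Y × ℝ, (if b q.1 ≤ q.2 ∧ q.2 ≤ 1 then u q.1 else 0) * F q.1 q.2 ∂(ν.prod volume)

/-- The integral over `b ≤ x ≤ z ≤ 1`. -/
def int₂ (F : Y → ℝ → ℝ → ℂ) : ℂ :=
  ∫ q : (Y × ℝ) × ℝ, (if b q.1.1 ≤ q.2 ∧ q.2 ≤ q.1.2 ∧ q.1.2 ≤ 1 then u q.1.1 else 0)
    * F q.1.1 q.1.2 q.2 ∂((ν.prod volume).prod volume)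

/-- The integral over `b ≤ x ≤ y ≤ z ≤ 1`. -/
def int₃ (F : Y → ℝ → ℝ → ℝ → ℂ) : ℂ :=
  ∫ q : ((Y × ℝ) × ℝ) × ℝ, (if b q.1.1.1 ≤ q.2 ∧ q.2 ≤ q.1.2 ∧ q.1.2 ≤ q.1.1.2 ∧ q.1.1.2 ≤ 1
    then u q.1.1.1 else 0) * F q.1.1.1 q.1.1.2 q.1.2 q.2
    ∂(((ν.prod volume).prod volume).prod volume)

variable {ν u b} {σ : Y → ℝ} {N : ℝ}

lemma measurableSet_region₁ (hb : Measurable b) :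
    MeasurableSet {q : Y × ℝ | b q.1 ≤ q.2 ∧ q.2 ≤ 1} := by
  simp only [ofPred_and]
  exact (measurableSet_le (by fun_prop) (by fun_prop)).inter
    (measurableSet_le (by fun_prop) (by fun_prop))

lemma measurableSet_region₂ (hb : Measurable b) :
    MeasurableSet {q : (Y × ℝ) × ℝ | b q.1.1 ≤ q.2 ∧ q.2 ≤ q.1.2 ∧ q.1.2 ≤ 1} := by
  simp only [ofPred_and]
  exact (measurableSet_le (by fun_prop) (by fun_prop)).inter
    ((measurableSet_le (by fun_prop) (by fun_prop)).inter
      (measurableSet_le (by fun_prop) (by fun_prop)))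

lemma measurableSet_region₃ (hb : Measurable b) :
    MeasurableSet {q : ((Y × ℝ) × ℝ) × ℝ |
      b q.1.1.1 ≤ q.2 ∧ q.2 ≤ q.1.2 ∧ q.1.2 ≤ q.1.1.2 ∧ q.1.1.2 ≤ 1} := by
  simp only [ofPred_and]
  exact (measurableSet_le (by fun_prop) (by fun_prop)).inter
    ((measurableSet_le (by fun_prop) (by fun_prop)).inter
      ((measurableSet_le (by fun_prop) (by fun_prop)).inter
        (measurableSet_le (by fun_prop) (by fun_prop))))

lemma IsTail.integrable (h : IsTail ν u b σ N) : Integrable u ν :=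
  ⟨h.measurable_weight.aestronglyMeasurable, h.mass.trans_lt ENNReal.ofReal_lt_top⟩

lemma IsTail.integrable₁ (h : IsTail ν u b σ N) {F : Y × ℝ → ℂ} (hF : Measurable F) {C : ℝ}
    (hC : ∀ q : Y × ℝ, q.2 ∈ Icc (0 : ℝ) 1 → ‖F q‖ ≤ C) :
    Integrable (fun q : Y × ℝ => (if b q.1 ≤ q.2 ∧ q.2 ≤ 1 then u q.1 else 0) * F q)
      (ν.prod volume) := by
  have hm := h.measurable_weight
  have hb := h.measurable_base
  have h1 : Integrable ((Icc (0 : ℝ) 1).indicator fun _ => C) volume :=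
    (integrable_indicator_iff measurableSet_Icc).2 (integrableOn_const (by simp))
  refine (h.integrable.norm.mul_prod h1).mono' (Measurable.aestronglyMeasurable ?_)
    (Eventually.of_forall fun q => ?_)
  · exact (Measurable.ite (measurableSet_region₁ hb) (by fun_prop) (by fun_prop)).mul hF
  · have h0 := h.base_mem q.1
    split_ifs with hq
    · have hq' : q.2 ∈ Icc (0 : ℝ) 1 := ⟨h0.1.trans hq.1, hq.2⟩
      rw [norm_mul, indicator_of_mem hq']
      exact mul_le_mul_of_nonneg_left (hC q hq') (norm_nonneg _)
    · rw [zero_mul, norm_zero]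
      refine mul_nonneg (norm_nonneg _) (indicator_nonneg (fun x hx => ?_) _)
      exact (norm_nonneg _).trans (hC (q.1, x) hx)

lemma IsTail.integrable₂ (h : IsTail ν u b σ N) {F : (Y × ℝ) × ℝ → ℂ} (hF : Measurable F) {C : ℝ}
    (hC : ∀ q : (Y × ℝ) × ℝ, q.1.2 ∈ Icc (0 : ℝ) 1 → q.2 ∈ Icc (0 : ℝ) 1 → ‖F q‖ ≤ C) :
    Integrable (fun q : (Y × ℝ) × ℝ =>
      (if b q.1.1 ≤ q.2 ∧ q.2 ≤ q.1.2 ∧ q.1.2 ≤ 1 then u q.1.1 else 0) * F q)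
      ((ν.prod volume).prod volume) := by
  have hm := h.measurable_weight
  have hb := h.measurable_base
  have h1 : Integrable ((Icc (0 : ℝ) 1).indicator fun _ => C) volume :=
    (integrable_indicator_iff measurableSet_Icc).2 (integrableOn_const (by simp))
  have h2 : Integrable ((Icc (0 : ℝ) 1).indicator fun _ => (1 : ℝ)) volume :=
    (integrable_indicator_iff measurableSet_Icc).2 (integrableOn_const (by simp))
  refine ((h.integrable.norm.mul_prod h2).mul_prod h1).mono' (Measurable.aestronglyMeasurable ?_)
    (Eventually.of_forall fun q => ?_)
  · exact (Measurable.ite (measurableSet_region₂ hb) (by fun_prop) (by fun_prop)).mul hF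
  · have h0 := h.base_mem q.1.1
    split_ifs with hq
    · have hq1 : q.1.2 ∈ Icc (0 : ℝ) 1 := ⟨h0.1.trans (hq.1.trans hq.2.1), hq.2.2⟩
      have hq2 : q.2 ∈ Icc (0 : ℝ) 1 := ⟨h0.1.trans hq.1, hq.2.1.trans hq.2.2⟩
      rw [norm_mul, indicator_of_mem hq1, indicator_of_mem hq2, mul_one]
      exact mul_le_mul_of_nonneg_left (hC q hq1 hq2) (norm_nonneg _)
    · rw [zero_mul, norm_zero]
      refine mul_nonneg (mul_nonneg (norm_nonneg _) (indicator_nonneg (fun x hx => zero_le_one) _))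
        (indicator_nonneg (fun x hx => ?_) _)
      exact (norm_nonneg _).trans (hC ((q.1.1, x), x) hx hx)

end Tail

/-! ### Integration by parts for the quadrilinear forms -/

/-- `f'` is the continuous derivative of `f`. -/
structure IsC1 (f f' : ℝ → ℂ) : Prop where
  hasDerivAt : ∀ x, HasDerivAt f (f' x) x
  continuous_deriv : Continuous f'

lemma IsC1.continuous {f f' : ℝ → ℂ} (h : IsC1 f f') : Continuous f :=
  continuous_iff_continuousAt.2 fun x => (h.hasDerivAt x).continuousAt

lemma exists_bound_Icc {f : ℝ → ℂ} (hf : Continuous f) :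
    ∃ C, 0 ≤ C ∧ ∀ x ∈ Icc (0 : ℝ) 1, ‖f x‖ ≤ C := by
  obtain ⟨C, hC⟩ := isCompact_Icc.exists_bound_of_continuousOn (hf.continuousOn (s := Icc 0 1))
  exact ⟨C, (norm_nonneg _).trans (hC 0 (by simp)), hC⟩

/-- Splits the region into a condition on the other variables and an interval for one of them, the
shape required by `integral_prod_by_parts`. -/
lemma ite_mul_indicator {P Q : Prop} [Decidable P] [Decidable Q] {lo hi x : ℝ}
    (h : P ↔ Q ∧ x ∈ Icc lo hi) {a F G k : ℂ} {f : ℝ → ℂ} (hF : F = G * (f x * k)) :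
    (if P then a else 0) * F
      = ((if Q then a else 0) * G) * ((Icc lo hi).indicator f x * k) := by
  by_cases hQ : Q <;> by_cases hx : x ∈ Icc lo hi <;> simp [h, hQ, hx, hF]
  ring

section Parts

variable {Y : Type*} [MeasurableSpace Y] {ν : Measure Y} [SFinite ν] {u : Y → ℂ} {b σ : Y → ℝ}
  {N B : ℝ} {f₀ f₀' f₁ f₁' f₂ f₂' η η' : ℝ → ℂ}

/-- Integration by parts in x from b to y. At x = y the argument collapses to z − σ; the term at x =
b is new and will be controlled by the supremum of f₂. -/
lemma int₃_parts_inner (h : IsTail ν u b σ N) (h₀ : Continuous f₀) (h₁ : Continuous f₁)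
    (h₂ : IsC1 f₂ f₂') (hη : IsC1 η η') (hb : ∀ x, ‖η x‖ ≤ B) (hb' : ∀ x, ‖η' x‖ ≤ B) :
    int₃ ν u b (fun t z y x => f₀ z * f₁ y * f₂ x * η' (z - y + x - σ t))
      = int₂ ν u b (fun t z y => f₀ z * f₁ y * f₂ y * η (z - σ t))
        - int₂ ν u b (fun t z y => f₀ z * f₁ y * f₂ (b t) * η (z - y + b t - σ t))
        - int₃ ν u b (fun t z y x => f₀ z * f₁ y * f₂' x * η (z - y + x - σ t)) := by
  have mb := h.measurable_base
  have mσ := h.measurable_shift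
  obtain ⟨C₀, hC₀, hC₀'⟩ := exists_bound_Icc h₀
  obtain ⟨C₁, hC₁, hC₁'⟩ := exists_bound_Icc h₁
  have iH := h.integrable₂ (F := fun q => f₀ q.1.2 * f₁ q.2) (C := C₀ * C₁) (by fun_prop)
    fun q h1 h2 => by
      rw [norm_mul]
      exact mul_le_mul (hC₀' _ h1) (hC₁' _ h2) (norm_nonneg _) hC₀
  have key := integral_prod_by_parts iH (lo := fun w => b w.1.1) (hi := fun w => w.2)
    (c := fun w => w.1.2 - w.2 - σ w.1.1) (by fun_prop) (by fun_prop) (by fun_prop)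
    (fun w hw => by
      have : b w.1.1 ≤ w.2 ∧ w.2 ≤ w.1.2 ∧ w.1.2 ≤ 1 := by
        by_contra hn
        simp [hn] at hw
      exact ⟨(h.base_mem _).1, this.1, this.2.1.trans this.2.2⟩)
    h₂.hasDerivAt h₂.continuous_deriv hη.hasDerivAt hη.continuous_deriv hb hb' 1
  unfold int₃ int₂
  refine Eq.trans ?_ (key.trans ?_)
  · rw [Complex.ofReal_one, one_mul]
    refine integral_congr_ae (Eventually.of_forall fun q => ite_mul_indicator ?_ ?_)
    · simp only [mem_Icc]; constructor
      · rintro ⟨a1, a2, a3, a4⟩; exact ⟨⟨a1.trans a2, a3, a4⟩, a1, a2⟩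
      · rintro ⟨⟨a1, a3, a4⟩, a5, a2⟩; exact ⟨a5, a2, a3, a4⟩
    · rw [show 1 * q.2 + (q.1.1.2 - q.1.2 - σ q.1.1.1) = q.1.1.2 - q.1.2 + q.2 - σ q.1.1.1 by ring]
      ring
  · congr 1
    · congr 1
      · refine integral_congr_ae (Eventually.of_forall fun q => ?_)
        simp only
        rw [show 1 * q.2 + (q.1.2 - q.2 - σ q.1.1) = q.1.2 - σ q.1.1 by ring]
        ring
      · refine integral_congr_ae (Eventually.of_forall fun q => ?_)
        simp only
        rw [show 1 * b q.1.1 + (q.1.2 - q.2 - σ q.1.1) = q.1.2 - q.2 + b q.1.1 - σ q.1.1 by ring]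
        ring
    · refine integral_congr_ae (Eventually.of_forall fun q => (ite_mul_indicator ?_ ?_).symm)
      · simp only [mem_Icc]; constructor
        · rintro ⟨a1, a2, a3, a4⟩; exact ⟨⟨a1.trans a2, a3, a4⟩, a1, a2⟩
        · rintro ⟨⟨a1, a3, a4⟩, a5, a2⟩; exact ⟨a5, a2, a3, a4⟩
      · rw [show 1 * q.2 + (q.1.1.2 - q.1.2 - σ q.1.1.1) = q.1.1.2 - q.1.2 + q.2 - σ q.1.1.1 by
          ring]
        ring

/-- Integration by parts in y from x to z, with ε = −1. Both endpoints are diagonals, at which two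
of the three variables cancel in the argument of η; thus no term at z = 1 or x = b appears. -/
lemma int₃_parts_middle (h : IsTail ν u b σ N) (h₀ : Continuous f₀) (h₁ : IsC1 f₁ f₁')
    (h₂ : Continuous f₂) (hη : IsC1 η η') (hb : ∀ x, ‖η x‖ ≤ B) (hb' : ∀ x, ‖η' x‖ ≤ B) :
    int₃ ν u b (fun t z y x => f₀ z * f₁ y * f₂ x * η' (z - y + x - σ t))
      = int₃ ν u b (fun t z y x => f₀ z * f₁' y * f₂ x * η (z - y + x - σ t))
        - int₂ ν u b (fun t z x => f₀ z * f₁ z * f₂ x * η (x - σ t))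
        + int₂ ν u b (fun t z y => f₀ z * f₁ y * f₂ y * η (z - σ t)) := by
  have mb := h.measurable_base
  have mσ := h.measurable_shift
  obtain ⟨C₀, hC₀, hC₀'⟩ := exists_bound_Icc h₀
  obtain ⟨C₂, hC₂, hC₂'⟩ := exists_bound_Icc h₂
  have iH := h.integrable₂ (F := fun q => f₀ q.1.2 * f₂ q.2) (C := C₀ * C₂) (by fun_prop)
    fun q h1 h2 => by
      rw [norm_mul]
      exact mul_le_mul (hC₀' _ h1) (hC₂' _ h2) (norm_nonneg _) hC₀
  have key := integral_prod_by_parts iH (lo := fun w => w.2) (hi := fun w => w.1.2)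
    (c := fun w => w.1.2 + w.2 - σ w.1.1) (by fun_prop) (by fun_prop) (by fun_prop)
    (fun w hw => by
      have : b w.1.1 ≤ w.2 ∧ w.2 ≤ w.1.2 ∧ w.1.2 ≤ 1 := by
        by_contra hn
        simp [hn] at hw
      exact ⟨(h.base_mem _).1.trans this.1, this.2⟩)
    h₁.hasDerivAt h₁.continuous_deriv hη.hasDerivAt hη.continuous_deriv hb hb' (-1)
  have e (g k : ℝ → ℂ) : int₃ ν u b (fun t z y x => f₀ z * g y * f₂ x * k (z - y + x - σ t))
      = ∫ q : ((Y × ℝ) × ℝ) × ℝ, ((if b q.1.1.1 ≤ q.1.2 ∧ q.1.2 ≤ q.1.1.2 ∧ q.1.1.2 ≤ 1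
          then u q.1.1.1 else 0) * (f₀ q.1.1.2 * f₂ q.1.2)) *
          ((Icc q.1.2 q.1.1.2).indicator g q.2 * k (-1 * q.2 + (q.1.1.2 + q.1.2 - σ q.1.1.1)))
          ∂(((ν.prod volume).prod volume).prod volume) := by
    unfold int₃
    rw [integral_swapLast]
    refine integral_congr_ae (Eventually.of_forall fun q => ite_mul_indicator ?_ ?_)
    · simp only [mem_Icc]; constructor
      · rintro ⟨a1, a2, a3, a4⟩; exact ⟨⟨a1, a2.trans a3, a4⟩, a2, a3⟩
      · rintro ⟨⟨a1, a3, a4⟩, a5, a2⟩; exact ⟨a1, a5, a2, a4⟩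
    · rw [show -1 * q.2 + (q.1.1.2 + q.1.2 - σ q.1.1.1) = q.1.1.2 - q.2 + q.1.2 - σ q.1.1.1 by ring]
      ring
  have e1 : int₂ ν u b (fun t z x => f₀ z * f₁ z * f₂ x * η (x - σ t))
      = ∫ w : (Y × ℝ) × ℝ, ((if b w.1.1 ≤ w.2 ∧ w.2 ≤ w.1.2 ∧ w.1.2 ≤ 1 then u w.1.1 else 0)
        * (f₀ w.1.2 * f₂ w.2)) * (f₁ w.1.2 * η (-1 * w.1.2 + (w.1.2 + w.2 - σ w.1.1)))
          ∂((ν.prod volume).prod volume) := by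
    refine integral_congr_ae (Eventually.of_forall fun q => ?_)
    simp only
    rw [show -1 * q.1.2 + (q.1.2 + q.2 - σ q.1.1) = q.2 - σ q.1.1 by ring]
    ring
  have ea : int₂ ν u b (fun t z y => f₀ z * f₁ y * f₂ y * η (z - σ t))
      = ∫ w : (Y × ℝ) × ℝ, ((if b w.1.1 ≤ w.2 ∧ w.2 ≤ w.1.2 ∧ w.1.2 ≤ 1 then u w.1.1 else 0)
        * (f₀ w.1.2 * f₂ w.2)) * (f₁ w.2 * η (-1 * w.2 + (w.1.2 + w.2 - σ w.1.1)))
          ∂((ν.prod volume).prod volume) := by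
    refine integral_congr_ae (Eventually.of_forall fun q => ?_)
    simp only
    rw [show -1 * q.2 + (q.1.2 + q.2 - σ q.1.1) = q.1.2 - σ q.1.1 by ring]
    ring
  rw [e f₁ η', e f₁' η, e1, ea]
  push_cast at key
  linear_combination -key

/-- Integration by parts in z from y to 1. At z = y the argument collapses to x − σ; the term at z =
1 involves f₀ only through its value there. -/
lemma int₃_parts_outer (h : IsTail ν u b σ N) (h₀ : IsC1 f₀ f₀') (h₁ : Continuous f₁)
    (h₂ : Continuous f₂) (hη : IsC1 η η') (hb : ∀ x, ‖η x‖ ≤ B) (hb' : ∀ x, ‖η' x‖ ≤ B) :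
    int₃ ν u b (fun t z y x => f₀ z * f₁ y * f₂ x * η' (z - y + x - σ t))
      = int₂ ν u b (fun t y x => f₀ 1 * f₁ y * f₂ x * η (1 - y + x - σ t))
        - int₂ ν u b (fun t z x => f₀ z * f₁ z * f₂ x * η (x - σ t))
        - int₃ ν u b (fun t z y x => f₀' z * f₁ y * f₂ x * η (z - y + x - σ t)) := by
  have mb := h.measurable_base
  have mσ := h.measurable_shift
  obtain ⟨C₁, hC₁, hC₁'⟩ := exists_bound_Icc h₁
  obtain ⟨C₂, hC₂, hC₂'⟩ := exists_bound_Icc h₂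
  have iH := h.integrable₂ (F := fun q => f₁ q.1.2 * f₂ q.2) (C := C₁ * C₂) (by fun_prop)
    fun q h1 h2 => by
      rw [norm_mul]
      exact mul_le_mul (hC₁' _ h1) (hC₂' _ h2) (norm_nonneg _) hC₁
  have key := integral_prod_by_parts iH (lo := fun w => w.1.2) (hi := fun w => 1)
    (c := fun w => -w.1.2 + w.2 - σ w.1.1) (by fun_prop) (by fun_prop) (by fun_prop)
    (fun w hw => by
      have : b w.1.1 ≤ w.2 ∧ w.2 ≤ w.1.2 ∧ w.1.2 ≤ 1 := by
        by_contra hn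
        simp [hn] at hw
      exact ⟨(h.base_mem _).1.trans (this.1.trans this.2.1), this.2.2, le_rfl⟩)
    h₀.hasDerivAt h₀.continuous_deriv hη.hasDerivAt hη.continuous_deriv hb hb' 1
  have e (g k : ℝ → ℂ) : int₃ ν u b (fun t z y x => g z * f₁ y * f₂ x * k (z - y + x - σ t))
      = ∫ q : ((Y × ℝ) × ℝ) × ℝ, ((if b q.1.1.1 ≤ q.1.2 ∧ q.1.2 ≤ q.1.1.2 ∧ q.1.1.2 ≤ 1
          then u q.1.1.1 else 0) * (f₁ q.1.1.2 * f₂ q.1.2)) *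
          ((Icc q.1.1.2 1).indicator g q.2 * k (1 * q.2 + (-q.1.1.2 + q.1.2 - σ q.1.1.1)))
          ∂(((ν.prod volume).prod volume).prod volume) := by
    unfold int₃
    rw [integral_rotate]
    refine integral_congr_ae (Eventually.of_forall fun q => ite_mul_indicator ?_ ?_)
    · simp only [mem_Icc]; constructor
      · rintro ⟨a1, a2, a3, a4⟩; exact ⟨⟨a1, a2, a3.trans a4⟩, a3, a4⟩
      · rintro ⟨⟨a1, a3, a4⟩, a5, a2⟩; exact ⟨a1, a3, a5, a2⟩
    · rw [show 1 * q.2 + (-q.1.1.2 + q.1.2 - σ q.1.1.1) = q.2 - q.1.1.2 + q.1.2 - σ q.1.1.1 by ring]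
      ring
  have e1 : int₂ ν u b (fun t z x => f₀ z * f₁ z * f₂ x * η (x - σ t))
      = ∫ w : (Y × ℝ) × ℝ, ((if b w.1.1 ≤ w.2 ∧ w.2 ≤ w.1.2 ∧ w.1.2 ≤ 1 then u w.1.1 else 0)
        * (f₁ w.1.2 * f₂ w.2)) * (f₀ w.1.2 * η (1 * w.1.2 + (-w.1.2 + w.2 - σ w.1.1)))
          ∂((ν.prod volume).prod volume) := by
    refine integral_congr_ae (Eventually.of_forall fun q => ?_)
    simp only
    rw [show 1 * q.1.2 + (-q.1.2 + q.2 - σ q.1.1) = q.2 - σ q.1.1 by ring]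
    ring
  have ea : int₂ ν u b (fun t y x => f₀ 1 * f₁ y * f₂ x * η (1 - y + x - σ t))
      = ∫ w : (Y × ℝ) × ℝ, ((if b w.1.1 ≤ w.2 ∧ w.2 ≤ w.1.2 ∧ w.1.2 ≤ 1 then u w.1.1 else 0)
        * (f₁ w.1.2 * f₂ w.2)) * (f₀ 1 * η (1 * 1 + (-w.1.2 + w.2 - σ w.1.1)))
          ∂((ν.prod volume).prod volume) := by
    refine integral_congr_ae (Eventually.of_forall fun q => ?_)
    simp only
    rw [show 1 * 1 + (-q.1.2 + q.2 - σ q.1.1) = 1 - q.1.2 + q.2 - σ q.1.1 by ring]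
    ring
  rw [e f₀ η', e f₀' η, e1, ea]
  push_cast at key
  linear_combination key

/-- At the lower end x = b the test function is evaluated at b − σ, which depends on the tail alone.
-/
lemma int₂_parts_inner (h : IsTail ν u b σ N) (h₀ : Continuous f₀) (h₁ : Continuous f₁)
    (h₂ : IsC1 f₂ f₂') (hη : IsC1 η η') (hb : ∀ x, ‖η x‖ ≤ B) (hb' : ∀ x, ‖η' x‖ ≤ B) :
    int₂ ν u b (fun t z x => f₀ z * f₁ z * f₂ x * η' (x - σ t))
      = int₁ ν u b (fun t z => f₀ z * f₁ z * f₂ z * η (z - σ t))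
        - int₁ ν u b (fun t z => f₀ z * f₁ z * f₂ (b t) * η (b t - σ t))
        - int₂ ν u b (fun t z x => f₀ z * f₁ z * f₂' x * η (x - σ t)) := by
  have mb := h.measurable_base
  have mσ := h.measurable_shift
  obtain ⟨C₀, hC₀, hC₀'⟩ := exists_bound_Icc h₀
  obtain ⟨C₁, hC₁, hC₁'⟩ := exists_bound_Icc h₁
  have iH := h.integrable₁ (F := fun q => f₀ q.2 * f₁ q.2) (C := C₀ * C₁) (by fun_prop)
    fun q h1 => by
      rw [norm_mul]
      exact mul_le_mul (hC₀' _ h1) (hC₁' _ h1) (norm_nonneg _) hC₀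
  have key := integral_prod_by_parts iH (lo := fun w => b w.1) (hi := fun w => w.2)
    (c := fun w => - σ w.1) (by fun_prop) (by fun_prop) (by fun_prop)
    (fun w hw => by
      have : b w.1 ≤ w.2 ∧ w.2 ≤ 1 := by
        by_contra hn
        simp [hn] at hw
      exact ⟨(h.base_mem _).1, this.1, this.2⟩)
    h₂.hasDerivAt h₂.continuous_deriv hη.hasDerivAt hη.continuous_deriv hb hb' 1
  have e (g k : ℝ → ℂ) : int₂ ν u b (fun t z x => f₀ z * f₁ z * g x * k (x - σ t))
      = ∫ q : (Y × ℝ) × ℝ, ((if b q.1.1 ≤ q.1.2 ∧ q.1.2 ≤ 1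
          then u q.1.1 else 0) * (f₀ q.1.2 * f₁ q.1.2)) *
          ((Icc (b q.1.1) q.1.2).indicator g q.2 * k (1 * q.2 + - σ q.1.1))
          ∂((ν.prod volume).prod volume) := by
    unfold int₂
    refine integral_congr_ae (Eventually.of_forall fun q => ite_mul_indicator ?_ ?_)
    · simp only [mem_Icc]; constructor
      · rintro ⟨a1, a2, a3⟩; exact ⟨⟨a1.trans a2, a3⟩, a1, a2⟩
      · rintro ⟨⟨a1, a3⟩, a5, a2⟩; exact ⟨a5, a2, a3⟩
    · rw [show 1 * q.2 + - σ q.1.1 = q.2 - σ q.1.1 by ring]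
      ring
  have e1 (k : Y × ℝ → ℝ) : int₁ ν u b (fun t z => f₀ z * f₁ z * f₂ (k (t, z)) * η (k (t, z) - σ t))
      = ∫ w : Y × ℝ, ((if b w.1 ≤ w.2 ∧ w.2 ≤ 1 then u w.1 else 0)
        * (f₀ w.2 * f₁ w.2)) * (f₂ (k w) * η (1 * k w + - σ w.1)) ∂(ν.prod volume) := by
    refine integral_congr_ae (Eventually.of_forall fun q => ?_)
    simp only
    rw [show 1 * k q + - σ q.1 = k q - σ q.1 by ring]
    ring
  have ea := e1 fun q => q.2
  have eb := e1 fun q => b q.1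
  simp only at ea eb
  rw [e f₂ η', e f₂' η, ea, eb]
  push_cast at key
  linear_combination key

/-- At the upper end z = 1 the test function is evaluated at 1 − σ, which depends on the tail alone.
-/
lemma int₂_parts_outer (h : IsTail ν u b σ N) (h₀ : IsC1 f₀ f₀') (h₁ : Continuous f₁)
    (h₂ : Continuous f₂) (hη : IsC1 η η') (hb : ∀ x, ‖η x‖ ≤ B) (hb' : ∀ x, ‖η' x‖ ≤ B) :
    int₂ ν u b (fun t z y => f₀ z * f₁ y * f₂ y * η' (z - σ t))
      = int₁ ν u b (fun t y => f₀ 1 * f₁ y * f₂ y * η (1 - σ t))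
        - int₁ ν u b (fun t y => f₀ y * f₁ y * f₂ y * η (y - σ t))
        - int₂ ν u b (fun t z y => f₀' z * f₁ y * f₂ y * η (z - σ t)) := by
  have mb := h.measurable_base
  have mσ := h.measurable_shift
  obtain ⟨C₂, hC₂, hC₂'⟩ := exists_bound_Icc h₂
  obtain ⟨C₁, hC₁, hC₁'⟩ := exists_bound_Icc h₁
  have iH := h.integrable₁ (F := fun q => f₁ q.2 * f₂ q.2) (C := C₁ * C₂) (by fun_prop)
    fun q h1 => by
      rw [norm_mul]
      exact mul_le_mul (hC₁' _ h1) (hC₂' _ h1) (norm_nonneg _) hC₁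
  have key := integral_prod_by_parts iH (lo := fun w => w.2) (hi := fun w => 1)
    (c := fun w => - σ w.1) (by fun_prop) (by fun_prop) (by fun_prop)
    (fun w hw => by
      have : b w.1 ≤ w.2 ∧ w.2 ≤ 1 := by
        by_contra hn
        simp [hn] at hw
      exact ⟨(h.base_mem _).1.trans this.1, this.2, le_rfl⟩)
    h₀.hasDerivAt h₀.continuous_deriv hη.hasDerivAt hη.continuous_deriv hb hb' 1
  have e (g k : ℝ → ℂ) : int₂ ν u b (fun t z y => g z * f₁ y * f₂ y * k (z - σ t))
      = ∫ q : (Y × ℝ) × ℝ, ((if b q.1.1 ≤ q.1.2 ∧ q.1.2 ≤ 1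
          then u q.1.1 else 0) * (f₁ q.1.2 * f₂ q.1.2)) *
          ((Icc q.1.2 1).indicator g q.2 * k (1 * q.2 + - σ q.1.1))
          ∂((ν.prod volume).prod volume) := by
    unfold int₂
    rw [integral_swapLast]
    refine integral_congr_ae (Eventually.of_forall fun q => ite_mul_indicator ?_ ?_)
    · simp only [mem_Icc]; constructor
      · rintro ⟨a1, a2, a3⟩; exact ⟨⟨a1, a2.trans a3⟩, a2, a3⟩
      · rintro ⟨⟨a1, a3⟩, a5, a2⟩; exact ⟨a1, a5, a2⟩
    · rw [show 1 * q.2 + - σ q.1.1 = q.2 - σ q.1.1 by ring]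
      ring
  have e1 (k : ℝ → ℝ) : int₁ ν u b (fun t y => f₀ (k y) * f₁ y * f₂ y * η (k y - σ t))
      = ∫ w : Y × ℝ, ((if b w.1 ≤ w.2 ∧ w.2 ≤ 1 then u w.1 else 0)
        * (f₁ w.2 * f₂ w.2)) * (f₀ (k w.2) * η (1 * k w.2 + - σ w.1)) ∂(ν.prod volume) := by
    refine integral_congr_ae (Eventually.of_forall fun q => ?_)
    simp only
    rw [show 1 * k q.2 + - σ q.1 = k q.2 - σ q.1 by ring]
    ring
  have ea := e1 fun _ => 1
  have eb := e1 fun y => y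
  rw [e f₀ η', e f₀' η, ea, eb]
  push_cast at key
  linear_combination key

end Parts

/-! ### Bounds for the quadrilinear forms -/

lemma ofReal_norm_mul_le {F : ℂ} {K a b c : ℝ} (h : ‖F‖ ≤ K * (a * (b * c))) (hK : 0 ≤ K)
    (ha : 0 ≤ a) (hb : 0 ≤ b) : ‖F‖ₑ ≤ ENNReal.ofReal K *
      (ENNReal.ofReal a * (ENNReal.ofReal b * ENNReal.ofReal c)) := by
  rw [← ofReal_norm, ← ENNReal.ofReal_mul hb, ← ENNReal.ofReal_mul ha, ← ENNReal.ofReal_mul hK]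
  exact ENNReal.ofReal_le_ofReal h

lemma norm_le_of_enorm_le_ofReal {z : ℂ} {a : ℝ} (ha : 0 ≤ a) (h : ‖z‖ₑ ≤ ENNReal.ofReal a) :
    ‖z‖ ≤ a := by
  rwa [← ofReal_norm, ENNReal.ofReal_le_ofReal_iff ha] at h

lemma indicator_enorm_eq {η : ℝ → ℂ} (h : ∀ x ∉ Ioo (0 : ℝ) 1, η x = 0) (x : ℝ) :
    (Ioo (0 : ℝ) 1).indicator (fun x => ‖η x‖ₑ) x = ‖η x‖ₑ := by
  by_cases hx : x ∈ Ioo (0 : ℝ) 1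
  · simp [hx]
  · simp [hx, h x hx]

section Bounds

variable {Y : Type*} [MeasurableSpace Y] {ν : Measure Y} {u : Y → ℂ} {b σ : Y → ℝ}
  {N K : ℝ} {a₀ a₁ η : ℝ → ℂ}

/-- The last variable pairs a₁ with η by Cauchy–Schwarz, the L_1-norm of a₀ is at most its L_2-norm,
and the tail contributes its mass. -/
lemma norm_int₂_le (h : IsTail ν u b σ N) (hK : 0 ≤ K) (m₀ : Measurable a₀)
    (l₀ : MemLp a₀ 2 unitMeasure) (m₁ : Measurable a₁) (l₁ : MemLp a₁ 2 unitMeasure)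
    (mη : Measurable η) (lη : MemLp η 2 unitMeasure) (hη : ∀ x ∉ Ioo (0 : ℝ) 1, η x = 0)
    {ε : ℝ} (hε : ε = 1 ∨ ε = -1) {c : Y × ℝ → ℝ} (hc : Measurable c) {F : Y → ℝ → ℝ → ℂ}
    (hF : ∀ t, ∀ z ∈ Icc (0 : ℝ) 1, ∀ x ∈ Icc (0 : ℝ) 1,
      ‖F t z x‖ ≤ K * (‖a₀ z‖ * (‖a₁ x‖ * ‖η (ε * x + c (t, z))‖))) :
    ‖int₂ ν u b F‖ ≤ N * K * (‖cls a₀‖ * (‖cls a₁‖ * ‖cls η‖)) := by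
  have hN := h.nonneg
  refine norm_le_of_enorm_le_ofReal (by positivity)
    ((enorm_integral_le_lintegral_enorm _).trans ?_)
  have hu := h.measurable_weight
  have mI := m₀.enorm.indicator (measurableSet_Icc (a := (0 : ℝ)) (b := 1))
  have hG : Measurable fun w : Y × ℝ =>
      ‖u w.1‖ₑ * (Icc (0 : ℝ) 1).indicator (fun x => ‖a₀ x‖ₑ) w.2 :=
    (hu.enorm.comp measurable_fst).mul (mI.comp measurable_snd)
  have e : ENNReal.ofReal (N * K * (‖cls a₀‖ * (‖cls a₁‖ * ‖cls η‖)))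
      = ENNReal.ofReal K * (ENNReal.ofReal N * e2 (fun x => ‖a₀ x‖ₑ)
        * (e2 (fun x => ‖a₁ x‖ₑ) * e2 (fun x => ‖η x‖ₑ))) := by
    rw [e2_enorm_eq_ofReal l₀, e2_enorm_eq_ofReal l₁, e2_enorm_eq_ofReal lη,
      ← ENNReal.ofReal_mul (norm_nonneg _), ← ENNReal.ofReal_mul hN,
      ← ENNReal.ofReal_mul (by positivity), ← ENNReal.ofReal_mul hK]
    congr 1; ring
  rw [e]
  refine le_trans ?_ (mul_le_mul_right (le_trans (lintegral_slab_le (μ := ν.prod volume) hG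
    m₁.enorm mη.enorm hε hc) (mul_le_mul_left (le_trans
      (lintegral_mul_indicator_le hu.enorm m₀.enorm) (mul_le_mul_left h.mass _)) _)) _)
  rw [← lintegral_const_mul' _ _ ENNReal.ofReal_ne_top]
  refine lintegral_mono fun q => ?_
  simp only [indicator_enorm_eq hη]
  split_ifs with hq
  · have h0 := (h.base_mem q.1.1).1
    have h1 : q.1.2 ∈ Icc (0 : ℝ) 1 := ⟨h0.trans (hq.1.trans hq.2.1), hq.2.2⟩
    have h2 : q.2 ∈ Icc (0 : ℝ) 1 := ⟨h0.trans hq.1, hq.2.1.trans hq.2.2⟩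
    have h3 := ofReal_norm_mul_le (hF q.1.1 _ h1 _ h2) hK (norm_nonneg _) (norm_nonneg _)
    simp only [ofReal_norm] at h3
    rw [indicator_of_mem h1, indicator_of_mem h2, enorm_mul]
    refine (mul_le_mul_right h3 _).trans (le_of_eq ?_)
    ring
  · simp

lemma norm_int₁_slab_le (h : IsTail ν u b σ N) (hK : 0 ≤ K) (m₁ : Measurable a₁)
    (l₁ : MemLp a₁ 2 unitMeasure)
    (mη : Measurable η) (lη : MemLp η 2 unitMeasure) (hη : ∀ x ∉ Ioo (0 : ℝ) 1, η x = 0)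
    {F : Y → ℝ → ℂ} (hF : ∀ t, ∀ x ∈ Icc (0 : ℝ) 1, ‖F t x‖ ≤ K * (‖a₁ x‖ * ‖η (x - σ t)‖)) :
    ‖int₁ ν u b F‖ ≤ N * K * (‖cls a₁‖ * ‖cls η‖) := by
  have hN := h.nonneg
  refine norm_le_of_enorm_le_ofReal (by positivity)
    ((enorm_integral_le_lintegral_enorm _).trans ?_)
  have hu := h.measurable_weight
  have hσ := h.measurable_shift
  have e : ENNReal.ofReal (N * K * (‖cls a₁‖ * ‖cls η‖))
      = ENNReal.ofReal K * (ENNReal.ofReal N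
        * (e2 (fun x => ‖a₁ x‖ₑ) * e2 (fun x => ‖η x‖ₑ))) := by
    rw [e2_enorm_eq_ofReal l₁, e2_enorm_eq_ofReal lη,
      ← ENNReal.ofReal_mul (norm_nonneg _), ← ENNReal.ofReal_mul hN, ← ENNReal.ofReal_mul hK]
    congr 1; ring
  rw [e]
  refine le_trans ?_ (mul_le_mul_right (le_trans (lintegral_slab_le (μ := ν) hu.enorm
    m₁.enorm mη.enorm (Or.inl rfl) hσ.neg) (mul_le_mul_left h.mass _)) _)
  rw [← lintegral_const_mul' _ _ ENNReal.ofReal_ne_top]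
  refine lintegral_mono fun q => ?_
  simp only [indicator_enorm_eq hη]
  split_ifs with hq
  · have h0 := (h.base_mem q.1).1
    have h2 : q.2 ∈ Icc (0 : ℝ) 1 := ⟨h0.trans hq.1, hq.2⟩
    have h3 := ofReal_norm_mul_le (a := 1) ((hF q.1 _ h2).trans_eq (by rw [one_mul])) hK zero_le_one
      (norm_nonneg _)
    simp only [ofReal_norm, ENNReal.ofReal_one, one_mul] at h3
    rw [indicator_of_mem h2, enorm_mul, Pi.neg_apply, one_mul, ← sub_eq_add_neg]
    refine (mul_le_mul_right h3 _).trans (le_of_eq ?_)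
    ring
  · simp

lemma lintegral_Icc_mul_le {a c : ℝ → ℝ≥0∞} (ha : Measurable a) (hc : Measurable c) :
    ∫⁻ x, (Icc (0 : ℝ) 1).indicator (fun x => a x * c x) x ≤ e2 a * e2 c := by
  rw [lintegral_Icc_eq]
  exact ENNReal.lintegral_mul_le_Lp_mul_Lq unitMeasure Real.HolderConjugate.two_two
    ha.aemeasurable hc.aemeasurable

/-- Here η depends only on the tail, so no space variable can absorb it; `hj` is supplied by the
jump conditions of `IsTail`. -/
lemma norm_int₁_jump_le (h : IsTail ν u b σ N) (hK : 0 ≤ K) (m₀ : Measurable a₀)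
    (l₀ : MemLp a₀ 2 unitMeasure) (m₁ : Measurable a₁) (l₁ : MemLp a₁ 2 unitMeasure)
    (mη : Measurable η) (lη : MemLp η 2 unitMeasure) {k : Y → ℝ}
    (hk : Measurable k) (hj : ∫⁻ t, ‖u t‖ₑ * ‖η (k t)‖ₑ ∂ν
      ≤ ENNReal.ofReal N * e2 fun x => ‖η x‖ₑ)
    {F : Y → ℝ → ℂ} (hF : ∀ t, ∀ x ∈ Icc (0 : ℝ) 1, ‖F t x‖ ≤ K * (‖a₀ x‖ * (‖a₁ x‖ * ‖η (k t)‖))) :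
    ‖int₁ ν u b F‖ ≤ N * K * (‖cls a₀‖ * (‖cls a₁‖ * ‖cls η‖)) := by
  have hN := h.nonneg
  refine norm_le_of_enorm_le_ofReal (by positivity)
    ((enorm_integral_le_lintegral_enorm _).trans ?_)
  have hu := h.measurable_weight
  have e : ENNReal.ofReal (N * K * (‖cls a₀‖ * (‖cls a₁‖ * ‖cls η‖)))
      = ENNReal.ofReal K * ((ENNReal.ofReal N * e2 (fun x => ‖η x‖ₑ))
        * (e2 (fun x => ‖a₀ x‖ₑ) * e2 (fun x => ‖a₁ x‖ₑ))) := by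
    rw [e2_enorm_eq_ofReal l₀, e2_enorm_eq_ofReal l₁, e2_enorm_eq_ofReal lη,
      ← ENNReal.ofReal_mul (norm_nonneg _), ← ENNReal.ofReal_mul hN,
      ← ENNReal.ofReal_mul (by positivity), ← ENNReal.ofReal_mul hK]
    congr 1; ring
  rw [e]
  refine le_trans ?_ (mul_le_mul_right (mul_le_mul' hj
    (lintegral_Icc_mul_le m₀.enorm m₁.enorm)) _)
  have e' := lintegral_prod_mul (μ := ν) (ν := volume) (f := fun t => ‖u t‖ₑ * ‖η (k t)‖ₑ)
    (g := (Icc (0 : ℝ) 1).indicator fun x => ‖a₀ x‖ₑ * ‖a₁ x‖ₑ)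
    (hu.enorm.mul (mη.enorm.comp hk)).aemeasurable
    ((m₀.enorm.mul m₁.enorm).indicator measurableSet_Icc).aemeasurable
  rw [← e', ← lintegral_const_mul' _ _ ENNReal.ofReal_ne_top]
  refine lintegral_mono fun q => ?_
  simp only
  split_ifs with hq
  · have h0 := (h.base_mem q.1).1
    have h2 : q.2 ∈ Icc (0 : ℝ) 1 := ⟨h0.trans hq.1, hq.2⟩
    have h3 := ofReal_norm_mul_le (hF q.1 _ h2) hK (norm_nonneg _) (norm_nonneg _)
    simp only [ofReal_norm] at h3
    rw [indicator_of_mem h2, enorm_mul]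
    refine (mul_le_mul_right h3 _).trans (le_of_eq ?_)
    ring
  · simp

/-! ### The forms on `L_2(0,1)` -/

/-- Only x is paired with the test function by Cauchy–Schwarz; then y and z are integrated out in
L_1 ≤ L_2, and the mass of the tail remains. -/
lemma IsTail.exists_form₃ (h : IsTail ν u b σ N) :
    ∃ T : ContinuousMultilinearMap ℂ (fun _ : Fin 4 => L2) ℂ,
      (∀ f : Fin 4 → ℝ → ℂ, (∀ i, Measurable (f i)) → (∀ i, MemLp (f i) 2 unitMeasure) →
        (∀ x ∉ Ioo (0 : ℝ) 1, f 3 x = 0) → T (fun i => cls (f i)) = int₃ ν u b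
          fun t z y x => f 0 z * f 1 y * f 2 x * f 3 (z - y + x - σ t)) ∧
      ∀ ψ : Fin 4 → L2, ‖T ψ‖ ≤ N * ∏ i, ‖ψ i‖ := by
  have hu := h.measurable_weight
  have hσ := h.measurable_shift
  let p : Fin 4 → ((Y × ℝ) × ℝ) × ℝ → ℝ := ![fun q => q.1.1.2, fun q => q.1.2, fun q => q.2,
    fun q => q.1.1.2 - q.1.2 + q.2 - σ q.1.1.1]
  -- The region records that the argument of the last function lies in (0,1), outside which its
  -- L_2-norm says nothing. For functions vanishing there the integral is unchanged.
  let R : Set (((Y × ℝ) × ℝ) × ℝ) := {q | b q.1.1.1 ≤ q.2 ∧ q.2 ≤ q.1.2 ∧ q.1.2 ≤ q.1.1.2 ∧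
    q.1.1.2 ≤ 1} ∩ p 3 ⁻¹' Ioo 0 1
  let v : ((Y × ℝ) × ℝ) × ℝ → ℂ := R.indicator fun q => u q.1.1.1
  have hp (i : Fin 4) : Measurable (p i) := by
    match i with
    | 0 => exact (by fun_prop : Measurable fun q : ((Y × ℝ) × ℝ) × ℝ => q.1.1.2)
    | 1 => exact (by fun_prop : Measurable fun q : ((Y × ℝ) × ℝ) × ℝ => q.1.2)
    | 2 => exact measurable_snd
    | 3 => exact (by fun_prop : Measurable fun q : ((Y × ℝ) × ℝ) × ℝ =>
        q.1.1.2 - q.1.2 + q.2 - σ q.1.1.1)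
  have hv : Measurable v := (hu.comp (by fun_prop)).indicator
    ((measurableSet_region₃ h.measurable_base).inter (measurableSet_Ioo.preimage (hp 3)))
  have H : IsFormBound (((ν.prod volume).prod volume).prod volume) v p N := by
    intro g hg
    have i0 := (hg 0).indicator (measurableSet_Icc (a := (0 : ℝ)) (b := 1))
    have i1 := (hg 1).indicator (measurableSet_Icc (a := (0 : ℝ)) (b := 1))
    have hG0 : Measurable fun w : Y × ℝ => ‖u w.1‖ₑ * (Icc (0 : ℝ) 1).indicator (g 0) w.2 :=
      (hu.enorm.comp measurable_fst).mul (i0.comp measurable_snd)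
    have hG1 : Measurable fun w : (Y × ℝ) × ℝ => (‖u w.1.1‖ₑ *
        (Icc (0 : ℝ) 1).indicator (g 0) w.1.2) * (Icc (0 : ℝ) 1).indicator (g 1) w.2 :=
      (hG0.comp measurable_fst).mul (i1.comp measurable_snd)
    refine le_trans (lintegral_mono fun q => ?_) (le_trans (lintegral_slab_le
      (μ := (ν.prod volume).prod volume) hG1 (hg 2) (hg 3) (Or.inl rfl)
      (c := fun w => w.1.2 - w.2 - σ w.1.1) (by fun_prop)) ((mul_le_mul_left
        ((lintegral_mul_indicator_le hG0 (hg 1)).trans (mul_le_mul_left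
        ((lintegral_mul_indicator_le hu.enorm (hg 0)).trans (mul_le_mul_left h.mass _)) _))
        _).trans (le_of_eq ?_)))
    · by_cases hq : q ∈ R
      · have h0 := (h.base_mem q.1.1.1).1
        have hvq : v q = u q.1.1.1 := indicator_of_mem hq _
        obtain ⟨⟨q1, q2, q3, q4⟩, q5⟩ := hq
        have h0 : q.1.1.2 ∈ Icc (0 : ℝ) 1 := ⟨h0.trans (q1.trans (q2.trans q3)), q4⟩
        have h1 : q.1.2 ∈ Icc (0 : ℝ) 1 :=
          ⟨(h.base_mem q.1.1.1).1.trans (q1.trans q2), q3.trans q4⟩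
        have h2 : q.2 ∈ Icc (0 : ℝ) 1 :=
          ⟨(h.base_mem q.1.1.1).1.trans q1, q2.trans (q3.trans q4)⟩
        have h3 : q.1.1.2 - q.1.2 + q.2 - σ q.1.1.1 ∈ Ioo (0 : ℝ) 1 := q5
        rw [hvq, show 1 * q.2 + (q.1.1.2 - q.1.2 - σ q.1.1.1) = q.1.1.2 - q.1.2 + q.2 - σ q.1.1.1 by ring,
          indicator_of_mem h0, indicator_of_mem h1, indicator_of_mem h2, indicator_of_mem h3,
          Fin.prod_univ_four]
        simp only [p, Matrix.cons_val]
        exact le_of_eq (by ring)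
      · simp [v, hq]
    · rw [Fin.prod_univ_four]; ring
  obtain ⟨T, hT, hT'⟩ := exists_form hv hp h.nonneg H
  refine ⟨T, fun f hf hf2 hf0 => (hT f hf hf2).trans ?_, hT'⟩
  refine integral_congr_ae (Eventually.of_forall fun q => ?_)
  simp only [Fin.prod_univ_four]
  by_cases h3 : p 3 q ∈ Ioo (0 : ℝ) 1
  · have : v q = if b q.1.1.1 ≤ q.2 ∧ q.2 ≤ q.1.2 ∧ q.1.2 ≤ q.1.1.2 ∧ q.1.1.2 ≤ 1
        then u q.1.1.1 else 0 := by
      split_ifs with hq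
      · exact indicator_of_mem (s := R) ⟨hq, h3⟩ _
      · exact indicator_of_notMem (s := R) (fun hh => hq hh.1) _
    rw [this]
    rfl
  · have e : f 3 (q.1.1.2 - q.1.2 + q.2 - σ q.1.1.1) = 0 := hf0 _ h3
    rw [hf0 _ h3, e]
    simp

/-- Common construction for the two diagonal forms, which differ in the arguments `p` and hence in
the estimate `H`. -/
lemma IsTail.exists_form₂ (h : IsTail ν u b σ N) {p : Fin 4 → (Y × ℝ) × ℝ → ℝ}
    (hp : ∀ i, Measurable (p i))
    (H : ∀ g : Fin 4 → ℝ → ℝ≥0∞, (∀ i, Measurable (g i)) →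
      ∫⁻ q : (Y × ℝ) × ℝ, ({q | b q.1.1 ≤ q.2 ∧ q.2 ≤ q.1.2 ∧ q.1.2 ≤ 1} ∩
        p 3 ⁻¹' Ioo 0 1).indicator (fun q => ‖u q.1.1‖ₑ) q * ∏ i, g i (p i q)
        ∂((ν.prod volume).prod volume) ≤ ENNReal.ofReal N * ∏ i, e2 (g i)) :
    ∃ T : ContinuousMultilinearMap ℂ (fun _ : Fin 4 => L2) ℂ,
      (∀ f : Fin 4 → ℝ → ℂ, (∀ i, Measurable (f i)) → (∀ i, MemLp (f i) 2 unitMeasure) →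
        (∀ x ∉ Ioo (0 : ℝ) 1, f 3 x = 0) → T (fun i => cls (f i)) = int₂ ν u b
          fun t z x => ∏ i, f i (p i ((t, z), x))) ∧
      ∀ ψ : Fin 4 → L2, ‖T ψ‖ ≤ N * ∏ i, ‖ψ i‖ := by
  have hu := h.measurable_weight
  let R : Set ((Y × ℝ) × ℝ) := {q | b q.1.1 ≤ q.2 ∧ q.2 ≤ q.1.2 ∧ q.1.2 ≤ 1} ∩ p 3 ⁻¹' Ioo 0 1
  let v : (Y × ℝ) × ℝ → ℂ := R.indicator fun q => u q.1.1
  have hv : Measurable v := (hu.comp (by fun_prop)).indicator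
    ((measurableSet_region₂ h.measurable_base).inter (measurableSet_Ioo.preimage (hp 3)))
  have H' : IsFormBound ((ν.prod volume).prod volume) v p N := by
    intro g hg
    refine le_trans (le_of_eq (lintegral_congr fun q => ?_)) (H g hg)
    simp only [v, R, enorm_indicator_eq_indicator_enorm]
  obtain ⟨T, hT, hT'⟩ := exists_form hv hp h.nonneg H'
  refine ⟨T, fun f hf hf2 hf0 => (hT f hf hf2).trans ?_, hT'⟩
  refine integral_congr_ae (Eventually.of_forall fun q => ?_)
  by_cases h3 : p 3 q ∈ Ioo (0 : ℝ) 1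
  · have : v q = if b q.1.1 ≤ q.2 ∧ q.2 ≤ q.1.2 ∧ q.1.2 ≤ 1 then u q.1.1 else 0 := by
      split_ifs with hq
      · exact indicator_of_mem (s := R) ⟨hq, h3⟩ _
      · exact indicator_of_notMem (s := R) (fun hh => hq hh.1) _
    simp only [this]
  · have e : ∏ i, f i (p i q) = 0 := Finset.prod_eq_zero (Finset.mem_univ 3) (hf0 _ h3)
    simp only [e, mul_zero]

/-- Cauchy–Schwarz twice: f₀ is paired with the test function in z, and f₁ with f₂ in y. -/
lemma IsTail.exists_form_outer (h : IsTail ν u b σ N) :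
    ∃ T : ContinuousMultilinearMap ℂ (fun _ : Fin 4 => L2) ℂ,
      (∀ f : Fin 4 → ℝ → ℂ, (∀ i, Measurable (f i)) → (∀ i, MemLp (f i) 2 unitMeasure) →
        (∀ x ∉ Ioo (0 : ℝ) 1, f 3 x = 0) → T (fun i => cls (f i)) = int₂ ν u b
          fun t z y => f 0 z * f 1 y * f 2 y * f 3 (z - σ t)) ∧
      ∀ ψ : Fin 4 → L2, ‖T ψ‖ ≤ N * ∏ i, ‖ψ i‖ := by
  have hu := h.measurable_weight
  have hσ := h.measurable_shift
  let p : Fin 4 → (Y × ℝ) × ℝ → ℝ := ![fun q => q.1.2, fun q => q.2, fun q => q.2,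
    fun q => q.1.2 - σ q.1.1]
  have hp (i : Fin 4) : Measurable (p i) := by
    match i with
    | 0 => exact (by fun_prop : Measurable fun q : (Y × ℝ) × ℝ => q.1.2)
    | 1 => exact measurable_snd
    | 2 => exact measurable_snd
    | 3 => exact (by fun_prop : Measurable fun q : (Y × ℝ) × ℝ => q.1.2 - σ q.1.1)
  refine (h.exists_form₂ hp fun g hg => ?_).imp fun T hT =>
    ⟨fun f hf hf2 hf0 => (hT.1 f hf hf2 hf0).trans ?_, hT.2⟩
  rotate_left
  · simp only [Fin.prod_univ_four]
    rfl
  have i0 := (hg 0).indicator (measurableSet_Icc (a := (0 : ℝ)) (b := 1))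
  have i3 := (hg 3).indicator (measurableSet_Ioo (a := (0 : ℝ)) (b := 1))
  have hG : Measurable fun w : Y × ℝ => ‖u w.1‖ₑ * ((Icc (0 : ℝ) 1).indicator (g 0) w.2 *
      (Ioo (0 : ℝ) 1).indicator (g 3) (1 * w.2 + -σ w.1)) :=
    (hu.enorm.comp measurable_fst).mul ((i0.comp measurable_snd).mul (i3.comp (by fun_prop)))
  have h12 := ((hg 1).mul (hg 2)).indicator (measurableSet_Icc (a := (0 : ℝ)) (b := 1))
  refine le_trans (lintegral_mono fun q => ?_) (le_trans (lintegral_prod_mul (μ := ν.prod volume)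
    (ν := volume) hG.aemeasurable h12.aemeasurable).le ((mul_le_mul' ((lintegral_slab_le hu.enorm
      (hg 0) (hg 3) (Or.inl rfl) hσ.neg).trans (mul_le_mul_left h.mass _))
      (lintegral_Icc_mul_le (hg 1) (hg 2))).trans (le_of_eq ?_)))
  · by_cases hq : q ∈ {q : (Y × ℝ) × ℝ | b q.1.1 ≤ q.2 ∧ q.2 ≤ q.1.2 ∧ q.1.2 ≤ 1} ∩
        p 3 ⁻¹' Ioo 0 1
    · have hb := (h.base_mem q.1.1).1
      rw [indicator_of_mem hq]
      obtain ⟨⟨q1, q2, q3⟩, q5⟩ := hq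
      have h0 : q.1.2 ∈ Icc (0 : ℝ) 1 := ⟨hb.trans (q1.trans q2), q3⟩
      have h1 : q.2 ∈ Icc (0 : ℝ) 1 := ⟨hb.trans q1, q2.trans q3⟩
      have h3 : q.1.2 - σ q.1.1 ∈ Ioo (0 : ℝ) 1 := q5
      rw [one_mul, ← sub_eq_add_neg, indicator_of_mem h0, indicator_of_mem h1,
        indicator_of_mem h3, Fin.prod_univ_four]
      simp only [p, Matrix.cons_val, Pi.mul_apply]
      exact le_of_eq (by ring)
    · rw [indicator_of_notMem hq, zero_mul]
      exact zero_le
  · rw [Fin.prod_univ_four]; ring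

/-- Cauchy–Schwarz twice: f₂ is paired with the test function in x, and f₀ with f₁ in z. -/
lemma IsTail.exists_form_inner (h : IsTail ν u b σ N) :
    ∃ T : ContinuousMultilinearMap ℂ (fun _ : Fin 4 => L2) ℂ,
      (∀ f : Fin 4 → ℝ → ℂ, (∀ i, Measurable (f i)) → (∀ i, MemLp (f i) 2 unitMeasure) →
        (∀ x ∉ Ioo (0 : ℝ) 1, f 3 x = 0) → T (fun i => cls (f i)) = int₂ ν u b
          fun t z x => f 0 z * f 1 z * f 2 x * f 3 (x - σ t)) ∧
      ∀ ψ : Fin 4 → L2, ‖T ψ‖ ≤ N * ∏ i, ‖ψ i‖ := by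
  have hu := h.measurable_weight
  have hσ := h.measurable_shift
  let p : Fin 4 → (Y × ℝ) × ℝ → ℝ := ![fun q => q.1.2, fun q => q.1.2, fun q => q.2,
    fun q => q.2 - σ q.1.1]
  have hp (i : Fin 4) : Measurable (p i) := by
    match i with
    | 0 => exact (by fun_prop : Measurable fun q : (Y × ℝ) × ℝ => q.1.2)
    | 1 => exact (by fun_prop : Measurable fun q : (Y × ℝ) × ℝ => q.1.2)
    | 2 => exact measurable_snd
    | 3 => exact (by fun_prop : Measurable fun q : (Y × ℝ) × ℝ => q.2 - σ q.1.1)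
  refine (h.exists_form₂ hp fun g hg => ?_).imp fun T hT =>
    ⟨fun f hf hf2 hf0 => (hT.1 f hf hf2 hf0).trans ?_, hT.2⟩
  rotate_left
  · simp only [Fin.prod_univ_four]
    rfl
  have h01 := ((hg 0).mul (hg 1)).indicator (measurableSet_Icc (a := (0 : ℝ)) (b := 1))
  have hG : Measurable fun w : Y × ℝ => ‖u w.1‖ₑ *
      (Icc (0 : ℝ) 1).indicator (fun x => g 0 x * g 1 x) w.2 :=
    (hu.enorm.comp measurable_fst).mul (h01.comp measurable_snd)
  refine le_trans (lintegral_mono fun q => ?_) (le_trans (lintegral_slab_le (μ := ν.prod volume)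
    hG (hg 2) (hg 3) (Or.inl rfl) (c := fun w => -σ w.1) (by fun_prop)) ((mul_le_mul_left
      ((lintegral_prod_mul hu.enorm.aemeasurable h01.aemeasurable).le.trans
      (mul_le_mul' h.mass (lintegral_Icc_mul_le (hg 0) (hg 1)))) _).trans (le_of_eq ?_)))
  · by_cases hq : q ∈ {q : (Y × ℝ) × ℝ | b q.1.1 ≤ q.2 ∧ q.2 ≤ q.1.2 ∧ q.1.2 ≤ 1} ∩
        p 3 ⁻¹' Ioo 0 1
    · have hb := (h.base_mem q.1.1).1
      rw [indicator_of_mem hq]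
      obtain ⟨⟨q1, q2, q3⟩, q5⟩ := hq
      have h0 : q.1.2 ∈ Icc (0 : ℝ) 1 := ⟨hb.trans (q1.trans q2), q3⟩
      have h1 : q.2 ∈ Icc (0 : ℝ) 1 := ⟨hb.trans q1, q2.trans q3⟩
      have h3 : q.2 - σ q.1.1 ∈ Ioo (0 : ℝ) 1 := q5
      rw [one_mul, ← sub_eq_add_neg, indicator_of_mem h0, indicator_of_mem h1,
        indicator_of_mem h3, Fin.prod_univ_four]
      simp only [p, Matrix.cons_val]
      exact le_of_eq (by ring)
    · rw [indicator_of_notMem hq, zero_mul]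
      exact zero_le
  · rw [Fin.prod_univ_four]; ring

end Bounds

/-! ### Integration by parts for the forms on `L_2(0,1)` -/

lemma cls_vec (f₀ f₁ f₂ f₃ : ℝ → ℂ) :
    (fun i => cls ((![f₀, f₁, f₂, f₃] : Fin 4 → ℝ → ℂ) i)) = ![cls f₀, cls f₁, cls f₂, cls f₃] := by
  ext1 i
  fin_cases i <;> rfl

/-- The relations between the three quadrilinear forms that are used in the interpolation
argument. -/
structure IsFormTriple (T A B : ContinuousMultilinearMap ℂ (fun _ : Fin 4 => L2) ℂ) (N : ℝ) :
    Prop where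
  nonneg : 0 ≤ N
  norm_le : ∀ ψ, ‖T ψ‖ ≤ N * ∏ i, ‖ψ i‖
  norm_outer_le : ∀ ψ, ‖A ψ‖ ≤ N * ∏ i, ‖ψ i‖
  norm_inner_le : ∀ ψ, ‖B ψ‖ ≤ N * ∏ i, ‖ψ i‖
  parts_middle : ∀ f₀ f₁ f₁' f₂ φ : ℝ → ℂ, Continuous f₀ → IsC1 f₁ f₁' → Continuous f₂ →
    φ ∈ testFun → T ![cls f₀, cls f₁, cls f₂, cls (deriv φ)]
      = T ![cls f₀, cls f₁', cls f₂, cls φ] - B ![cls f₀, cls f₁, cls f₂, cls φ]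
        + A ![cls f₀, cls f₁, cls f₂, cls φ]
  parts_outer : ∀ (f₀ f₀' f₁ f₂ φ : ℝ → ℂ) (s₀ : ℝ), IsC1 f₀ f₀' → Continuous f₁ → Continuous f₂ →
    φ ∈ testFun → (∀ x, ‖f₀ x‖ ≤ s₀) →
    ‖T ![cls f₀, cls f₁, cls f₂, cls (deriv φ)] + B ![cls f₀, cls f₁, cls f₂, cls φ]
      + T ![cls f₀', cls f₁, cls f₂, cls φ]‖ ≤ N * s₀ * (‖cls f₁‖ * (‖cls f₂‖ * ‖cls φ‖))
  parts_inner : ∀ (f₀ f₁ f₂ f₂' φ : ℝ → ℂ) (s₂ : ℝ), Continuous f₀ → Continuous f₁ → IsC1 f₂ f₂' →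
    φ ∈ testFun → (∀ x, ‖f₂ x‖ ≤ s₂) →
    ‖T ![cls f₀, cls f₁, cls f₂, cls (deriv φ)] - A ![cls f₀, cls f₁, cls f₂, cls φ]
      + T ![cls f₀, cls f₁, cls f₂', cls φ]‖ ≤ N * s₂ * (‖cls f₀‖ * (‖cls f₁‖ * ‖cls φ‖))
  outer_parts : ∀ (f₀ f₀' f₁ f₂ φ : ℝ → ℂ) (s₀ : ℝ), IsC1 f₀ f₀' → Continuous f₁ → Continuous f₂ →
    φ ∈ testFun → (∀ x, ‖f₀ x‖ ≤ s₀) →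
    (∀ s₁, (∀ x, ‖f₁ x‖ ≤ s₁) →
      ‖A ![cls f₀, cls f₁, cls f₂, cls (deriv φ)] + A ![cls f₀', cls f₁, cls f₂, cls φ]‖
        ≤ N * s₀ * (‖cls f₁‖ + s₁) * (‖cls f₂‖ * ‖cls φ‖)) ∧
    (∀ s₂, (∀ x, ‖f₂ x‖ ≤ s₂) →
      ‖A ![cls f₀, cls f₁, cls f₂, cls (deriv φ)] + A ![cls f₀', cls f₁, cls f₂, cls φ]‖
        ≤ N * s₀ * (‖cls f₂‖ + s₂) * (‖cls f₁‖ * ‖cls φ‖))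
  inner_parts : ∀ (f₀ f₁ f₂ f₂' φ : ℝ → ℂ) (s₂ : ℝ), Continuous f₀ → Continuous f₁ → IsC1 f₂ f₂' →
    φ ∈ testFun → (∀ x, ‖f₂ x‖ ≤ s₂) →
    (∀ s₀, (∀ x, ‖f₀ x‖ ≤ s₀) →
      ‖B ![cls f₀, cls f₁, cls f₂, cls (deriv φ)] + B ![cls f₀, cls f₁, cls f₂', cls φ]‖
        ≤ N * s₂ * (‖cls f₀‖ + s₀) * (‖cls f₁‖ * ‖cls φ‖)) ∧
    (∀ s₁, (∀ x, ‖f₁ x‖ ≤ s₁) →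
      ‖B ![cls f₀, cls f₁, cls f₂, cls (deriv φ)] + B ![cls f₀, cls f₁, cls f₂', cls φ]‖
        ≤ N * s₂ * (‖cls f₁‖ + s₁) * (‖cls f₀‖ * ‖cls φ‖))

lemma testFun.isC1 {φ : ℝ → ℂ} (h : φ ∈ testFun) : IsC1 φ (deriv φ) :=
  ⟨testFun.hasDerivAt h, testFun.continuous (testFun.deriv_mem h)⟩

lemma testFun.exists_bound {φ : ℝ → ℂ} (h : φ ∈ testFun) :
    ∃ C, (∀ x, ‖φ x‖ ≤ C) ∧ ∀ x, ‖deriv φ x‖ ≤ C := by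
  obtain ⟨C, hC⟩ := h.2.1.exists_bound_of_continuous (testFun.continuous h)
  have h' := testFun.deriv_mem h
  obtain ⟨C', hC'⟩ := h'.2.1.exists_bound_of_continuous (testFun.continuous h')
  exact ⟨max C C', fun x => (hC x).trans (le_max_left _ _), fun x => (hC' x).trans (le_max_right _ _)⟩

/-- Each relation is one of the integrations by parts, with every boundary term that is not a value
of T, A or B estimated directly. A factor evaluated at the fixed point 1 or at b enters through its
supremum. -/
lemma IsTail.exists_formTriple {Y : Type*} [MeasurableSpace Y] {ν : Measure Y} [SFinite ν]
    {u : Y → ℂ} {b σ : Y → ℝ} {N : ℝ} (h : IsTail ν u b σ N) :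
    ∃ T A B : ContinuousMultilinearMap ℂ (fun _ : Fin 4 => L2) ℂ, IsFormTriple T A B N ∧
      ∀ f : Fin 4 → ℝ → ℂ, (∀ i, Measurable (f i)) → (∀ i, MemLp (f i) 2 unitMeasure) →
        (∀ x ∉ Ioo (0 : ℝ) 1, f 3 x = 0) → T (fun i => cls (f i)) = int₃ ν u b
          fun t z y x => f 0 z * f 1 y * f 2 x * f 3 (z - y + x - σ t) := by
  obtain ⟨T, hT, hT'⟩ := h.exists_form₃
  obtain ⟨A, hA, hA'⟩ := h.exists_form_outer
  obtain ⟨B, hB, hB'⟩ := h.exists_form_inner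
  have mb := h.measurable_base
  have mσ := h.measurable_shift
  have vm {f₀ f₁ f₂ f₃ : ℝ → ℂ} (h₀ : Continuous f₀) (h₁ : Continuous f₁) (h₂ : Continuous f₂)
      (h₃ : Continuous f₃) (i : Fin 4) : Continuous ((![f₀, f₁, f₂, f₃] : Fin 4 → ℝ → ℂ) i) := by
    fin_cases i <;> assumption
  have eT {f₀ f₁ f₂ f₃ : ℝ → ℂ} (h₀ : Continuous f₀) (h₁ : Continuous f₁) (h₂ : Continuous f₂)
      (h₃ : f₃ ∈ testFun) : T ![cls f₀, cls f₁, cls f₂, cls f₃] = int₃ ν u b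
        fun t z y x => f₀ z * f₁ y * f₂ x * f₃ (z - y + x - σ t) := by
    have hc := vm h₀ h₁ h₂ (testFun.continuous h₃)
    rw [← cls_vec]
    exact hT _ (fun i => (hc i).measurable) (fun i => memLp_of_continuous (hc i))
      fun x hx => testFun.eq_zero h₃ hx
  have eA {f₀ f₁ f₂ f₃ : ℝ → ℂ} (h₀ : Continuous f₀) (h₁ : Continuous f₁) (h₂ : Continuous f₂)
      (h₃ : f₃ ∈ testFun) : A ![cls f₀, cls f₁, cls f₂, cls f₃] = int₂ ν u b
        fun t z y => f₀ z * f₁ y * f₂ y * f₃ (z - σ t) := by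
    have hc := vm h₀ h₁ h₂ (testFun.continuous h₃)
    rw [← cls_vec]
    exact hA _ (fun i => (hc i).measurable) (fun i => memLp_of_continuous (hc i))
      fun x hx => testFun.eq_zero h₃ hx
  have eB {f₀ f₁ f₂ f₃ : ℝ → ℂ} (h₀ : Continuous f₀) (h₁ : Continuous f₁) (h₂ : Continuous f₂)
      (h₃ : f₃ ∈ testFun) : B ![cls f₀, cls f₁, cls f₂, cls f₃] = int₂ ν u b
        fun t z x => f₀ z * f₁ z * f₂ x * f₃ (x - σ t) := by
    have hc := vm h₀ h₁ h₂ (testFun.continuous h₃)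
    rw [← cls_vec]
    exact hB _ (fun i => (hc i).measurable) (fun i => memLp_of_continuous (hc i))
      fun x hx => testFun.eq_zero h₃ hx
  refine ⟨T, A, B, ⟨h.nonneg, hT', hA', hB', ?_, ?_, ?_, ?_, ?_⟩, hT⟩
  · intro f₀ f₁ f₁' f₂ φ h₀ h₁ h₂ hφ
    obtain ⟨C, hC, hC'⟩ := testFun.exists_bound hφ
    rw [eT h₀ h₁.continuous h₂ (testFun.deriv_mem hφ), eT h₀ h₁.continuous_deriv h₂ hφ,
      eB h₀ h₁.continuous h₂ hφ, eA h₀ h₁.continuous h₂ hφ]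
    exact int₃_parts_middle h h₀ h₁ h₂ (testFun.isC1 hφ) hC hC'
  · intro f₀ f₀' f₁ f₂ φ s₀ h₀ h₁ h₂ hφ hs
    obtain ⟨C, hC, hC'⟩ := testFun.exists_bound hφ
    have cφ := testFun.continuous hφ
    rw [eT h₀.continuous h₁ h₂ (testFun.deriv_mem hφ), eT h₀.continuous_deriv h₁ h₂ hφ,
      eB h₀.continuous h₁ h₂ hφ, int₃_parts_outer h h₀ h₁ h₂ (testFun.isC1 hφ) hC hC',
      sub_right_comm, sub_add_cancel, sub_add_cancel]
    refine norm_int₂_le h ((norm_nonneg _).trans (hs 0)) h₁.measurable (memLp_of_continuous h₁)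
      h₂.measurable (memLp_of_continuous h₂) cφ.measurable (testFun.memLp hφ)
      (fun x hx => testFun.eq_zero hφ hx) (Or.inl rfl) (c := fun w => 1 - w.2 - σ w.1)
      (by fun_prop) fun t z _ x _ => ?_
    rw [show 1 * x + (1 - z - σ t) = 1 - z + x - σ t by ring, norm_mul, norm_mul, norm_mul,
      mul_assoc, mul_assoc]
    exact mul_le_mul_of_nonneg_right (hs 1) (by positivity)
  · intro f₀ f₁ f₂ f₂' φ s₂ h₀ h₁ h₂ hφ hs
    obtain ⟨C, hC, hC'⟩ := testFun.exists_bound hφ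
    have cφ := testFun.continuous hφ
    rw [eT h₀ h₁ h₂.continuous (testFun.deriv_mem hφ), eT h₀ h₁ h₂.continuous_deriv hφ,
      eA h₀ h₁ h₂.continuous hφ, int₃_parts_inner h h₀ h₁ h₂ (testFun.isC1 hφ) hC hC',
      sub_right_comm, sub_add_cancel, sub_sub_cancel_left, norm_neg]
    refine norm_int₂_le h ((norm_nonneg _).trans (hs 0)) h₀.measurable (memLp_of_continuous h₀)
      h₁.measurable (memLp_of_continuous h₁) cφ.measurable (testFun.memLp hφ)
      (fun x hx => testFun.eq_zero hφ hx) (Or.inr rfl) (c := fun w => w.2 + b w.1 - σ w.1)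
      (by fun_prop) fun t z _ x _ => ?_
    rw [show -1 * x + (z + b t - σ t) = z - x + b t - σ t by ring, norm_mul, norm_mul, norm_mul]
    calc _ = ‖f₂ (b t)‖ * (‖f₀ z‖ * (‖f₁ x‖ * ‖φ (z - x + b t - σ t)‖)) := by ring
      _ ≤ _ := mul_le_mul_of_nonneg_right (hs _) (by positivity)
  · intro f₀ f₀' f₁ f₂ φ s₀ h₀ h₁ h₂ hφ hs
    obtain ⟨C, hC, hC'⟩ := testFun.exists_bound hφ
    have cφ := testFun.continuous hφ
    have hs0 := (norm_nonneg _).trans (hs 0)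
    have hN := h.nonneg
    have q1 : ‖int₁ ν u b (fun t y => f₀ 1 * f₁ y * f₂ y * φ (1 - σ t))‖
        ≤ N * s₀ * (‖cls f₁‖ * (‖cls f₂‖ * ‖cls φ‖)) := by
      refine norm_int₁_jump_le h hs0 h₁.measurable (memLp_of_continuous h₁)
        h₂.measurable (memLp_of_continuous h₂) cφ.measurable (testFun.memLp hφ)
        (k := fun t => 1 - σ t) (by fun_prop) ?_ fun t y _ => ?_
      · have := h.jump_one (fun x => ‖φ x‖ₑ) cφ.measurable.enorm
        simpa only [indicator_enorm_eq fun x hx => testFun.eq_zero hφ hx] using this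
      · rw [norm_mul, norm_mul, norm_mul, mul_assoc, mul_assoc]
        exact mul_le_mul_of_nonneg_right (hs 1) (by positivity)
    rw [eA h₀.continuous h₁ h₂ (testFun.deriv_mem hφ), eA h₀.continuous_deriv h₁ h₂ hφ,
      int₂_parts_outer h h₀ h₁ h₂ (testFun.isC1 hφ) hC hC', sub_add_cancel]
    -- In the term at z = y three factors and φ share one variable. Two factors are taken in the
    -- supremum norm and the third is paired with φ; besides f₀ the bounded factor may be f₁ or f₂,
    -- hence two versions.
    refine ⟨fun s₁ hs₁ => ?_, fun s₂ hs₂ => ?_⟩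
    · have hs0' := (norm_nonneg _).trans (hs₁ 0)
      have q2 : ‖int₁ ν u b (fun t y => f₀ y * f₁ y * f₂ y * φ (y - σ t))‖
          ≤ N * (s₀ * s₁) * (‖cls f₂‖ * ‖cls φ‖) := by
        refine norm_int₁_slab_le h (by positivity) h₂.measurable (memLp_of_continuous h₂)
          cφ.measurable (testFun.memLp hφ) (fun x hx => testFun.eq_zero hφ hx) fun t y _ => ?_
        rw [norm_mul, norm_mul, norm_mul, mul_assoc]
        exact mul_le_mul_of_nonneg_right (mul_le_mul (hs y) (hs₁ y) (norm_nonneg _) hs0)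
          (by positivity)
      refine (norm_sub_le _ _).trans ((add_le_add q1 q2).trans (le_of_eq ?_))
      ring
    · have hs0' := (norm_nonneg _).trans (hs₂ 0)
      have q2 : ‖int₁ ν u b (fun t y => f₀ y * f₁ y * f₂ y * φ (y - σ t))‖
          ≤ N * (s₀ * s₂) * (‖cls f₁‖ * ‖cls φ‖) := by
        refine norm_int₁_slab_le h (by positivity) h₁.measurable (memLp_of_continuous h₁)
          cφ.measurable (testFun.memLp hφ) (fun x hx => testFun.eq_zero hφ hx) fun t y _ => ?_
        rw [norm_mul, norm_mul, norm_mul]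
        calc _ = ‖f₀ y‖ * ‖f₂ y‖ * (‖f₁ y‖ * ‖φ (y - σ t)‖) := by ring
          _ ≤ _ := mul_le_mul_of_nonneg_right (mul_le_mul (hs y) (hs₂ y) (norm_nonneg _) hs0)
            (by positivity)
      refine (norm_sub_le _ _).trans ((add_le_add q1 q2).trans (le_of_eq ?_))
      ring
  · intro f₀ f₁ f₂ f₂' φ s₂ h₀ h₁ h₂ hφ hs
    obtain ⟨C, hC, hC'⟩ := testFun.exists_bound hφ
    have cφ := testFun.continuous hφ
    have hs0 := (norm_nonneg _).trans (hs 0)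
    have hN := h.nonneg
    have q1 : ‖int₁ ν u b (fun t z => f₀ z * f₁ z * f₂ (b t) * φ (b t - σ t))‖
        ≤ N * s₂ * (‖cls f₀‖ * (‖cls f₁‖ * ‖cls φ‖)) := by
      refine norm_int₁_jump_le h hs0 h₀.measurable (memLp_of_continuous h₀)
        h₁.measurable (memLp_of_continuous h₁) cφ.measurable (testFun.memLp hφ)
        (k := fun t => b t - σ t) (by fun_prop) ?_ fun t y _ => ?_
      · have := h.jump_base (fun x => ‖φ x‖ₑ) cφ.measurable.enorm
        simpa only [indicator_enorm_eq fun x hx => testFun.eq_zero hφ hx] using this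
      · rw [norm_mul, norm_mul, norm_mul]
        calc _ = ‖f₂ (b t)‖ * (‖f₀ y‖ * (‖f₁ y‖ * ‖φ (b t - σ t)‖)) := by ring
          _ ≤ _ := mul_le_mul_of_nonneg_right (hs _) (by positivity)
    rw [eB h₀ h₁ h₂.continuous (testFun.deriv_mem hφ), eB h₀ h₁ h₂.continuous_deriv hφ,
      int₂_parts_inner h h₀ h₁ h₂ (testFun.isC1 hφ) hC hC', sub_add_cancel]
    refine ⟨fun s₀ hs₀ => ?_, fun s₁ hs₁ => ?_⟩
    · have hs0' := (norm_nonneg _).trans (hs₀ 0)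
      have q2 : ‖int₁ ν u b (fun t y => f₀ y * f₁ y * f₂ y * φ (y - σ t))‖
          ≤ N * (s₂ * s₀) * (‖cls f₁‖ * ‖cls φ‖) := by
        refine norm_int₁_slab_le h (by positivity) h₁.measurable (memLp_of_continuous h₁)
          cφ.measurable (testFun.memLp hφ) (fun x hx => testFun.eq_zero hφ hx) fun t y _ => ?_
        rw [norm_mul, norm_mul, norm_mul]
        calc _ = ‖f₂ y‖ * ‖f₀ y‖ * (‖f₁ y‖ * ‖φ (y - σ t)‖) := by ring
          _ ≤ _ := mul_le_mul_of_nonneg_right (mul_le_mul (hs y) (hs₀ y) (norm_nonneg _) hs0)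
            (by positivity)
      refine (norm_sub_le _ _).trans ((add_le_add q2 q1).trans (le_of_eq ?_))
      ring
    · have hs0' := (norm_nonneg _).trans (hs₁ 0)
      have q2 : ‖int₁ ν u b (fun t y => f₀ y * f₁ y * f₂ y * φ (y - σ t))‖
          ≤ N * (s₂ * s₁) * (‖cls f₀‖ * ‖cls φ‖) := by
        refine norm_int₁_slab_le h (by positivity) h₀.measurable (memLp_of_continuous h₀)
          cφ.measurable (testFun.memLp hφ) (fun x hx => testFun.eq_zero hφ hx) fun t y _ => ?_
        rw [norm_mul, norm_mul, norm_mul]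
        calc _ = ‖f₂ y‖ * ‖f₁ y‖ * (‖f₀ y‖ * ‖φ (y - σ t)‖) := by ring
          _ ≤ _ := mul_le_mul_of_nonneg_right (mul_le_mul (hs y) (hs₁ y) (norm_nonneg _) hs0)
            (by positivity)
      refine (norm_sub_le _ _).trans ((add_le_add q2 q1).trans (le_of_eq ?_))
      ring

/-! ### Functionals with weak derivatives -/

/-- The elements of `L_2(0,1)` that represent the coefficient functionals. -/
def coefRep (k : ℤ) : L2 := (exists_pair_eq (aCoef k)).choose

lemma pair_coefRep (k : ℤ) (u : L2) : pair u (coefRep k) = aCoef k u := by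
  rw [pair_comm, coefRep, ← (exists_pair_eq (aCoef k)).choose_spec.1]

/-- The element of `L_2(0,1)` that represents a finite combination of coefficient functionals. -/
def dualL2 : (ℤ →₀ ℂ) →ₗ[ℂ] L2 := Finsupp.linearCombination ℂ coefRep

lemma pair_dualL2 (u : L2) (d : ℤ →₀ ℂ) : pair u (dualL2 d) = ∑ k ∈ d.support, d k * aCoef k u := by
  rw [← pairCLM_apply, dualL2, Finsupp.linearCombination_apply, Finsupp.sum, map_sum]
  refine Finset.sum_congr rfl fun k _ => ?_
  rw [map_smul, pairCLM_apply, pair_coefRep, smul_eq_mul]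

/-- Cauchy–Schwarz after splitting 1 = wt^s · wt^(−s). -/
lemma norm_pair_dualL2_le {u : L2} {s B : ℝ} (hB : 0 ≤ B)
    (h : ∀ S : Finset ℤ, ∑ k ∈ S, (wt k ^ s * ‖aCoef k u‖) ^ 2 ≤ B ^ 2) (d : ℤ →₀ ℂ) :
    ‖pair u (dualL2 d)‖ ≤ B * nrm (-s) d := by
  have e : pair u (dualL2 d) = ∑ k ∈ d.support,
      ((wt k ^ s : ℝ) * aCoef k u : ℂ) * ((wt k ^ (-s) : ℝ) * d k) := by
    rw [pair_dualL2]
    refine Finset.sum_congr rfl fun k _ => ?_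
    have : ((wt k ^ s : ℝ) : ℂ) * (wt k ^ (-s) : ℝ) = 1 := by
      rw [← Complex.ofReal_mul, ← Real.rpow_add (wt_pos k), add_neg_cancel, Real.rpow_zero,
        Complex.ofReal_one]
    linear_combination (-(d k * aCoef k u)) * this
  rw [e]
  refine (norm_sum_mul_le _ _ _).trans ?_
  have hn (r : ℝ) (k : ℤ) (z : ℂ) : ‖((wt k ^ r : ℝ) : ℂ) * z‖ = wt k ^ r * ‖z‖ := by
    rw [norm_mul, Complex.norm_real, Real.norm_of_nonneg (Real.rpow_nonneg (wt_pos k).le r)]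
  simp only [hn]
  exact mul_le_mul_of_nonneg_right ((Real.sqrt_le_left hB).2 (h _)) (nrm_nonneg _ _)

section Functional

variable {l : L2 →L[ℂ] ℂ} {M : ℝ}

lemma norm_apply_dualL2_le (hM : 0 ≤ M) (h0 : ∀ ψ, ‖l ψ‖ ≤ M * ‖ψ‖) (d : ℤ →₀ ℂ) :
    ‖l (dualL2 d)‖ ≤ 6000 * M * nrm 0 d := by
  obtain ⟨u, hu, hu'⟩ := exists_pair_eq l
  have hn : ‖u‖ ≤ M := hu'.trans_le (l.opNorm_le_bound hM h0)
  rw [hu, ← neg_zero]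
  refine norm_pair_dualL2_le (by positivity) (fun S => ?_) d
  simp only [Real.rpow_zero, one_mul]
  refine (sum_sq_aCoef_le u S).trans ?_
  gcongr
  linarith

/-- By `h1` the representing element of the functional has a weak derivative in L_2, so its
coefficients carry one weight. -/
lemma norm_apply_dualL2_le_one (hM : 0 ≤ M) (h0 : ∀ ψ, ‖l ψ‖ ≤ M * ‖ψ‖)
    (h1 : ∀ φ ∈ testFun, ‖l (cls (deriv φ))‖ ≤ M * ‖cls φ‖) (d : ℤ →₀ ℂ) :
    ‖l (dualL2 d)‖ ≤ 6000 * M * nrm (-1) d := by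
  obtain ⟨u, hu, hu'⟩ := exists_pair_eq l
  have hn : ‖u‖ ≤ M := hu'.trans_le (l.opNorm_le_bound hM h0)
  simp only [hu] at h1 ⊢
  obtain ⟨v, hv, huv, -⟩ := exists_isWeakDeriv hM h1
  refine norm_pair_dualL2_le (by positivity) (fun S => ?_) d
  simp only [Real.rpow_one]
  refine (sum_wt_aCoef_le huv S).trans ?_
  exact pow_le_pow_left₀ (by positivity) (by linarith) 2

/-- The bound on second derivatives of test functions gives the weak derivative of the representing
element a weak derivative of its own. -/
lemma norm_apply_dualL2_le_two (hM : 0 ≤ M) (h0 : ∀ ψ, ‖l ψ‖ ≤ M * ‖ψ‖)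
    (h1 : ∀ φ ∈ testFun, ‖l (cls (deriv φ))‖ ≤ M * ‖cls φ‖)
    (h2 : ∀ φ ∈ testFun, ‖l (cls (deriv (deriv φ)))‖ ≤ M * ‖cls φ‖) (d : ℤ →₀ ℂ) :
    ‖l (dualL2 d)‖ ≤ 6000 * M * nrm (-2) d := by
  obtain ⟨u, hu, hu'⟩ := exists_pair_eq l
  have hn : ‖u‖ ≤ M := hu'.trans_le (l.opNorm_le_bound hM h0)
  simp only [hu] at h1 h2 ⊢
  obtain ⟨v, hv, huv, hp⟩ := exists_isWeakDeriv hM h1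
  obtain ⟨w, hw, hvw, -⟩ := exists_isWeakDeriv (u := v) hM fun φ hφ => by
    have := h2 φ hφ
    rwa [hp _ (testFun.deriv_mem hφ), norm_neg] at this
  refine norm_pair_dualL2_le (by positivity) (fun S => ?_) d
  simp only [Real.rpow_ofNat]
  refine (sum_wt_sq_aCoef_le huv hvw S).trans ?_
  exact pow_le_pow_left₀ (by positivity) (by linarith) 2

end Functional

/-- The operator `ψ ↦ ∫_x^1 ψ` on `L_2(0,1)`. -/
def coprimCLM : L2 →L[ℂ] L2 := (pairCLM (cls fun _ => 1)).smulRight (cls fun _ => 1) - primCLM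

lemma norm_coprimCLM_le (ψ : L2) : ‖coprimCLM ψ‖ ≤ 2 * ‖ψ‖ := by
  have h1 : ‖cls fun _ => (1 : ℂ)‖ ≤ 1 := norm_cls_le_of_bound zero_le_one fun _ _ => by simp
  have h2 := norm_pair_le (cls fun _ => 1) ψ
  have h3 : ‖pair (cls fun _ => 1) ψ‖ ≤ ‖ψ‖ :=
    h2.trans (mul_le_of_le_one_left (norm_nonneg _) h1)
  have h4 : ‖pair (cls fun _ => 1) ψ • cls fun _ => (1 : ℂ)‖ ≤ ‖ψ‖ := by
    rw [norm_smul]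
    exact (mul_le_mul h3 h1 (norm_nonneg _) (norm_nonneg _)).trans_eq (mul_one _)
  have h5 := norm_sub_le (pair (cls fun _ => 1) ψ • cls fun _ => (1 : ℂ)) (primCLM ψ)
  have h6 := norm_primCLM_le ψ
  have e : coprimCLM ψ = pair (cls fun _ => 1) ψ • (cls fun _ => (1 : ℂ)) - primCLM ψ := by
    rw [← pairCLM_apply]; rfl
  rw [e]
  linarith

/-- Since φ vanishes at both ends, its derivative integrates to −φ. Precomposing a form with
`coprimCLM` in the last slot therefore gains one derivative there. -/
lemma coprimCLM_deriv {φ : ℝ → ℂ} (h : φ ∈ testFun) : coprimCLM (cls (deriv φ)) = -cls φ := by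
  have h' := testFun.deriv_mem h
  have hp (x : ℝ) : prim (deriv φ) x = φ x := by
    rw [prim, intervalIntegral.integral_eq_sub_of_hasDerivAt (fun y _ => testFun.hasDerivAt h y)
      ((testFun.continuous h').intervalIntegrable _ _), testFun.eq_zero h (x := 0) (by simp),
      sub_zero]
  have e : coprimCLM (cls (deriv φ))
      = pair (cls fun _ => 1) (cls (deriv φ)) • (cls fun _ => (1 : ℂ)) - primCLM (cls (deriv φ)) := by
    rw [← pairCLM_apply]; rfl
  have h0 : pair (cls fun _ => 1) (cls (deriv φ)) = 0 := by
    rw [pair_cls (memLp_of_continuous continuous_const) (testFun.memLp h'),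
      ← integral_Ioc_eq_integral_Ioo, ← intervalIntegral.integral_of_le zero_le_one]
    simp only [one_mul]
    exact (hp 1).trans (testFun.eq_zero h (by simp))
  rw [e, h0, zero_smul, zero_sub, primCLM_cls (testFun.memLp h'), funext hp]

/-! ### Bounds for the quadrilinear forms in weighted norms -/

/-- A form on `L_2(0,1)`, evaluated at three trigonometric polynomials and at a combination of
coefficient functionals. -/
def seqForm (F : ContinuousMultilinearMap ℂ (fun _ : Fin 4 => L2) ℂ) :
    MultilinearMap ℂ (fun _ : Fin 4 => ℤ →₀ ℂ) ℂ :=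
  F.toMultilinearMap.compLinearMap ![trigL2, trigL2, trigL2, dualL2]

lemma seqForm_apply (F : ContinuousMultilinearMap ℂ (fun _ : Fin 4 => L2) ℂ)
    (c : Fin 4 → ℤ →₀ ℂ) : seqForm F c
      = F ![cls (trig (c 0)), cls (trig (c 1)), cls (trig (c 2)), dualL2 (c 3)] := by
  simp only [← trigL2_eq]
  rw [seqForm, MultilinearMap.compLinearMap_apply]
  change F _ = F _
  congr 1
  ext1 i
  fin_cases i <;> rfl

/-- The composition of a form with the operator `ψ ↦ ∫_x^1 ψ` in the last variable. -/
def compCoprim (F : ContinuousMultilinearMap ℂ (fun _ : Fin 4 => L2) ℂ) :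
    ContinuousMultilinearMap ℂ (fun _ : Fin 4 => L2) ℂ :=
  F.compContinuousLinearMap
    ![ContinuousLinearMap.id ℂ L2, ContinuousLinearMap.id ℂ L2, ContinuousLinearMap.id ℂ L2,
      coprimCLM]

lemma compCoprim_apply (F : ContinuousMultilinearMap ℂ (fun _ : Fin 4 => L2) ℂ) (a b c ψ : L2) :
    compCoprim F ![a, b, c, ψ] = F ![a, b, c, coprimCLM ψ] := by
  rw [compCoprim, ContinuousMultilinearMap.compContinuousLinearMap_apply]
  congr 1
  ext1 i
  fin_cases i <;> rfl

lemma exists_last (F : ContinuousMultilinearMap ℂ (fun _ : Fin 4 => L2) ℂ) (a b c : L2) :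
    ∃ l : L2 →L[ℂ] ℂ, ∀ ψ, l ψ = F ![a, b, c, ψ] := by
  refine ⟨F.toContinuousLinearMap ![a, b, c, 0] 3, fun ψ => ?_⟩
  change F _ = F _
  congr 1
  ext1 i
  fin_cases i <;> rfl

section Vertex

variable {F : ContinuousMultilinearMap ℂ (fun _ : Fin 4 => L2) ℂ} {a₀ a₁ a₂ C : ℝ}

lemma prod_nrm (a : Fin 4 → ℝ) (c : Fin 4 → ℤ →₀ ℂ) : ∏ i, nrm (a i) (c i)
    = nrm (a 0) (c 0) * (nrm (a 1) (c 1) * nrm (a 2) (c 2)) * nrm (a 3) (c 3) := by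
  rw [Fin.prod_univ_four]; ring

/-- With three slots frozen the form is a functional of the last one. Controlling it on j-th
derivatives of test functions, for all j up to 1 or 2, puts order −1 or −2 in the last slot in the
next two lemmas. -/
lemma hasBound_zero (hC : 0 ≤ C) (h0 : ∀ c₀ c₁ c₂ ψ,
      ‖F ![cls (trig c₀), cls (trig c₁), cls (trig c₂), ψ]‖
        ≤ C * (nrm a₀ c₀ * (nrm a₁ c₁ * nrm a₂ c₂)) * ‖ψ‖) :
    HasBound (seqForm F) ![a₀, a₁, a₂, 0] (6000 * C) := by
  intro c
  obtain ⟨l, hl⟩ := exists_last F (cls (trig (c 0))) (cls (trig (c 1))) (cls (trig (c 2)))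
  have n0 := nrm_nonneg a₀ (c 0)
  have n1 := nrm_nonneg a₁ (c 1)
  have n2 := nrm_nonneg a₂ (c 2)
  rw [seqForm_apply, ← hl, prod_nrm]
  refine (norm_apply_dualL2_le (M := C * (nrm a₀ (c 0) * (nrm a₁ (c 1) * nrm a₂ (c 2))))
    (by positivity) (fun ψ => by rw [hl]; exact h0 _ _ _ _) _).trans (le_of_eq ?_)
  simp only [Matrix.cons_val]
  ring

lemma hasBound_one (hC : 0 ≤ C) (h0 : ∀ c₀ c₁ c₂ ψ,
      ‖F ![cls (trig c₀), cls (trig c₁), cls (trig c₂), ψ]‖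
        ≤ C * (nrm a₀ c₀ * (nrm a₁ c₁ * nrm a₂ c₂)) * ‖ψ‖)
    (h1 : ∀ c₀ c₁ c₂, ∀ φ ∈ testFun,
      ‖F ![cls (trig c₀), cls (trig c₁), cls (trig c₂), cls (deriv φ)]‖
        ≤ C * (nrm a₀ c₀ * (nrm a₁ c₁ * nrm a₂ c₂)) * ‖cls φ‖) :
    HasBound (seqForm F) ![a₀, a₁, a₂, -1] (6000 * C) := by
  intro c
  obtain ⟨l, hl⟩ := exists_last F (cls (trig (c 0))) (cls (trig (c 1))) (cls (trig (c 2)))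
  have n0 := nrm_nonneg a₀ (c 0)
  have n1 := nrm_nonneg a₁ (c 1)
  have n2 := nrm_nonneg a₂ (c 2)
  rw [seqForm_apply, ← hl, prod_nrm]
  refine (norm_apply_dualL2_le_one (M := C * (nrm a₀ (c 0) * (nrm a₁ (c 1) * nrm a₂ (c 2))))
    (by positivity) (fun ψ => by rw [hl]; exact h0 _ _ _ _)
    (fun φ hφ => by rw [hl]; exact h1 _ _ _ φ hφ) _).trans (le_of_eq ?_)
  simp only [Matrix.cons_val]
  ring

lemma hasBound_two (hC : 0 ≤ C) (h0 : ∀ c₀ c₁ c₂ ψ,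
      ‖F ![cls (trig c₀), cls (trig c₁), cls (trig c₂), ψ]‖
        ≤ C * (nrm a₀ c₀ * (nrm a₁ c₁ * nrm a₂ c₂)) * ‖ψ‖)
    (h1 : ∀ c₀ c₁ c₂, ∀ φ ∈ testFun,
      ‖F ![cls (trig c₀), cls (trig c₁), cls (trig c₂), cls (deriv φ)]‖
        ≤ C * (nrm a₀ c₀ * (nrm a₁ c₁ * nrm a₂ c₂)) * ‖cls φ‖)
    (h2 : ∀ c₀ c₁ c₂, ∀ φ ∈ testFun,
      ‖F ![cls (trig c₀), cls (trig c₁), cls (trig c₂), cls (deriv (deriv φ))]‖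
        ≤ C * (nrm a₀ c₀ * (nrm a₁ c₁ * nrm a₂ c₂)) * ‖cls φ‖) :
    HasBound (seqForm F) ![a₀, a₁, a₂, -2] (6000 * C) := by
  intro c
  obtain ⟨l, hl⟩ := exists_last F (cls (trig (c 0))) (cls (trig (c 1))) (cls (trig (c 2)))
  have n0 := nrm_nonneg a₀ (c 0)
  have n1 := nrm_nonneg a₁ (c 1)
  have n2 := nrm_nonneg a₂ (c 2)
  rw [seqForm_apply, ← hl, prod_nrm]
  refine (norm_apply_dualL2_le_two (M := C * (nrm a₀ (c 0) * (nrm a₁ (c 1) * nrm a₂ (c 2))))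
    (by positivity) (fun ψ => by rw [hl]; exact h0 _ _ _ _)
    (fun φ hφ => by rw [hl]; exact h1 _ _ _ φ hφ)
    (fun φ hφ => by rw [hl]; exact h2 _ _ _ φ hφ) _).trans (le_of_eq ?_)
  simp only [Matrix.cons_val]
  ring

end Vertex

/-- The constant `L` bounds trigonometric polynomials by their weighted norms. -/
structure IsTrigBound (L : ℝ) : Prop where
  one_le : 1 ≤ L
  norm_zero : ∀ c, ‖cls (trig c)‖ ≤ L * nrm 0 c
  norm_one : ∀ c, ‖cls (trig c)‖ ≤ L * nrm 1 c
  norm_deriv : ∀ c, ‖cls (trig (trigDeriv c))‖ ≤ L * nrm 1 c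
  bound : ∀ c x, ‖trig c x‖ ≤ L * nrm 1 c

lemma exists_isTrigBound : ∃ L, IsTrigBound L := by
  obtain ⟨K, hK, hK'⟩ := exists_norm_trig_le
  have key (c : ℤ →₀ ℂ) : ‖cls (trig c)‖ ≤ 16 * K * nrm 0 c := by
    have := nrm_nonneg 0 c
    refine (norm_trigL2_le c).trans ?_
    gcongr
    linarith
  refine ⟨16 * K, by linarith, key, fun c => (key c).trans ?_, fun c => ?_, fun c x => ?_⟩
  · gcongr
    exact nrm_mono zero_le_one c
  · have := nrm_nonneg 1 c
    refine (norm_trigDeriv_le c).trans ?_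
    gcongr
    linarith
  · have := nrm_nonneg 1 c
    refine (hK' c x).trans ?_
    gcongr
    linarith

lemma isC1_trig (c : ℤ →₀ ℂ) : IsC1 (trig c) (trig (trigDeriv c)) :=
  ⟨hasDerivAt_trig c, continuous_trig _⟩

lemma norm_apply_vec_le {F : ContinuousMultilinearMap ℂ (fun _ : Fin 4 => L2) ℂ} {N L x y z : ℝ}
    (hN : 0 ≤ N) (hF : ∀ ψ, ‖F ψ‖ ≤ N * ∏ i, ‖ψ i‖) {a b c : L2} (ha : ‖a‖ ≤ L * x)
    (hb : ‖b‖ ≤ L * y) (hc : ‖c‖ ≤ L * z) (d : L2) :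
    ‖F ![a, b, c, d]‖ ≤ N * L ^ 3 * (x * (y * z)) * ‖d‖ := by
  refine (hF _).trans ?_
  rw [Fin.prod_univ_four]
  simp only [Matrix.cons_val]
  have h1 := (norm_nonneg _).trans ha
  have h2 := (norm_nonneg _).trans hb
  calc _ ≤ N * (L * x * (L * y) * (L * z) * ‖d‖) := by gcongr
    _ = _ := by ring

namespace IsFormTriple

variable {T A B : ContinuousMultilinearMap ℂ (fun _ : Fin 4 => L2) ℂ} {N L : ℝ}

/-- The part of the first form of a triple that is not smoothed in the last variable only. -/
def main (T A B : ContinuousMultilinearMap ℂ (fun _ : Fin 4 => L2) ℂ) :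
    ContinuousMultilinearMap ℂ (fun _ : Fin 4 => L2) ℂ := T - compCoprim B + compCoprim A

lemma main_apply (a b c ψ : L2) : main T A B ![a, b, c, ψ]
    = T ![a, b, c, ψ] - B ![a, b, c, coprimCLM ψ] + A ![a, b, c, coprimCLM ψ] := by
  rw [← compCoprim_apply, ← compCoprim_apply]; rfl

lemma apply_neg_last (F : ContinuousMultilinearMap ℂ (fun _ : Fin 4 => L2) ℂ) (a b c ψ : L2) :
    F ![a, b, c, -ψ] = -F ![a, b, c, ψ] := by
  obtain ⟨l, hl⟩ := exists_last F a b c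
  rw [← hl, ← hl, map_neg]

/-- On derivatives the primitives disappear and the diagonal forms enter with the signs opposite to
those in `parts_middle`. -/
lemma main_deriv (a b c : L2) {φ : ℝ → ℂ} (hφ : φ ∈ testFun) :
    main T A B ![a, b, c, cls (deriv φ)]
      = T ![a, b, c, cls (deriv φ)] + B ![a, b, c, cls φ] - A ![a, b, c, cls φ] := by
  rw [main_apply, coprimCLM_deriv hφ, apply_neg_last, apply_neg_last]
  ring

/-- The factor is 5 = 1 + 2 + 2, since `coprimCLM` has norm at most 2. -/
lemma norm_main_le (h : IsFormTriple T A B N) (hL : IsTrigBound L) {c₀ c₁ c₂ : ℤ →₀ ℂ} {x y z : ℝ} (h₀ : ‖cls (trig c₀)‖ ≤ L * x)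
    (h₁ : ‖cls (trig c₁)‖ ≤ L * y) (h₂ : ‖cls (trig c₂)‖ ≤ L * z) (ψ : L2) :
    ‖main T A B ![cls (trig c₀), cls (trig c₁), cls (trig c₂), ψ]‖
      ≤ 5 * (N * L ^ 3) * (x * (y * z)) * ‖ψ‖ := by
  have hL0 := zero_le_one.trans hL.one_le
  have hN := h.nonneg
  have h1 := norm_apply_vec_le hN h.norm_le h₀ h₁ h₂ ψ
  have h2 := norm_apply_vec_le hN h.norm_inner_le h₀ h₁ h₂ (coprimCLM ψ)
  have h3 := norm_apply_vec_le hN h.norm_outer_le h₀ h₁ h₂ (coprimCLM ψ)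
  have p0 := (norm_nonneg _).trans h₀
  have p1 := (norm_nonneg _).trans h₁
  have p2 := (norm_nonneg _).trans h₂
  have hP : 0 ≤ N * L ^ 3 * (x * (y * z)) := by
    have : 0 ≤ N * ((L * x) * ((L * y) * (L * z))) := by positivity
    refine this.trans_eq (by ring)
  have h4 := mul_le_mul_of_nonneg_left (norm_coprimCLM_le ψ) hP
  rw [main_apply]
  refine (norm_add_le _ _).trans ((add_le_add_left (norm_sub_le _ _) _).trans ?_)
  linarith

end IsFormTriple

/-- A factor 3 would do; 5 matches `norm_main_le`, so that all vertices of the interpolation share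
one constant. -/
lemma norm_le_of_eq_three {w q b t : ℂ} {E : ℝ} (hw : w = q + b - t) (hq : ‖q‖ ≤ E) (hb : ‖b‖ ≤ E)
    (ht : ‖t‖ ≤ E) : ‖w‖ ≤ 5 * E := by
  have := norm_sub_le (q + b) t
  have := norm_add_le q b
  have := norm_nonneg q
  rw [hw]
  linarith

lemma mul_le_cubic {N L a b x y z d : ℝ} (hN : 0 ≤ N) (hd : 0 ≤ d) (ha : a ≤ L * x) (ha' : 0 ≤ a)
    (hb : b ≤ L * y) (hb' : 0 ≤ b) (hz : 0 ≤ L * z) :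
    N * (L * z) * (a * (b * d)) ≤ N * L ^ 3 * (x * y * z) * d := by
  have := ha'.trans ha
  calc N * (L * z) * (a * (b * d)) ≤ N * (L * z) * (L * x * (L * y * d)) := by gcongr
    _ = _ := by ring

namespace IsFormTriple

variable {T A B : ContinuousMultilinearMap ℂ (fun _ : Fin 4 => L2) ℂ} {N L : ℝ}

lemma main_hasBound_zero (h : IsFormTriple T A B N) (hL : IsTrigBound L) :
    HasBound (seqForm (main T A B)) ![0, 0, 0, 0] (6000 * (5 * (N * L ^ 3))) := by
  have hL0 := zero_le_one.trans hL.one_le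
  have hN := h.nonneg
  exact hasBound_zero (by positivity) fun c₀ c₁ c₂ ψ =>
    h.norm_main_le hL (hL.norm_zero _) (hL.norm_zero _) (hL.norm_zero _) ψ

/-- Integration by parts in x produces a term that cancels the A in `main_deriv`. The form B and the
form T with f₂' remain, next to a boundary term bounded by the supremum of f₂. -/
lemma main_hasBound_one (h : IsFormTriple T A B N) (hL : IsTrigBound L) :
    HasBound (seqForm (main T A B)) ![0, 0, 1, -1] (6000 * (5 * (N * L ^ 3))) := by
  have hL0 := zero_le_one.trans hL.one_le
  have hN := h.nonneg
  refine hasBound_one (by positivity) (fun c₀ c₁ c₂ ψ =>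
    h.norm_main_le hL (hL.norm_zero _) (hL.norm_zero _) (hL.norm_one _) ψ) fun c₀ c₁ c₂ φ hφ => ?_
  have n2 := nrm_nonneg 1 c₂
  have q := h.parts_inner (trig c₀) (trig c₁) (trig c₂) _ φ (L * nrm 1 c₂) (continuous_trig _)
    (continuous_trig _) (isC1_trig c₂) hφ (hL.bound c₂)
  have q' := q.trans (mul_le_cubic hN (norm_nonneg _) (hL.norm_zero c₀) (norm_nonneg _)
    (hL.norm_zero c₁) (norm_nonneg _) (by positivity))
  have b := norm_apply_vec_le hN h.norm_inner_le (hL.norm_zero c₀) (hL.norm_zero c₁)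
    (hL.norm_one c₂) (cls φ)
  have t := norm_apply_vec_le hN h.norm_le (hL.norm_zero c₀) (hL.norm_zero c₁)
    (hL.norm_deriv c₂) (cls φ)
  rw [main_deriv _ _ _ hφ]
  refine (norm_le_of_eq_three ?_ (q'.trans_eq (by ring)) b t).trans_eq (by ring)
  ring

/-- The corrections in `main` are exactly the diagonal terms of the integration by parts in y. What
is left is T itself, which can be integrated by parts once more. -/
lemma main_deriv_trig (h : IsFormTriple T A B N) (c₀ c₁ c₂ : ℤ →₀ ℂ) {φ : ℝ → ℂ}
    (hφ : φ ∈ testFun) :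
    main T A B ![cls (trig c₀), cls (trig c₁), cls (trig c₂), cls (deriv φ)]
      = T ![cls (trig c₀), cls (trig (trigDeriv c₁)), cls (trig c₂), cls φ] := by
  rw [main_deriv _ _ _ hφ, h.parts_middle _ _ _ _ _ (continuous_trig c₀) (isC1_trig c₁)
    (continuous_trig c₂) hφ]
  ring

/-- The first derivative falls on f₁ without remainder, the second on f₀ through z. -/
lemma main_hasBound_two_outer (h : IsFormTriple T A B N) (hL : IsTrigBound L) :
    HasBound (seqForm (main T A B)) ![1, 1, 0, -2] (6000 * (5 * (N * L ^ 3))) := by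
  have hL0 := zero_le_one.trans hL.one_le
  have hN := h.nonneg
  refine hasBound_two (by positivity) (fun c₀ c₁ c₂ ψ =>
    h.norm_main_le hL (hL.norm_one _) (hL.norm_one _) (hL.norm_zero _) ψ) (fun c₀ c₁ c₂ φ hφ => ?_)
    fun c₀ c₁ c₂ φ hφ => ?_
  · have n0 := nrm_nonneg 1 c₀
    have n1 := nrm_nonneg 1 c₁
    have n2 := nrm_nonneg 0 c₂
    rw [h.main_deriv_trig _ _ _ hφ]
    refine (norm_apply_vec_le hN h.norm_le (hL.norm_one c₀) (hL.norm_deriv c₁)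
      (hL.norm_zero c₂) (cls φ)).trans ?_
    have : 0 ≤ N * L ^ 3 * (nrm 1 c₀ * (nrm 1 c₁ * nrm 0 c₂)) * ‖cls φ‖ := by positivity
    linarith
  · have n0 := nrm_nonneg 1 c₀
    rw [h.main_deriv_trig _ _ _ (testFun.deriv_mem hφ)]
    have q := h.parts_outer (trig c₀) _ (trig (trigDeriv c₁)) (trig c₂) φ (L * nrm 1 c₀)
      (isC1_trig c₀) (continuous_trig _) (continuous_trig _) hφ (hL.bound c₀)
    have q' := q.trans (mul_le_cubic hN (norm_nonneg _) (hL.norm_deriv c₁) (norm_nonneg _)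
      (hL.norm_zero c₂) (norm_nonneg _) (by positivity))
    have b := norm_apply_vec_le hN h.norm_inner_le (hL.norm_one c₀) (hL.norm_deriv c₁)
      (hL.norm_zero c₂) (cls φ)
    have t := norm_apply_vec_le hN h.norm_le (hL.norm_deriv c₀) (hL.norm_deriv c₁)
      (hL.norm_zero c₂) (cls φ)
    rw [← norm_neg] at b
    refine (norm_le_of_eq_three ?_ (q'.trans_eq (by ring)) b t).trans_eq (by ring)
    ring

/-- The first derivative falls on f₁ without remainder, the second on f₂ through x. -/
lemma main_hasBound_two_inner (h : IsFormTriple T A B N) (hL : IsTrigBound L) :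
    HasBound (seqForm (main T A B)) ![0, 1, 1, -2] (6000 * (5 * (N * L ^ 3))) := by
  have hL0 := zero_le_one.trans hL.one_le
  have hN := h.nonneg
  refine hasBound_two (by positivity) (fun c₀ c₁ c₂ ψ =>
    h.norm_main_le hL (hL.norm_zero _) (hL.norm_one _) (hL.norm_one _) ψ) (fun c₀ c₁ c₂ φ hφ => ?_)
    fun c₀ c₁ c₂ φ hφ => ?_
  · have n0 := nrm_nonneg 0 c₀
    have n1 := nrm_nonneg 1 c₁
    have n2 := nrm_nonneg 1 c₂
    rw [h.main_deriv_trig _ _ _ hφ]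
    refine (norm_apply_vec_le hN h.norm_le (hL.norm_zero c₀) (hL.norm_deriv c₁)
      (hL.norm_one c₂) (cls φ)).trans ?_
    have : 0 ≤ N * L ^ 3 * (nrm 0 c₀ * (nrm 1 c₁ * nrm 1 c₂)) * ‖cls φ‖ := by positivity
    linarith
  · have n2 := nrm_nonneg 1 c₂
    rw [h.main_deriv_trig _ _ _ (testFun.deriv_mem hφ)]
    have q := h.parts_inner (trig c₀) (trig (trigDeriv c₁)) (trig c₂) _ φ (L * nrm 1 c₂)
      (continuous_trig _) (continuous_trig _) (isC1_trig c₂) hφ (hL.bound c₂)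
    have q' := q.trans (mul_le_cubic hN (norm_nonneg _) (hL.norm_zero c₀) (norm_nonneg _)
      (hL.norm_deriv c₁) (norm_nonneg _) (by positivity))
    have b := norm_apply_vec_le hN h.norm_outer_le (hL.norm_zero c₀) (hL.norm_deriv c₁)
      (hL.norm_one c₂) (cls φ)
    have t := norm_apply_vec_le hN h.norm_le (hL.norm_zero c₀) (hL.norm_deriv c₁)
      (hL.norm_deriv c₂) (cls φ)
    refine (norm_le_of_eq_three ?_ (q'.trans_eq (by ring)) b t).trans_eq (by ring)
    ring

lemma compCoprim_deriv (F : ContinuousMultilinearMap ℂ (fun _ : Fin 4 => L2) ℂ) (a b c : L2)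
    {φ : ℝ → ℂ} (hφ : φ ∈ testFun) :
    compCoprim F ![a, b, c, cls (deriv φ)] = -F ![a, b, c, cls φ] := by
  rw [compCoprim_apply, coprimCLM_deriv hφ, apply_neg_last]

lemma norm_compCoprim_le {F : ContinuousMultilinearMap ℂ (fun _ : Fin 4 => L2) ℂ} {x y z : ℝ}
    (hN : 0 ≤ N) (hF : ∀ ψ, ‖F ψ‖ ≤ N * ∏ i, ‖ψ i‖) (hL0 : 0 ≤ L) (hx : 0 ≤ x) (hy : 0 ≤ y)
    (hz : 0 ≤ z) {a b c : L2} (ha : ‖a‖ ≤ L * x) (hb : ‖b‖ ≤ L * y) (hc : ‖c‖ ≤ L * z) (ψ : L2) :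
    ‖compCoprim F ![a, b, c, ψ]‖ ≤ 5 * (N * L ^ 3) * (x * (y * z)) * ‖ψ‖ := by
  rw [compCoprim_apply]
  refine (norm_apply_vec_le hN hF ha hb hc _).trans ?_
  have h1 : 0 ≤ N * L ^ 3 * (x * (y * z)) := by positivity
  have h2 := mul_le_mul_of_nonneg_left (norm_coprimCLM_le ψ) h1
  have h3 := mul_nonneg h1 (norm_nonneg ψ)
  linarith

lemma norm_compCoprim_deriv_le {F : ContinuousMultilinearMap ℂ (fun _ : Fin 4 => L2) ℂ} {x y z : ℝ}
    (hN : 0 ≤ N) (hF : ∀ ψ, ‖F ψ‖ ≤ N * ∏ i, ‖ψ i‖) (hL0 : 0 ≤ L) (hx : 0 ≤ x) (hy : 0 ≤ y)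
    (hz : 0 ≤ z) {a b c : L2} (ha : ‖a‖ ≤ L * x) (hb : ‖b‖ ≤ L * y) (hc : ‖c‖ ≤ L * z)
    {φ : ℝ → ℂ} (hφ : φ ∈ testFun) :
    ‖compCoprim F ![a, b, c, cls (deriv φ)]‖ ≤ 5 * (N * L ^ 3) * (x * (y * z)) * ‖cls φ‖ := by
  rw [compCoprim_deriv _ _ _ _ hφ, norm_neg]
  refine (norm_apply_vec_le hN hF ha hb hc _).trans ?_
  have h1 : 0 ≤ N * L ^ 3 * (x * (y * z)) := by positivity
  have h3 := mul_nonneg h1 (norm_nonneg (cls φ))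
  linarith

/-- The primitive in the last slot pays for one derivative, so no regularity of the factors is
needed. -/
lemma outer_hasBound_one (h : IsFormTriple T A B N) (hL : IsTrigBound L) :
    HasBound (seqForm (compCoprim A)) ![0, 0, 0, -1] (6000 * (5 * (N * L ^ 3))) := by
  have hL0 := zero_le_one.trans hL.one_le
  have hN := h.nonneg
  exact hasBound_one (by positivity)
    (fun c₀ c₁ c₂ ψ => norm_compCoprim_le hN h.norm_outer_le hL0 (nrm_nonneg _ _) (nrm_nonneg _ _)
      (nrm_nonneg _ _) (hL.norm_zero _) (hL.norm_zero _) (hL.norm_zero _) ψ)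
    fun c₀ c₁ c₂ φ hφ => norm_compCoprim_deriv_le hN h.norm_outer_le hL0 (nrm_nonneg _ _)
      (nrm_nonneg _ _) (nrm_nonneg _ _) (hL.norm_zero _) (hL.norm_zero _) (hL.norm_zero _) hφ

lemma inner_hasBound_one (h : IsFormTriple T A B N) (hL : IsTrigBound L) :
    HasBound (seqForm (compCoprim B)) ![0, 0, 0, -1] (6000 * (5 * (N * L ^ 3))) := by
  have hL0 := zero_le_one.trans hL.one_le
  have hN := h.nonneg
  exact hasBound_one (by positivity)
    (fun c₀ c₁ c₂ ψ => norm_compCoprim_le hN h.norm_inner_le hL0 (nrm_nonneg _ _) (nrm_nonneg _ _)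
      (nrm_nonneg _ _) (hL.norm_zero _) (hL.norm_zero _) (hL.norm_zero _) ψ)
    fun c₀ c₁ c₂ φ hφ => norm_compCoprim_deriv_le hN h.norm_inner_le hL0 (nrm_nonneg _ _)
      (nrm_nonneg _ _) (nrm_nonneg _ _) (hL.norm_zero _) (hL.norm_zero _) (hL.norm_zero _) hφ

lemma norm_le_of_add_le {w t : ℂ} {E d s y P : ℝ} (hs : ‖w + t‖ ≤ N * s * (d + s') * y)
    (hP : N * s * (d + s') * y ≤ 2 * P) (ht : ‖t‖ ≤ P) (hE : 3 * P ≤ E) : ‖-w‖ ≤ E := by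
  have : w = (w + t) - t := by ring
  rw [norm_neg, this]
  refine (norm_sub_le _ _).trans ?_
  linarith

lemma mul_add_le_cubic {a b x y z d : ℝ} (hN : 0 ≤ N) (hd : 0 ≤ d) (ha : a ≤ L * x)
    (hb : b ≤ L * y) (hb' : 0 ≤ b) (hz : 0 ≤ L * z) (hx : 0 ≤ L * x) :
    N * (L * z) * (a + L * x) * (b * d) ≤ 2 * (N * L ^ 3 * (x * y * z) * d) := by
  calc N * (L * z) * (a + L * x) * (b * d) ≤ N * (L * z) * (L * x + L * x) * (L * y * d) := by
        gcongr
    _ = _ := by ring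

/-- The second derivative goes to f₀ through z. The boundary term at z = y also needs a supremum
bound, here of f₁; the next lemma takes f₂ instead. -/
lemma outer_hasBound_two_middle (h : IsFormTriple T A B N) (hL : IsTrigBound L) :
    HasBound (seqForm (compCoprim A)) ![1, 1, 0, -2] (6000 * (5 * (N * L ^ 3))) := by
  have hL0 := zero_le_one.trans hL.one_le
  have hN := h.nonneg
  refine hasBound_two (by positivity)
    (fun c₀ c₁ c₂ ψ => norm_compCoprim_le hN h.norm_outer_le hL0 (nrm_nonneg _ _) (nrm_nonneg _ _)
      (nrm_nonneg _ _) (hL.norm_one _) (hL.norm_one _) (hL.norm_zero _) ψ)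
    (fun c₀ c₁ c₂ φ hφ => norm_compCoprim_deriv_le hN h.norm_outer_le hL0 (nrm_nonneg _ _)
      (nrm_nonneg _ _) (nrm_nonneg _ _) (hL.norm_one _) (hL.norm_one _) (hL.norm_zero _) hφ)
    fun c₀ c₁ c₂ φ hφ => ?_
  have n0 := nrm_nonneg 1 c₀
  have n1 := nrm_nonneg 1 c₁
  have n2 := nrm_nonneg 0 c₂
  rw [compCoprim_deriv _ _ _ _ (testFun.deriv_mem hφ)]
  have q := (h.outer_parts (trig c₀) _ (trig c₁) (trig c₂) φ (L * nrm 1 c₀)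
    (isC1_trig c₀) (continuous_trig _) (continuous_trig _) hφ (hL.bound c₀)).1 _ (hL.bound c₁)
  refine norm_le_of_add_le q (mul_add_le_cubic hN (norm_nonneg _) (hL.norm_one c₁)
    (hL.norm_zero c₂) (norm_nonneg _) (by positivity) (by positivity))
    ((norm_apply_vec_le hN h.norm_outer_le (hL.norm_deriv c₀) (hL.norm_one c₁)
    (hL.norm_zero c₂) (cls φ)).trans_eq (by ring)) ?_
  have : 0 ≤ N * L ^ 3 * (nrm 1 c₀ * (nrm 1 c₁ * nrm 0 c₂)) * ‖cls φ‖ := by positivity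
  linarith

lemma outer_hasBound_two_inner (h : IsFormTriple T A B N) (hL : IsTrigBound L) :
    HasBound (seqForm (compCoprim A)) ![1, 0, 1, -2] (6000 * (5 * (N * L ^ 3))) := by
  have hL0 := zero_le_one.trans hL.one_le
  have hN := h.nonneg
  refine hasBound_two (by positivity)
    (fun c₀ c₁ c₂ ψ => norm_compCoprim_le hN h.norm_outer_le hL0 (nrm_nonneg _ _) (nrm_nonneg _ _)
      (nrm_nonneg _ _) (hL.norm_one _) (hL.norm_zero _) (hL.norm_one _) ψ)
    (fun c₀ c₁ c₂ φ hφ => norm_compCoprim_deriv_le hN h.norm_outer_le hL0 (nrm_nonneg _ _)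
      (nrm_nonneg _ _) (nrm_nonneg _ _) (hL.norm_one _) (hL.norm_zero _) (hL.norm_one _) hφ)
    fun c₀ c₁ c₂ φ hφ => ?_
  have n0 := nrm_nonneg 1 c₀
  have n1 := nrm_nonneg 0 c₁
  have n2 := nrm_nonneg 1 c₂
  rw [compCoprim_deriv _ _ _ _ (testFun.deriv_mem hφ)]
  have q := (h.outer_parts (trig c₀) _ (trig c₁) (trig c₂) φ (L * nrm 1 c₀)
    (isC1_trig c₀) (continuous_trig _) (continuous_trig _) hφ (hL.bound c₀)).2 _ (hL.bound c₂)
  refine norm_le_of_add_le q (mul_add_le_cubic hN (norm_nonneg _) (hL.norm_one c₂)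
    (hL.norm_zero c₁) (norm_nonneg _) (by positivity) (by positivity))
    ((norm_apply_vec_le hN h.norm_outer_le (hL.norm_deriv c₀) (hL.norm_zero c₁)
    (hL.norm_one c₂) (cls φ)).trans_eq (by ring)) ?_
  have : 0 ≤ N * L ^ 3 * (nrm 1 c₀ * (nrm 0 c₁ * nrm 1 c₂)) * ‖cls φ‖ := by positivity
  linarith

/-- The second derivative goes to f₂ through x. The boundary term at x = z also needs a supremum
bound, here of f₀; the next lemma takes f₁ instead. -/
lemma inner_hasBound_two_outer (h : IsFormTriple T A B N) (hL : IsTrigBound L) :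
    HasBound (seqForm (compCoprim B)) ![1, 0, 1, -2] (6000 * (5 * (N * L ^ 3))) := by
  have hL0 := zero_le_one.trans hL.one_le
  have hN := h.nonneg
  refine hasBound_two (by positivity)
    (fun c₀ c₁ c₂ ψ => norm_compCoprim_le hN h.norm_inner_le hL0 (nrm_nonneg _ _) (nrm_nonneg _ _)
      (nrm_nonneg _ _) (hL.norm_one _) (hL.norm_zero _) (hL.norm_one _) ψ)
    (fun c₀ c₁ c₂ φ hφ => norm_compCoprim_deriv_le hN h.norm_inner_le hL0 (nrm_nonneg _ _)
      (nrm_nonneg _ _) (nrm_nonneg _ _) (hL.norm_one _) (hL.norm_zero _) (hL.norm_one _) hφ)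
    fun c₀ c₁ c₂ φ hφ => ?_
  have n0 := nrm_nonneg 1 c₀
  have n1 := nrm_nonneg 0 c₁
  have n2 := nrm_nonneg 1 c₂
  rw [compCoprim_deriv _ _ _ _ (testFun.deriv_mem hφ)]
  have q := (h.inner_parts (trig c₀) (trig c₁) (trig c₂) _ φ (L * nrm 1 c₂)
    (continuous_trig _) (continuous_trig _) (isC1_trig c₂) hφ (hL.bound c₂)).1 _ (hL.bound c₀)
  refine norm_le_of_add_le q (mul_add_le_cubic hN (norm_nonneg _) (hL.norm_one c₀)
    (hL.norm_zero c₁) (norm_nonneg _) (by positivity) (by positivity))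
    ((norm_apply_vec_le hN h.norm_inner_le (hL.norm_one c₀) (hL.norm_zero c₁)
    (hL.norm_deriv c₂) (cls φ)).trans_eq (by ring)) ?_
  have : 0 ≤ N * L ^ 3 * (nrm 1 c₀ * (nrm 0 c₁ * nrm 1 c₂)) * ‖cls φ‖ := by positivity
  linarith

lemma inner_hasBound_two_middle (h : IsFormTriple T A B N) (hL : IsTrigBound L) :
    HasBound (seqForm (compCoprim B)) ![0, 1, 1, -2] (6000 * (5 * (N * L ^ 3))) := by
  have hL0 := zero_le_one.trans hL.one_le
  have hN := h.nonneg
  refine hasBound_two (by positivity)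
    (fun c₀ c₁ c₂ ψ => norm_compCoprim_le hN h.norm_inner_le hL0 (nrm_nonneg _ _) (nrm_nonneg _ _)
      (nrm_nonneg _ _) (hL.norm_zero _) (hL.norm_one _) (hL.norm_one _) ψ)
    (fun c₀ c₁ c₂ φ hφ => norm_compCoprim_deriv_le hN h.norm_inner_le hL0 (nrm_nonneg _ _)
      (nrm_nonneg _ _) (nrm_nonneg _ _) (hL.norm_zero _) (hL.norm_one _) (hL.norm_one _) hφ)
    fun c₀ c₁ c₂ φ hφ => ?_
  have n0 := nrm_nonneg 0 c₀
  have n1 := nrm_nonneg 1 c₁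
  have n2 := nrm_nonneg 1 c₂
  rw [compCoprim_deriv _ _ _ _ (testFun.deriv_mem hφ)]
  have q := (h.inner_parts (trig c₀) (trig c₁) (trig c₂) _ φ (L * nrm 1 c₂)
    (continuous_trig _) (continuous_trig _) (isC1_trig c₂) hφ (hL.bound c₂)).2 _ (hL.bound c₁)
  refine norm_le_of_add_le q (mul_add_le_cubic hN (norm_nonneg _) (hL.norm_one c₁)
    (hL.norm_zero c₀) (norm_nonneg _) (by positivity) (by positivity))
    ((norm_apply_vec_le hN h.norm_inner_le (hL.norm_zero c₀) (hL.norm_one c₁)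
    (hL.norm_deriv c₂) (cls φ)).trans_eq (by ring)) ?_
  have : 0 ≤ N * L ^ 3 * (nrm 0 c₀ * (nrm 1 c₁ * nrm 1 c₂)) * ‖cls φ‖ := by positivity
  linarith

/-- The bound for the first form of a triple in the norms of orders `α` and `-γ`. -/
lemma hasBound (h : IsFormTriple T A B N) (hL : IsTrigBound L) {α γ : ℝ} (hα : 0 < α)
    (hα' : α ≤ 1) (h3 : γ ≤ 3 * α) (h1 : γ ≤ 1 + α) :
    HasBound (seqForm T) ![α, α, α, -γ] (90000 * N * L ^ 3) := by
  have hL0 := zero_le_one.trans hL.one_le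
  have hN := h.nonneg
  set C := 6000 * (5 * (N * L ^ 3)) with hC
  have hC0 : 0 ≤ C := by positivity
  -- Midpoints of the vertices: `m1` has the orders (1/2, 1/2, 1/2; −3/2) and `m2` has (1/2, 1, 1/2;
  -- −2).
  have m1 := (h.main_hasBound_one hL).interp (h.main_hasBound_two_outer hL)
    (θ := 1 / 2) (by norm_num) (by norm_num)
  have m2 := (h.main_hasBound_two_outer hL).interp (h.main_hasBound_two_inner hL)
    (θ := 1 / 2) (by norm_num) (by norm_num)
  have hm : HasBound (seqForm (main T A B)) ![α, α, α, -γ] C := by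
    -- From (0,0,0; 0) to `m1` the parameter 2α gives (α, α, α; −3α). From `m1` to `m2` the
    -- parameter 2α − 1 gives (1/2, α, 1/2; −1−α), which is stronger than required for α ≥ 1/2.
    rcases le_total α (1 / 2) with ha | ha
    · refine ((h.main_hasBound_zero hL).interp m1 (θ := 2 * α) (by linarith) (by linarith)).mono
        hC0 fun i => ?_
      fin_cases i <;> simp <;> linarith
    · refine (m1.interp m2 (θ := 2 * α - 1) (by linarith) (by linarith)).mono hC0 fun i => ?_
      fin_cases i <;> simp <;> linarith
  -- The midpoint of the two bounds of order −2 is (1, 1/2, 1/2; −2). The parameter α from (0,0,0;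
  -- −1) gives (α, α/2, α/2; −1−α). For B the roles of the outer and the inner factor are exchanged.
  have ho : HasBound (seqForm (compCoprim A)) ![α, α, α, -γ] C := by
    refine ((h.outer_hasBound_one hL).interp ((h.outer_hasBound_two_middle hL).interp
      (h.outer_hasBound_two_inner hL) (θ := 1 / 2) (by norm_num) (by norm_num)) hα.le hα').mono
      hC0 fun i => ?_
    fin_cases i <;> simp <;> linarith
  have hi : HasBound (seqForm (compCoprim B)) ![α, α, α, -γ] C := by
    refine ((h.inner_hasBound_one hL).interp ((h.inner_hasBound_two_outer hL).interp
      (h.inner_hasBound_two_middle hL) (θ := 1 / 2) (by norm_num) (by norm_num)) hα.le hα').mono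
      hC0 fun i => ?_
    fin_cases i <;> simp <;> linarith
  intro c
  have e : seqForm T c = seqForm (main T A B) c + seqForm (compCoprim B) c
      - seqForm (compCoprim A) c := by
    rw [seqForm_apply, seqForm_apply, seqForm_apply, seqForm_apply, main]
    simp only [add_apply, sub_apply]
    ring
  rw [e]
  have q1 := hm c
  have q2 := hi c
  have q3 := ho c
  refine (norm_sub_le _ _).trans ((add_le_add_left (norm_add_le _ _) _).trans ?_)
  linarith

end IsFormTriple

/-! ### Passage to the limit -/

/-- A finitely supported restriction of a sequence. -/
def restrictSeq (S : Finset ℤ) (a : ℤ → ℂ) : ℤ →₀ ℂ :=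
  Finsupp.onFinset S (fun k => if k ∈ S then a k else 0) fun k hk => by
    by_contra h
    simp [h] at hk

lemma restrictSeq_apply {S : Finset ℤ} {a : ℤ → ℂ} {k : ℤ} (h : k ∈ S) :
    restrictSeq S a k = a k := by
  simp [restrictSeq, h]

lemma support_restrictSeq (S : Finset ℤ) (a : ℤ → ℂ) : (restrictSeq S a).support ⊆ S :=
  Finsupp.support_onFinset_subset

lemma sq_nrm_restrictSeq (s : ℝ) (S : Finset ℤ) (a : ℤ → ℂ) :
    nrm s (restrictSeq S a) ^ 2 = ∑ k ∈ S, (wt k ^ s * ‖a k‖) ^ 2 := by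
  rw [sq_nrm, Finset.sum_subset (support_restrictSeq S a) fun k _ hk => by
    rw [Finsupp.notMem_support_iff.1 hk]; simp]
  exact Finset.sum_congr rfl fun k hk => by rw [restrictSeq_apply hk]

lemma trigL2_restrictSeq (S : Finset ℤ) (a : ℤ → ℂ) :
    trigL2 (restrictSeq S a) = ∑ k ∈ S, a k • expL2 k := by
  rw [trigL2, Finsupp.linearCombination_apply, Finsupp.sum,
    Finset.sum_subset (support_restrictSeq S a) fun k _ hk => by
      rw [Finsupp.notMem_support_iff.1 hk, zero_smul]]
  exact Finset.sum_congr rfl fun k hk => by rw [restrictSeq_apply hk]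

lemma pair_dualL2_restrictSeq (u : L2) (S : Finset ℤ) (a : ℤ → ℂ) :
    pair u (dualL2 (restrictSeq S a)) = ∑ k ∈ S, a k * aCoef k u := by
  rw [pair_dualL2, Finset.sum_subset (support_restrictSeq S a) fun k _ hk => by
      rw [Finsupp.notMem_support_iff.1 hk, zero_mul]]
  exact Finset.sum_congr rfl fun k hk => by rw [restrictSeq_apply hk]

/-- Test with d_k = wt^(2γ) times the conjugate coefficient, for k in S. The pairing is then the
square sum Q and the norm of d of order −γ is √Q, so Q ≤ D√Q. -/
lemma sum_wt_le_of_pair_le {v : L2} {D γ : ℝ}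
    (h : ∀ d, ‖pair v (dualL2 d)‖ ≤ D * nrm (-γ) d) (S : Finset ℤ) :
    ∑ k ∈ S, (wt k ^ γ * ‖aCoef k v‖) ^ 2 ≤ D ^ 2 := by
  set Q := ∑ k ∈ S, (wt k ^ γ * ‖aCoef k v‖) ^ 2 with hQ
  have hQ0 : 0 ≤ Q := Finset.sum_nonneg fun _ _ => sq_nonneg _
  have hw (k : ℤ) := Real.rpow_pos_of_pos (wt_pos k) γ
  let a : ℤ → ℂ := fun k => ((wt k ^ γ) ^ 2 : ℝ) * (starRingEnd ℂ) (aCoef k v)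
  have e1 : pair v (dualL2 (restrictSeq S a)) = (Q : ℂ) := by
    rw [pair_dualL2_restrictSeq, hQ, Complex.ofReal_sum]
    refine Finset.sum_congr rfl fun k _ => ?_
    simp only [a]
    rw [mul_assoc, Complex.conj_mul', mul_pow]
    push_cast
    ring
  have e2 : nrm (-γ) (restrictSeq S a) ^ 2 = Q := by
    rw [sq_nrm_restrictSeq, hQ]
    refine Finset.sum_congr rfl fun k _ => ?_
    simp only [a]
    rw [norm_mul, Complex.norm_real, RCLike.norm_conj, Real.norm_of_nonneg (sq_nonneg _),
      Real.rpow_neg (wt_pos k).le]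
    have := (hw k).ne'
    field_simp
  have h1 := h (restrictSeq S a)
  rw [e1, Complex.norm_real, Real.norm_of_nonneg hQ0, ← e2] at h1
  have h2 := nrm_nonneg (-γ) (restrictSeq S a)
  rw [← e2]
  rcases h2.eq_or_lt with h0 | h0
  · rw [← h0, zero_pow two_ne_zero]; positivity
  · have : nrm (-γ) (restrictSeq S a) ≤ D := by
      rw [sq] at h1
      exact le_of_mul_le_mul_right h1 h0
    gcongr

/-- T is continuous on L_2, so its value at x is the limit of its values at partial Fourier sums,
whose norms of order α are at most M. The bound obtained holds for every d, and duality concludes.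
-/
lemma IsFormTriple.sum_wt_le {T A B : ContinuousMultilinearMap ℂ (fun _ : Fin 4 => L2) ℂ}
    {N L α γ : ℝ} (h : IsFormTriple T A B N) (hL : IsTrigBound L) (hα : 0 < α) (hα' : α ≤ 1)
    (h3 : γ ≤ 3 * α) (h1 : γ ≤ 1 + α) {x v : L2} {M : ℝ} (hM : 0 ≤ M)
    (hx : ∀ S : Finset ℤ, ∑ k ∈ S, (wt k ^ α * ‖aCoef k x‖) ^ 2 ≤ M ^ 2)
    (hv : ∀ ψ, pair v ψ = T ![x, x, x, ψ]) (S : Finset ℤ) :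
    ∑ k ∈ S, (wt k ^ γ * ‖aCoef k v‖) ^ 2 ≤ (90000 * N * L ^ 3 * M ^ 3) ^ 2 := by
  have hN := h.nonneg
  have hL0 := zero_le_one.trans hL.one_le
  refine sum_wt_le_of_pair_le (fun d => ?_) S
  have hc : Continuous fun y : L2 => ‖T ![y, y, y, dualL2 d]‖ := by
    refine (T.cont.comp (continuous_pi fun i => ?_)).norm
    fin_cases i
    · exact continuous_id
    · exact continuous_id
    · exact continuous_id
    · exact continuous_const
  have ht := (hc.tendsto x).comp (hasSum_aCoef x)
  rw [hv]
  refine le_of_tendsto ht (Eventually.of_forall fun S => ?_)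
  have hb := h.hasBound hL hα hα' h3 h1
    ![restrictSeq S fun k => aCoef k x, restrictSeq S fun k => aCoef k x,
      restrictSeq S fun k => aCoef k x, d]
  have hn : nrm α (restrictSeq S fun k => aCoef k x) ≤ M :=
    le_of_sq_le_sq ((sq_nrm_restrictSeq _ _ _).trans_le (hx S)) hM
  rw [seqForm_apply, prod_nrm] at hb
  simp only [Matrix.cons_val, ← trigL2_eq, trigL2_restrictSeq] at hb
  have n0 := nrm_nonneg α (restrictSeq S fun k => aCoef k x)
  have nd := nrm_nonneg (-γ) d
  refine hb.trans ?_
  calc _ ≤ 90000 * N * L ^ 3 * (M * (M * M) * nrm (-γ) d) := by gcongr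
    _ = _ := by ring

/-- The regularity of the function that is represented by a quadrilinear form with a tail. -/
lemma IsTail.sum_wt_le {Y : Type*} [MeasurableSpace Y] {ν : Measure Y} [SFinite ν]
    {u : Y → ℂ} {b σ : Y → ℝ} {N L α γ : ℝ} (h : IsTail ν u b σ N) (hL : IsTrigBound L)
    (hα : 0 < α) (hα' : α ≤ 1) (h3 : γ ≤ 3 * α) (h1 : γ ≤ 1 + α) {f : ℝ → ℂ} (hf : Measurable f)
    (hf2 : MemLp f 2 unitMeasure) {v : L2} {M : ℝ} (hM : 0 ≤ M)
    (hx : ∀ S : Finset ℤ, ∑ k ∈ S, (wt k ^ α * ‖aCoef k (cls f)‖) ^ 2 ≤ M ^ 2)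
    (hv : ∀ η : ℝ → ℂ, Measurable η → MemLp η 2 unitMeasure → (∀ x ∉ Ioo (0 : ℝ) 1, η x = 0) →
      pair v (cls η) = int₃ ν u b fun t z y x => f z * f y * f x * η (z - y + x - σ t))
    (S : Finset ℤ) :
    ∑ k ∈ S, (wt k ^ γ * ‖aCoef k v‖) ^ 2 ≤ (90000 * N * L ^ 3 * M ^ 3) ^ 2 := by
  obtain ⟨T, A, B, hT, hT'⟩ := h.exists_formTriple
  refine hT.sum_wt_le hL hα hα' h3 h1 hM hx (fun ψ => ?_) S
  let η : ℝ → ℂ := (Ioo (0 : ℝ) 1).indicator ψ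
  have hη : Measurable η := (measurable_coe ψ).indicator measurableSet_Ioo
  have hη' : η =ᵐ[unitMeasure] ψ := by
    filter_upwards [ae_restrict_mem measurableSet_Ioo] with x hx
    exact indicator_of_mem hx _
  have hη2 : MemLp η 2 unitMeasure := (Lp.memLp ψ).ae_eq hη'.symm
  have hη0 : ∀ x ∉ Ioo (0 : ℝ) 1, η x = 0 := fun x hx => indicator_of_notMem hx _
  have e : ψ = cls η := by rw [cls_congr hη', cls_coe]
  rw [e, hv η hη hη2 hη0, ← cls_vec]
  refine (hT' ![f, f, f, η] (fun i => ?_) (fun i => ?_) hη0).symm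
  · fin_cases i <;> assumption
  · fin_cases i <;> assumption

/-! ### Integrals over ordered simplices -/

lemma measurePreserving_cons (m : ℕ) :
    MeasurePreserving (fun q : (Fin m → ℝ) × ℝ => (Fin.cons q.2 q.1 : Fin (m + 1) → ℝ))
      (volume.prod volume) volume := by
  have h := (volume_preserving_piFinSuccAbove (fun _ : Fin (m + 1) => ℝ) 0).symm
  have h' := h.comp (Measure.measurePreserving_swap (μ := (volume : Measure (Fin m → ℝ)))
    (ν := (volume : Measure ℝ)))
  convert! h' using 1
  ext1 q
  exact (Fin.insertNth_zero' q.2 q.1).symm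

lemma measurable_cons (m : ℕ) :
    Measurable fun q : (Fin m → ℝ) × ℝ => (Fin.cons q.2 q.1 : Fin (m + 1) → ℝ) :=
  (measurePreserving_cons m).measurable

lemma lintegral_cons {m : ℕ} {G : (Fin (m + 1) → ℝ) → ℝ≥0∞} (hG : Measurable G) :
    ∫⁻ w, G w = ∫⁻ t, ∫⁻ x, G (Fin.cons x t) := by
  rw [← (measurePreserving_cons m).lintegral_comp hG]
  exact lintegral_prod _ (hG.comp (measurable_cons m)).aemeasurable

lemma lintegral_cons_symm {m : ℕ} {G : (Fin (m + 1) → ℝ) → ℝ≥0∞} (hG : Measurable G) :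
    ∫⁻ w, G w = ∫⁻ x, ∫⁻ t, G (Fin.cons x t) := by
  rw [lintegral_cons hG]
  exact lintegral_lintegral_swap (hG.comp (measurable_cons m)).aemeasurable

/-- The simplex `a ≥ t_1 ≥ t_2 ≥ ⋯ ≥ t_m ≥ 0`. -/
def simplex (m : ℕ) (a : ℝ) : Set (Fin m → ℝ) := {t | Antitone t ∧ ∀ i, t i ∈ Icc 0 a}

lemma antitone_cons {m : ℕ} {x : ℝ} {t : Fin m → ℝ} :
    Antitone (Fin.cons x t : Fin (m + 1) → ℝ) ↔ (∀ i, t i ≤ x) ∧ Antitone t := by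
  constructor
  · intro h
    refine ⟨fun i => ?_, fun i j hij => ?_⟩
    · simpa using h (Fin.zero_le i.succ)
    · simpa using h (Fin.succ_le_succ_iff.2 hij)
  · rintro ⟨h1, h2⟩ i j hij
    cases i using Fin.cases with
    | zero => cases j using Fin.cases with
      | zero => simp
      | succ j => simpa using h1 j
    | succ i => cases j using Fin.cases with
      | zero => exact absurd hij (by simp)
      | succ j => simpa using h2 (Fin.succ_le_succ_iff.1 hij)

lemma cons_mem_simplex {m : ℕ} {a x : ℝ} {t : Fin m → ℝ} :
    (Fin.cons x t : Fin (m + 1) → ℝ) ∈ simplex (m + 1) a ↔ x ∈ Icc 0 a ∧ t ∈ simplex m x := by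
  simp only [simplex, mem_ofPred_eq, antitone_cons, Fin.forall_fin_succ, Fin.cons_zero,
    Fin.cons_succ, mem_Icc]
  constructor
  · rintro ⟨⟨h1, h2⟩, h3, h4⟩
    exact ⟨h3, h2, fun i => ⟨(h4 i).1, h1 i⟩⟩
  · rintro ⟨h1, h2, h3⟩
    exact ⟨⟨fun i => (h3 i).2, h2⟩, h1, fun i => ⟨(h3 i).1, (h3 i).2.trans h1.2⟩⟩

lemma simplex_mono {m : ℕ} {a b : ℝ} (h : a ≤ b) : simplex m a ⊆ simplex m b :=
  fun _ ht => ⟨ht.1, fun i => ⟨(ht.2 i).1, (ht.2 i).2.trans h⟩⟩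

lemma isClosed_simplex (m : ℕ) (a : ℝ) : IsClosed (simplex m a) := by
  have h1 : IsClosed {t : Fin m → ℝ | Antitone t} := by
    have : {t : Fin m → ℝ | Antitone t} = ⋂ i, ⋂ j, ⋂ _ : i ≤ j, {t | t j ≤ t i} := by
      ext t; simp [Antitone]
    rw [this]
    exact isClosed_iInter fun i => isClosed_iInter fun j => isClosed_iInter fun _ =>
      isClosed_le (continuous_apply j) (continuous_apply i)
  have h2 : IsClosed {t : Fin m → ℝ | ∀ i, t i ∈ Icc 0 a} := by
    have : {t : Fin m → ℝ | ∀ i, t i ∈ Icc 0 a} = ⋂ i, {t | t i ∈ Icc 0 a} := by ext t; simp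
    rw [this]
    exact isClosed_iInter fun i => isClosed_Icc.preimage (continuous_apply i)
  exact h1.inter h2

lemma measurableSet_simplex (m : ℕ) (a : ℝ) : MeasurableSet (simplex m a) :=
  (isClosed_simplex m a).measurableSet

/-- The product of the values of `g` on the simplex. -/
def simplexProd (g : ℝ → ℝ≥0∞) (m : ℕ) (a : ℝ) (t : Fin m → ℝ) : ℝ≥0∞ :=
  (simplex m a).indicator (fun t => ∏ i, g (t i)) t

lemma measurable_simplexProd {g : ℝ → ℝ≥0∞} (hg : Measurable g) (m : ℕ) (a : ℝ) :
    Measurable (simplexProd g m a) :=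
  (Finset.measurable_fun_prod _ fun i _ => hg.comp (measurable_pi_apply i)).indicator
    (measurableSet_simplex m a)

lemma simplexProd_cons (g : ℝ → ℝ≥0∞) (m : ℕ) (a x : ℝ) (t : Fin m → ℝ) :
    simplexProd g (m + 1) a (Fin.cons x t)
      = (Icc 0 a).indicator g x * simplexProd g m x t := by
  unfold simplexProd
  by_cases h1 : x ∈ Icc 0 a <;> by_cases h2 : t ∈ simplex m x <;>
    simp [indicator, cons_mem_simplex, h1, h2, Fin.prod_univ_succ]

lemma simplexProd_mono (g : ℝ → ℝ≥0∞) (m : ℕ) {a b : ℝ} (h : a ≤ b) (t : Fin m → ℝ) :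
    simplexProd g m a t ≤ simplexProd g m b t :=
  indicator_le_indicator_of_subset (simplex_mono h) (fun _ => zero_le) t

lemma simplexProd_cons_le (g : ℝ → ℝ≥0∞) (m : ℕ) (x : ℝ) (t : Fin m → ℝ) :
    simplexProd g (m + 1) 1 (Fin.cons x t)
      ≤ (Icc (0 : ℝ) 1).indicator g x * simplexProd g m 1 t := by
  rw [simplexProd_cons]
  by_cases hx : x ∈ Icc (0 : ℝ) 1
  · exact mul_le_mul_right (simplexProd_mono g m hx.2 t) _
  · simp [hx]

lemma lintegral_Icc_pow_div {a : ℝ} (ha : 0 ≤ a) (m : ℕ) :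
    ∫⁻ x in Icc 0 a, ENNReal.ofReal (x ^ m / m.factorial)
      = ENNReal.ofReal (a ^ (m + 1) / (m + 1).factorial) := by
  rw [← ofReal_integral_eq_lintegral_ofReal]
  · rw [integral_Icc_eq_integral_Ioc, ← intervalIntegral.integral_of_le ha,
      intervalIntegral.integral_div, integral_pow, Nat.factorial_succ]
    congr 1
    have : (m.factorial : ℝ) ≠ 0 := by positivity
    push_cast
    field_simp
    simp
  · exact (by fun_prop : Continuous fun x : ℝ => x ^ m / m.factorial).continuousOn.integrableOn_Icc
  · filter_upwards [ae_restrict_mem measurableSet_Icc] with x hx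
    have := hx.1
    positivity

/-- Induction on the largest variable x. The remaining simplex has height x and contributes
(x^m/m!)^(1/2); Cauchy–Schwarz against g integrates x^m/m! to a^(m+1)/(m+1)!. -/
lemma lintegral_simplexProd_le {g : ℝ → ℝ≥0∞} (hg : Measurable g) (m : ℕ) {a : ℝ}
    (ha : a ∈ Icc (0 : ℝ) 1) : ∫⁻ t, simplexProd g m a t
      ≤ ENNReal.ofReal (a ^ m / m.factorial) ^ (1 / (2 : ℝ)) * e2 g ^ m := by
  induction m generalizing a with
  | zero =>
    have hv : (volume : Measure (Fin 0 → ℝ)) univ = 1 := by simp [volume_pi]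
    have : ∀ t : Fin 0 → ℝ, simplexProd g 0 a t = 1 := fun t => by
      have : t ∈ simplex 0 a := ⟨fun i => i.elim0, fun i => i.elim0⟩
      simp [simplexProd, this]
    simp [this, hv]
  | succ m ih =>
    have h1 : ∫⁻ t, simplexProd g (m + 1) a t ≤ ∫⁻ x in Icc 0 a,
        g x * (ENNReal.ofReal (x ^ m / m.factorial) ^ (1 / (2 : ℝ)) * e2 g ^ m) := by
      rw [lintegral_cons_symm (measurable_simplexProd hg _ _), ← lintegral_indicator measurableSet_Icc]
      refine lintegral_mono fun x => ?_
      simp only [simplexProd_cons]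
      by_cases hx : x ∈ Icc 0 a
      · rw [indicator_of_mem hx, indicator_of_mem hx,
          lintegral_const_mul _ (measurable_simplexProd hg _ _)]
        exact mul_le_mul_right (ih ⟨hx.1, hx.2.trans ha.2⟩) _
      · simp [hx]
    refine h1.trans ?_
    have h2 := ENNReal.lintegral_mul_le_Lp_mul_Lq (volume.restrict (Icc 0 a))
      Real.HolderConjugate.two_two hg.aemeasurable
      (g := fun x => ENNReal.ofReal (x ^ m / m.factorial) ^ (1 / (2 : ℝ)) * e2 g ^ m)
      (by fun_prop)
    refine h2.trans ?_
    have h3 : (∫⁻ x in Icc 0 a, g x ^ (2 : ℝ)) ^ (1 / (2 : ℝ)) ≤ e2 g := by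
      refine ENNReal.rpow_le_rpow ?_ (by norm_num)
      rw [← lintegral_Icc_eq, lintegral_indicator measurableSet_Icc]
      exact lintegral_mono_set (Icc_subset_Icc_right ha.2)
    have h4 : (∫⁻ x in Icc 0 a, (ENNReal.ofReal (x ^ m / m.factorial) ^ (1 / (2 : ℝ))
        * e2 g ^ m) ^ (2 : ℝ)) ^ (1 / (2 : ℝ))
        = ENNReal.ofReal (a ^ (m + 1) / (m + 1).factorial) ^ (1 / (2 : ℝ)) * e2 g ^ m := by
      have : ∀ x : ℝ, (ENNReal.ofReal (x ^ m / m.factorial) ^ (1 / (2 : ℝ)) * e2 g ^ m) ^ (2 : ℝ)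
          = ENNReal.ofReal (x ^ m / m.factorial) * (e2 g ^ m) ^ (2 : ℝ) := fun x => by
        rw [ENNReal.mul_rpow_of_nonneg _ _ (by norm_num), ← ENNReal.rpow_mul]
        norm_num
      simp only [this]
      rw [lintegral_mul_const _ (by fun_prop), lintegral_Icc_pow_div ha.1,
        ENNReal.mul_rpow_of_nonneg _ _ (by norm_num), ← ENNReal.rpow_mul]
      norm_num
    rw [h4, pow_succ (e2 g) m]
    refine (mul_le_mul_left h3 _).trans (le_of_eq ?_)
    ring

lemma lintegral_simplexProd_enorm_le {f : ℝ → ℂ} (hf : Measurable f)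
    (hf2 : MemLp f 2 unitMeasure) (m : ℕ) :
    ∫⁻ t, simplexProd (fun x => ‖f x‖ₑ) m 1 t
      ≤ ENNReal.ofReal (‖cls f‖ ^ m / √(m.factorial : ℝ)) := by
  refine (lintegral_simplexProd_le hf.enorm m (by simp)).trans (le_of_eq ?_)
  rw [e2_enorm_eq_ofReal hf2, ENNReal.ofReal_rpow_of_nonneg (by positivity) (by norm_num),
    ← ENNReal.ofReal_pow (norm_nonneg _), ← ENNReal.ofReal_mul (by positivity),
    ← Real.sqrt_eq_rpow, one_pow, Real.sqrt_div zero_le_one, Real.sqrt_one]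
  congr 1
  ring

/-! ### The tails of the multilinear integrals -/

lemma altSum_cons {m : ℕ} (x : ℝ) (t : Fin m → ℝ) :
    altSum (Fin.cons x t : Fin (m + 1) → ℝ) = x - altSum t := by
  unfold altSum
  rw [Fin.sum_univ_succ, sub_eq_add_neg, ← Finset.sum_neg_distrib]
  simp [pow_succ]

lemma measurable_altSum (m : ℕ) : Measurable (altSum (n := m)) :=
  Finset.measurable_fun_sum _ fun i _ => (measurable_pi_apply i).const_mul _

/-- The largest coordinate of a point of the simplex. -/
def base : {m : ℕ} → (Fin m → ℝ) → ℝ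
  | 0, _ => 0
  | _ + 1, t => max 0 (min 1 (t 0))

lemma base_mem {m : ℕ} (t : Fin m → ℝ) : base t ∈ Icc (0 : ℝ) 1 := by
  cases m with
  | zero => simp [base]
  | succ m => exact ⟨le_max_left _ _, max_le zero_le_one (min_le_left _ _)⟩

lemma measurable_base (m : ℕ) : Measurable (base (m := m)) := by
  cases m with
  | zero => exact measurable_const
  | succ m => exact measurable_const.max (measurable_const.min (measurable_pi_apply 0))

/-- The tail interacts with x only through `base t`. Clamping to [0,1] keeps `base` in range off the
simplex, and its value 0 for the empty tail is the right lower limit for x. -/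
lemma mem_simplex_iff {m : ℕ} {x : ℝ} (hx : x ≤ 1) {t : Fin m → ℝ} (hx0 : 0 ≤ x) :
    t ∈ simplex m x ↔ t ∈ simplex m 1 ∧ base t ≤ x := by
  refine ⟨fun h => ⟨simplex_mono hx h, ?_⟩, fun h => ⟨h.1.1, fun i => ⟨(h.1.2 i).1, ?_⟩⟩⟩
  · cases m with
    | zero => exact hx0
    | succ m => exact max_le hx0 ((min_le_right _ _).trans (h.2 0).2)
  · cases m with
    | zero => exact i.elim0
    | succ m =>
      have h1 : min 1 (t 0) ≤ x := (le_max_right _ _).trans h.2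
      rw [min_eq_right (h.1.2 0).2] at h1
      exact (h.1.1 (Fin.zero_le i)).trans h1

/-- The weight of the tail. -/
def tailWeight (f : ℝ → ℂ) (m : ℕ) (t : Fin m → ℝ) : ℂ :=
  (simplex m 1).indicator (fun t => ∏ i, f (t i)) t

lemma enorm_tailWeight (f : ℝ → ℂ) (m : ℕ) (t : Fin m → ℝ) :
    ‖tailWeight f m t‖ₑ = simplexProd (fun x => ‖f x‖ₑ) m 1 t := by
  rw [tailWeight, simplexProd, enorm_indicator_eq_indicator_enorm]
  congr 1
  ext t
  simp only [← ofReal_norm, norm_prod]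
  rw [ENNReal.ofReal_prod_of_nonneg fun i _ => norm_nonneg _]

/-- The largest variable enters the alternating sum with coefficient 1, so it alone absorbs φ by
Cauchy–Schwarz. The other m variables keep their order and hence their factorial. -/
lemma lintegral_simplexProd_jump_le {g φ : ℝ → ℝ≥0∞} (hg : Measurable g) (hφ : Measurable φ)
    {ε : ℝ} (hε : ε = 1 ∨ ε = -1) (m : ℕ) (c : ℝ) :
    ∫⁻ t, simplexProd g (m + 1) 1 t * (Ioo (0 : ℝ) 1).indicator φ (ε * altSum t + c)
      ≤ (∫⁻ t, simplexProd g m 1 t) * (e2 g * e2 φ) := by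
  have i1 := hφ.indicator (measurableSet_Ioo (a := (0 : ℝ)) (b := 1))
  have i2 := hg.indicator (measurableSet_Icc (a := (0 : ℝ)) (b := 1))
  have ma := measurable_altSum (m + 1)
  rw [lintegral_cons (G := fun t => simplexProd g (m + 1) 1 t *
      (Ioo (0 : ℝ) 1).indicator φ (ε * altSum t + c)) ((measurable_simplexProd hg _ _).mul (i1.comp (by fun_prop))),
    ← lintegral_mul_const _ (measurable_simplexProd hg _ _)]
  refine lintegral_mono fun t => ?_
  simp only
  refine le_trans (lintegral_mono fun x => ?_) ((lintegral_const_mul _ ?_).le.trans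
    (mul_le_mul_right (lintegral_mul_affine_le hg hφ hε (-(ε * altSum t) + c)) _))
  · simp only
    rw [altSum_cons, show ε * (x - altSum t) + c = ε * x + (-(ε * altSum t) + c) by ring]
    refine (mul_le_mul_left (simplexProd_cons_le g m x t) _).trans (le_of_eq ?_)
    ring
  · exact i2.mul (i1.comp (by fun_prop))

/-- The largest variable does not occur in H and is integrated out by itself. -/
lemma lintegral_simplexProd_le_pred {g : ℝ → ℝ≥0∞} (hg : Measurable g) (m : ℕ)
    {H : (Fin m → ℝ) → ℝ≥0∞} (hH : Measurable H) :
    ∫⁻ w, simplexProd g (m + 1) 1 w * H (Fin.tail w)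
      ≤ e2 g * ∫⁻ t, simplexProd g m 1 t * H t := by
  have i2 := hg.indicator (measurableSet_Icc (a := (0 : ℝ)) (b := 1))
  have mt : Measurable (fun w : Fin (m + 1) → ℝ => Fin.tail w) :=
    measurable_pi_lambda _ fun i => measurable_pi_apply _
  rw [lintegral_cons_symm (G := fun w => simplexProd g (m + 1) 1 w * H (Fin.tail w))
    ((measurable_simplexProd hg _ _).mul (hH.comp mt))]
  refine le_trans (lintegral_mono fun x => ?_) ((lintegral_mul_const _ i2).le.trans
    (mul_le_mul_left (lintegral_Icc_le_e2 hg) _))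
  refine le_trans (lintegral_mono fun t => ?_)
    (lintegral_const_mul _ ((measurable_simplexProd hg _ _).mul hH)).le
  simp only [Fin.tail_cons, Pi.mul_apply]
  rw [← mul_assoc]
  exact mul_le_mul_left (simplexProd_cons_le g m x t) _

/-- The mass has √(m!) in the denominator. The jump at 1 spends one variable on φ, leaving
√((m−1)!); the jump at the base loses the largest variable as well, leaving √((m−2)!), the worst of
the three. -/
lemma isTail_tailWeight {f : ℝ → ℂ} (hf : Measurable f) (hf2 : MemLp f 2 unitMeasure) (m : ℕ) :
    IsTail volume (tailWeight f m) base altSum (‖cls f‖ ^ m / √((m - 2).factorial : ℝ)) := by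
  have hg := hf.enorm
  have hle {a b : ℝ} (j : ℕ) (hj : m - 2 ≤ j) (h : a ≤ b / √(j.factorial : ℝ)) (hb : 0 ≤ b) :
      ENNReal.ofReal a ≤ ENNReal.ofReal (b / √((m - 2).factorial : ℝ)) := by
    refine ENNReal.ofReal_le_ofReal (h.trans ?_)
    gcongr
  refine ⟨?_, measurable_base m, measurable_altSum m, by positivity, base_mem, ?_, ?_, ?_⟩
  · exact (Finset.measurable_fun_prod _ fun i _ => hf.comp (measurable_pi_apply i)).indicator
      (measurableSet_simplex m 1)
  · simp only [enorm_tailWeight]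
    exact (lintegral_simplexProd_enorm_le hf hf2 m).trans
      (hle m (Nat.sub_le _ _) le_rfl (by positivity))
  · intro φ hφ
    simp only [enorm_tailWeight]
    cases m with
    -- With an empty tail the argument is 1, outside the open interval.
    | zero => simp [altSum]
    | succ m =>
      have h := lintegral_simplexProd_jump_le hg hφ (Or.inr rfl) m 1
      simp only [neg_mul, one_mul, neg_add_eq_sub] at h
      refine h.trans ((mul_le_mul_left (lintegral_simplexProd_enorm_le hf hf2 m) _).trans ?_)
      rw [e2_enorm_eq_ofReal hf2, ← mul_assoc, ← ENNReal.ofReal_mul (by positivity)]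
      refine mul_le_mul_left (hle m (by omega) (le_of_eq ?_) (by positivity)) _
      ring
  · intro φ hφ
    simp only [enorm_tailWeight]
    match m with
    -- For tails of length 0 and 1 the base equals the alternating sum on the simplex, and the
    -- argument 0 lies outside the open interval.
    | 0 => simp [altSum, base]
    | 1 =>
      have : ∀ t : Fin 1 → ℝ, simplexProd (fun x => ‖f x‖ₑ) 1 1 t
          * (Ioo (0 : ℝ) 1).indicator φ (base t - altSum t) = 0 := fun t => by
        by_cases ht : t ∈ simplex 1 1
        · have h0 := ht.2 0
          have : base t - altSum t = 0 := by
            simp [base, altSum, h0.1, h0.2]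
          rw [this]; simp
        · simp [simplexProd, ht]
      simp [this]
    | m + 2 =>
      have i1 := hφ.indicator (measurableSet_Ioo (a := (0 : ℝ)) (b := 1))
      have ma := measurable_altSum (m + 1)
      -- The largest coordinate cancels in `base t - altSum t`, which leaves the alternating sum of
      -- the remaining coordinates.
      have e : ∀ t : Fin (m + 2) → ℝ, simplexProd (fun x => ‖f x‖ₑ) (m + 2) 1 t
          * (Ioo (0 : ℝ) 1).indicator φ (base t - altSum t)
          = simplexProd (fun x => ‖f x‖ₑ) (m + 2) 1 t
          * (fun t => (Ioo (0 : ℝ) 1).indicator φ (1 * altSum t + 0)) (Fin.tail t) := fun t => by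
        by_cases ht : t ∈ simplex (m + 2) 1
        · have h0 : base t = t 0 := by
            have h0 := ht.2 0
            simp [base, h0.1, h0.2]
          have h1 : altSum t = t 0 - altSum (Fin.tail t) := by
            rw [← altSum_cons, Fin.cons_self_tail]
          rw [h0, h1]
          simp
        · simp [simplexProd, ht]
      simp only [e]
      refine (lintegral_simplexProd_le_pred hg (m + 1)
        (H := fun t => (Ioo (0 : ℝ) 1).indicator φ (1 * altSum t + 0))
        (i1.comp (by fun_prop))).trans ?_
      refine (mul_le_mul_right ((lintegral_simplexProd_jump_le hg hφ (Or.inl rfl) m 0).trans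
        (mul_le_mul_left (lintegral_simplexProd_enorm_le hf hf2 m) _)) _).trans ?_
      rw [e2_enorm_eq_ofReal hf2, ← mul_assoc, ← mul_assoc, ← ENNReal.ofReal_mul (by positivity),
        ← ENNReal.ofReal_mul (by positivity)]
      refine mul_le_mul_left (hle m (by omega) (le_of_eq ?_) (by positivity)) _
      ring

/-! ### The multilinear integrals -/

lemma mem_slice_iff {n : ℕ} {s : ℝ} {y : Fin n → ℝ} :
    y ∈ slice n s ↔ y ∈ simplex n (s + altSum y) ∧ s + altSum y ≤ 1 := by
  simp only [slice, simplex, mem_ofPred_eq, mem_Icc, forall_and]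
  tauto

lemma measurableSet_slice_graph (n : ℕ) :
    MeasurableSet {q : (Fin n → ℝ) × ℝ | q.1 ∈ slice n q.2} := by
  have ha : Continuous fun q : (Fin n → ℝ) × ℝ => q.2 + altSum q.1 := by
    unfold altSum; fun_prop
  have h1 : IsClosed {q : (Fin n → ℝ) × ℝ | Antitone q.1} := by
    have : {q : (Fin n → ℝ) × ℝ | Antitone q.1}
        = ⋂ i, ⋂ j, ⋂ _ : i ≤ j, {q | q.1 j ≤ q.1 i} := by
      ext t; simp [Antitone]
    rw [this]
    exact isClosed_iInter fun i => isClosed_iInter fun j => isClosed_iInter fun _ =>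
      isClosed_le (by fun_prop) (by fun_prop)
  have h2 : IsClosed {q : (Fin n → ℝ) × ℝ | ∀ i, 0 ≤ q.1 i} := by
    simp only [ofPred_forall]
    exact isClosed_iInter fun i => isClosed_le (by fun_prop) (by fun_prop)
  have h3 : IsClosed {q : (Fin n → ℝ) × ℝ | ∀ i, q.1 i ≤ q.2 + altSum q.1} := by
    simp only [ofPred_forall]
    exact isClosed_iInter fun i => isClosed_le (by fun_prop) ha
  have h4 : IsClosed {q : (Fin n → ℝ) × ℝ | q.2 + altSum q.1 ≤ 1} := isClosed_le ha (by fun_prop)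
  exact (h2.inter (h1.inter (h3.inter h4))).measurableSet

lemma measurableSet_slice (n : ℕ) (s : ℝ) : MeasurableSet (slice n s) :=
  (measurableSet_slice_graph n).preimage (measurable_prodMk_right (y := s))

/-- The integrand of the multilinear integral as a function on the whole space. -/
def fullIntegrand (f : ℝ → ℂ) (n : ℕ) (q : (Fin n → ℝ) × ℝ) : ℂ :=
  {q : (Fin n → ℝ) × ℝ | q.1 ∈ slice n q.2}.indicator
    (fun q => f (q.2 + altSum q.1) * ∏ i, f (q.1 i)) q

lemma measurable_fullIntegrand {f : ℝ → ℂ} (hf : Measurable f) (n : ℕ) :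
    Measurable (fullIntegrand f n) := by
  have ha := measurable_altSum n
  refine ((hf.comp (by fun_prop)).mul (Finset.measurable_fun_prod _ fun i _ => hf.comp ?_)).indicator
    (measurableSet_slice_graph n)
  exact (measurable_pi_apply i).comp measurable_fst

lemma fullIntegrand_eq (f : ℝ → ℂ) (n : ℕ) (y : Fin n → ℝ) (s : ℝ) :
    fullIntegrand f n (y, s) = (slice n s).indicator (integrand (fun _ => f) s) y := by
  by_cases h : y ∈ slice n s
  · rw [indicator_of_mem h, fullIntegrand, indicator_of_mem (by exact h)]
    rfl
  · rw [indicator_of_notMem h, fullIntegrand, indicator_of_notMem (by exact h)]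

lemma multInt_eq (f : ℝ → ℂ) (n : ℕ) (s : ℝ) :
    multInt (n := n) (fun _ => f) s = ∫ y, fullIntegrand f n (y, s) := by
  rw [multInt, ← integral_indicator (measurableSet_slice n s)]
  simp only [fullIntegrand_eq]

lemma enorm_fullIntegrand_le (f : ℝ → ℂ) (n : ℕ) (y : Fin n → ℝ) (s : ℝ) :
    ‖fullIntegrand f n (y, s)‖ₑ
      ≤ simplexProd (fun x => ‖f x‖ₑ) n 1 y * ‖f (s + altSum y)‖ₑ := by
  by_cases h : y ∈ slice n s
  · have h1 : y ∈ simplex n 1 := simplex_mono (mem_slice_iff.1 h).2 (mem_slice_iff.1 h).1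
    rw [fullIntegrand, indicator_of_mem (by exact h), simplexProd, indicator_of_mem h1, enorm_mul,
      mul_comm]
    refine mul_le_mul_left (le_of_eq ?_) _
    simp only [← ofReal_norm, norm_prod]
    rw [ENNReal.ofReal_prod_of_nonneg fun i _ => norm_nonneg _]
  · rw [fullIntegrand, indicator_of_notMem (by exact h), enorm_zero]
    exact zero_le

/-- Cauchy–Schwarz for the functions F and 1 with respect to the measure P dμ. -/
lemma sq_lintegral_mul_le {X : Type*} [MeasurableSpace X] {μ : Measure X} {P F : X → ℝ≥0∞}
    (hP : Measurable P) (hF : Measurable F) :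
    (∫⁻ x, P x * F x ∂μ) ^ (2 : ℝ) ≤ (∫⁻ x, P x ∂μ) * ∫⁻ x, P x * F x ^ (2 : ℝ) ∂μ := by
  have h := ENNReal.lintegral_mul_le_Lp_mul_Lq μ Real.HolderConjugate.two_two
    (f := fun x => P x ^ (1 / (2 : ℝ))) (g := fun x => P x ^ (1 / (2 : ℝ)) * F x)
    (by fun_prop) (by fun_prop)
  have e1 : ∀ x, P x ^ (1 / (2 : ℝ)) * (P x ^ (1 / (2 : ℝ)) * F x) = P x * F x := fun x => by
    rw [← mul_assoc, ← ENNReal.rpow_add_of_nonneg _ _ (by norm_num) (by norm_num)]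
    norm_num
  have e2 : ∀ x, (P x ^ (1 / (2 : ℝ))) ^ (2 : ℝ) = P x := fun x => by
    rw [← ENNReal.rpow_mul]; norm_num
  simp only [Pi.mul_apply, e1, ENNReal.mul_rpow_of_nonneg _ _ (zero_le_two (α := ℝ)), e2] at h
  refine (ENNReal.rpow_le_rpow h (zero_le_two (α := ℝ))).trans (le_of_eq ?_)
  rw [ENNReal.mul_rpow_of_nonneg _ _ (zero_le_two (α := ℝ)), ← ENNReal.rpow_mul, ← ENNReal.rpow_mul]
  norm_num

lemma lintegral_eq_of_eq_zero {F : ℝ → ℝ≥0∞} (h : ∀ x ∉ Ioo (0 : ℝ) 1, F x = 0) :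
    ∫⁻ x, F x = ∫⁻ x, F x ∂unitMeasure := by
  rw [← lintegral_indicator measurableSet_Ioo]
  refine lintegral_congr fun x => ?_
  by_cases hx : x ∈ Ioo (0 : ℝ) 1
  · rw [indicator_of_mem hx]
  · rw [indicator_of_notMem hx, h x hx]

/-- The bound for the `L_2`-norms of the absolutely convergent multilinear integrals. -/
lemma e2_lintegral_fullIntegrand_le {f : ℝ → ℂ} (hf : Measurable f) (hf2 : MemLp f 2 unitMeasure)
    (hf0 : ∀ x ∉ Ioo (0 : ℝ) 1, f x = 0) (n : ℕ) :
    e2 (fun s => ∫⁻ y, ‖fullIntegrand f n (y, s)‖ₑ)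
      ≤ ENNReal.ofReal (‖cls f‖ ^ (n + 1) / √(n.factorial : ℝ)) := by
  set A := ∫⁻ t, simplexProd (fun x => ‖f x‖ₑ) n 1 t with hA
  have hP := measurable_simplexProd hf.enorm n 1
  have ma := measurable_altSum n
  have e : ∫⁻ x, ‖f x‖ₑ ^ (2 : ℝ) = e2 (fun x => ‖f x‖ₑ) ^ (2 : ℝ) := by
    rw [e2, ← ENNReal.rpow_mul, lintegral_eq_of_eq_zero fun x hx => by simp [hf0 x hx]]
    norm_num
  -- Cauchy–Schwarz in y with the simplex weight, then Tonelli. The shift s ↦ s + ξ(y) preserves the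
  -- L_2-norm of f, because f vanishes outside (0,1).
  have key : ∫⁻ s, (∫⁻ y, ‖fullIntegrand f n (y, s)‖ₑ) ^ (2 : ℝ) ∂unitMeasure
      ≤ (A * e2 (fun x => ‖f x‖ₑ)) ^ (2 : ℝ) := by
    refine (lintegral_mono' Measure.restrict_le_self le_rfl).trans ?_
    refine (lintegral_mono fun s => (ENNReal.rpow_le_rpow (lintegral_mono fun y =>
      enorm_fullIntegrand_le f n y s) zero_le_two).trans (sq_lintegral_mul_le hP
        (F := fun y => ‖f (s + altSum y)‖ₑ) (by fun_prop))).trans ?_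
    rw [lintegral_const_mul' _ _ ((lintegral_simplexProd_enorm_le hf hf2 n).trans_lt
      ENNReal.ofReal_lt_top).ne, lintegral_lintegral_swap
        (f := fun s y => simplexProd (fun x => ‖f x‖ₑ) n 1 y * ‖f (s + altSum y)‖ₑ ^ (2 : ℝ))
        (Measurable.aemeasurable ((hP.comp measurable_snd).mul (by fun_prop)))]
    have e' : ∀ y : Fin n → ℝ, ∫⁻ s, simplexProd (fun x => ‖f x‖ₑ) n 1 y
        * ‖f (s + altSum y)‖ₑ ^ (2 : ℝ) = simplexProd (fun x => ‖f x‖ₑ) n 1 y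
          * e2 (fun x => ‖f x‖ₑ) ^ (2 : ℝ) := fun y => by
      rw [lintegral_const_mul _ (by fun_prop), ← e,
        lintegral_add_right_eq_self (fun x => ‖f x‖ₑ ^ (2 : ℝ)) (altSum y)]
    simp only [e']
    rw [lintegral_mul_const _ hP, ENNReal.mul_rpow_of_nonneg _ _ zero_le_two, ← hA, ← mul_assoc]
    refine mul_le_mul_left (le_of_eq ?_) _
    rw [← sq, ← ENNReal.rpow_natCast]
    norm_num
  refine (ENNReal.rpow_le_rpow key (by norm_num)).trans ?_
  rw [← ENNReal.rpow_mul]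
  norm_num
  refine (mul_le_mul_left (lintegral_simplexProd_enorm_le hf hf2 n) _).trans (le_of_eq ?_)
  rw [e2_enorm_eq_ofReal hf2, ← ENNReal.ofReal_mul (by positivity)]
  congr 1
  ring

lemma measurable_lintegral_fullIntegrand {f : ℝ → ℂ} (hf : Measurable f) (n : ℕ) :
    Measurable fun s => ∫⁻ y, ‖fullIntegrand f n (y, s)‖ₑ :=
  (measurable_fullIntegrand hf n).enorm.lintegral_prod_left'

lemma ae_lintegral_fullIntegrand_lt_top {f : ℝ → ℂ} (hf : Measurable f)
    (hf2 : MemLp f 2 unitMeasure) (hf0 : ∀ x ∉ Ioo (0 : ℝ) 1, f x = 0) (n : ℕ) :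
    ∀ᵐ s ∂unitMeasure, ∫⁻ y, ‖fullIntegrand f n (y, s)‖ₑ < ⊤ := by
  have hm := measurable_lintegral_fullIntegrand hf n
  have h := (e2_lintegral_fullIntegrand_le hf hf2 hf0 n).trans_lt ENNReal.ofReal_lt_top
  have h' : ∫⁻ s, (∫⁻ y, ‖fullIntegrand f n (y, s)‖ₑ) ^ (2 : ℝ) ∂unitMeasure ≠ ⊤ := by
    intro h0
    rw [e2, h0] at h
    simp at h
  filter_upwards [ae_lt_top (hm.pow_const _) h'] with s hs
  exact (ENNReal.rpow_lt_top_iff_of_pos zero_lt_two).1 hs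

lemma integrableOn_slice {f : ℝ → ℂ} (hf : Measurable f) (hf2 : MemLp f 2 unitMeasure)
    (hf0 : ∀ x ∉ Ioo (0 : ℝ) 1, f x = 0) (n : ℕ) :
    ∀ᵐ s ∂unitMeasure, IntegrableOn (integrand (n := n) (fun _ => f) s) (slice n s) := by
  filter_upwards [ae_lintegral_fullIntegrand_lt_top hf hf2 hf0 n] with s hs
  rw [← integrable_indicator_iff (measurableSet_slice n s)]
  have e : (slice n s).indicator (integrand (fun _ => f) s) = fun y => fullIntegrand f n (y, s) := by
    ext y; rw [fullIntegrand_eq]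
  rw [e]
  exact ⟨((measurable_fullIntegrand hf n).comp measurable_prodMk_right).aestronglyMeasurable, hs⟩

lemma memLp_multInt {f : ℝ → ℂ} (hf : Measurable f) (hf2 : MemLp f 2 unitMeasure)
    (hf0 : ∀ x ∉ Ioo (0 : ℝ) 1, f x = 0) (n : ℕ) :
    MemLp (multInt (n := n) fun _ => f) 2 unitMeasure ∧
      ‖cls (multInt (n := n) fun _ => f)‖ ≤ ‖cls f‖ ^ (n + 1) / √(n.factorial : ℝ) := by
  have hm : StronglyMeasurable (multInt (n := n) fun _ => f) := by
    rw [funext (multInt_eq f n)]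
    exact (measurable_fullIntegrand hf n).stronglyMeasurable.integral_prod_left'
  have hb : eLpNorm (multInt (n := n) fun _ => f) 2 unitMeasure
      ≤ ENNReal.ofReal (‖cls f‖ ^ (n + 1) / √(n.factorial : ℝ)) := by
    rw [← e2_enorm]
    refine le_trans ?_ (e2_lintegral_fullIntegrand_le hf hf2 hf0 n)
    refine ENNReal.rpow_le_rpow (lintegral_mono fun s => ENNReal.rpow_le_rpow ?_ zero_le_two)
      (by norm_num)
    change ‖multInt (n := n) (fun _ => f) s‖ₑ ≤ ∫⁻ y, ‖fullIntegrand f n (y, s)‖ₑ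
    rw [multInt_eq]
    exact enorm_integral_le_lintegral_enorm _
  have h2 : MemLp (multInt (n := n) fun _ => f) 2 unitMeasure :=
    ⟨hm.aestronglyMeasurable, hb.trans_lt ENNReal.ofReal_lt_top⟩
  refine ⟨h2, ?_⟩
  rw [norm_cls h2]
  exact ENNReal.toReal_le_of_le_ofReal (by positivity) hb

/-! ### The multilinear integrals as quadrilinear forms -/

/-- The map sends (t, z, y, x) to (w, s) with w = (y, x, t) and s = z − ξ(w): a permutation of
coordinates followed by a shear. -/
lemma measurePreserving_tail (m : ℕ) :
    MeasurePreserving (fun q : (((Fin m → ℝ) × ℝ) × ℝ) × ℝ =>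
      ((Fin.cons q.1.2 (Fin.cons q.2 q.1.1.1 : Fin (m + 1) → ℝ) : Fin (m + 2) → ℝ),
        q.1.1.2 - altSum (Fin.cons q.1.2 (Fin.cons q.2 q.1.1.1 : Fin (m + 1) → ℝ)
          : Fin (m + 2) → ℝ)))
      (((volume.prod volume).prod volume).prod volume) (volume.prod volume) := by
  have h1 := measurePreserving_swapLast ((volume : Measure (Fin m → ℝ)).prod (volume : Measure ℝ))
  have h2 := (measurePreserving_swapLast (volume : Measure (Fin m → ℝ))).prod
    (MeasurePreserving.id (volume : Measure ℝ))
  have h3 := ((measurePreserving_cons m).prod (MeasurePreserving.id (volume : Measure ℝ))).prod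
    (MeasurePreserving.id (volume : Measure ℝ))
  have h4 := (measurePreserving_cons (m + 1)).prod (MeasurePreserving.id (volume : Measure ℝ))
  have ma := measurable_altSum (m + 2)
  have h5 := MeasurePreserving.skew_product (μc := (volume : Measure ℝ)) (μd := (volume : Measure ℝ))
    (MeasurePreserving.id (volume : Measure (Fin (m + 2) → ℝ)))
    (g := fun w z => z - altSum w) (by fun_prop)
    (Eventually.of_forall fun w => (measurePreserving_sub_right volume (altSum w)).map_eq)
  exact h5.comp (h4.comp (h3.comp (h1.comp (h2.comp h1))))

/-- In the new variables z = s + ξ(w), and the slice becomes the chain t ≤ x ≤ y ≤ z ≤ 1. The first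
two coordinates of w are split off as y and x, and m coordinates form the tail. -/
lemma integral_multInt_mul {f : ℝ → ℂ} (hf : Measurable f) (hf2 : MemLp f 2 unitMeasure)
    (hf0 : ∀ x ∉ Ioo (0 : ℝ) 1, f x = 0) (m : ℕ) {η : ℝ → ℂ} (hη : Measurable η)
    (hη2 : MemLp η 2 unitMeasure) (hη0 : ∀ x ∉ Ioo (0 : ℝ) 1, η x = 0) :
    ∫ s, multInt (n := m + 2) (fun _ => f) s * η s ∂unitMeasure
      = int₃ volume (tailWeight f m) base
        fun t z y x => f z * f y * f x * η (z - y + x - altSum t) := by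
  let G : (Fin (m + 2) → ℝ) × ℝ → ℂ := fun q => fullIntegrand f (m + 2) q * η q.2
  have hGm : Measurable G := (measurable_fullIntegrand hf _).mul (hη.comp measurable_snd)
  have hG : Integrable G (volume.prod volume) := by
    refine ⟨hGm.aestronglyMeasurable, ?_⟩
    rw [HasFiniteIntegral, lintegral_prod_symm _ hGm.enorm.aemeasurable]
    have e (s : ℝ) : ∫⁻ y, ‖G (y, s)‖ₑ
        = (∫⁻ y, ‖fullIntegrand f (m + 2) (y, s)‖ₑ) * ‖η s‖ₑ := by
      simp only [G, enorm_mul]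
      exact lintegral_mul_const' _ _ enorm_ne_top
    simp only [e]
    rw [lintegral_eq_of_eq_zero fun s hs => by simp [hη0 s hs]]
    refine (ENNReal.lintegral_mul_le_Lp_mul_Lq unitMeasure Real.HolderConjugate.two_two
      (measurable_lintegral_fullIntegrand hf _).aemeasurable hη.enorm.aemeasurable).trans_lt ?_
    refine ENNReal.mul_lt_top ((e2_lintegral_fullIntegrand_le hf hf2 hf0 (m + 2)).trans_lt
      ENNReal.ofReal_lt_top) ?_
    have := (e2_enorm_eq_ofReal hη2).trans_lt ENNReal.ofReal_lt_top
    exact this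
  have e1 : ∫ s, multInt (n := m + 2) (fun _ => f) s * η s ∂unitMeasure
      = ∫ q, G q ∂(volume.prod volume) := by
    rw [integral_prod_symm _ hG, setIntegral_eq_integral_of_forall_compl_eq_zero
      fun s hs => by rw [hη0 s hs, mul_zero]]
    refine integral_congr_ae (Eventually.of_forall fun s => ?_)
    simp only [G, multInt_eq]
    rw [integral_mul_const]
  have hΨ := measurePreserving_tail m
  rw [e1, ← hΨ.map_eq, integral_map hΨ.measurable.aemeasurable hGm.aestronglyMeasurable, int₃]
  refine integral_congr_ae (Eventually.of_forall fun q => ?_)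
  obtain ⟨⟨⟨t, z⟩, y⟩, x⟩ := q
  simp only [G]
  set w : Fin (m + 2) → ℝ := Fin.cons y (Fin.cons x t : Fin (m + 1) → ℝ) with hw
  have hs : z - altSum w = z - y + x - altSum t := by
    rw [hw, altSum_cons, altSum_cons]; ring
  rw [← hs]
  have hz : z - altSum w + altSum w = z := by ring
  have hmem : w ∈ slice (m + 2) (z - altSum w)
      ↔ t ∈ simplex m 1 ∧ base t ≤ x ∧ x ≤ y ∧ y ≤ z ∧ z ≤ 1 := by
    rw [mem_slice_iff, hz, hw, cons_mem_simplex, cons_mem_simplex, mem_Icc, mem_Icc]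
    have hb := (base_mem t).1
    constructor
    · rintro ⟨⟨⟨a1, a2⟩, ⟨a3, a4⟩, a5⟩, a6⟩
      have := (mem_simplex_iff (a4.trans (a2.trans a6)) a3).1 a5
      exact ⟨this.1, this.2, a4, a2, a6⟩
    · rintro ⟨a1, a2, a3, a4, a5⟩
      have hx := hb.trans a2
      exact ⟨⟨⟨hx.trans a3, a4⟩, ⟨hx, a3⟩,
        (mem_simplex_iff (a3.trans (a4.trans a5)) hx).2 ⟨a1, a2⟩⟩, a5⟩
  by_cases h : w ∈ slice (m + 2) (z - altSum w)
  · have h' := hmem.1 h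
    rw [if_pos h'.2, tailWeight, indicator_of_mem h'.1, fullIntegrand, indicator_of_mem (by exact h)]
    change f (z - altSum w + altSum w) * (∏ i, f (w i)) * η (z - altSum w)
      = (∏ i, f (t i)) * (f z * f y * f x * η (z - altSum w))
    have hprod : ∏ i, f (w i) = f y * (f x * ∏ i, f (t i)) := by
      simp [hw, Fin.prod_univ_succ]
    rw [hz, hprod]
    ring
  · rw [fullIntegrand, indicator_of_notMem (by exact h)]
    by_cases h' : base t ≤ x ∧ x ≤ y ∧ y ≤ z ∧ z ≤ 1
    · have ht : t ∉ simplex m 1 := fun ht => h (hmem.2 ⟨ht, h'⟩)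
      rw [tailWeight, indicator_of_notMem ht]
      simp
    · rw [if_neg h']
      simp

/-! ### Dependence on the representative -/

/-- A surjective linear functional pulls null sets back to null sets. At least one variable is
needed for the alternating sum to be nonzero. -/
lemma ae_altSum_notMem {n : ℕ} (s : ℝ) {Z : Set ℝ} (hZ : volume Z = 0) :
    ∀ᵐ y : Fin (n + 1) → ℝ, s + altSum y ∉ Z := by
  let L : (Fin (n + 1) → ℝ) →ₗ[ℝ] ℝ := ∑ i : Fin (n + 1), (-1 : ℝ) ^ (i : ℕ) • LinearMap.proj i
  have hL (y : Fin (n + 1) → ℝ) : L y = altSum y := by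
    simp [L, altSum]
  have hsur : Function.Surjective L := fun c => ⟨Fin.cons c 0, by
    rw [hL, altSum_cons]; simp [altSum]⟩
  have hq := quasiMeasurePreserving_add_left (volume : Measure ℝ) s
  have hae : ∀ᵐ x : ℝ, x ∈ toMeasurable volume Z → False := by
    rw [ae_iff]; simpa [measure_toMeasurable] using hZ
  have h1 : ∀ᵐ x : ℝ, x ∈ (fun x => s + x) ⁻¹' (toMeasurable volume Z)ᶜ := hq.ae hae
  have h2 := (ae_comp_linearMap_mem_iff L volume volume hsur
    ((measurableSet_toMeasurable volume Z).compl.preimage (measurable_const_add s))).2 h1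
  filter_upwards [h2] with y hy hyZ
  rw [hL] at hy
  exact hy (subset_toMeasurable _ _ hyZ)

/-- On the slice every argument lies in [0,1], where f and τ agree up to a null set, and each
argument avoids that set for almost every y. This holds for every s, so the integrals agree
everywhere. -/
lemma integrand_ae_eq {f τ : ℝ → ℂ} (h : f =ᵐ[unitMeasure] τ) (n : ℕ) (s : ℝ) :
    integrand (n := n + 1) (fun _ => τ) s
      =ᵐ[volume.restrict (slice (n + 1) s)] integrand (fun _ => f) s := by
  let Z : Set ℝ := {x | x ∈ Icc (0 : ℝ) 1 ∧ f x ≠ τ x}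
  have hZ : volume Z = 0 := by
    have h' : ∀ᵐ x ∂(volume.restrict (Icc (0 : ℝ) 1)), f x = τ x := by
      rwa [← restrict_Ioo_eq_restrict_Icc]
    rw [ae_restrict_iff' measurableSet_Icc, ae_iff] at h'
    convert! h' using 2
    ext x; simp [Z, and_assoc]
  have h1 : ∀ᵐ y : Fin (n + 1) → ℝ, ∀ i, y i ∉ Z := by
    refine ae_all_iff.2 fun i => ?_
    exact (Measure.quasiMeasurePreserving_eval (fun _ : Fin (n + 1) => (volume : Measure ℝ)) i).ae
      (measure_eq_zero_iff_ae_notMem.1 hZ)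
  filter_upwards [ae_restrict_of_ae h1, ae_restrict_of_ae (ae_altSum_notMem s hZ),
    ae_restrict_mem (measurableSet_slice _ _)] with y a1 a2 a3
  have h0 := mem_slice_iff.1 a3
  have hn {x : ℝ} (hx : x ∈ Icc (0 : ℝ) 1) (hxZ : x ∉ Z) : τ x = f x := by
    by_contra hne
    exact hxZ ⟨hx, fun h => hne h.symm⟩
  have hi (i : Fin (n + 1)) : τ (y i) = f (y i) :=
    hn ⟨(h0.1.2 i).1, (h0.1.2 i).2.trans h0.2⟩ (a1 i)
  have h0' : τ (s + altSum y) = f (s + altSum y) :=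
    hn ⟨(h0.1.2 0).1.trans (h0.1.2 0).2, h0.2⟩ a2
  simp only [integrand, hi, h0']

lemma multInt_congr {f τ : ℝ → ℂ} (h : f =ᵐ[unitMeasure] τ) (n : ℕ) :
    multInt (n := n + 1) (fun _ => τ) = multInt (n := n + 1) fun _ => f := by
  ext s
  exact integral_congr_ae (integrand_ae_eq h n s)

/-! ### Weighted coefficient bounds -/

/-- The coefficients of `u`, weighted by `wt k ^ γ`, have `ℓ_2`-norm at most `B`. -/
def HasWeightBound (γ B : ℝ) (u : L2) : Prop :=
  ∀ S : Finset ℤ, ∑ k ∈ S, (wt k ^ γ * ‖aCoef k u‖) ^ 2 ≤ B ^ 2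

/-- The finite family of weighted coefficients. -/
def weightedCoef (γ : ℝ) (S : Finset ℤ) : L2 →L[ℂ] EuclideanSpace ℂ S :=
  ((EuclideanSpace.equiv S ℂ).symm : (S → ℂ) →L[ℂ] EuclideanSpace ℂ S).comp
    (ContinuousLinearMap.pi fun k : S => ((wt k ^ γ : ℝ) : ℂ) • aCoef k)

lemma norm_weightedCoef_sq (γ : ℝ) (S : Finset ℤ) (u : L2) :
    ‖weightedCoef γ S u‖ ^ 2 = ∑ k ∈ S, (wt k ^ γ * ‖aCoef k u‖) ^ 2 := by
  rw [EuclideanSpace.norm_sq_eq, ← Finset.sum_coe_sort S]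
  refine Finset.sum_congr rfl fun k _ => ?_
  change ‖((wt k ^ γ : ℝ) : ℂ) * aCoef k u‖ ^ 2 = _
  rw [norm_mul, Complex.norm_real, Real.norm_of_nonneg (Real.rpow_nonneg (wt_pos _).le _)]

/-- Expresses the bound by norms of continuous linear maps, so that scalar factors, convergent
series and infima are handled by norm estimates. -/
lemma hasWeightBound_iff {γ B : ℝ} (hB : 0 ≤ B) {u : L2} :
    HasWeightBound γ B u ↔ ∀ S, ‖weightedCoef γ S u‖ ≤ B := by
  simp only [HasWeightBound, ← norm_weightedCoef_sq]
  exact forall_congr' fun S => by rw [sq_le_sq₀ (norm_nonneg _) hB]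

lemma HasWeightBound.mono {γ B B' : ℝ} {u : L2} (h : HasWeightBound γ B u) (hB : 0 ≤ B)
    (hle : B ≤ B') : HasWeightBound γ B' u :=
  fun S => (h S).trans (by gcongr)

lemma HasWeightBound.of_hasSum {γ : ℝ} {b : ℕ → ℝ} {v : ℕ → L2} {u : L2} {B : ℝ}
    (hb0 : ∀ n, 0 ≤ b n) (h : ∀ n, HasWeightBound γ (b n) (v n)) (hb : HasSum b B)
    (hu : HasSum v u) : HasWeightBound γ B u := by
  refine (hasWeightBound_iff (hb.nonneg hb0)).2 fun S => ?_
  exact ((weightedCoef γ S).hasSum hu).norm_le_of_bounded hb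
    fun n => (hasWeightBound_iff (hb0 n)).1 (h n) S

lemma HasWeightBound.smul {γ B : ℝ} (hB : 0 ≤ B) {u : L2} (h : HasWeightBound γ B u) {c : ℂ}
    (hc : ‖c‖ = 1) : HasWeightBound γ B (c • u) := by
  refine (hasWeightBound_iff hB).2 fun S => ?_
  rw [map_smul, norm_smul, hc, one_mul]
  exact (hasWeightBound_iff hB).1 h S

lemma HasWeightBound.memW {γ B : ℝ} (hγ : 0 < γ) (hγ' : γ ≤ 2) (hB : 0 ≤ B) {u : L2}
    (h : HasWeightBound γ B u) {f : ℝ → ℂ} (hf : u =ᵐ[unitMeasure] f) :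
    MemW γ f ∧ normW γ f ≤ 100 * B := by
  obtain ⟨M, hM, hle⟩ := exists_mem_sobolevBounds hγ hγ' hB h (hasSum_aCoef u) hf
  refine ⟨⟨M, hM⟩, (csInf_le ⟨0, fun M' hM' => ?_⟩ hM).trans hle⟩
  rw [sobolevBounds, if_neg hγ.ne'] at hM'
  split_ifs at hM'
  · obtain ⟨w, -, hw⟩ := hM'
    exact (norm_nonneg _).trans hw
  · obtain ⟨w, -, hw⟩ := hM'
    exact nonneg_of_mem_interpBounds hw

/-- A function of `W_2^α` has a representative on the whole line whose `L_2`-norm and weighted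
coefficients are controlled by the norm in `W_2^α`. -/
lemma MemW.exists_representative {α : ℝ} (hα : 0 < α) (hα' : α ≤ 1) {τ : ℝ → ℂ} (h : MemW α τ) :
    ∃ f : ℝ → ℂ, Measurable f ∧ MemLp f 2 unitMeasure ∧ (∀ x ∉ Ioo (0 : ℝ) 1, f x = 0) ∧
      f =ᵐ[unitMeasure] τ ∧ ‖cls f‖ ≤ normW α τ ∧
      HasWeightBound α (6000 * normW α τ) (cls f) := by
  have hB (M : ℝ) : M ∈ sobolevBounds α τ ↔
      ∃ h : L2, h =ᵐ[unitMeasure] τ ∧ M ∈ interpBounds W22.toL2 (1 - α / 2) h := by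
    rw [sobolevBounds, if_neg hα.ne', if_neg (by linarith)]; rfl
  obtain ⟨M₀, hM₀⟩ := h
  obtain ⟨w, hw, -⟩ := (hB M₀).1 hM₀
  -- All bounds for τ refer to one and the same class `w`, which permits taking the infimum over M
  -- afterwards.
  have hB' {M : ℝ} (hM : M ∈ sobolevBounds α τ) : M ∈ interpBounds W22.toL2 (1 - α / 2) w := by
    obtain ⟨w', hw', hM'⟩ := (hB M).1 hM
    rwa [Lp.ext (hw.trans hw'.symm)]
  have hfw : (Ioo (0 : ℝ) 1).indicator w =ᵐ[unitMeasure] w := by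
    filter_upwards [ae_restrict_mem measurableSet_Ioo] with x hx
    exact indicator_of_mem hx _
  have hc : cls ((Ioo (0 : ℝ) 1).indicator w) = w := by rw [cls_congr hfw, cls_coe]
  refine ⟨(Ioo (0 : ℝ) 1).indicator w, (measurable_coe w).indicator measurableSet_Ioo,
    (Lp.memLp w).ae_eq hfw.symm, fun x hx => indicator_of_notMem hx _, hfw.trans hw, ?_, ?_⟩
  · rw [hc]
    exact le_csInf ⟨M₀, hM₀⟩ fun M hM =>
      norm_le_of_mem_interpBounds (by linarith) (by linarith) (hB' hM)
  · have hn : 0 ≤ normW α τ :=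
      le_csInf ⟨M₀, hM₀⟩ fun M hM => nonneg_of_mem_interpBounds (hB' hM)
    rw [hc, hasWeightBound_iff (by positivity)]
    intro S
    have : ‖weightedCoef α S w‖ / 6000 ≤ normW α τ := by
      refine le_csInf ⟨M₀, hM₀⟩ fun M hM => ?_
      rw [div_le_iff₀ (by norm_num), mul_comm]
      have hM0 := nonneg_of_mem_interpBounds (hB' hM)
      exact (hasWeightBound_iff (by positivity)).1
        (sum_wt_rpow_aCoef_le_of_mem_interpBounds hα.le (by linarith) (hB' hM)) S
    rw [div_le_iff₀ (by norm_num)] at this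
    linarith

/-! ### The functions `τ_n` -/

lemma tauIntegrable_of_ae_eq {f τ : ℝ → ℂ} (hf : Measurable f) (hf2 : MemLp f 2 unitMeasure)
    (hf0 : ∀ x ∉ Ioo (0 : ℝ) 1, f x = 0) (h : f =ᵐ[unitMeasure] τ) : TauIntegrable τ := by
  intro n hn
  obtain ⟨n, rfl⟩ := Nat.exists_eq_succ_of_ne_zero (by omega : n ≠ 0)
  filter_upwards [integrableOn_slice hf hf2 hf0 (n + 1)] with s hs
  exact hs.congr (integrand_ae_eq h n s).symm

lemma div_sqrt_factorial_le {t : ℝ} (ht : 0 ≤ t) {a b : ℕ} (h : a ≤ b) (n : ℕ) :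
    t ^ n / √(b.factorial : ℝ) ≤ t ^ n / √(a.factorial : ℝ) := by
  have : 0 < √(a.factorial : ℝ) := Real.sqrt_pos.2 (by exact_mod_cast a.factorial_pos)
  have h' : (a.factorial : ℝ) ≤ b.factorial := by exact_mod_cast Nat.factorial_le h
  gcongr

lemma memLp_tauSeq {f τ : ℝ → ℂ} (hf : Measurable f) (hf2 : MemLp f 2 unitMeasure)
    (hf0 : ∀ x ∉ Ioo (0 : ℝ) 1, f x = 0) (h : f =ᵐ[unitMeasure] τ) :
    ∀ n, MemLp (tauSeq τ n) 2 unitMeasure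
  | 0 => MemLp.zero
  | 1 => hf2.ae_eq h
  | n + 2 => by
    rw [tauSeq, multInt_congr h]
    exact (memLp_multInt hf hf2 hf0 _).1

lemma norm_cls_tauSeq_le {f τ : ℝ → ℂ} (hf : Measurable f) (hf2 : MemLp f 2 unitMeasure)
    (hf0 : ∀ x ∉ Ioo (0 : ℝ) 1, f x = 0) (h : f =ᵐ[unitMeasure] τ) (n : ℕ) :
    ‖cls (tauSeq τ (n + 2))‖ ≤ ‖cls f‖ ^ (n + 2) / √((n + 1).factorial : ℝ) := by
  rw [tauSeq, multInt_congr h]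
  exact (memLp_multInt hf hf2 hf0 _).2

/-- τ_{m+3} has a tail of length m. Its factorial (m − 2)! is weakened to that of n − 7 for n = m +
3. -/
lemma hasWeightBound_tauSeq {α γ L t : ℝ} (hα : 0 < α) (hα' : α ≤ 1) (h3 : γ ≤ 3 * α)
    (h1 : γ ≤ 1 + α) (hL : IsTrigBound L) (hL0 : 0 ≤ L) {f τ : ℝ → ℂ} (hf : Measurable f)
    (hf2 : MemLp f 2 unitMeasure) (hf0 : ∀ x ∉ Ioo (0 : ℝ) 1, f x = 0) (h : f =ᵐ[unitMeasure] τ)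
    (ht : ‖cls f‖ ≤ t) (hw : HasWeightBound α (6000 * t) (cls f)) (m : ℕ) :
    HasWeightBound γ (90000 * L ^ 3 * 6000 ^ 3 * (t ^ (m + 3) / √((m + 3 - 7).factorial : ℝ)))
      (cls (tauSeq τ (m + 3))) := by
  have ht0 : 0 ≤ t := (norm_nonneg _).trans ht
  rw [tauSeq, multInt_congr h]
  have hb : HasWeightBound γ (90000 * (‖cls f‖ ^ m / √((m - 2).factorial : ℝ)) * L ^ 3
      * (6000 * t) ^ 3) (cls (multInt (n := m + 2) fun _ => f)) :=
    (isTail_tailWeight hf hf2 m).sum_wt_le hL hα hα' h3 h1 hf hf2 (by positivity) hw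
      fun η hη hη2 hη0 => by
        rw [pair_cls (memLp_multInt hf hf2 hf0 _).1 hη2, integral_multInt_mul hf hf2 hf0 m hη hη2 hη0]
  refine hb.mono (by positivity) ?_
  have e : ‖cls f‖ ^ m / √((m - 2).factorial : ℝ) ≤ t ^ m / √((m + 3 - 7).factorial : ℝ) :=
    (div_le_div_of_nonneg_right (pow_le_pow_left₀ (norm_nonneg _) ht m) (by positivity)).trans
      (div_sqrt_factorial_le ht0 (by omega) m)
  calc _ ≤ 90000 * (t ^ m / √((m + 3 - 7).factorial : ℝ)) * L ^ 3 * (6000 * t) ^ 3 := by gcongr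
    _ = _ := by ring

/-- Each term is a product of (2t)^n/√(n!) and 2^(−n), at most the sum of their squares, and these
form an exponential and a geometric series. -/
lemma summable_pow_div_sqrt_factorial (t : ℝ) (ht : 0 ≤ t) :
    Summable fun n : ℕ => t ^ n / √(n.factorial : ℝ) := by
  have h1 := Real.summable_pow_div_factorial (4 * t ^ 2)
  have h2 := summable_geometric_of_lt_one (r := (1 / 4 : ℝ)) (by norm_num) (by norm_num)
  refine Summable.of_nonneg_of_le (fun n => by positivity) (fun n => ?_) (h1.add h2)
  have hs : √(n.factorial : ℝ) ^ 2 = n.factorial := Real.sq_sqrt (by positivity)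
  have hs0 : 0 < √(n.factorial : ℝ) := Real.sqrt_pos.2 (by exact_mod_cast n.factorial_pos)
  have e1 : (4 * t ^ 2) ^ n / (n.factorial : ℝ) = ((2 * t) ^ n / √(n.factorial : ℝ)) ^ 2 := by
    rw [div_pow, hs, ← pow_mul, mul_comm n, pow_mul]; ring
  have e2 : (1 / 4 : ℝ) ^ n = ((1 / 2 : ℝ) ^ n) ^ 2 := by
    rw [← pow_mul, mul_comm n, pow_mul]; norm_num
  have e3 : t ^ n / √(n.factorial : ℝ) = (2 * t) ^ n / √(n.factorial : ℝ) * (1 / 2 : ℝ) ^ n := by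
    rw [div_mul_eq_mul_div, ← mul_pow]; congr 2; ring
  rw [e1, e2, e3]
  nlinarith [sq_nonneg ((2 * t) ^ n / √(n.factorial : ℝ) - (1 / 2 : ℝ) ^ n),
    sq_nonneg ((2 * t) ^ n / √(n.factorial : ℝ)), sq_nonneg ((1 / 2 : ℝ) ^ n)]

lemma summable_pow_div_sqrt_factorial_sub (t : ℝ) (ht : 0 ≤ t) :
    Summable fun n : ℕ => t ^ (n + 3) / √((n + 3 - 7).factorial : ℝ) := by
  rw [← summable_nat_add_iff 4]
  refine ((summable_pow_div_sqrt_factorial t ht).mul_left (t ^ 7)).congr fun n => ?_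
  rw [show n + 4 + 3 - 7 = n by omega]
  ring

lemma sum_Icc_one_add_two {R : Type*} [AddCommMonoid R] (a : ℕ → R) (M : ℕ) :
    ∑ n ∈ Finset.Icc 1 (M + 2), a n = a 1 + a 2 + ∑ n ∈ Finset.range M, a (n + 3) := by
  induction M with
  | zero => simp [Finset.sum_Icc_succ_top]
  | succ M ih =>
    rw [show M + 1 + 2 = M + 2 + 1 by ring, Finset.sum_Icc_succ_top (by omega), ih,
      Finset.sum_range_succ, add_assoc]

/-- The series of the `τ_n` converges, and its terms from the third on have a sum in `W_2^γ`. -/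
lemma exists_isTauSum {γ K t : ℝ} (hγ : 0 < γ) (hγ' : γ ≤ 2) (hK : 0 ≤ K) (ht : 0 ≤ t) {τ : ℝ → ℂ}
    (hm : ∀ n, MemLp (tauSeq τ n) 2 unitMeasure)
    (hn : ∀ n, ‖cls (tauSeq τ (n + 3))‖ ≤ t ^ (n + 3) / √((n + 3 - 7).factorial : ℝ))
    (hw : ∀ n, HasWeightBound γ (K * (t ^ (n + 3) / √((n + 3 - 7).factorial : ℝ)))
      (cls (tauSeq τ (n + 3)))) {ε : ℂ} (hε : ε ^ 2 = 1) :
    ∃ T φ : ℝ → ℂ, IsTauSum ε τ T ∧ MemW γ φ ∧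
      ∀ᵐ s ∂unitMeasure, T s = ε * τ s + tauSeq τ 2 s + φ s := by
  have hε1 : ‖ε‖ = 1 := by
    have : ‖ε‖ ^ 2 = 1 := by rw [← norm_pow, hε, norm_one]
    nlinarith [norm_nonneg ε]
  have hεn (n : ℕ) : ‖ε ^ n‖ = 1 := by rw [norm_pow, hε1, one_pow]
  have hs := summable_pow_div_sqrt_factorial_sub t ht
  have hv : Summable fun n => ε ^ (n + 3) • cls (tauSeq τ (n + 3)) :=
    Summable.of_norm_bounded hs fun n => by rw [norm_smul, hεn, one_mul]; exact hn n
  obtain ⟨φ, hφ⟩ := hv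
  obtain ⟨B, hB⟩ := hs.mul_left K
  -- The majorant for the L_2-norms, multiplied by K, also bounds the weighted coefficients, so the
  -- sum inherits the regularity of its terms.
  have hφw : HasWeightBound γ B φ := HasWeightBound.of_hasSum (fun n => by positivity)
    (fun n => (hw n).smul (by positivity) (hεn _)) hB hφ
  have hφW := (hφw.memW hγ hγ' (hB.nonneg fun n => by positivity) EventuallyEq.rfl).1
  have hτ : MemLp τ 2 unitMeasure := hm 1
  refine ⟨fun s => ε * τ s + tauSeq τ 2 s + φ s, φ, ⟨hm, ?_, ?_⟩, hφW,
    Eventually.of_forall fun s => rfl⟩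
  · exact ((hτ.const_mul ε).add (hm 2)).add (Lp.memLp φ)
  -- After a shift by two each partial sum contains ετ and ε²τ_2 = τ_2, so the remainder is that of
  -- the series for φ.
  · rw [← tendsto_add_atTop_iff_nat 2]
    have hd (M : ℕ) : eLpNorm (fun s => ε * τ s + tauSeq τ 2 s + φ s
        - ∑ n ∈ Finset.Icc 1 (M + 2), ε ^ n * tauSeq τ n s) 2 unitMeasure
        = ENNReal.ofReal ‖φ - ∑ n ∈ Finset.range M, ε ^ (n + 3) • cls (tauSeq τ (n + 3))‖ := by
      rw [ofReal_norm, Lp.enorm_def]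
      refine eLpNorm_congr_ae ?_
      have hsum : (∑ n ∈ Finset.range M, ε ^ (n + 3) • cls (tauSeq τ (n + 3)) : L2)
          =ᵐ[unitMeasure] fun s => ∑ n ∈ Finset.range M, ε ^ (n + 3) * tauSeq τ (n + 3) s := by
        induction M with
        | zero =>
          simp only [Finset.range_zero, Finset.sum_empty]
          exact Lp.coeFn_zero ℂ 2 unitMeasure
        | succ M ih =>
          rw [Finset.sum_range_succ]
          filter_upwards [ih, Lp.coeFn_add (∑ n ∈ Finset.range M, ε ^ (n + 3)
            • cls (tauSeq τ (n + 3)) : L2) (ε ^ (M + 3) • cls (tauSeq τ (M + 3))),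
            Lp.coeFn_smul (ε ^ (M + 3)) (cls (tauSeq τ (M + 3))), cls_ae (hm (M + 3))]
            with s h1 h2 h3 h4
          rw [h2, Pi.add_apply, h1, h3, Pi.smul_apply, h4, smul_eq_mul, Finset.sum_range_succ]
      filter_upwards [hsum, Lp.coeFn_sub φ (∑ n ∈ Finset.range M, ε ^ (n + 3)
        • cls (tauSeq τ (n + 3)) : L2)] with s h1 h2
      rw [h2, Pi.sub_apply, h1, sum_Icc_one_add_two, hε, pow_one, one_mul, tauSeq]
      ring
    simp only [hd]
    rw [← ENNReal.ofReal_zero]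
    refine (ENNReal.continuous_ofReal.tendsto 0).comp ?_
    simpa using (hφ.tendsto_sum_nat.const_sub φ).norm

end SobolevInterval

end

open SobolevInterval

theorem corollary4p5 (α γ : ℝ) (hα : 0 < α) (hα' : α ≤ 1) (hγ : γ = min (3 * α) (1 + α)) :
    (∃ C : ℝ, 0 < C ∧ ∀ τ : ℝ → ℂ, MemW α τ →
      TauIntegrable τ ∧
      ∀ n : ℕ, 3 ≤ n → MemW γ (tauSeq τ n) ∧
        normW γ (tauSeq τ n) ≤ C / √((n - 7).factorial : ℝ) * normW α τ ^ n) ∧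
    ∀ τ : ℝ → ℂ, MemW α τ → ∃ τp τm φp φm : ℝ → ℂ,
      IsTauSum 1 τ τp ∧ IsTauSum (-1) τ τm ∧ MemW γ φp ∧ MemW γ φm ∧
      (∀ᵐ s ∂unitMeasure, τp s = τ s + tauSeq τ 2 s + φp s) ∧
      (∀ᵐ s ∂unitMeasure, τm s = -τ s + tauSeq τ 2 s + φm s) := by
  obtain ⟨L, hL⟩ := exists_isTrigBound
  have hL0 : 0 ≤ L := zero_le_one.trans hL.one_le
  have h3 : γ ≤ 3 * α := hγ ▸ min_le_left _ _
  have h1 : γ ≤ 1 + α := hγ ▸ min_le_right _ _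
  have hγ0 : 0 < γ := hγ ▸ lt_min (by linarith) (by linarith)
  have hγ2 : γ ≤ 2 := by linarith
  set K : ℝ := 90000 * L ^ 3 * 6000 ^ 3 with hK
  have hK0 : 0 ≤ K := by positivity
  -- The factor 100 is that of `HasWeightBound.memW`; the summand 1 makes positivity of the constant
  -- immediate.
  refine ⟨⟨100 * K + 1, by positivity, fun τ hτ => ?_⟩, fun τ hτ => ?_⟩
  all_goals
    obtain ⟨f, hf, hf2, hf0, hfτ, ht, hw⟩ := hτ.exists_representative hα hα'
    have ht0 := (norm_nonneg _).trans ht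
    have hb := hasWeightBound_tauSeq hα hα' h3 h1 hL hL0 hf hf2 hf0 hfτ ht hw
    have hm := memLp_tauSeq hf hf2 hf0 hfτ
  · refine ⟨tauIntegrable_of_ae_eq hf hf2 hf0 hfτ, fun n hn => ?_⟩
    obtain ⟨m, rfl⟩ := Nat.exists_eq_add_of_le' hn
    obtain ⟨h4, h5⟩ := (hb m).memW hγ0 hγ2 (by positivity) (cls_ae (hm (m + 3)))
    refine ⟨h4, h5.trans ?_⟩
    have e : 0 ≤ normW α τ ^ (m + 3) / √((m + 3 - 7).factorial : ℝ) := by positivity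
    calc _ ≤ (100 * K + 1) * (normW α τ ^ (m + 3) / √((m + 3 - 7).factorial : ℝ)) := by
          rw [← mul_assoc]; exact mul_le_mul_of_nonneg_right (by linarith) e
      _ = _ := by ring
  -- The L_2 bound is weakened to the factorial of the weighted bound, so that one majorant serves
  -- both.
  · have hn (n : ℕ) : ‖cls (tauSeq τ (n + 3))‖
        ≤ normW α τ ^ (n + 3) / √((n + 3 - 7).factorial : ℝ) :=
      (norm_cls_tauSeq_le hf hf2 hf0 hfτ (n + 1)).trans
        ((div_le_div_of_nonneg_right (pow_le_pow_left₀ (norm_nonneg _) ht _) (by positivity)).trans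
          (div_sqrt_factorial_le ht0 (by omega) _))
    obtain ⟨τp, φp, hp1, hp2, hp3⟩ := exists_isTauSum hγ0 hγ2 hK0 ht0 hm hn hb (one_pow 2)
    obtain ⟨τm, φm, hm1, hm2, hm3⟩ := exists_isTauSum hγ0 hγ2 hK0 ht0 hm hn hb (ε := -1) (by norm_num)
    exact ⟨τp, τm, φp, φm, hp1, hm1, hp2, hm2, by simpa using hp3, by simpa using hm3⟩
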